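/- **Setting.** Let $G$ be a finite group acting on $\mathbb R^{2n}=\mathbb R^{2k}\oplus\mathbb R^{2l}$ by linear symplectic maps $\rho(h)$ (coordinates $y^i$ on $\mathbb R^{2k}$, $z^j$ on $\mathbb R^{2l}$, both Darboux; $\omega^{ij}$ is the constant matrix with $\omega^{i,i+k}=1=-\omega^{i+k,i}$ for the $y$'s and likewise for the $z$'s) and on $\mathbb C^r$ by matrices $\kappa(h)$. Let $g\in G$ be such that the fixed space of $\rho(g)$ is exactly $\mathbb R^{2k}$ and $\rho(g)$ preserves $\mathbb R^{2l}$; let $g_\perp=\rho(g)|_{\mathbb R^{2l}}$ and let $C(g)$ be the centralizer of $g$. Put $\mathbb K=\mathbb C((\hbar))$, $\mathcal W=\mathbb C[[y,z]]((\hbar))$ with the Moyal product $a\star b=\mathrm{mult}\big(e^{\frac{\hbar}{2}\sum\omega^{ij}\partial_i\otimes\partial_j}(a\otimes b)\big)$, $\mathcal W^+=\mathbb C[[y,z]][[\hbar]]$, $A=\mathfrak{gl}_r(\mathcal W)$, $[x,a]=\hbar^{-1}(x\star a-a\star x)$. An element $h\in G$ acts on $A$ by $(ha)(v)=\kappa(h)\,a(\rho(h)^{-1}v)\,\kappa(h)^{-1}$.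 Let $$\mathfrak g=(\mathcal W^+)^g\cdot\mathrm{Id}+\hbar\,(\mathfrak{gl}_r(\mathcal W^+))^g .$$ **Chains.** Let $C_{-m}(A)=A\otimes_{\mathbb K}(A/\mathbb K1)^{\otimes m}$, with the diagonal action of $G$ and with $\mathfrak g$ acting by the derivations $[x,-]$, and $$b_g(a_0\otimes\cdots\otimes a_m)=(-1)^m a_ma_0\otimes a_1\otimes\cdots\otimes a_{m-1}+a_0g(a_1)\otimes a_2\otimes\cdots\otimes a_m+\sum_{i=1}^{m-1}(-1)^ia_0\otimes\cdots\otimes a_ia_{i+1}\otimes\cdots\otimes a_m ,$$ ($b_g=0$ on $C_0$), $$B_g(a_0\otimes\cdots\otimes a_m)=\sum_{i=0}^m(-1)^{mi}\,1\otimes a_{m-i+1}\otimes\cdots\otimes a_m\otimes a_0\otimes g(a_1)\otimes\cdots\otimes g(a_{m-i}).$$ Let $CC^{per}(A,g)=C_{-\bullet}(A)^g[u,u^{-1}]$ (a chain is $g$-invariant if it is fixed by the diagonal action of $g$). **Forms.** Let $\hat\Omega_{2k}=\mathbb C[[y]]\otimes\Lambda(dy^1,\dots,dy^{2k})\,((\hbar))$,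 $d=\sum dy^i\partial_{y^i}$, $\Delta=\sum\omega^{ij}\mathcal L_{\partial_{y^i}}\iota_{\partial_{y^j}}$, with trivial $\mathfrak g$-action; $h\in C(g)$ acts by pullback along $\rho(h)^{-1}$. **Free correlation map.** Let $\Pi_1,\Pi_2$ be the $y$- and $z$-parts of $\sum\omega^{ij}\partial_i\otimes\partial_j$. For $0<x-y<1$ let $P_1(x,y)=(x-y-\tfrac12)\Pi_1-\big(1\otimes\tfrac1{1-g_\perp}\big)\Pi_2$, let $P_1(y,x)$ be its transpose, and let $P_2=-\big(1\otimes\tfrac{g_\perp}{1-g_\perp}\big)\Pi_2-\tfrac12\Pi_2$. For $0<\theta_1<\dots<\theta_m<1$ and $\theta_0=1$, let $\partial_{P_1}=\tfrac12\sum_{\alpha\neq\beta}P_1(\theta_\alpha,\theta_\beta)$ (acting on the $\alpha$-th and $\beta$-th factors) and $\partial_{P_2}=\tfrac12\sum_\alpha P_2$ (acting twice on the $\alpha$-th factor). Then $$\langle a_0\otimes\cdots\otimes a_m\rangle_{free}^g=\det(1-g_\perp^{-1})^{-1}\int_{0<\theta_1<\dots<\theta_m<1}\mathrm{tr}\,\mathrm{mult}\;e^{\hbar\partial_{P_1}}e^{\hbar\partial_{P_2}}\big(a_0\,\kappa(g)\otimes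 d a_1\otimes\cdots\otimes da_m\big)\Big|_{z=dz=0}\,d\theta_1\cdots d\theta_m ,$$ where mult multiplies the factors (commutatively in $y,z$, as matrices, and by the exterior product of forms). **Interactive correlation map.** For $j\ge0$, $\xi_1,\dots,\xi_j\in\mathfrak g$, put $$\langle a_0\otimes\cdots\otimes a_m\rangle_{int}^g(\xi_1,\dots,\xi_j)=\sum\pm\,\langle a_0\otimes w_1\otimes\cdots\otimes w_{m+j}\rangle_{free}^g ,$$ where the sum is over all words $w$ obtained by placing $a_1,\dots,a_m$ in this order, and $\xi_1/\hbar,\dots,\xi_j/\hbar$ in any order, in the slots $1,\dots,m+j$; if $\xi_q/\hbar$ is in the slot $s_q$, the (Koszul) sign is $(-1)^{s_1+\dots+s_j}$ times the sign of the permutation that sorts $(s_1,\dots,s_j)$. (This is the shuffle insertion of the universal connection $\widehat\Theta/\hbar$, $\widehat\Theta=\mathrm{Id}:\mathfrak g\to\mathfrak g$.) Extend it $\mathbb C[u,u^{-1}]$-linearly. **Theorem.** (i) $\mathfrak g$ is closed under the bracket $[\,,]$, and for each $j$ the above formula defines an alternating $\mathbb C$-multilinear map $$\Phi_j=\langle-\rangle^g_{int}:\mathfrak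 g^j\to\mathrm{Hom}_{\mathbb K}\big(C_{-\bullet}(A)[u,u^{-1}],\hat\Omega_{2k}[u,u^{-1}]\big).$$ (ii) It is $C(g)$-equivariant: $\Phi_j(h\xi_1,\dots,h\xi_j)(hO)=h\,\Phi_j(\xi_1,\dots,\xi_j)(O)$ for $h\in C(g)$. In particular, values on $C(g)$-invariant arguments are $C(g)$-invariant forms. (iii) Regarded as a cochain of $\mathfrak g$ with values in $\mathrm{Hom}_{\mathbb K}(CC^{per}(A,g),\hat\Omega_{2k}[u,u^{-1}])$, $\langle-\rangle_{int}^g$ is closed under $(\partial_{Lie}+b_g-\hbar\Delta)+u(B_g-d)$; that is, for all $j\ge0$, $\xi\in\mathfrak g^j$ and $O\in CC^{per}(A,g)$, $$(\partial_{Lie}\Phi_{j-1})(\xi)(O)+\Phi_j(\xi)\big((b_g+uB_g)O\big)-(-1)^j(\hbar\Delta+ud)\,\Phi_j(\xi)(O)=0 ,$$ where $\partial_{Lie}\Phi_{-1}=0$ and $\partial_{Lie}$ is the Chevalley–Eilenberg differential $$(\partial_{Lie}\varphi)(x_1,\dots,x_j)(O)=-\sum_i(-1)^{i-1}\varphi(\dots\hat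 x_i\dots)([x_i,O])+\sum_{i<p}(-1)^{i+p}\varphi([x_i,x_p],\dots\hat x_i\dots\hat x_p\dots)(O).$$ -/

import Mathlib

noncomputable section

namespace TwistedTQM

/-! ## Laurent series in `ħ` with coefficients in a complex vector space -/

/-- The field `ℂ((ħ))`. -/
abbrev K : Type := LaurentSeries ℂ

/-- The formal parameter `ħ`, and its inverse. -/
def hbar : K := HahnSeries.single 1 1

def hbarInv : K := HahnSeries.single (-1) 1

/-- `S((ħ))` for a complex vector space `S`, as a vector space over `ℂ((ħ))`. -/
def Lau (S : Type*) [AddCommGroup S] [Module ℂ S] : Type _ := HahnModule ℤ ℂ S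

section Laurent

variable {S S' : Type*} [AddCommGroup S] [Module ℂ S] [AddCommGroup S'] [Module ℂ S']

instance : AddCommGroup (Lau S) := inferInstanceAs (AddCommGroup (HahnModule ℤ ℂ S))

instance : Module ℂ (Lau S) := inferInstanceAs (Module ℂ (HahnModule ℤ ℂ S))

instance : Module K (Lau S) := inferInstanceAs (Module K (HahnModule ℤ ℂ S))

instance : IsScalarTower ℂ K (Lau S) := inferInstanceAs (IsScalarTower ℂ K (HahnModule ℤ ℂ S))

instance : SMulCommClass ℂ K (Lau S) := inferInstanceAs (SMulCommClass ℂ K (HahnModule ℤ ℂ S))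

instance : SMulCommClass K ℂ (Lau S) := SMulCommClass.symm ℂ K (Lau S)

/-- The underlying series. -/
def toS : Lau S ≃ HahnSeries ℤ S := (HahnModule.of ℂ).symm

/-- The element with a given underlying series. -/
def ofS : HahnSeries ℤ S ≃ Lau S := HahnModule.of ℂ

@[simp] theorem toS_ofS (x : HahnSeries ℤ S) : toS (ofS x) = x := rfl

@[simp] theorem ofS_toS (f : Lau S) : ofS (toS f) = f := rfl

@[simp] theorem toS_zero : toS (0 : Lau S) = 0 := rfl

@[simp] theorem toS_add (f f' : Lau S) : toS (f + f') = toS f + toS f' := rfl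

@[simp] theorem ofS_add (x x' : HahnSeries ℤ S) : ofS (x + x') = ofS x + ofS x' := rfl

@[simp] theorem toS_base_smul (c : ℂ) (f : Lau S) : toS (c • f) = c • toS f := rfl

theorem toS_smul (c : K) (f : Lau S) :
    toS (c • f) = (HahnModule.of ℂ).symm (c • HahnModule.of ℂ (toS f)) := rfl

theorem toS_injective : Function.Injective (toS : Lau S → HahnSeries ℤ S) := toS.injective

/-- The constant series `s`. -/
def const (s : S) : Lau S := ofS (HahnSeries.single 0 s)

/-- A linear map applied to all the coefficients. -/
def mapC (φ : S →ₗ[ℂ] S') : Lau S →ₗ[K] Lau S' where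
  toFun f := ofS ((toS f).map φ)
  map_add' f g := by
    apply toS_injective
    ext n
    simp
  map_smul' c f := by
    apply toS_injective
    ext n
    have h : ((toS f).map φ).support ⊆ (toS f).support := by
      intro a ha h0
      apply ha
      simp [h0]
    simp only [RingHom.id_apply, toS_ofS, toS_smul]
    rw [HahnModule.coeff_smul_right (toS f).isPWO_support (by simpa using h)]
    simp [HahnModule.coeff_smul, map_sum]

/-- Extension of scalars from `ℂ((ħ))` to `R((ħ))` for a complex algebra `R`. -/
def toAlg (R : Type*) [Ring R] [Algebra ℂ R] (c : K) : HahnSeries ℤ R :=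
  HahnSeries.map c (algebraMap ℂ R)

theorem toAlg_smul {R V : Type*} [Ring R] [Algebra ℂ R] [AddCommGroup V] [Module R V] [Module ℂ V]
    [IsScalarTower ℂ R V] (c : K) (f : HahnSeries ℤ V) :
    toS (c • ofS f)
      = (HahnModule.of R).symm (toAlg R c • HahnModule.of R f) := by
  ext n
  have h : (toAlg R c).support ⊆ c.support := by
    intro a ha h0
    apply ha
    simp [toAlg, h0]
  rw [toS_smul, HahnModule.coeff_smul_left c.isPWO_support h, HahnModule.coeff_smul]
  simp [toAlg]

theorem toAlg_comm {R : Type*} [Ring R] [Algebra ℂ R] (c : K) (x : HahnSeries ℤ R) :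
    toAlg R c * x = x * toAlg R c := by
  ext n
  have h : (toAlg R c).support ⊆ c.support := by
    intro a ha h0
    apply ha
    simp [toAlg, h0]
  rw [HahnSeries.coeff_mul_left' c.isPWO_support h, HahnSeries.coeff_mul_right' c.isPWO_support h]
  refine Finset.sum_nbij' (fun p => (p.2, p.1)) (fun p => (p.2, p.1)) ?_ ?_ ?_ ?_ ?_
  · intro p hp
    simp only [Finset.mem_antidiagonal] at hp ⊢
    exact ⟨hp.2.1, hp.1, by rw [add_comm]; exact hp.2.2⟩
  · intro p hp
    simp only [Finset.mem_antidiagonal] at hp ⊢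
    exact ⟨hp.2.1, hp.1, by rw [add_comm]; exact hp.2.2⟩
  · intros; rfl
  · intros; rfl
  · intro p _
    simpa [toAlg] using Algebra.commutes (c.coeff p.1) (x.coeff p.2)

theorem series_mul_smul {R V : Type*} [Ring R] [AddCommGroup V] [Module R V]
    (x y : HahnSeries ℤ R) (z : HahnModule ℤ R V) : (x * y) • z = x • y • z :=
  mul_smul x y z

/-- The operator `∑ ħ ^ p / p! D ^ p`, as a series with operator coefficients. -/
def expSeries (D : Module.End ℂ S) : HahnSeries ℤ (Module.End ℂ S) :=
  HahnSeries.ofPowerSeries ℤ (Module.End ℂ S)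
    (PowerSeries.mk fun p => ((p.factorial : ℂ)⁻¹) • D ^ p)

/-- The operator `exp (ħ D)` on `S((ħ))`. -/
def hexp (D : Module.End ℂ S) : Lau S →ₗ[K] Lau S where
  toFun f := ofS ((HahnModule.of (Module.End ℂ S)).symm
    (expSeries D • HahnModule.of (Module.End ℂ S) (toS f)))
  map_add' f g := by
    simp [smul_add]
  map_smul' c f := by
    have h := toAlg_smul (R := Module.End ℂ S) c (toS f)
    have h' := toAlg_smul (R := Module.End ℂ S) c ((HahnModule.of (Module.End ℂ S)).symm
      (expSeries D • HahnModule.of (Module.End ℂ S) (toS f)))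
    simp only [ofS_toS, Equiv.apply_symm_apply] at h h'
    simp only [RingHom.id_apply]
    rw [h, Equiv.apply_symm_apply, ← series_mul_smul, ← toAlg_comm, series_mul_smul, ← h',
      ofS_toS]

end Laurent

section Mult

variable {S : Type*} [CommRing S] [Algebra ℂ S]

/-- The product of `S((ħ))` for a commutative algebra `S`. -/
def mulC : Lau S →ₗ[K] Lau S →ₗ[K] Lau S :=
  LinearMap.mk₂ K
    (fun f g => ofS (toS f * toS g))
    (fun f f' g => by simp [add_mul])
    (fun c f g => by
      have h := toAlg_smul (R := S) c (toS f)
      have h' := toAlg_smul (R := S) c (toS f * toS g)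
      rw [ofS_toS, HahnSeries.of_symm_smul_of_eq_mul] at h
      rw [HahnSeries.of_symm_smul_of_eq_mul] at h'
      rw [h, mul_assoc, ← h', ofS_toS])
    (fun f g g' => by simp [mul_add])
    (fun c f g => by
      have h := toAlg_smul (R := S) c (toS g)
      have h' := toAlg_smul (R := S) c (toS f * toS g)
      rw [ofS_toS, HahnSeries.of_symm_smul_of_eq_mul] at h
      rw [HahnSeries.of_symm_smul_of_eq_mul] at h'
      rw [h, mul_left_comm, ← h', ofS_toS])

end Mult
theorem of_symm_hexp_coeff_eq_zero {S : Type*} [AddCommGroup S] [Module ℂ S]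
    (D : Module.End ℂ S) (f : Lau S) (N : ℤ)
    (hf : ∀ n < N, (toS f).coeff n = 0) (n : ℤ) (hn : n < N) :
    (toS (hexp D f)).coeff n = 0 := by
  by_contra h
  have h1 := HahnModule.support_smul_subset_vadd_support' (R := Module.End ℂ S)
    (x := expSeries D) (y := HahnModule.of (Module.End ℂ S) (toS f)) h
  obtain ⟨a, ha, b, hb, hab⟩ := Set.mem_vadd.1 h1
  have ha0 : 0 ≤ a := by
    by_contra hneg
    apply ha
    unfold expSeries
    rw [HahnSeries.ofPowerSeries_apply]
    apply HahnSeries.embDomain_of_notMem_range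
    rintro ⟨p, hp⟩
    have : (p : ℤ) = a := hp
    omega
  have hbN : N ≤ b := by
    by_contra hlt
    exact hb (hf b (by omega))
  have : a + b = n := hab
  omega

/-! ## The linear data of a twisted sector -/

/-- Indices of the coordinates `y`: the first `k` and the last `k` ones are canonically
conjugate. -/
abbrev YVar (k : ℕ) : Type := Fin k ⊕ Fin k

/-- Indices of all the coordinates: `Sum.inl` for the `y`, `Sum.inr` for the `z`. -/
abbrev Var (k l : ℕ) : Type := YVar k ⊕ YVar l

/-- The matrix `ω ^ {ij}` of the standard Poisson bivector in `2n` Darboux coordinates. -/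
def poisson (R : Type*) [CommRing R] (n : ℕ) : Matrix (YVar n) (YVar n) R :=
  Matrix.fromBlocks 0 1 (-1) 0

/-- The matrix `ω ^ {ij}` in the coordinates `(y, z)`. -/
def poissonYZ (R : Type*) [CommRing R] (k l : ℕ) : Matrix (Var k l) (Var k l) R :=
  Matrix.fromBlocks (poisson R k) 0 0 (poisson R l)

/-- A finite group `G` acting by symplectic matrices `ρ` on `ℝ ^ {2n}`, `n = k + l`, and by
matrices `κ` on `ℂ ^ r`, and an element `g` of `G` whose fixed space is the space of the
coordinates `y` and which maps the space of the coordinates `z` to itself. -/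
structure Sector (G : Type*) [Group G] (k l r : ℕ) where
  ρ : G →* Matrix (Var k l) (Var k l) ℝ
  κ : G →* Matrix (Fin r) (Fin r) ℂ
  g : G
  symplectic : ∀ h : G, (ρ h).transpose * poissonYZ ℝ k l * ρ h = poissonYZ ℝ k l
  fixed_iff : ∀ v : Var k l → ℝ, (ρ g).mulVec v = v ↔ ∀ j, v (Sum.inr j) = 0
  perp : ∀ v : Var k l → ℝ, (∀ i, v (Sum.inl i) = 0) →
    ∀ i, (ρ g).mulVec v (Sum.inl i) = 0

/-! ## Power series: differential operators, substitutions -/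

/-- Formal power series in variables indexed by `σ`. -/
abbrev PS (σ : Type) : Type := MvPowerSeries σ ℂ

/-- The partial derivative as a linear map. -/
def pd {σ : Type} (i : σ) : Module.End ℂ (PS σ) := (MvPowerSeries.pderiv ℂ i).toLinearMap

theorem hasSubst_linear {σ : Type} [Fintype σ] (M : Matrix σ σ ℝ) :
    MvPowerSeries.HasSubst (fun i => ∑ j, MvPowerSeries.C (M i j : ℂ) * (MvPowerSeries.X j : PS σ)) :=
  MvPowerSeries.hasSubst_of_constantCoeff_zero (by intro i; simp)

/-- The pullback `f ↦ (v ↦ f (M v))`. -/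
def pull {σ : Type} [Fintype σ] (M : Matrix σ σ ℝ) : PS σ →ₐ[ℂ] PS σ :=
  MvPowerSeries.substAlgHom (hasSubst_linear M)

/-- The copy of a power series in the variables of the point `α`, among `N` points. -/
def atPoint {N : ℕ} {σ : Type} [Finite σ] (α : Fin N) : PS σ →ₐ[ℂ] PS (Fin N × σ) :=
  MvPowerSeries.rename (Prod.mk α)

/-- The multiplication map: the variables of all the points are identified. -/
def mult {N : ℕ} {σ : Type} [Finite σ] : PS (Fin N × σ) →ₐ[ℂ] PS σ :=
  MvPowerSeries.rename Prod.snd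

/-- The bidifferential operator `∑ P i j ∂_i ⊗ ∂_j`, acting on the points `α` and `β`. -/
def lineOp {N : ℕ} {σ : Type} [Fintype σ] (P : Matrix σ σ ℂ) (α β : Fin N) :
    Module.End ℂ (PS (Fin N × σ)) :=
  ∑ i, ∑ j, P i j • (pd (α, i) * pd (β, j))

/-! ## The Weyl algebra and its matrices -/

/-- The Weyl algebra `ℂ[[y, z]]((ħ))`. -/
abbrev W (k l : ℕ) : Type := Lau (PS (Var k l))

/-- The Moyal product. -/
def star {k l : ℕ} : W k l →ₗ[K] W k l →ₗ[K] W k l :=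
  (((mulC (S := PS (Fin 2 × Var k l))).compl₁₂
    (mapC (atPoint 0).toLinearMap) (mapC (atPoint 1).toLinearMap)).compr₂
    (hexp ((1 / 2 : ℂ) • lineOp (poissonYZ ℂ k l) 0 1))).compr₂ (mapC mult.toLinearMap)

/-- The algebra of `r` by `r` matrices over the Weyl algebra. -/
abbrev A (k l r : ℕ) : Type := Matrix (Fin r) (Fin r) (W k l)

/-- The product of matrices over the Weyl algebra. -/
def mmul {k l r : ℕ} : A k l r →ₗ[K] A k l r →ₗ[K] A k l r :=
  LinearMap.mk₂ K (fun a b => Matrix.of fun i j => ∑ c, star (a i c) (b c j))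
    (fun a a' b => by ext1 i j; simp [Finset.sum_add_distrib])
    (fun c a b => by ext1 i j; simp [Finset.smul_sum])
    (fun a b b' => by ext1 i j; simp [Finset.sum_add_distrib])
    (fun c a b => by ext1 i j; simp [Finset.smul_sum])

/-- The scalar matrix `f Id`. -/
def scalarMat {k l : ℕ} (r : ℕ) (f : W k l) : A k l r :=
  Matrix.of fun i j => if i = j then f else 0

theorem scalarMat_add {k l : ℕ} (r : ℕ) (f f' : W k l) :
    scalarMat r (f + f') = scalarMat r f + scalarMat r f' := by
  ext1 i j
  by_cases h : i = j <;> simp [scalarMat, h]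

theorem scalarMat_smul {k l : ℕ} (r : ℕ) (c : ℂ) (f : W k l) :
    scalarMat r (c • f) = c • scalarMat r f := by
  ext1 i j
  by_cases h : i = j
  · simp [scalarMat, h]
  · simp only [scalarMat, Matrix.of_apply, Matrix.smul_apply, if_neg h]
    exact (smul_zero (A := W k l) c).symm

/-- The unit of the algebra of matrices. -/
def oneA (k l r : ℕ) : A k l r := scalarMat r (const 1)

/-- The Lie bracket `[x, a] = ħ⁻¹ (x ⋆ a - a ⋆ x)`. -/
def ad {k l r : ℕ} (x : A k l r) : A k l r →ₗ[K] A k l r :=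
  hbarInv • (mmul x - mmul.flip x)

namespace Sector

variable {G : Type*} [Group G] {k l r : ℕ} (D : Sector G k l r)

/-- The action of `h` on functions, `(h f) v = f (h⁻¹ v)`. -/
def actW (h : G) : W k l →ₗ[K] W k l := mapC (pull (D.ρ h⁻¹)).toLinearMap

/-- The action of `h` on matrices over the Weyl algebra: on the entries, and by conjugation with
`κ h`. -/
def actA (h : G) : A k l r →ₗ[K] A k l r where
  toFun a := Matrix.of fun i j =>
    ∑ c, ∑ d, (HahnSeries.C (D.κ h i c * D.κ h⁻¹ d j) : K) • D.actW h (a c d)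
  map_add' a b := by
    ext1 i j
    simp [Finset.sum_add_distrib]
  map_smul' c a := by
    ext1 i j
    simp only [Matrix.smul_apply, map_smul, Matrix.of_apply, Finset.smul_sum, RingHom.id_apply]
    refine Finset.sum_congr rfl fun x _ => Finset.sum_congr rfl fun y _ => smul_comm _ _ _

/-! ## Propagators -/

/-- The action of `g` on the space of the coordinates `z`. -/
def gPerp : Matrix (YVar l) (YVar l) ℂ := (D.ρ D.g).toBlocks₂₂.map Complex.ofReal

/-- The bivector `(1 ⊗ M) Π` in the coordinates `z`. -/
def twistPi (M : Matrix (YVar l) (YVar l) ℂ) : Matrix (YVar l) (YVar l) ℂ :=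
  poisson ℂ l * M.transpose

/-- The propagator `P₁ (x, y)` for `s = x - y`, `0 < s < 1`:
`(s - 1 / 2) Π₁ - (1 ⊗ (1 - g)⁻¹) Π₂`. -/
def propLine (s : ℝ) : Matrix (Var k l) (Var k l) ℂ :=
  Matrix.fromBlocks (((s : ℂ) - 1 / 2) • poisson ℂ k) 0 0 (-twistPi (1 - D.gPerp)⁻¹)

/-- The propagator `P₂` of a self loop: `- (1 ⊗ g (1 - g)⁻¹) Π₂ - 1 / 2 Π₂`. -/
def propLoop : Matrix (Var k l) (Var k l) ℂ :=
  Matrix.fromBlocks 0 0 0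
    (-twistPi (D.gPerp * (1 - D.gPerp)⁻¹) - (1 / 2 : ℂ) • poisson ℂ l)

/-- The positions on the circle `ℝ / ℤ` cut at the point `0`: the twist by `g` sits directly
after the point `0`, the other points are at `u`. -/
def pos {m : ℕ} (u : Fin m → ℝ) : Fin (m + 1) → ℝ := Fin.cons 1 u

/-- The propagator between the points `α` and `β`. -/
def propBetween {m : ℕ} (u : Fin m → ℝ) (α β : Fin (m + 1)) : Matrix (Var k l) (Var k l) ℂ :=
  if pos u β < pos u α then D.propLine (pos u α - pos u β)
  else (D.propLine (pos u β - pos u α)).transpose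

/-- The operator of all the lines. -/
def lines {m : ℕ} (u : Fin m → ℝ) : Module.End ℂ (PS (Fin (m + 1) × Var k l)) :=
  (1 / 2 : ℂ) • ∑ α, ∑ β, if α = β then 0 else lineOp (D.propBetween u α β) α β

/-- The operator of all the self loops. -/
def loops (m : ℕ) : Module.End ℂ (PS (Fin (m + 1) × Var k l)) :=
  (1 / 2 : ℂ) • ∑ α, lineOp D.propLoop α α

end Sector

/-! ## Differential forms -/

/-- Formal differential forms on `ℝ ^ {2k}`. -/
abbrev Form (k : ℕ) : Type := TensorProduct ℂ (PS (YVar k)) (ExteriorAlgebra ℂ (YVar k → ℂ))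

/-- Formal differential forms with coefficients in `ℂ((ħ))`. -/
abbrev Ω (k : ℕ) : Type := Lau (Form k)

/-- The form `dy ^ i`. -/
def dy {k : ℕ} (i : YVar k) : ExteriorAlgebra ℂ (YVar k → ℂ) :=
  ExteriorAlgebra.ι ℂ (Pi.single i 1)

/-- The de Rham differential `∑ dy ^ i ∂_i`. -/
def deRham (k : ℕ) : Ω k →ₗ[K] Ω k :=
  mapC (∑ i, TensorProduct.map (pd i) (LinearMap.mulLeft ℂ (dy i)))

/-- The operator `∑ ω ^ {ij} ∂_i ι_j`. -/
def BV (k : ℕ) : Ω k →ₗ[K] Ω k :=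
  mapC (∑ i, ∑ j, poisson ℂ k i j •
    TensorProduct.map (pd i) (CliffordAlgebra.contractLeft (LinearMap.proj j)))

namespace Sector

variable {G : Type*} [Group G] {k l r : ℕ} (D : Sector G k l r)

/-- The pullback of forms by a real matrix. -/
def pullForm (M : Matrix (YVar k) (YVar k) ℝ) : Form k →ₗ[ℂ] Form k :=
  TensorProduct.map (pull M).toLinearMap
    (ExteriorAlgebra.map (Matrix.mulVecLin (M.map Complex.ofReal).transpose)).toLinearMap

/-- The action of `h` on forms, for `h` in the centralizer of `g`, by pullback along `h⁻¹`. -/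
def actΩ (h : G) : Ω k →ₗ[K] Ω k := mapC (pullForm (D.ρ h⁻¹).toBlocks₁₁)

/-! ## Correlation maps -/

/-- The open simplex `0 < u_1 < … < u_m < 1`. -/
def simplex (m : ℕ) : Set (Fin m → ℝ) := {u | StrictMono u ∧ ∀ i, u i ∈ Set.Ioo (0 : ℝ) 1}

/-- The integrand: the sum over all the graphs with lines and self loops, followed by the
multiplication map and by `z ↦ 0`. -/
def integrand {m : ℕ} (F : Lau (PS (Fin (m + 1) × Var k l))) (u : Fin m → ℝ) :
    Lau (PS (YVar k)) :=
  mapC ((MvPowerSeries.killCompl Function.Embedding.inl).comp mult).toLinearMap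
    (hexp (D.lines u) (hexp (D.loops m) F))

theorem integrand_coeff_eq_zero {m : ℕ} (F : Lau (PS (Fin (m + 1) × Var k l))) (N : ℤ)
    (hF : ∀ n < N, (toS F).coeff n = 0) (u : Fin m → ℝ) (n : ℤ) (hn : n < N) :
    (toS (D.integrand F u)).coeff n = 0 := by
  have h := of_symm_hexp_coeff_eq_zero (D.lines u) _ N
    (of_symm_hexp_coeff_eq_zero (D.loops m) F N hF) n hn
  change ((MvPowerSeries.killCompl Function.Embedding.inl).comp mult).toLinearMap
    ((toS (hexp (D.lines u) (hexp (D.loops m) F))).coeff n) = 0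
  rw [h, map_zero]

theorem exists_lower_bound {S : Type*} [AddCommGroup S] [Module ℂ S] (F : Lau S) :
    ∃ N : ℤ, ∀ n < N, (toS F).coeff n = 0 := by
  refine ⟨(toS F).order, fun n hn => ?_⟩
  exact HahnSeries.coeff_eq_zero_of_lt_order hn

/-- The integral of the integrand over the simplex, coefficient by coefficient. -/
def integral {m : ℕ} (F : Lau (PS (Fin (m + 1) × Var k l))) : Lau (PS (YVar k)) :=
  ofS (HahnSeries.ofSuppBddBelow
    (fun n d => ∫ u in simplex m,
      MvPowerSeries.coeff d ((toS (D.integrand F u)).coeff n)) (by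
    obtain ⟨N, hN⟩ := exists_lower_bound F
    refine ⟨N, fun n hn => ?_⟩
    by_contra hlt
    apply hn
    funext d
    simp only [D.integrand_coeff_eq_zero F N hN _ n (not_le.1 hlt), map_zero,
      MeasureTheory.integral_zero]
    rfl))

/-- The matrix `a` at the point `α`. -/
def insertAt {N : ℕ} (α : Fin N) (a : A k l r) :
    Matrix (Fin r) (Fin r) (HahnSeries ℤ (PS (Fin N × Var k l))) :=
  a.map fun f => toS (mapC (atPoint α).toLinearMap f)

/-- The twisted trace `tr (t_0 g ∂_{i_1} t_1 … ∂_{i_m} t_m)`, the factors being placed at their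
points. -/
def traceAt {m : ℕ} (t : Fin (m + 1) → A k l r) (i : Fin m → YVar k) :
    Lau (PS (Fin (m + 1) × Var k l)) :=
  ofS (Matrix.trace
    (insertAt 0 (t 0) * (D.κ D.g).map (fun c => HahnSeries.C (MvPowerSeries.C c)) *
      (List.ofFn fun q : Fin m => insertAt q.succ ((t q.succ).map (mapC (pd (Sum.inl (i q)))))).prod))

/-- The twisted free correlation map
`det (1 - g⁻¹)⁻¹ ∫ exp (ħ ∂_{P₁}) exp (ħ ∂_{P₂}) tr (t_0 g dt_1 … dt_m)` at `z = 0`. -/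
def freeCorr {m : ℕ} (t : Fin (m + 1) → A k l r) : Ω k :=
  (HahnSeries.C ((1 - D.gPerp⁻¹).det⁻¹) : K) •
    ∑ i : Fin m → YVar k,
      mapC ((TensorProduct.mk ℂ (PS (YVar k)) (ExteriorAlgebra ℂ (YVar k → ℂ))).flip
        (List.ofFn fun q => dy (i q)).prod) (D.integral (D.traceAt t i))

/-- The Koszul sign of a shuffle: one-forms `1, …, j` are placed in the slots `σ (inr a)`; each
of them passes the operators `d` of the slots up to its own, and they are reordered. -/
def shuffleSign {m j : ℕ} (σ : Fin m ⊕ Fin j ≃ Fin (m + j)) : ℤ :=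
  (∏ a : Fin j, (-1 : ℤ) ^ ((σ (Sum.inr a)).val + 1)) *
    ∏ a : Fin j, ∏ b : Fin j,
      if a < b ∧ σ (Sum.inr b) < σ (Sum.inr a) then (-1 : ℤ) else 1

open Classical in
/-- The `j`-cochain component of the interactive correlation map on `(ξ_1, …, ξ_j)` and on the
chain `t_0 ⊗ … ⊗ t_m`: the elements `ξ / ħ` are shuffled into `t_1 ⊗ … ⊗ t_m`. -/
def intCorr {m j : ℕ} (ξ : Fin j → A k l r) (t : Fin (m + 1) → A k l r) : Ω k :=
  ∑ σ : Fin m ⊕ Fin j ≃ Fin (m + j),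
    if StrictMono (fun q => σ (Sum.inl q)) then
      shuffleSign σ • D.freeCorr (Fin.cons (t 0) fun s : Fin (m + j) =>
        Sum.elim (fun q => t q.succ) (fun a => hbarInv • ξ a) (σ.symm s))
    else 0

end Sector

/-! ## Chains -/

/-- Polynomials in `u, u⁻¹` with coefficients in `M`: the coefficient of `u ^ p` sits at `p`. -/
abbrev Per (M : Type*) [AddCommMonoid M] [Module K M] : Type _ := ℤ →₀ M

section Per

variable {M M' : Type*} [AddCommMonoid M] [Module K M] [AddCommMonoid M'] [Module K M']

/-- The `u`-linear extension of a map. -/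
def ext (φ : M →ₗ[K] M') : Per M →ₗ[K] Per M' := Finsupp.mapRange.linearMap φ

/-- Multiplication by `u`. -/
def mulU : Per M →ₗ[K] Per M := Finsupp.lmapDomain M K (fun p : ℤ => p + 1)

end Per

/-- The `(m + 1)`-st tensor power of the algebra of matrices over `ℂ((ħ))`. -/
abbrev Tens (k l r m : ℕ) : Type := PiTensorProduct K (fun _ : Fin (m + 1) => A k l r)

/-- Finite sums of tensors `a_0 ⊗ … ⊗ a_m`, representing cyclic chains. -/
abbrev Chain (k l r : ℕ) : Type := DirectSum ℕ (fun m => Tens k l r m)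

/-- The quotient of the algebra by the multiples of its unit. -/
abbrev ABar (k l r : ℕ) : Type := A k l r ⧸ Submodule.span K {oneA k l r}

/-- The space of cyclic `m`-chains `A ⊗ (A / 1) ^ {⊗ m}`. -/
abbrev CycTens (k l r m : ℕ) : Type :=
  TensorProduct K (A k l r) (PiTensorProduct K (fun _ : Fin m => ABar k l r))

/-- The space of all cyclic chains. -/
abbrev CycChain (k l r : ℕ) : Type := DirectSum ℕ (fun m => CycTens k l r m)

section Chains

variable {k l r : ℕ}

/-- The map `(a_0, …, a_m) ↦ a_0 ⊗ [a_1] ⊗ … ⊗ [a_m]`. -/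
def classMulti (m : ℕ) : MultilinearMap K (fun _ : Fin (m + 1) => A k l r) (CycTens k l r m) :=
  LinearMap.uncurryLeft
    { toFun := fun a => (TensorProduct.mk K _ _ a).compMultilinearMap
        ((PiTensorProduct.tprod K).compLinearMap fun _ : Fin m =>
          (Submodule.span K {oneA k l r}).mkQ)
      map_add' := fun a a' => by
        ext v
        simp
      map_smul' := fun c a => by
        ext v
        simp }

/-- The class of a chain in the space of cyclic chains. -/
def toCyc (k l r : ℕ) : Chain k l r →ₗ[K] CycChain k l r :=
  DirectSum.lmap fun m => PiTensorProduct.lift (classMulti m)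

theorem contractNth_update {α : Type*} {m : ℕ} (op : α → α → α) (i : Fin (m + 1))
    (a : Fin (m + 2) → α) (p : Fin (m + 2)) [DecidableEq (Fin (m + 2))] :
    ∃ q : Fin (m + 1),
      (∀ x, Fin.contractNth i.castSucc op (Function.update a p x) =
        Function.update (Fin.contractNth i.castSucc op a) q x) ∨
      (∃ y, ∀ x, Fin.contractNth i.castSucc op (Function.update a p x) =
        Function.update (Fin.contractNth i.castSucc op a) q (op x y)) ∨
      (∃ y, ∀ x, Fin.contractNth i.castSucc op (Function.update a p x) =
        Function.update (Fin.contractNth i.castSucc op a) q (op y x)) := by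
  have key : ∀ s : Fin (m + 1), ∀ x, Fin.contractNth i.castSucc op (Function.update a p x) s =
      if s.val < i.val then (if s.val = p.val then x else a s.castSucc)
      else if s.val = i.val then op (if s.val = p.val then x else a s.castSucc)
        (if s.val + 1 = p.val then x else a s.succ)
      else (if s.val + 1 = p.val then x else a s.succ) := by
    intro s x
    simp only [Fin.contractNth, Function.update_apply, Fin.ext_iff, Fin.val_castSucc, Fin.val_succ]
  have hp2 := p.isLt
  have hi2 := i.isLt
  rcases lt_trichotomy p.val i.val with hp | hp | hp
  · refine ⟨⟨p.val, by omega⟩, Or.inl fun x => funext fun s => ?_⟩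
    rw [key, Function.update_apply, Fin.contractNth]
    simp only [Fin.ext_iff, Fin.val_castSucc]
    split_ifs <;> first | omega | rfl
  · refine ⟨i, Or.inr (Or.inl ⟨a i.succ, fun x => funext fun s => ?_⟩)⟩
    rw [key, Function.update_apply, Fin.contractNth]
    by_cases hs : s = i
    · subst hs
      simp [hp]
    · have hs' : s.val ≠ i.val := fun h => hs (Fin.ext h)
      simp only [Fin.val_castSucc, hs, hs', if_false]
      split_ifs <;> first | omega | rfl
  · by_cases hp1 : p.val = i.val + 1
    · refine ⟨i, Or.inr (Or.inr ⟨a i.castSucc, fun x => funext fun s => ?_⟩)⟩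
      rw [key, Function.update_apply, Fin.contractNth]
      by_cases hs : s = i
      · subst hs
        simp [hp1]
      · have hs' : s.val ≠ i.val := fun h => hs (Fin.ext h)
        simp only [Fin.val_castSucc, hs, hs', if_false]
        split_ifs <;> first | omega | rfl
    · refine ⟨⟨p.val - 1, by omega⟩, Or.inl fun x => funext fun s => ?_⟩
      rw [key, Function.update_apply, Fin.contractNth]
      simp only [Fin.ext_iff, Fin.val_castSucc]
      split_ifs <;> first | omega | rfl

/-- The map `(a_0, …, a_{m + 1}) ↦ a_0 ⊗ … ⊗ a_i a_{i + 1} ⊗ … ⊗ a_{m + 1}`. -/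
def face (m : ℕ) (i : Fin (m + 1)) :
    MultilinearMap K (fun _ : Fin (m + 2) => A k l r) (Tens k l r m) where
  toFun a := PiTensorProduct.tprod K (Fin.contractNth i.castSucc (fun x y => mmul x y) a)
  map_update_add' a p x y := by
    obtain ⟨q, h | ⟨z, h⟩ | ⟨z, h⟩⟩ := contractNth_update (fun x y => mmul x y) i a p <;>
      simp only [h, map_add, LinearMap.add_apply, MultilinearMap.map_update_add]
  map_update_smul' a p c x := by
    obtain ⟨q, h | ⟨z, h⟩ | ⟨z, h⟩⟩ := contractNth_update (fun x y => mmul x y) i a p <;>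
      simp only [h, map_smul, LinearMap.smul_apply, MultilinearMap.map_update_smul]

/-- The map `(a_0, …, a_m) ↦ 1 ⊗ a_0 ⊗ … ⊗ a_m`. -/
def consOne (m : ℕ) : MultilinearMap K (fun _ : Fin (m + 1) => A k l r) (Tens k l r (m + 1)) :=
  (PiTensorProduct.tprod K (s := fun _ : Fin (m + 2) => A k l r)).curryLeft (oneA k l r)

/-- The derivation `[x, -]` on chains. -/
def adChain (x : A k l r) : Chain k l r →ₗ[K] Chain k l r :=
  DirectSum.lmap fun m => ∑ i : Fin (m + 1),
    PiTensorProduct.map (Function.update (fun _ => LinearMap.id) i (ad x))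

end Chains

namespace Sector

variable {G : Type*} [Group G] {k l r : ℕ} (D : Sector G k l r)

/-- The twisted Hochschild operator on `(a_0, …, a_{m + 1})`:
`(-1) ^ (m + 1) a_{m + 1} a_0 ⊗ a_1 ⊗ … ⊗ a_m + a_0 g (a_1) ⊗ a_2 ⊗ … ⊗ a_{m + 1}
+ ∑_{i = 1} ^ m (-1) ^ i a_0 ⊗ … ⊗ a_i a_{i + 1} ⊗ … ⊗ a_{m + 1}`. -/
def hochMulti (m : ℕ) : MultilinearMap K (fun _ : Fin (m + 2) => A k l r) (Tens k l r m) :=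
  (-1 : K) ^ (m + 1) • (face m 0).domDomCongr (Equiv.subRight 1) +
    (face m 0).compLinearMap (fun s => if s = 1 then D.actA D.g else LinearMap.id) +
    ∑ i : Fin m, (-1 : K) ^ (i.val + 1) • face m i.succ

/-- The twisted Connes operator on `(a_0, …, a_m)`:
`∑_{i = 0} ^ m (-1) ^ (m i) 1 ⊗ a_{m - i + 1} ⊗ … ⊗ a_m ⊗ a_0 ⊗ g (a_1) ⊗ … ⊗ g (a_{m - i})`. -/
def connesMulti (m : ℕ) :
    MultilinearMap K (fun _ : Fin (m + 1) => A k l r) (Tens k l r (m + 1)) :=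
  ∑ i : Fin (m + 1), (-1 : K) ^ (m * i.val) •
    ((consOne m).compLinearMap
      (fun s : Fin (m + 1) => if i < s then D.actA D.g else LinearMap.id)).domDomCongr
        (Equiv.subRight i)

/-- The twisted Hochschild operator `b_g`. -/
def hoch : Chain k l r →ₗ[K] Chain k l r :=
  DirectSum.toModule K ℕ _ fun m => match m with
    | 0 => 0
    | m + 1 => (DirectSum.lof K ℕ (fun m => Tens k l r m) m).comp
        (PiTensorProduct.lift (D.hochMulti m))

/-- The twisted Connes operator `B_g`. -/
def connes : Chain k l r →ₗ[K] Chain k l r :=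
  DirectSum.toModule K ℕ _ fun m => (DirectSum.lof K ℕ (fun m => Tens k l r m) (m + 1)).comp
    (PiTensorProduct.lift (D.connesMulti m))

/-- The diagonal action of `h` on chains. -/
def actChain (h : G) : Chain k l r →ₗ[K] Chain k l r :=
  DirectSum.lmap fun _ => PiTensorProduct.map fun _ => D.actA h

/-- The differential `b_g + u B_g`. -/
def chainDiff : Per (Chain k l r) →ₗ[K] Per (Chain k l r) :=
  ext D.hoch + mulU.comp (ext D.connes)

end Sector

/-- The differential `ħ Δ + u d`. -/
def formDiff (k : ℕ) : Per (Ω k) →ₗ[K] Per (Ω k) :=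
  ext (hbar • BV k) + mulU.comp (ext (deRham k))

/-! ## The Lie algebra -/

/-- Series without negative powers of `ħ`. -/
def IsPlus {k l : ℕ} (f : W k l) : Prop := ∀ n < 0, (toS f).coeff n = 0

namespace Sector

variable {G : Type*} [Group G] {k l r : ℕ} (D : Sector G k l r)

/-- The space of all `f Id + ħ a` with `g`-invariant `f` and `a` without negative powers of
`ħ`. -/
def lieAlg : Submodule ℂ (A k l r) where
  carrier := {x | ∃ (f : W k l) (a : A k l r), IsPlus f ∧ D.actW D.g f = f ∧
    (∀ i j, IsPlus (a i j)) ∧ D.actA D.g a = a ∧ x = scalarMat r f + hbar • a}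
  add_mem' := by
    rintro _ _ ⟨f, a, hf, hgf, ha, hga, rfl⟩ ⟨f', a', hf', hgf', ha', hga', rfl⟩
    refine ⟨f + f', a + a', fun n hn => ?_, ?_, fun i j n hn => ?_, ?_, ?_⟩
    · simp [hf n hn, hf' n hn]
    · rw [map_add, hgf, hgf']
    · simp [ha i j n hn, ha' i j n hn]
    · rw [map_add, hga, hga']
    · rw [scalarMat_add, smul_add]
      abel
  zero_mem' := by
    refine ⟨0, 0, fun n _ => rfl, map_zero _, fun i j n _ => rfl, map_zero _, ?_⟩
    ext1 i j
    simp [scalarMat]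
  smul_mem' := by
    rintro c _ ⟨f, a, hf, hgf, ha, hga, rfl⟩
    refine ⟨c • f, c • a, fun n hn => ?_, ?_, fun i j n hn => ?_, ?_, ?_⟩
    · exact (congrArg (c • ·) (hf n hn)).trans (smul_zero c)
    · rw [LinearMap.map_smul_of_tower, hgf]
    · exact (congrArg (c • ·) (ha i j n hn)).trans (smul_zero c)
    · rw [LinearMap.map_smul_of_tower, hga]
    · rw [scalarMat_smul, smul_add, smul_comm c hbar a]

/-- The space of `j`-cochains: alternating `j`-forms on the Lie algebra with values in the
`ℂ((ħ))`-linear maps from periodic cyclic chains to forms. -/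
abbrev Cochain (j : ℕ) : Type :=
  AlternatingMap ℂ D.lieAlg (Per (CycChain k l r) →ₗ[K] Per (Ω k)) (Fin j)

/-- The value of the Chevalley–Eilenberg differential of a cochain `φ` on `(x_0, …, x_{j - 1})` and
on (the class of) a chain `O`:
`∑_i (-1) ^ i (x_i • φ (x without x_i)) (O)
+ ∑_{i < p} (-1) ^ {i + p} φ ([x_i, x_p], x without x_i and x_p) (O)`,
where `(x • ψ) (O) = - ψ ([x, O])`: the Lie algebra acts by derivations on chains and trivially on
forms. -/
def dLie (br : D.lieAlg → D.lieAlg → D.lieAlg) (Φ : ∀ j, D.Cochain j) :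
    ∀ {j : ℕ}, (Fin j → D.lieAlg) → Per (Chain k l r) → Per (Ω k)
  | 0, _, _ => 0
  | 1, x, O => -Φ 0 ![] (ext (toCyc k l r) (ext (adChain (x 0 : A k l r)) O))
  | j + 2, x, O =>
    (∑ i : Fin (j + 2), (-1 : ℤ) ^ i.val •
      -Φ (j + 1) (fun q => x (i.succAbove q))
        (ext (toCyc k l r) (ext (adChain (x i : A k l r)) O))) +
    ∑ p : Fin (j + 2), ∑ i : Fin (j + 1), if i.castSucc < p then
      (-1 : ℤ) ^ (i.val + p.val) •
        Φ (j + 1) (Fin.cons (br (x i.castSucc) (x p)) fun q => x (p.succAbove (i.succAbove q)))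
          (ext (toCyc k l r) O)
      else 0

end Sector

end TwistedTQM

end

/-! ### Linear maps of power series with finite dependence, linear substitutions, second order
operators -/

noncomputable section
namespace TwistedTQM

/-! The free correlation map places functions at points of a circle that is cut at the position of
`a_0`, and its properties follow from one normal form of the propagators. On the `z` coordinates `(1
- g)⁻¹ = g (1 - g)⁻¹ + 1`, so all lines and self loops together form a single quadratic operator:
its block between points `α` and `β`, equal or not, is `(θ α - θ β) ω_Y + s ω + L`, where `ω_Y` is
the `y` part of the Poisson matrix `ω`, `s` is `1/2`, `-1/2` or `0` according to the order of the
points, and the self loop `L` is a fixed symmetric matrix (`lines_add_loops`, `propLoop_transpose`).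

Three properties of these blocks do the work. Neighbouring points at one position have the same
lines to all other points and the Moyal kernel between them, so a collision is a star product
(`corr_merge`). Applying `g` to the last points amounts to moving them to the front with positions
lowered by one (`corr_wrap`). Positions enter only through `ω_Y`, linearly, so a derivative in a
position is `ħ` times a divergence in `y` (`hasDerivAt_corr`).

The terms of `b_g` are the collisions of cyclic neighbours, hence the facets of the simplex; by the
Leibniz rule an interior collision is a sum of two boundary terms, and the Stokes formula turns the
alternating sum into `ħ Δ` (`formInt_hoch`). In `B_g` the unit at the base point can be dropped, and
the rotations of the circle combine the cyclic summands into one integral over a simplex of one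
dimension less, with every function differentiated; this is `d` of the correlation form, because
repeated derivatives at one point cancel against the antisymmetry of the `dy` (`formInt_connes`). On
matrices `f E`, which span the algebra, the correlation map is a function part times a twisted trace
of the `E`, and the trace is unchanged by all these moves (`freeMulti_elem`). This gives the free
statement in `freeChain_hoch` and `freeChain_connes`.

The interactive statement is then pure algebra. Let `i_x` be the signed insertion of `x / ħ` in all
slots after the first and `L_x` the derivation `[x, -]`. There is a Cartan calculus: `b i_x + i_x b
= L_x` and `B i_x + i_x B = 0` for `g`-invariant `x`, `L_x i_y - i_y L_x = i_[x,y]`, and `i_x i_y =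
- i_y i_x` (`hoch_insChain`, `connes_insChain`, `adChain_insChain`, `insChain_anticomm`). The
insertions therefore generate an action of the exterior algebra, whose value on `j` elements is the
signed sum over shuffles (`insAlt_lof`), and closedness follows by induction on `j` (`hoch_insAlt`,
`connes_insAlt`). Units in later slots are killed by differentiation, so the maps descend to the
normalized chains. Equivariance expresses the invariance of `ω_Y`, `ω` and `L` under the centralizer
of `g`. -/

open MvPowerSeries in
/-- Each coefficient of `φ f` depends on finitely many coefficients of `f`. -/
def FinDep {ι κ : Type} (φ : PS ι →ₗ[ℂ] PS κ) : Prop :=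
  ∀ d : κ →₀ ℕ, ∃ s : Finset (ι →₀ ℕ), ∀ f, (∀ e ∈ s, coeff e f = 0) → coeff d (φ f) = 0

section FinDep

open MvPowerSeries

variable {ι κ μ : Type}

/-- The series differs from its truncation to `s` by a series that `φ` does not see in degree `d`.
Each output coefficient is thus a fixed finite linear combination of input coefficients, which lets
`φ` pass through limits, derivatives and integrals. -/
theorem FinDep.coeff_eq {φ : PS ι →ₗ[ℂ] PS κ} (h : FinDep φ) (d : κ →₀ ℕ) :
    ∃ s : Finset (ι →₀ ℕ), ∀ f,
      coeff d (φ f) = ∑ e ∈ s, coeff e f * coeff d (φ (monomial e 1)) := by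
  classical
  obtain ⟨s, hs⟩ := h d
  refine ⟨s, fun f => ?_⟩
  have h1 := hs (f - ∑ e ∈ s, coeff e f • monomial e 1) (fun e he => by
    simp [map_sum, coeff_monomial, he])
  rw [map_sub, map_sub, sub_eq_zero] at h1
  rw [h1]
  simp only [map_sum, map_smul, smul_eq_mul]

theorem FinDep.ext {φ ψ : PS ι →ₗ[ℂ] PS κ} (hφ : FinDep φ) (hψ : FinDep ψ)
    (h : ∀ e, φ (monomial e 1) = ψ (monomial e 1)) : φ = ψ := by
  classical
  refine LinearMap.ext fun f => MvPowerSeries.ext fun d => ?_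
  obtain ⟨s, hs⟩ := hφ d
  obtain ⟨s', hs'⟩ := hψ d
  have key : ∀ e ∈ s ∪ s', coeff e (f - ∑ e ∈ s ∪ s', coeff e f • monomial e 1) = 0 := by
    intro e he
    rw [Finset.mem_union] at he
    simp [map_sum, coeff_monomial, he]
  have h1 := hs _ fun e he => key e (Finset.mem_union_left _ he)
  have h2 := hs' _ fun e he => key e (Finset.mem_union_right _ he)
  rw [map_sub, map_sub, sub_eq_zero] at h1 h2
  rw [h1, h2]
  simp only [map_sum, map_smul, h]

theorem FinDep.comp {ψ : PS κ →ₗ[ℂ] PS μ} {φ : PS ι →ₗ[ℂ] PS κ} (hψ : FinDep ψ) (hφ : FinDep φ) :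
    FinDep (ψ ∘ₗ φ) := by
  classical
  intro d
  obtain ⟨s, hs⟩ := hψ d
  choose t ht using hφ
  refine ⟨s.biUnion t, fun f hf => hs _ fun e he => ht e f fun e' he' => hf e' ?_⟩
  exact Finset.mem_biUnion.2 ⟨e, he, he'⟩

theorem FinDep.add {φ ψ : PS ι →ₗ[ℂ] PS κ} (hφ : FinDep φ) (hψ : FinDep ψ) : FinDep (φ + ψ) := by
  classical
  intro d
  obtain ⟨s, hs⟩ := hφ d
  obtain ⟨s', hs'⟩ := hψ d
  refine ⟨s ∪ s', fun f hf => ?_⟩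
  rw [LinearMap.add_apply, map_add, hs f fun e he => hf e (Finset.mem_union_left _ he),
    hs' f fun e he => hf e (Finset.mem_union_right _ he), add_zero]

theorem FinDep.smul {φ : PS ι →ₗ[ℂ] PS κ} (hφ : FinDep φ) (c : ℂ) : FinDep (c • φ) := by
  intro d
  obtain ⟨s, hs⟩ := hφ d
  refine ⟨s, fun f hf => ?_⟩
  rw [LinearMap.smul_apply, map_smul, hs f hf, smul_zero]

theorem FinDep.zero : FinDep (0 : PS ι →ₗ[ℂ] PS κ) := fun _ => ⟨∅, fun _ _ => by simp⟩

theorem FinDep.sum {β : Type*} (t : Finset β) {φ : β → PS ι →ₗ[ℂ] PS κ}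
    (h : ∀ b ∈ t, FinDep (φ b)) : FinDep (∑ b ∈ t, φ b) :=
  Finset.sum_induction _ _ (fun _ _ => FinDep.add) FinDep.zero h

theorem finDep_pd (i : ι) : FinDep (pd i) := by
  intro d
  refine ⟨{d + Finsupp.single i 1}, fun f hf => ?_⟩
  have := hf _ (Finset.mem_singleton_self _)
  change coeff d (pderiv ℂ i f) = 0
  rw [coeff_pderiv, this, zero_mul]

theorem coeff_pd (i : ι) (d : ι →₀ ℕ) (f : PS ι) :
    coeff d (pd i f) = coeff (d + Finsupp.single i 1) f * (d i + 1) := coeff_pderiv ..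

/-- Renaming preserves the total degree, so over finitely many variables only finitely many
exponents map to `d`. -/
theorem finDep_rename [Finite ι] (e : ι → κ) :
    FinDep (rename e : PS ι →ₐ[ℂ] PS κ).toLinearMap := by
  intro d
  refine ⟨(Filter.TendstoCofinite.finite_preimage_singleton (Finsupp.mapDomain e) d).toFinset,
    fun f hf => ?_⟩
  change coeff d (rename e f) = 0
  rw [coeff_rename]
  exact Finset.sum_eq_zero hf

theorem finDep_killCompl (e : ι ↪ κ) :
    FinDep (killCompl e : PS κ →ₐ[ℂ] PS ι).toLinearMap := by
  intro d
  refine ⟨{Finsupp.embDomain e d}, fun f hf => ?_⟩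
  change coeff d (killCompl e f) = 0
  rw [coeff_killCompl]
  exact hf _ (Finset.mem_singleton_self _)

theorem finDep_substAlgHom {a : ι → PS κ} (ha : HasSubst a) :
    FinDep (substAlgHom (R := ℂ) ha).toLinearMap := by
  intro d
  -- The series with all coefficients `1` detects every exponent whose monomial contributes in
  -- degree `d`.
  have h := coeff_subst_finite (R := ℂ) ha (fun _ => (1 : ℂ) : PS ι) d
  refine ⟨h.toFinset, fun f hf => ?_⟩
  change coeff d (substAlgHom ha f) = 0
  rw [substAlgHom_apply, coeff_subst ha]
  refine finsum_eq_zero_of_forall_eq_zero fun e => ?_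
  by_cases he : e ∈ h.toFinset
  · rw [hf e he, zero_smul]
  · have : ¬ coeff e (fun _ => (1 : ℂ) : PS ι) • coeff d (e.prod fun s e => a s ^ e) ≠ 0 := by
      simpa using! he
    have h1 : coeff e (fun _ => (1 : ℂ) : PS ι) = 1 := rfl
    rw [h1, one_smul, not_not] at this
    rw [this, smul_zero]

/-- `φ` is the substitution of the linear forms `∑ M x y X y` for the variables `X x`. -/
structure LinSub [Fintype κ] (φ : PS ι →ₐ[ℂ] PS κ) (M : Matrix ι κ ℂ) : Prop where
  finDep : FinDep φ.toLinearMap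
  map_X : ∀ x, φ (X x) = ∑ y, M x y • X y

/-- The variables determine both maps on polynomials, in particular on monomials, and finite
dependence passes from monomials to all series. Identities between substitutions thereby become
identities between matrices. -/
theorem algHom_ext_of_finDep {φ ψ : PS ι →ₐ[ℂ] PS κ} (hφ : FinDep φ.toLinearMap)
    (hψ : FinDep ψ.toLinearMap) (h : ∀ x, φ (X x) = ψ (X x)) : φ = ψ := by
  have h1 : φ.comp (MvPolynomial.coeToMvPowerSeries.algHom ℂ)
      = ψ.comp (MvPolynomial.coeToMvPowerSeries.algHom ℂ) :=
    MvPolynomial.algHom_ext fun x => by simpa using! h x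
  apply AlgHom.toLinearMap_injective
  refine hφ.ext hψ fun e => ?_
  simpa using! DFunLike.congr_fun h1 (MvPolynomial.monomial e 1)

theorem LinSub.unique [Fintype κ] {φ ψ : PS ι →ₐ[ℂ] PS κ} {M : Matrix ι κ ℂ} (hφ : LinSub φ M)
    (hψ : LinSub ψ M) : φ = ψ :=
  algHom_ext_of_finDep hφ.finDep hψ.finDep fun x => by rw [hφ.map_X, hψ.map_X]

theorem LinSub.comp [Fintype κ] [Fintype μ] {ψ : PS κ →ₐ[ℂ] PS μ} {φ : PS ι →ₐ[ℂ] PS κ}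
    {M : Matrix ι κ ℂ} {N : Matrix κ μ ℂ} (hψ : LinSub ψ N) (hφ : LinSub φ M) :
    LinSub (ψ.comp φ) (M * N) where
  finDep := hψ.finDep.comp hφ.finDep
  map_X x := by
    simp only [AlgHom.comp_apply, hφ.map_X, map_sum, map_smul, hψ.map_X, Finset.smul_sum,
      Matrix.mul_apply, Finset.sum_smul, smul_smul]
    rw [Finset.sum_comm]

theorem linSub_rename [Finite ι] [Fintype κ] [DecidableEq κ] (e : ι → κ) :
    LinSub (rename e : PS ι →ₐ[ℂ] PS κ) (Matrix.of fun x y => if e x = y then 1 else 0) where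
  finDep := finDep_rename e
  map_X x := by simp [rename_X]

theorem linSub_pull [Fintype ι] (M : Matrix ι ι ℝ) : LinSub (pull M) (M.map Complex.ofReal) where
  finDep := finDep_substAlgHom _
  map_X x := by
    unfold pull
    rw [substAlgHom_X]
    simp [MvPowerSeries.smul_eq_C_mul]

theorem linSub_killCompl [Fintype ι] [DecidableEq ι] [DecidableEq κ] (e : ι ↪ κ) :
    LinSub (killCompl e : PS κ →ₐ[ℂ] PS ι) (Matrix.of fun x y => if x = e y then 1 else 0) where
  finDep := finDep_killCompl e
  map_X x := by
    by_cases hx : x ∈ Set.range e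
    · obtain ⟨y, rfl⟩ := hx
      simp
    · rw [killCompl_X_eq_zero hx, Finset.sum_eq_zero]
      intro y _
      have : x ≠ e y := fun h => hx ⟨y, h.symm⟩
      simp [this]

theorem linSub_id [Fintype ι] [DecidableEq ι] : LinSub (AlgHom.id ℂ (PS ι)) 1 where
  finDep d := ⟨{d}, fun f hf => hf d (Finset.mem_singleton_self d)⟩
  map_X x := by simp [Matrix.one_apply]

theorem pd_X [DecidableEq ι] (x y : ι) : pd y (X x : PS ι) = if x = y then 1 else 0 := by
  have h := MvPowerSeries.pderiv_coe (R := ℂ) (i := y) (MvPolynomial.X x : MvPolynomial ι ℂ)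
  rw [MvPolynomial.coe_X] at h
  change pderiv ℂ y (X x) = _
  rw [h, MvPolynomial.pderiv_X]
  by_cases hxy : x = y
  · subst hxy; simp
  · simp [hxy]

theorem pd_mul (i : ι) (f g : PS ι) : pd i (f * g) = f * pd i g + g * pd i f :=
  Derivation.leibniz (pderiv ℂ i) f g

theorem pd_comm (i j : ι) : Commute (pd i) (pd j) := by
  refine LinearMap.ext fun f => MvPowerSeries.ext fun d => ?_
  change coeff d (pd i (pd j f)) = coeff d (pd j (pd i f))
  simp only [coeff_pd, Finsupp.add_apply]
  rw [add_right_comm]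
  by_cases h : i = j
  · subst h; rfl
  · have h' : j ≠ i := fun e => h e.symm
    simp [h, h']
    ring

/-- The chain rule. -/
theorem LinSub.pd_comp [Fintype ι] [Fintype κ] {φ : PS ι →ₐ[ℂ] PS κ} {M : Matrix ι κ ℂ}
    (hφ : LinSub φ M) (y : κ) :
    pd y ∘ₗ φ.toLinearMap = φ.toLinearMap ∘ₗ ∑ x, M x y • pd x := by
  classical
  have hR : FinDep (∑ x, M x y • pd (σ := ι) x) :=
    FinDep.sum _ fun x _ => (finDep_pd x).smul _
  refine ((finDep_pd y).comp hφ.finDep).ext (hφ.finDep.comp hR) fun e => ?_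
  -- Both sides have finite dependence, so polynomials suffice, and there the product rule allows an
  -- induction.
  have key : ∀ p : MvPolynomial ι ℂ, pd y (φ (p : PS ι)) = φ (∑ x, M x y • pd x (p : PS ι)) := by
    intro p
    induction p using MvPolynomial.induction_on with
    | C a =>
      have h1 : ∀ {τ : Type} (x : τ), pd x (C a : PS τ) = 0 := fun x =>
        (pderiv ℂ x).map_algebraMap a
      have h2 : φ (C a) = C a := φ.commutes a
      simp [h1, h2]
    | add p q hp hq => simp [hp, hq, Finset.sum_add_distrib]
    | mul_X p x hp =>
      simp only [MvPolynomial.coe_mul, MvPolynomial.coe_X, map_mul, pd_mul, hp, hφ.map_X, map_sum,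
        map_smul, pd_X, Finset.sum_add_distrib, smul_add, map_add, mul_ite, mul_one,
        mul_zero, smul_ite, smul_zero, apply_ite φ, map_zero, Finset.mul_sum, Finset.sum_mul,
        mul_smul_comm, smul_mul_assoc, Finset.smul_sum]
      simp only [Finset.sum_ite_eq', Finset.sum_ite_eq, Finset.mem_univ, if_true]
      congr 1
      rw [Finset.sum_comm]
      refine Finset.sum_congr rfl fun i _ => Finset.sum_congr rfl fun j _ => ?_
      rw [smul_comm]
  have := key (MvPolynomial.monomial e 1)
  simpa using! this

/-- The second order operator `1 / 2 ∑ Q x y ∂_x ∂_y`. -/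
def bi [Fintype ι] (Q : Matrix ι ι ℂ) : Module.End ℂ (PS ι) :=
  (1 / 2 : ℂ) • ∑ x, ∑ y, Q x y • (pd x * pd y)

theorem sum_rotate₄ {α β γ δ R : Type*} [Fintype α] [Fintype β] [Fintype γ] [Fintype δ]
    [AddCommMonoid R] (F : α → β → γ → δ → R) :
    ∑ i, ∑ j, ∑ y, ∑ x, F i j y x = ∑ x, ∑ y, ∑ i, ∑ j, F i j y x := by
  have h1 : ∀ i, ∑ j, ∑ y, ∑ x, F i j y x = ∑ x, ∑ y, ∑ j, F i j y x := fun i => by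
    rw [Finset.sum_comm, Finset.sum_congr rfl fun y _ => Finset.sum_comm, Finset.sum_comm]
  rw [Finset.sum_congr rfl fun i _ => h1 i, Finset.sum_comm,
    Finset.sum_congr rfl fun x _ => Finset.sum_comm]

/-- The chain rule used twice: the quadratic form of the operator is transported by congruence. -/
theorem LinSub.bi_comp [Fintype ι] [Fintype κ] {φ : PS ι →ₐ[ℂ] PS κ} {M : Matrix ι κ ℂ}
    (hφ : LinSub φ M) (Q : Matrix κ κ ℂ) :
    bi Q ∘ₗ φ.toLinearMap = φ.toLinearMap ∘ₗ bi (M * Q * M.transpose) := by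
  have h : ∀ y f, pd y (φ f) = φ ((∑ x, M x y • pd x) f) := fun y f =>
    LinearMap.congr_fun (hφ.pd_comp y) f
  refine LinearMap.ext fun f => ?_
  change bi Q (φ f) = φ (bi (M * Q * M.transpose) f)
  simp only [bi, LinearMap.smul_apply, LinearMap.sum_apply, Module.End.mul_apply, h, map_smul,
    Matrix.mul_apply, Matrix.transpose_apply, Finset.sum_mul, Finset.sum_smul, map_sum,
    Finset.smul_sum, smul_smul]
  rw [sum_rotate₄]
  refine Finset.sum_congr rfl fun x _ => Finset.sum_congr rfl fun y _ =>
    Finset.sum_comm.trans (Finset.sum_congr rfl fun i _ => Finset.sum_congr rfl fun j _ => ?_)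
  congr 1
  ring

/-- Partial derivatives commute, so only the symmetric part of the matrix matters. This is what
allows a line to be recorded in one or in both directions. -/
theorem bi_congr [Fintype ι] {Q Q' : Matrix ι ι ℂ}
    (h : ∀ x y, Q x y + Q y x = Q' x y + Q' y x) : bi Q = bi Q' := by
  have key : ∀ R : Matrix ι ι ℂ, bi R = (1 / 4 : ℂ) • ∑ x, ∑ y, (R x y + R y x) • (pd x * pd y) := by
    intro R
    have h1 : ∑ x, ∑ y, R y x • (pd x * pd y : Module.End ℂ (PS ι))
        = ∑ x, ∑ y, R x y • (pd x * pd y) := by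
      rw [Finset.sum_comm]
      refine Finset.sum_congr rfl fun x _ => Finset.sum_congr rfl fun y _ => ?_
      rw [(pd_comm x y).eq]
    simp only [add_smul, Finset.sum_add_distrib, h1, bi]
    module
  rw [key Q, key Q']
  simp only [h]

theorem bi_add [Fintype ι] (Q Q' : Matrix ι ι ℂ) : bi (Q + Q') = bi Q + bi Q' := by
  simp only [bi, Matrix.add_apply, add_smul, Finset.sum_add_distrib, smul_add]

theorem bi_comm_pd [Fintype ι] (Q : Matrix ι ι ℂ) (z : ι) : Commute (bi Q) (pd z) := by
  unfold bi
  refine Commute.smul_left (Commute.sum_left _ _ _ fun x _ => Commute.sum_left _ _ _ fun y _ =>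
    Commute.smul_left (Commute.mul_left (pd_comm _ _) (pd_comm _ _)) _) _

theorem bi_comm [Fintype ι] (Q Q' : Matrix ι ι ℂ) : Commute (bi Q) (bi Q') := by
  rw [bi.eq_def (Q := Q')]
  exact Commute.smul_right (Commute.sum_right _ _ _ fun x _ => Commute.sum_right _ _ _ fun y _ =>
    Commute.smul_right (Commute.mul_right (bi_comm_pd Q _) (bi_comm_pd Q _)) _) _

end FinDep
end TwistedTQM
end

/-! ### Coefficients and exponentials of operators on Laurent series -/

noncomputable section
namespace TwistedTQM

section LaurentOperators

variable {S S' S'' : Type*} [AddCommGroup S] [Module ℂ S] [AddCommGroup S'] [Module ℂ S']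
  [AddCommGroup S''] [Module ℂ S'']

/-- The coefficient of `ħ ^ n`. -/
def lcoeff (n : ℤ) : Lau S →ₗ[ℂ] S where
  toFun f := (toS f).coeff n
  map_add' _ _ := rfl
  map_smul' _ _ := rfl

theorem lcoeff_ofS (n : ℤ) (x : HahnSeries ℤ S) : lcoeff n (ofS x) = x.coeff n := rfl

theorem Lau.ext {f f' : Lau S} (h : ∀ n, lcoeff n f = lcoeff n f') : f = f' :=
  toS_injective (HahnSeries.ext (funext h))

@[simp] theorem lcoeff_mapC (φ : S →ₗ[ℂ] S') (f : Lau S) (n : ℤ) :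
    lcoeff n (mapC φ f) = φ (lcoeff n f) := rfl

theorem exists_lcoeff_eq_zero (f : Lau S) : ∃ N : ℤ, ∀ n < N, lcoeff n f = 0 :=
  Sector.exists_lower_bound f

/-- `A` and `N` bound the two supports from below. The sum over an antidiagonal depending on the
supports becomes a sum over a range that is the same for a whole family of series with common
bounds. -/
theorem coeff_smul_eq_sum_range {R V : Type*} [Ring R] [AddCommGroup V] [Module R V]
    (x : HahnSeries ℤ R) (y : HahnSeries ℤ V) (A N n : ℤ) (M : ℕ)
    (hx : ∀ n < A, x.coeff n = 0) (hy : ∀ n < N, y.coeff n = 0) (h : n < A + N + M) :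
    ((HahnModule.of R).symm (x • HahnModule.of R y)).coeff n
      = ∑ p ∈ Finset.range M, x.coeff (A + p) • y.coeff (n - A - p) := by
  rw [HahnModule.coeff_smul]
  refine Finset.sum_bij_ne_zero (fun ij _ _ => (ij.1 - A).toNat) ?_ ?_ ?_ ?_
  · intro ij hij hne
    have h1 : A ≤ ij.1 := by
      by_contra hlt
      exact hne (by rw [hx _ (by omega), zero_smul])
    have h2 : N ≤ ij.2 := by
      by_contra hlt
      apply hne
      have : ((HahnModule.of R).symm ((HahnModule.of R) y)).coeff ij.2 = 0 := hy _ (by omega)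
      rw [this, smul_zero]
    have h3 : ij.1 + ij.2 = n := (Finset.mem_vaddAntidiagonal _ _).1 hij |>.2.2
    rw [Finset.mem_range]
    omega
  · rintro ⟨i, j⟩ hij hne ⟨i', j'⟩ hij' hne' heq
    have h1 : A ≤ i := by
      by_contra hlt
      exact hne (by rw [hx _ (by simpa using hlt), zero_smul])
    have h1' : A ≤ i' := by
      by_contra hlt
      exact hne' (by rw [hx _ (by simpa using hlt), zero_smul])
    have h3 : i + j = n := (Finset.mem_vaddAntidiagonal _ _).1 hij |>.2.2
    have h3' : i' + j' = n := (Finset.mem_vaddAntidiagonal _ _).1 hij' |>.2.2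
    simp only at heq
    have : i = i' := by omega
    subst this
    have : j = j' := by omega
    rw [this]
  · intro p hp hne
    refine ⟨(A + p, n - A - p), ?_, hne, by simp⟩
    rw [Finset.mem_vaddAntidiagonal]
    refine ⟨?_, ?_, ?_⟩
    · intro h0
      exact hne (by rw [h0, zero_smul])
    · intro h0
      have h0' : y.coeff (n - A - p) = 0 := h0
      exact hne (by rw [h0', smul_zero])
    · change A + p + (n - A - p) = n
      omega
  · rintro ⟨i, j⟩ hij hne
    have h1 : A ≤ i := by
      by_contra hlt
      exact hne (by rw [hx _ (by simpa using hlt), zero_smul])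
    have h3 : i + j = n := (Finset.mem_vaddAntidiagonal _ _).1 hij |>.2.2
    have e1 : A + ((i - A).toNat : ℤ) = i := by omega
    have e2 : n - A - ((i - A).toNat : ℤ) = j := by omega
    simp only [e1, e2]
    rfl

theorem expSeries_coeff_nat (D : Module.End ℂ S) (p : ℕ) :
    (expSeries D).coeff (p : ℤ) = ((p.factorial : ℂ)⁻¹) • D ^ p := by
  unfold expSeries
  rw [HahnSeries.ofPowerSeries_apply_coeff, PowerSeries.coeff_mk]

theorem expSeries_coeff_neg (D : Module.End ℂ S) (n : ℤ) (hn : n < 0) :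
    (expSeries D).coeff n = 0 := by
  unfold expSeries
  rw [HahnSeries.ofPowerSeries_apply]
  apply HahnSeries.embDomain_of_notMem_range
  rintro ⟨p, hp⟩
  have : (p : ℤ) = n := hp
  omega

theorem lcoeff_hexp (D : Module.End ℂ S) (f : Lau S) {N n : ℤ} {M : ℕ}
    (hf : ∀ n < N, lcoeff n f = 0) (h : n < N + M) :
    lcoeff n (hexp D f)
      = ∑ p ∈ Finset.range M, ((p.factorial : ℂ)⁻¹) • (D ^ p) (lcoeff (n - p) f) := by
  have h1 := coeff_smul_eq_sum_range (expSeries D) (toS f) 0 N n M (expSeries_coeff_neg D) hf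
    (by omega)
  refine Eq.trans h1 (Finset.sum_congr rfl fun p _ => ?_)
  rw [zero_add, sub_zero, expSeries_coeff_nat]
  rfl

theorem hexp_comp_eq_of_mul {D D' E : Module.End ℂ S}
    (h : expSeries D * expSeries D' = expSeries E) (f : Lau S) :
    hexp D (hexp D' f) = hexp E f := by
  apply toS_injective
  change (HahnModule.of (Module.End ℂ S)).symm (expSeries D • HahnModule.of (Module.End ℂ S)
    ((HahnModule.of (Module.End ℂ S)).symm (expSeries D' • HahnModule.of (Module.End ℂ S) (toS f))))
    = (HahnModule.of (Module.End ℂ S)).symm (expSeries E • HahnModule.of (Module.End ℂ S) (toS f))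
  rw [Equiv.apply_symm_apply, ← series_mul_smul, h]

/-- The binomial theorem for commuting operators, applied to the series with operator coefficients.
-/
theorem hexp_add {D D' : Module.End ℂ S} (h : Commute D D') (f : Lau S) :
    hexp D (hexp D' f) = hexp (D + D') f := by
  refine hexp_comp_eq_of_mul ?_ f
  unfold expSeries
  rw [← map_mul]
  congr 1
  ext1 n
  rw [PowerSeries.coeff_mul, PowerSeries.coeff_mk, h.add_pow', Finset.smul_sum]
  refine Finset.sum_congr rfl fun ij hij => ?_
  have hij : ij.1 + ij.2 = n := Finset.HasAntidiagonal.mem_antidiagonal.1 hij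
  rw [PowerSeries.coeff_mk, PowerSeries.coeff_mk, smul_mul_smul_comm, ← hij,
    ← Nat.cast_smul_eq_nsmul ℂ, smul_smul]
  congr 1
  have h1 := Nat.add_choose_mul_factorial_mul_factorial ij.1 ij.2
  rw [← Nat.choose_symm_add] at h1
  have h2 : ((ij.1 + ij.2).choose ij.1 : ℂ) * ij.1.factorial * ij.2.factorial
      = (ij.1 + ij.2).factorial := by exact_mod_cast h1
  have a := Nat.factorial_ne_zero ij.1
  have b := Nat.factorial_ne_zero ij.2
  have c := Nat.factorial_ne_zero (ij.1 + ij.2)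
  field_simp
  rw [← h2]
  ring

/-- An intertwiner of `D` and `D'` intertwines all their powers, and each coefficient of the
exponential is a finite sum of such powers. All changes of points and of coordinates below pass
through exponentials in this way. -/
theorem mapC_hexp {D : Module.End ℂ S} {D' : Module.End ℂ S'} {φ : S →ₗ[ℂ] S'}
    (h : φ ∘ₗ D = D' ∘ₗ φ) (f : Lau S) : mapC φ (hexp D f) = hexp D' (mapC φ f) := by
  obtain ⟨N, hN⟩ := exists_lcoeff_eq_zero f
  refine Lau.ext fun n => ?_
  have hn : n < N + (n - N + 1).toNat := by omega
  rw [lcoeff_mapC, lcoeff_hexp D f hN hn,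
    lcoeff_hexp D' (mapC φ f) (fun n hn => by rw [lcoeff_mapC, hN n hn, map_zero]) hn, map_sum]
  refine Finset.sum_congr rfl fun p _ => ?_
  rw [map_smul, lcoeff_mapC]
  congr 1
  generalize lcoeff (n - p) f = s
  clear * - h
  induction p generalizing s with
  | zero => rfl
  | succ p ih =>
    rw [pow_succ, pow_succ, Module.End.mul_apply, Module.End.mul_apply, ih]
    exact congrArg _ (LinearMap.congr_fun h s)

theorem mapC_comp (ψ : S' →ₗ[ℂ] S'') (φ : S →ₗ[ℂ] S') (f : Lau S) :
    mapC ψ (mapC φ f) = mapC (ψ ∘ₗ φ) f := rfl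

theorem mapC_add (φ ψ : S →ₗ[ℂ] S') (f : Lau S) : mapC (φ + ψ) f = mapC φ f + mapC ψ f := rfl

theorem mapC_smul (c : ℂ) (φ : S →ₗ[ℂ] S') (f : Lau S) : mapC (c • φ) f = c • mapC φ f := rfl

theorem mapC_sum {β : Type*} (t : Finset β) (φ : β → S →ₗ[ℂ] S') (f : Lau S) :
    mapC (∑ b ∈ t, φ b) f = ∑ b ∈ t, mapC (φ b) f := by
  refine Lau.ext fun n => ?_
  rw [map_sum, lcoeff_mapC, LinearMap.sum_apply]
  rfl

theorem single_smul (a : ℤ) (c : ℂ) (f : Lau S) (n : ℤ) :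
    lcoeff n ((HahnSeries.single a c : K) • f) = c • lcoeff (n - a) f := by
  obtain ⟨N, hN⟩ := exists_lcoeff_eq_zero f
  have h := coeff_smul_eq_sum_range (HahnSeries.single a c : K) (toS f) a N n
    ((n - N - a + 1).toNat + 1) (fun n hn => HahnSeries.coeff_single_of_ne (by omega)) hN
    (by omega)
  refine Eq.trans h ?_
  rw [Finset.sum_range_succ', Finset.sum_eq_zero]
  · simp only [Nat.cast_zero, add_zero, sub_zero, zero_add, HahnSeries.coeff_single_same]
    rfl
  · intro p _
    rw [HahnSeries.coeff_single_of_ne (by push_cast; omega), zero_smul]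

theorem lcoeff_hbar_smul (f : Lau S) (n : ℤ) : lcoeff n (hbar • f) = lcoeff (n - 1) f := by
  unfold hbar
  rw [single_smul, one_smul]

theorem lcoeff_hbarInv_smul (f : Lau S) (n : ℤ) : lcoeff n (hbarInv • f) = lcoeff (n + 1) f := by
  unfold hbarInv
  rw [single_smul, one_smul, sub_neg_eq_add]

theorem C_smul (c : ℂ) (f : Lau S) : (HahnSeries.C c : K) • f = c • f := by
  refine Lau.ext fun n => ?_
  rw [(lcoeff n).map_smul c f]
  exact (single_smul 0 c f n).trans (by rw [sub_zero])

theorem hbar_mul_hbarInv : hbar * hbarInv = 1 := by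
  unfold hbar hbarInv
  rw [HahnSeries.single_mul_single]
  simp

end LaurentOperators

section LaurentProducts

variable {S S' : Type*} [CommRing S] [Algebra ℂ S] [CommRing S'] [Algebra ℂ S']

theorem toS_K_smul (c : K) (f : Lau S) : toS (c • f) = toAlg S c * toS f := by
  have h := toAlg_smul (R := S) c (toS f)
  rwa [ofS_toS, HahnSeries.of_symm_smul_of_eq_mul] at h

theorem toS_mapC_mul (φ : S →ₐ[ℂ] S') (x y : HahnSeries ℤ S) :
    toS (mapC φ.toLinearMap (ofS (x * y)))
      = toS (mapC φ.toLinearMap (ofS x)) * toS (mapC φ.toLinearMap (ofS y)) :=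
  HahnSeries.map_mul (φ.toRingHom : S →ₙ+* S')

theorem toS_mapC_one (φ : S →ₐ[ℂ] S') : toS (mapC φ.toLinearMap (ofS 1)) = 1 := by
  refine HahnSeries.ext (funext fun n => ?_)
  change φ ((1 : HahnSeries ℤ S).coeff n) = _
  rw [HahnSeries.coeff_one, HahnSeries.coeff_one]
  split_ifs <;> simp

theorem toS_mapC_prod (φ : S →ₐ[ℂ] S') {β : Type*} (t : Finset β) (x : β → HahnSeries ℤ S) :
    toS (mapC φ.toLinearMap (ofS (∏ b ∈ t, x b)))
      = ∏ b ∈ t, toS (mapC φ.toLinearMap (ofS (x b))) := by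
  classical
  induction t using Finset.induction_on with
  | empty => simpa using toS_mapC_one φ
  | insert a t ha ih => rw [Finset.prod_insert ha, Finset.prod_insert ha, toS_mapC_mul, ih]

/-- The series of the operators of multiplication by the coefficients of `h`. -/
def mulSeries (h : HahnSeries ℤ S) : HahnSeries ℤ (Module.End ℂ S) :=
  HahnSeries.map h (Algebra.lmul ℂ S)

/-- Multiplication by `h` is thereby the action of a series of operators, like `hexp D`, so that
both can be commuted inside one ring. -/
theorem mulSeries_smul (h : HahnSeries ℤ S) (x : HahnSeries ℤ S) :
    (HahnModule.of _).symm (mulSeries h • HahnModule.of (Module.End ℂ S) x) = h * x := by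
  ext n
  have hs : (mulSeries h).support ⊆ h.support := by
    intro a ha h0
    apply ha
    simp [mulSeries, h0]
  rw [HahnModule.coeff_smul_left h.isPWO_support hs, HahnSeries.coeff_mul]
  rfl

theorem hahnSeries_mul_comm_of_coeff {R : Type*} [Ring R] (x y : HahnSeries ℤ R)
    (hxy : ∀ a b, Commute (x.coeff a) (y.coeff b)) : x * y = y * x := by
  ext n
  rw [HahnSeries.coeff_mul, HahnSeries.coeff_mul]
  refine Finset.sum_nbij' (fun p => (p.2, p.1)) (fun p => (p.2, p.1)) ?_ ?_ ?_ ?_ ?_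
  · intro p hp
    simp only [Finset.mem_antidiagonal] at hp ⊢
    exact ⟨hp.2.1, hp.1, by rw [add_comm]; exact hp.2.2⟩
  · intro p hp
    simp only [Finset.mem_antidiagonal] at hp ⊢
    exact ⟨hp.2.1, hp.1, by rw [add_comm]; exact hp.2.2⟩
  · intros; rfl
  · intros; rfl
  · intro p _
    exact hxy _ _

theorem commute_expSeries_mulSeries {D : Module.End ℂ S} {h : HahnSeries ℤ S}
    (hD : ∀ n s, D (h.coeff n * s) = h.coeff n * D s) :
    expSeries D * mulSeries h = mulSeries h * expSeries D := by
  refine hahnSeries_mul_comm_of_coeff _ _ fun a b => ?_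
  have h1 : Commute D ((mulSeries h).coeff b) := LinearMap.ext fun s => hD b s
  rcases lt_or_ge a 0 with ha | ha
  · rw [expSeries_coeff_neg D a ha]
    exact Commute.zero_left _
  · lift a to ℕ using ha
    rw [expSeries_coeff_nat]
    exact (h1.pow_left _).smul_left _

/-- `exp (ħ D)` commutes with the multiplication by `h` if `D` does. -/
theorem hexp_mul_left {D : Module.End ℂ S} {h : HahnSeries ℤ S}
    (hD : ∀ n s, D (h.coeff n * s) = h.coeff n * D s) (x : HahnSeries ℤ S) :
    hexp D (ofS (h * x)) = ofS (h * toS (hexp D (ofS x))) := by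
  apply toS_injective
  change (HahnModule.of (Module.End ℂ S)).symm (expSeries D • HahnModule.of (Module.End ℂ S) (h * x))
    = h * (HahnModule.of (Module.End ℂ S)).symm (expSeries D • HahnModule.of (Module.End ℂ S) x)
  rw [← mulSeries_smul h ((HahnModule.of _).symm _), ← mulSeries_smul h x, Equiv.apply_symm_apply,
    Equiv.apply_symm_apply, ← series_mul_smul, commute_expSeries_mulSeries hD, series_mul_smul]

theorem mapC_mul_left {D : Module.End ℂ S} {h : HahnSeries ℤ S}
    (hD : ∀ n s, D (h.coeff n * s) = h.coeff n * D s) (x : HahnSeries ℤ S) :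
    mapC D (ofS (h * x)) = ofS (h * toS (mapC D (ofS x))) := by
  refine Lau.ext fun n => ?_
  change D ((h * x).coeff n) = (h * (toS (mapC D (ofS x)))).coeff n
  have hs : (toS (mapC D (ofS x))).support ⊆ x.support := by
    intro a ha h0
    apply ha
    change D (x.coeff a) = 0
    rw [h0, map_zero]
  rw [HahnSeries.coeff_mul, HahnSeries.coeff_mul_right' x.isPWO_support hs, map_sum]
  exact Finset.sum_congr rfl fun p _ => hD _ _

end LaurentProducts
end TwistedTQM
end

/-! ### Functions placed at points; collision of two points -/

noncomputable section
namespace TwistedTQM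

set_option linter.unusedSectionVars false

section Points

open MvPowerSeries

variable {I J σ : Type} [Fintype I] [Fintype J] [Fintype σ]

/-- The copy of a power series in the variables of the point `α`. -/
def atP (α : I) : PS σ →ₐ[ℂ] PS (I × σ) := rename (Prod.mk α)

/-- The map of power series induced by a map of points. -/
def onPts (c : J → I) : PS (J × σ) →ₐ[ℂ] PS (I × σ) := rename (Prod.map c id)

/-- The identification of the variables of all the points. -/
def diag : PS (I × σ) →ₐ[ℂ] PS σ := rename Prod.snd

theorem onPts_comp_atP (c : J → I) (β : J) :
    (onPts c).comp (atP β) = (atP (c β) : PS σ →ₐ[ℂ] PS (I × σ)) := by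
  unfold onPts atP
  rw [rename_comp_rename]
  rfl

theorem diag_comp_onPts (c : J → I) : diag.comp (onPts c) = (diag : PS (J × σ) →ₐ[ℂ] PS σ) := by
  unfold diag onPts
  rw [rename_comp_rename]
  rfl

theorem atP_comp_diag (α : I) : (atP α).comp diag = (onPts fun _ : J => α : PS (J × σ) →ₐ[ℂ] _) := by
  unfold diag onPts atP
  rw [rename_comp_rename]
  rfl

theorem onPts_comp_onPts {L : Type} [Fintype L] (c : J → I) (e : L → J) :
    (onPts c).comp (onPts e) = (onPts (c ∘ e) : PS (L × σ) →ₐ[ℂ] _) := by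
  unfold onPts
  rw [rename_comp_rename]
  rfl

theorem linSub_atP [DecidableEq I] [DecidableEq σ] (α : I) : LinSub (atP α : PS σ →ₐ[ℂ] PS (I × σ))
    (Matrix.of fun x y => if (α, x) = y then 1 else 0) := linSub_rename _

theorem linSub_diag [DecidableEq I] [DecidableEq σ] : LinSub (diag : PS (I × σ) →ₐ[ℂ] PS σ)
    (Matrix.of fun x y => if x.2 = y then 1 else 0) := linSub_rename _

theorem linSub_onPts [DecidableEq I] [DecidableEq σ] (c : J → I) :
    LinSub (onPts c : PS (J × σ) →ₐ[ℂ] PS (I × σ))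
      (Matrix.of fun x y => if (c x.1, x.2) = y then 1 else 0) := linSub_rename _

theorem pd_atP_of_ne {α β : I} (h : α ≠ β) (i : σ) (s : PS σ) : pd (α, i) (atP β s) = 0 := by
  classical
  have := LinearMap.congr_fun ((linSub_atP (σ := σ) β).pd_comp (α, i)) s
  refine this.trans ?_
  simp [h.symm]

theorem pd_atP_same (α : I) (i : σ) (s : PS σ) : pd (α, i) (atP α s) = atP α (pd i s) := by
  classical
  have := LinearMap.congr_fun ((linSub_atP (σ := σ) α).pd_comp (α, i)) s
  refine this.trans ?_
  simp [ite_smul]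

/-- The quadratic form is pulled back along the map of points; `c` may identify points, whose lines
then become lines between points of one fibre. -/
theorem bi_onPts (c : J → I) (Q : Matrix (I × σ) (I × σ) ℂ) :
    bi Q ∘ₗ (onPts c).toLinearMap = (onPts c).toLinearMap ∘ₗ
      bi (Matrix.of fun x y => Q (c x.1, x.2) (c y.1, y.2)) := by
  classical
  rw [(linSub_onPts c).bi_comp Q]
  congr 2
  ext x y
  simp [Matrix.mul_apply]

/-- The external product of functions placed at the points. -/
def emb (f : I → Lau (PS σ)) : HahnSeries ℤ (PS (I × σ)) :=
  ∏ α, toS (mapC (atP α).toLinearMap (f α))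

/-- Functions whose points have the same image under `c` are multiplied commutatively at that image.
-/
theorem mapC_onPts_emb (c : J → I) (f : J → Lau (PS σ)) :
    mapC (onPts c).toLinearMap (ofS (emb f))
      = ofS (∏ β, toS (mapC (atP (c β)).toLinearMap (f β))) := by
  apply toS_injective
  unfold emb
  rw [toS_mapC_prod, toS_ofS]
  refine Finset.prod_congr rfl fun β _ => ?_
  rw [ofS_toS, mapC_comp, ← AlgHom.comp_toLinearMap, onPts_comp_atP]

theorem mapC_atP_one (α : I) : toS (mapC (atP α).toLinearMap (const (1 : PS σ))) = 1 :=
  toS_mapC_one _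

theorem emb_eq_mapC_onPts {c : J → I} (hc : Function.Injective c) (f : I → Lau (PS σ))
    (hf : ∀ α, α ∉ Set.range c → f α = const 1) :
    ofS (emb f) = mapC (onPts c).toLinearMap (ofS (emb (f ∘ c))) := by
  classical
  rw [mapC_onPts_emb]
  congr 1
  unfold emb
  refine Eq.trans ?_ (Finset.prod_image (s := Finset.univ) (g := c)
    (f := fun α => toS (mapC (atP α).toLinearMap (f α))) (fun _ _ _ _ h => hc h))
  refine (Finset.prod_subset (Finset.subset_univ _) fun α _ hα => ?_).symm
  rw [hf α (by simpa using hα), mapC_atP_one]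

theorem hexp_prod_mul {D : Module.End ℂ (PS σ)} {β : Type*} (t : Finset β)
    (h : β → HahnSeries ℤ (PS σ))
    (hD : ∀ b ∈ t, ∀ n s, D ((h b).coeff n * s) = (h b).coeff n * D s) (x : HahnSeries ℤ (PS σ)) :
    hexp D (ofS ((∏ b ∈ t, h b) * x)) = ofS ((∏ b ∈ t, h b) * toS (hexp D (ofS x))) := by
  classical
  induction t using Finset.induction_on with
  | empty => simp
  | insert a t ha ih =>
    rw [Finset.prod_insert ha, mul_assoc, hexp_mul_left (hD a (Finset.mem_insert_self a t)),
      ih fun b hb => hD b (Finset.mem_insert_of_mem hb), toS_ofS, mul_assoc]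

theorem mapC_prod_mul {D : Module.End ℂ (PS σ)} {β : Type*} (t : Finset β)
    (h : β → HahnSeries ℤ (PS σ))
    (hD : ∀ b ∈ t, ∀ n s, D ((h b).coeff n * s) = (h b).coeff n * D s) (x : HahnSeries ℤ (PS σ)) :
    mapC D (ofS ((∏ b ∈ t, h b) * x)) = ofS ((∏ b ∈ t, h b) * toS (mapC D (ofS x))) := by
  classical
  induction t using Finset.induction_on with
  | empty => simp
  | insert a t ha ih =>
    rw [Finset.prod_insert ha, mul_assoc, mapC_mul_left (hD a (Finset.mem_insert_self a t)),
      ih fun b hb => hD b (Finset.mem_insert_of_mem hb), toS_ofS, mul_assoc]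

theorem pd_mul_of_eq_zero {i : σ} {f : PS σ} (hf : pd i f = 0) (g : PS σ) :
    pd i (f * g) = f * pd i g := by
  rw [pd_mul, hf, mul_zero, add_zero]

/-- A derivative in the variables of `α` treats the factors at the other points as constants. -/
theorem mapC_pd_emb [DecidableEq I] (α : I) (i : σ) (f : I → Lau (PS σ)) :
    mapC (pd (α, i)) (ofS (emb f)) = ofS (emb (Function.update f α (mapC (pd i) (f α)))) := by
  unfold emb
  rw [← Finset.prod_erase_mul _ _ (Finset.mem_univ α), mapC_prod_mul,
    ← Finset.prod_erase_mul (f := fun β => toS (mapC (atP β).toLinearMap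
      (Function.update f α (mapC (pd i) (f α)) β))) _ (Finset.mem_univ α)]
  · congr 2
    · refine Finset.prod_congr rfl fun β hβ => ?_
      rw [Function.update_of_ne (Finset.ne_of_mem_erase hβ)]
    · rw [Function.update_self, ofS_toS, mapC_comp, mapC_comp]
      exact congrArg (fun φ => toS (mapC φ (f α))) (LinearMap.ext fun s => pd_atP_same α i s)
  · intro β hβ n s
    exact pd_mul_of_eq_zero (pd_atP_of_ne (Finset.ne_of_mem_erase hβ).symm i _) s

/-- The matrix of the bidifferential operator `P` between the points `a` and `b`. -/
def linkMat [DecidableEq I] (P : Matrix σ σ ℂ) (a b : I) : Matrix (I × σ) (I × σ) ℂ :=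
  Matrix.of fun x y => if x.1 = a ∧ y.1 = b then P x.2 y.2 else 0

theorem half_lineOp_eq_bi {N : ℕ} (P : Matrix σ σ ℂ) (a b : Fin N) :
    (1 / 2 : ℂ) • lineOp P a b = bi (linkMat P a b) := by
  unfold lineOp bi linkMat
  congr 1
  rw [Fintype.sum_prod_type, Finset.sum_eq_single a]
  · refine Finset.sum_congr rfl fun i _ => ?_
    rw [Fintype.sum_prod_type, Finset.sum_eq_single b]
    · simp
    · intro c _ hc
      simp [hc]
    · simp
  · intro c _ hc
    simp [hc]
  · simp

end Points

section Merge

open MvPowerSeries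

variable {I J : Type} [Fintype I] [Fintype J] [DecidableEq I] {k l : ℕ}

/-- The Moyal product in the language of points: one directed link of weight `ω` between two points,
then their identification. The factor `1 / 2` of the Moyal exponent is the one inside `bi`. -/
theorem star_eq (p q : W k l) :
    star p q = mapC diag.toLinearMap (hexp (bi (linkMat (poissonYZ ℂ k l) (0 : Fin 2) 1))
      (ofS (emb ![p, q]))) := by
  rw [← half_lineOp_eq_bi]
  unfold emb
  rw [Fin.prod_univ_two]
  rfl

theorem mapC_diag_comp_onPts {σ : Type} [Fintype σ] (j : I) (x : Lau (PS (J × σ))) :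
    mapC (atP j).toLinearMap (mapC diag.toLinearMap x)
      = mapC (onPts fun _ => j).toLinearMap x := by
  rw [mapC_comp, ← AlgHom.comp_toLinearMap, atP_comp_diag]

/-- A product of two functions at a point is obtained from functions at two points. -/
theorem emb_merge {c : I → J} {a b : I} (hab : a ≠ b) (hc : c a = c b)
    (hbij : ∀ j, j ≠ c a → ∃! x, c x = j) (hinj : ∀ x, c x = c a → x = a ∨ x = b)
    (f : I → W k l) (f' : J → W k l) (h0 : f' (c a) = star (f a) (f b))
    (h1 : ∀ x, x ≠ a → x ≠ b → f' (c x) = f x) :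
    ofS (emb f') = mapC (onPts c).toLinearMap
      (hexp (bi (linkMat (poissonYZ ℂ k l) a b)) (ofS (emb f))) := by
  classical
  -- The link only differentiates at `a` and `b`, so the other factors come out of the exponential.
  have e1 : emb f = (∏ x ∈ (Finset.univ.erase a).erase b, toS (mapC (atP x).toLinearMap (f x))) *
      (toS (mapC (atP a).toLinearMap (f a)) * toS (mapC (atP b).toLinearMap (f b))) := by
    unfold emb
    rw [← Finset.prod_erase_mul _ _ (Finset.mem_univ a), ← Finset.prod_erase_mul _ _
      (Finset.mem_erase.2 ⟨hab.symm, Finset.mem_univ b⟩)]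
    ring
  have e2 : ofS (toS (mapC (atP a).toLinearMap (f a)) * toS (mapC (atP b).toLinearMap (f b)))
      = mapC (onPts ![a, b]).toLinearMap (ofS (emb ![f a, f b])) := by
    rw [mapC_onPts_emb, Fin.prod_univ_two]
    rfl
  rw [e1, hexp_prod_mul, e2, ← mapC_hexp (bi_onPts _ _).symm]
  · apply toS_injective
    rw [toS_mapC_mul, toS_mapC_prod, ofS_toS, mapC_comp, ← AlgHom.comp_toLinearMap,
      onPts_comp_onPts]
    -- Both points go to `c a`: the two remaining factors are identified first and then placed at `c
    -- a`, which is the star product at that point.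
    have e3 : c ∘ ![a, b] = fun _ => c a := by
      ext i
      fin_cases i
      · rfl
      · exact hc.symm
    have e4 : (Matrix.of fun x y : Fin 2 × Var k l =>
        linkMat (poissonYZ ℂ k l) a b (![a, b] x.1, x.2) (![a, b] y.1, y.2))
        = linkMat (poissonYZ ℂ k l) 0 1 := by
      ext ⟨x, i⟩ ⟨y, j⟩
      fin_cases x <;> fin_cases y <;> simp [linkMat, hab, hab.symm]
    rw [e3, e4, ← mapC_diag_comp_onPts, ← star_eq, ← h0, toS_ofS]
    unfold emb
    rw [← Finset.prod_erase_mul _ _ (Finset.mem_univ (c a))]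
    congr 1
    refine Finset.prod_bij' (fun j hj => (hbij j (Finset.ne_of_mem_erase hj)).choose)
      (fun x _ => c x) ?_ ?_ ?_ ?_ ?_
    · intro j hj
      have h2 := (hbij j (Finset.ne_of_mem_erase hj)).choose_spec.1
      have h3 := Finset.ne_of_mem_erase hj
      simp only [Finset.mem_erase, Finset.mem_univ, and_true]
      refine ⟨fun h => h3 ?_, fun h => h3 ?_⟩
      · rw [h] at h2; rw [← h2, hc]
      · rw [h] at h2; exact h2.symm
    · intro x hx
      simp only [Finset.mem_erase, Finset.mem_univ, and_true] at hx ⊢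
      intro h
      rcases hinj x h with h | h
      · exact hx.2 h
      · exact hx.1 h
    · intro j hj
      exact (hbij j (Finset.ne_of_mem_erase hj)).choose_spec.1
    · intro x hx
      simp only [Finset.mem_erase, Finset.mem_univ, and_true] at hx
      have h3 : c x ≠ c a := fun h => by
        rcases hinj x h with h | h
        · exact hx.2 h
        · exact hx.1 h
      exact ((hbij (c x) h3).choose_spec.2 x rfl).symm
    · intro j hj
      have h2 := (hbij j (Finset.ne_of_mem_erase hj)).choose_spec.1
      have h3 := Finset.ne_of_mem_erase hj
      rw [ofS_toS, mapC_comp, ← AlgHom.comp_toLinearMap, onPts_comp_atP]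
      conv_rhs => rw [← h1 _ (fun h => h3 (by rw [h] at h2; exact h2.symm))
        (fun h => h3 (by rw [h] at h2; rw [← h2, hc]))]
      rw [h2]
  · intro x hx n s
    simp only [Finset.mem_erase, Finset.mem_univ, and_true] at hx
    have h2 : ∀ i s, pd (a, i) ((toS (mapC (atP x).toLinearMap (f x))).coeff n * s)
        = (toS (mapC (atP x).toLinearMap (f x))).coeff n * pd (a, i) s := fun i s =>
      pd_mul_of_eq_zero (pd_atP_of_ne (fun h => hx.2 h.symm) i _) s
    have h3 : ∀ i s, pd (b, i) ((toS (mapC (atP x).toLinearMap (f x))).coeff n * s)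
        = (toS (mapC (atP x).toLinearMap (f x))).coeff n * pd (b, i) s := fun i s =>
      pd_mul_of_eq_zero (pd_atP_of_ne (fun h => hx.1 h.symm) i _) s
    simp only [bi, LinearMap.smul_apply, LinearMap.sum_apply, Module.End.mul_apply,
      Finset.mul_sum, mul_smul_comm]
    congr 1
    refine Finset.sum_congr rfl fun u _ => Finset.sum_congr rfl fun v _ => ?_
    by_cases huv : u.1 = a ∧ v.1 = b
    · obtain ⟨u1, u2⟩ := u
      obtain ⟨v1, v2⟩ := v
      obtain ⟨rfl, rfl⟩ := huv
      rw [h3, h2]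
    · simp [linkMat, huv]

end Merge

/-! ### Wick sums: merging, substitutions, total derivatives -/

section Wick

open MvPowerSeries

variable {I J : Type} [Fintype I] [Fintype J] {k l : ℕ}

/-- The multiplication map followed by the restriction to `z = 0`. -/
def proj (I : Type) [Fintype I] (k l : ℕ) : PS (I × Var k l) →ₐ[ℂ] PS (YVar k) :=
  (killCompl Function.Embedding.inl).comp diag

theorem linSub_proj [DecidableEq I] : LinSub (proj I k l)
    (Matrix.of fun x y => if x.2 = Sum.inl y then 1 else 0) := by
  have h := (linSub_killCompl (Function.Embedding.inl : YVar k ↪ Var k l)).comp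
    (linSub_diag (I := I))
  have e : (Matrix.of fun (x : I × Var k l) y => if x.2 = y then (1 : ℂ) else 0) *
      (Matrix.of fun x y => if x = (Function.Embedding.inl : YVar k ↪ Var k l) y then (1 : ℂ) else 0)
      = Matrix.of fun (x : I × Var k l) y => if x.2 = Sum.inl y then (1 : ℂ) else 0 := by
    ext x y
    simp [Matrix.mul_apply]
  exact e ▸ h

theorem proj_comp_onPts (c : J → I) : (proj I k l).comp (onPts c) = proj J k l := by
  unfold proj
  rw [AlgHom.comp_assoc, diag_comp_onPts]

/-- The sum over the Feynman graphs of the quadratic operator `bi Q` on the external product of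
the functions `f α`. -/
def wick (Q : Matrix (I × Var k l) (I × Var k l) ℂ) (f : I → W k l) : Lau (PS (YVar k)) :=
  mapC (proj I k l).toLinearMap (hexp (bi Q) (ofS (emb f)))

theorem wick_congr {Q Q' : Matrix (I × Var k l) (I × Var k l) ℂ}
    (h : ∀ x y, Q x y + Q y x = Q' x y + Q' y x) (f : I → W k l) : wick Q f = wick Q' f := by
  unfold wick
  rw [bi_congr h]

theorem mapC_proj_onPts (c : J → I) (x : Lau (PS (J × Var k l))) :
    mapC (proj I k l).toLinearMap (mapC (onPts c).toLinearMap x)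
      = mapC (proj J k l).toLinearMap x := by
  rw [mapC_comp, ← AlgHom.comp_toLinearMap, proj_comp_onPts]

/-- Points with the function `1` can be omitted. -/
theorem wick_comp {c : J → I} (hc : Function.Injective c)
    (Q : Matrix (I × Var k l) (I × Var k l) ℂ) (f : I → W k l)
    (hf : ∀ α, α ∉ Set.range c → f α = const 1) :
    wick Q f = wick (Matrix.of fun x y => Q (c x.1, x.2) (c y.1, y.2)) (f ∘ c) := by
  unfold wick
  rw [emb_eq_mapC_onPts hc f hf, ← mapC_hexp (bi_onPts c Q).symm, mapC_proj_onPts]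

/-- The exponential inside the star product and the exponential of the propagators commute, so they
combine into one Wick sum over the unmerged points; the propagators there are pulled back along `c`.
-/
theorem wick_merge [DecidableEq I] {c : I → J} {a b : I} (hab : a ≠ b) (hc : c a = c b)
    (hbij : ∀ j, j ≠ c a → ∃! x, c x = j) (hinj : ∀ x, c x = c a → x = a ∨ x = b)
    (Q : Matrix (J × Var k l) (J × Var k l) ℂ)
    (f : I → W k l) (f' : J → W k l) (h0 : f' (c a) = star (f a) (f b))
    (h1 : ∀ x, x ≠ a → x ≠ b → f' (c x) = f x) :
    wick Q f' = wick ((Matrix.of fun x y => Q (c x.1, x.2) (c y.1, y.2))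
      + linkMat (poissonYZ ℂ k l) a b) f := by
  unfold wick
  rw [emb_merge hab hc hbij hinj f f' h0 h1, ← mapC_hexp (bi_onPts c Q).symm, mapC_proj_onPts,
    hexp_add (bi_comm _ _), bi_add]

/-- The linear substitutions `m α` at the points `α`. -/
def pullPts [DecidableEq I] (m : I → Matrix (Var k l) (Var k l) ℝ) :
    PS (I × Var k l) →ₐ[ℂ] PS (I × Var k l) :=
  pull (Matrix.of fun x y => if x.1 = y.1 then m x.1 x.2 y.2 else 0)

theorem pullPts_comp_atP [DecidableEq I] (m : I → Matrix (Var k l) (Var k l) ℝ) (α : I) :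
    (pullPts m).comp (atP α) = (atP α).comp (pull (m α)) := by
  refine LinSub.unique (((linSub_pull _).comp (linSub_atP α))) ?_
  convert (linSub_atP (I := I) α).comp (linSub_pull (m α)) using 1
  ext x y
  simp only [Matrix.mul_apply, Matrix.of_apply, Matrix.map_apply]
  rw [Finset.sum_eq_single (α, x)]
  · obtain ⟨β, y⟩ := y
    by_cases h : α = β
    · subst h; simp
    · simp [h]
  · intro b _ hb
    rw [if_neg (fun h => hb h.symm), zero_mul]
  · simp

theorem mapC_pullPts_emb [DecidableEq I] (m : I → Matrix (Var k l) (Var k l) ℝ) (f : I → W k l) :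
    mapC (pullPts m).toLinearMap (ofS (emb f))
      = ofS (emb fun α => mapC (pull (m α)).toLinearMap (f α)) := by
  apply toS_injective
  unfold emb
  rw [toS_mapC_prod, toS_ofS]
  refine Finset.prod_congr rfl fun α _ => ?_
  rw [ofS_toS, mapC_comp, mapC_comp, ← AlgHom.comp_toLinearMap, ← AlgHom.comp_toLinearMap,
    pullPts_comp_atP]

/-- By `h0` the substituted `z` involve no `y`, so setting `z = 0` survives the substitution; by
`hN` the `y` are transformed alike at all points, so the points can still be identified. -/
theorem proj_comp_pullPts [DecidableEq I] {m : I → Matrix (Var k l) (Var k l) ℝ}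
    {N : Matrix (YVar k) (YVar k) ℝ} (hN : ∀ α i j, m α (Sum.inl i) (Sum.inl j) = N i j)
    (h0 : ∀ α i j, m α (Sum.inr i) (Sum.inl j) = 0) :
    (proj I k l).comp (pullPts m) = (pull N).comp (proj I k l) := by
  refine LinSub.unique ((linSub_proj.comp (linSub_pull _))) ?_
  convert (linSub_pull N).comp (linSub_proj (I := I)) using 1
  ext ⟨α, x⟩ y
  simp only [Matrix.mul_apply, Matrix.of_apply, Matrix.map_apply, Fintype.sum_prod_type]
  rw [Finset.sum_eq_single α]
  · rcases x with x | x <;> simp [hN, h0]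
  · intro β _ hβ
    refine Finset.sum_eq_zero fun j _ => ?_
    rw [if_neg (fun h => hβ h.symm), Complex.ofReal_zero, zero_mul]
  · simp

theorem bi_comp_pullPts [DecidableEq I] {m : I → Matrix (Var k l) (Var k l) ℝ}
    (Q Q' : Matrix (I × Var k l) (I × Var k l) ℂ)
    (hQ : ∀ α β, (m α).map Complex.ofReal * (Matrix.of fun i j => Q (α, i) (β, j))
      * ((m β).map Complex.ofReal).transpose = Matrix.of fun i j => Q' (α, i) (β, j)) :
    bi Q ∘ₗ (pullPts m).toLinearMap = (pullPts m).toLinearMap ∘ₗ bi Q' := by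
  have h := (linSub_pull (Matrix.of fun x y : I × Var k l =>
    if x.1 = y.1 then m x.1 x.2 y.2 else 0)).bi_comp Q
  have hQ' : (Matrix.of fun x y : I × Var k l =>
      if x.1 = y.1 then m x.1 x.2 y.2 else 0).map Complex.ofReal * Q *
      ((Matrix.of fun x y : I × Var k l =>
        if x.1 = y.1 then m x.1 x.2 y.2 else 0).map Complex.ofReal).transpose = Q' := by
    ext ⟨α, x⟩ ⟨β, y⟩
    refine Eq.trans ?_ (congrFun (congrFun (hQ α β) x) y)
    simp only [Matrix.mul_apply, Matrix.of_apply, Matrix.map_apply, Fintype.sum_prod_type,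
      Matrix.transpose_apply]
    rw [Finset.sum_eq_single β]
    · refine Finset.sum_congr rfl fun j _ => ?_
      rw [Finset.sum_eq_single α]
      · simp
      · intro γ _ hγ
        refine Finset.sum_eq_zero fun j _ => ?_
        rw [if_neg (fun h => hγ h.symm), Complex.ofReal_zero, zero_mul]
      · simp
    · intro γ _ hγ
      refine Finset.sum_eq_zero fun j _ => ?_
      rw [if_neg (fun h => hγ h.symm), Complex.ofReal_zero, mul_zero]
    · simp
  rw [hQ'] at h
  exact h

/-- Different substitutions at different points are needed for the twist, where `g` acts on some of
the points only. -/
theorem wick_pull [DecidableEq I] {m : I → Matrix (Var k l) (Var k l) ℝ}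
    {N : Matrix (YVar k) (YVar k) ℝ} (hN : ∀ α i j, m α (Sum.inl i) (Sum.inl j) = N i j)
    (h0 : ∀ α i j, m α (Sum.inr i) (Sum.inl j) = 0)
    (Q Q' : Matrix (I × Var k l) (I × Var k l) ℂ)
    (hQ : ∀ α β, (m α).map Complex.ofReal * (Matrix.of fun i j => Q (α, i) (β, j))
      * ((m β).map Complex.ofReal).transpose = Matrix.of fun i j => Q' (α, i) (β, j))
    (f : I → W k l) :
    wick Q (fun α => mapC (pull (m α)).toLinearMap (f α))
      = mapC (pull N).toLinearMap (wick Q' f) := by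
  unfold wick
  have h := bi_comp_pullPts Q Q' hQ
  rw [← mapC_pullPts_emb, ← mapC_hexp h.symm, mapC_comp, mapC_comp, ← AlgHom.comp_toLinearMap,
    ← AlgHom.comp_toLinearMap]
  rw [proj_comp_pullPts hN h0]

theorem commute_hexp_mapC {S : Type*} [AddCommGroup S] [Module ℂ S] {D E : Module.End ℂ S}
    (h : Commute D E) (f : Lau S) : hexp D (mapC E f) = mapC E (hexp D f) :=
  (mapC_hexp (φ := E) h.symm f).symm

/-- The total derivative. -/
theorem pd_wick [DecidableEq I] (y : YVar k) (Q : Matrix (I × Var k l) (I × Var k l) ℂ)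
    (f : I → W k l) :
    mapC (pd y) (wick Q f)
      = ∑ α, wick Q (Function.update f α (mapC (pd (Sum.inl y)) (f α))) := by
  -- After the identification of the points, `∂_y` is the sum of the derivatives at all points, and
  -- these commute with the propagators.
  have h : pd y ∘ₗ (proj I k l).toLinearMap
      = (proj I k l).toLinearMap ∘ₗ ∑ α, pd (α, Sum.inl y) := by
    rw [(linSub_proj (I := I) (k := k) (l := l)).pd_comp y]
    congr 1
    rw [Fintype.sum_prod_type]
    refine Finset.sum_congr rfl fun α _ => ?_
    simp [ite_smul]
  unfold wick
  rw [mapC_comp, h, ← mapC_comp, mapC_sum, map_sum]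
  refine Finset.sum_congr rfl fun α _ => ?_
  rw [← commute_hexp_mapC (bi_comm_pd Q _), mapC_pd_emb]

theorem wick_update_add [DecidableEq I] (Q : Matrix (I × Var k l) (I × Var k l) ℂ) (f : I → W k l)
    (α : I) (x y : W k l) : wick Q (Function.update f α (x + y))
      = wick Q (Function.update f α x) + wick Q (Function.update f α y) := by
  have h : ∀ z, emb (Function.update f α z) = toS (mapC (atP α).toLinearMap z) *
      ∏ β ∈ Finset.univ.erase α, toS (mapC (atP β).toLinearMap (f β)) := by
    intro z
    unfold emb
    rw [← Finset.mul_prod_erase _ _ (Finset.mem_univ α), Function.update_self]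
    congr 1
    refine Finset.prod_congr rfl fun β hβ => ?_
    rw [Function.update_of_ne (Finset.ne_of_mem_erase hβ)]
  unfold wick
  rw [h, h, h, map_add, toS_add, add_mul, ofS_add, map_add, map_add]

theorem wick_update_smul [DecidableEq I] (Q : Matrix (I × Var k l) (I × Var k l) ℂ) (f : I → W k l)
    (α : I) (c : ℂ) (x : W k l) : wick Q (Function.update f α (c • x))
      = c • wick Q (Function.update f α x) := by
  have h : ∀ z, emb (Function.update f α z) = toS (mapC (atP α).toLinearMap z) *
      ∏ β ∈ Finset.univ.erase α, toS (mapC (atP β).toLinearMap (f β)) := by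
    intro z
    unfold emb
    rw [← Finset.mul_prod_erase _ _ (Finset.mem_univ α), Function.update_self]
    congr 1
    refine Finset.prod_congr rfl fun β hβ => ?_
    rw [Function.update_of_ne (Finset.ne_of_mem_erase hβ)]
  unfold wick
  have h2 : ofS (toS (mapC (atP α).toLinearMap (c • x)) *
      ∏ β ∈ Finset.univ.erase α, toS (mapC (atP β).toLinearMap (f β)))
      = (HahnSeries.C c : K) • ofS (toS (mapC (atP α).toLinearMap x) *
      ∏ β ∈ Finset.univ.erase α, toS (mapC (atP β).toLinearMap (f β))) := by
    apply toS_injective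
    rw [← C_smul, map_smul, toS_K_smul, toS_K_smul, toS_ofS, toS_ofS, mul_assoc]
  rw [h, h, h2, map_smul, map_smul, C_smul]

end Wick
end TwistedTQM
end

/-! ### Linear algebra of the propagators -/

noncomputable section
namespace TwistedTQM

set_option linter.unusedSectionVars false

section PoissonMatrix

theorem poisson_transpose (n : ℕ) : (poisson ℂ n).transpose = -poisson ℂ n := by
  simp [poisson, Matrix.fromBlocks_transpose, Matrix.fromBlocks_neg]

theorem poissonYZ_transpose (k l : ℕ) : (poissonYZ ℂ k l).transpose = -poissonYZ ℂ k l := by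
  simp [poissonYZ, Matrix.fromBlocks_transpose, poisson_transpose, Matrix.fromBlocks_neg]

theorem poisson_mul_self (R : Type*) [CommRing R] (n : ℕ) : poisson R n * poisson R n = -1 := by
  simp [poisson, Matrix.fromBlocks_multiply, ← Matrix.fromBlocks_one, Matrix.fromBlocks_neg]

theorem poissonYZ_mul_self (R : Type*) [CommRing R] (k l : ℕ) :
    poissonYZ R k l * poissonYZ R k l = -1 := by
  simp [poissonYZ, Matrix.fromBlocks_multiply, ← Matrix.fromBlocks_one, Matrix.fromBlocks_neg,
    poisson_mul_self]

theorem poissonYZ_map (k l : ℕ) :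
    (poissonYZ ℝ k l).map Complex.ofReal = poissonYZ ℂ k l := by
  ext (i | i) (j | j) <;> rcases i with i | i <;> rcases j with j | j <;>
    simp [poissonYZ, poisson, Matrix.one_apply, apply_ite Complex.ofReal]

/-- The part of the Poisson bivector in the coordinates `y`. -/
def poissonY (k l : ℕ) : Matrix (Var k l) (Var k l) ℂ := Matrix.fromBlocks (poisson ℂ k) 0 0 0

theorem poissonY_transpose (k l : ℕ) : (poissonY k l).transpose = -poissonY k l := by
  simp [poissonY, Matrix.fromBlocks_transpose, poisson_transpose, Matrix.fromBlocks_neg]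

end PoissonMatrix

namespace Sector

variable {G : Type*} [Group G] {k l r : ℕ} (D : Sector G k l r)

/-- The complex matrix of the action of `h`. -/
def cρ (h : G) : Matrix (Var k l) (Var k l) ℂ := (D.ρ h).map Complex.ofReal

/-- Since `Ω ^ 2 = -1`, the symplectic condition exhibits `-Ω ρᵀ Ω` as a left inverse of `ρ`; it is
also a right inverse, which moves the condition from forms to bivectors. -/
theorem rho_mul_poisson_mul (h : G) :
    D.ρ h * poissonYZ ℝ k l * (D.ρ h).transpose = poissonYZ ℝ k l := by
  set Ω := poissonYZ ℝ k l with hΩ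
  have h1 : (-(Ω * (D.ρ h).transpose * Ω)) * D.ρ h = 1 := by
    rw [neg_mul, mul_assoc, mul_assoc, ← mul_assoc (D.ρ h).transpose, D.symplectic h,
      poissonYZ_mul_self, neg_neg]
  have h2 := mul_eq_one_comm.1 h1
  rw [mul_neg, ← mul_assoc, ← mul_assoc] at h2
  have h3 := congrArg (· * Ω) h2
  simp only [neg_mul, one_mul] at h3
  rw [mul_assoc _ Ω Ω, hΩ, poissonYZ_mul_self, ← hΩ, mul_neg, mul_one, neg_neg] at h3
  exact h3

theorem cρ_mul_poisson_mul (h : G) :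
    D.cρ h * poissonYZ ℂ k l * (D.cρ h).transpose = poissonYZ ℂ k l := by
  have h1 := congrArg (fun M => M.map (Complex.ofRealHom)) (D.rho_mul_poisson_mul h)
  simp only [Matrix.map_mul] at h1
  change D.cρ h * (poissonYZ ℝ k l).map Complex.ofReal * (D.cρ h).transpose
    = (poissonYZ ℝ k l).map Complex.ofReal at h1
  rwa [poissonYZ_map] at h1

theorem cρ_mul (h h' : G) : D.cρ (h * h') = D.cρ h * D.cρ h' := by
  unfold cρ
  rw [map_mul]
  exact Matrix.map_mul (f := Complex.ofRealHom)

theorem cρ_one : D.cρ 1 = 1 := by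
  unfold cρ
  rw [map_one]
  exact Matrix.map_one _ (by simp) (by simp)

/-- The `y` vectors are fixed, which gives the first block column, and the `z` space is preserved,
which gives the zero above the last block. -/
theorem rho_g : D.ρ D.g = Matrix.fromBlocks 1 0 0 (D.ρ D.g).toBlocks₂₂ := by
  ext (i | i) (j | j)
  · have h := (D.fixed_iff (Pi.single (Sum.inl j) 1)).2 (fun _ => by simp)
    have h1 := congrFun h (Sum.inl i)
    rw [Matrix.mulVec_single_one] at h1
    simp only [Matrix.fromBlocks_apply₁₁]
    refine h1.trans ?_
    by_cases hij : i = j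
    · subst hij; simp
    · simp [hij]
  · have h := D.perp (Pi.single (Sum.inr j) 1) (fun _ => by simp) i
    rw [Matrix.mulVec_single_one] at h
    simpa using! h
  · have h := (D.fixed_iff (Pi.single (Sum.inl j) 1)).2 (fun _ => by simp)
    have h1 := congrFun h (Sum.inr i)
    rw [Matrix.mulVec_single_one] at h1
    simpa using! h1
  · rfl

theorem cρ_g : D.cρ D.g = Matrix.fromBlocks 1 0 0 D.gPerp := by
  unfold cρ
  rw [D.rho_g]
  ext (i | i) (j | j) <;> simp [gPerp, Matrix.one_apply, apply_ite Complex.ofReal]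

/-- A real kernel vector, extended by zero in the `y` directions, is fixed by `g` and so has no `z`
component. The real determinant maps to the complex one. -/
theorem isUnit_one_sub_gPerp : IsUnit (1 - D.gPerp).det := by
  set R := (D.ρ D.g).toBlocks₂₂ with hR
  have h1 : (1 - D.gPerp) = (1 - R).map Complex.ofRealHom := by
    ext i j
    simp [gPerp, ← hR, Matrix.one_apply, apply_ite Complex.ofReal]
  have h2 : (1 - R).det ≠ 0 := by
    intro h0
    obtain ⟨v, hv, hv0⟩ := Matrix.exists_mulVec_eq_zero_iff.2 h0
    rw [Matrix.sub_mulVec, Matrix.one_mulVec, sub_eq_zero] at hv0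
    apply hv
    have h3 : (D.ρ D.g).mulVec (Sum.elim (0 : YVar k → ℝ) v) = Sum.elim (0 : YVar k → ℝ) v := by
      rw [D.rho_g, Matrix.fromBlocks_mulVec, ← hR]
      simp [← hv0]
    have h4 := (D.fixed_iff _).1 h3
    exact funext fun j => by simpa using h4 j
  rw [h1, ← RingHom.mapMatrix_apply, ← RingHom.map_det, isUnit_iff_ne_zero]
  simpa using! h2

/-- `g (1 - g)⁻¹ + 1 = (1 - g)⁻¹` on the coordinates `z`. -/
theorem gPerp_mul_inv_add_one :
    D.gPerp * (1 - D.gPerp)⁻¹ + 1 = (1 - D.gPerp)⁻¹ := by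
  have h := Matrix.mul_nonsing_inv _ D.isUnit_one_sub_gPerp
  rw [sub_mul, one_mul, sub_eq_iff_eq_add] at h
  rw [h, add_comm]
  congr 2
  rw [← h]

theorem commute_gPerp_inv {d : Matrix (YVar l) (YVar l) ℂ} (hd : Commute d D.gPerp) :
    Commute d (1 - D.gPerp)⁻¹ := by
  have h1 : Commute d (1 - D.gPerp) := (Commute.one_right d).sub_right hd
  have hu := D.isUnit_one_sub_gPerp
  have e1 := Matrix.mul_nonsing_inv _ hu
  have e2 := Matrix.nonsing_inv_mul _ hu
  calc d * (1 - D.gPerp)⁻¹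
      = ((1 - D.gPerp)⁻¹ * (1 - D.gPerp)) * d * (1 - D.gPerp)⁻¹ := by rw [e2, one_mul]
    _ = (1 - D.gPerp)⁻¹ * d * ((1 - D.gPerp) * (1 - D.gPerp)⁻¹) := by
        rw [mul_assoc (1 - D.gPerp)⁻¹, ← h1.eq]
        simp only [mul_assoc]
    _ = _ := by rw [e1, mul_one]

theorem gPerp_mul_poisson_mul : D.gPerp * poisson ℂ l * D.gPerp.transpose = poisson ℂ l := by
  have h := D.cρ_mul_poisson_mul D.g
  rw [D.cρ_g, poissonYZ, Matrix.fromBlocks_transpose, Matrix.fromBlocks_multiply,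
    Matrix.fromBlocks_multiply, Matrix.fromBlocks_inj] at h
  simpa using h.2.2.2

/-- An off-diagonal block of a matrix commuting with `g` is annihilated, on one side, by the
invertible matrix `1 - g`. -/
theorem toBlocks_of_mem_centralizer {h : G} (hh : h ∈ Subgroup.centralizer {D.g}) :
    ∃ (a : Matrix (YVar k) (YVar k) ℝ) (d : Matrix (YVar l) (YVar l) ℝ),
      D.ρ h = Matrix.fromBlocks a 0 0 d := by
  have hc : D.ρ h * D.ρ D.g = D.ρ D.g * D.ρ h := by
    rw [← map_mul, ← map_mul, Subgroup.mem_centralizer_singleton_iff.1 hh]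
  set R := (D.ρ D.g).toBlocks₂₂ with hR
  have hu : IsUnit (1 - R).det := by
    have h1 : (1 - D.gPerp) = (1 - R).map Complex.ofRealHom := by
      ext i j
      simp [gPerp, ← hR, Matrix.one_apply, apply_ite Complex.ofReal]
    have := D.isUnit_one_sub_gPerp
    rw [h1, ← RingHom.mapMatrix_apply, ← RingHom.map_det, isUnit_iff_ne_zero] at this
    rw [isUnit_iff_ne_zero]
    intro h0
    exact this (by rw [h0, map_zero])
  rw [← Matrix.fromBlocks_toBlocks (D.ρ h), D.rho_g, ← hR, Matrix.fromBlocks_multiply,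
    Matrix.fromBlocks_multiply, Matrix.fromBlocks_inj] at hc
  simp only [Matrix.mul_one, Matrix.mul_zero, add_zero, zero_add, Matrix.zero_mul,
    Matrix.one_mul] at hc
  obtain ⟨-, h12, h21, -⟩ := hc
  have e12 : (D.ρ h).toBlocks₁₂ = 0 := by
    have : (D.ρ h).toBlocks₁₂ * (1 - R) = 0 := by
      rw [Matrix.mul_sub, Matrix.mul_one, h12, sub_self]
    calc _ = (D.ρ h).toBlocks₁₂ * ((1 - R) * (1 - R)⁻¹) := by
          rw [Matrix.mul_nonsing_inv _ hu, Matrix.mul_one]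
      _ = 0 := by rw [← Matrix.mul_assoc, this, Matrix.zero_mul]
  have e21 : (D.ρ h).toBlocks₂₁ = 0 := by
    have : (1 - R) * (D.ρ h).toBlocks₂₁ = 0 := by
      rw [Matrix.sub_mul, Matrix.one_mul, ← h21, sub_self]
    calc _ = (1 - R)⁻¹ * (1 - R) * (D.ρ h).toBlocks₂₁ := by
          rw [Matrix.nonsing_inv_mul _ hu, Matrix.one_mul]
      _ = 0 := by rw [Matrix.mul_assoc, this, Matrix.mul_zero]
  refine ⟨(D.ρ h).toBlocks₁₁, (D.ρ h).toBlocks₂₂, ?_⟩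
  conv_lhs => rw [← Matrix.fromBlocks_toBlocks (D.ρ h), e12, e21]

theorem cρ_of_mem_centralizer {h : G} (hh : h ∈ Subgroup.centralizer {D.g}) :
    ∃ (a : Matrix (YVar k) (YVar k) ℂ) (d : Matrix (YVar l) (YVar l) ℂ),
      D.cρ h = Matrix.fromBlocks a 0 0 d ∧ a * poisson ℂ k * a.transpose = poisson ℂ k ∧
      d * poisson ℂ l * d.transpose = poisson ℂ l ∧ Commute d D.gPerp := by
  obtain ⟨a, d, e⟩ := D.toBlocks_of_mem_centralizer hh
  have e1 : D.cρ h = Matrix.fromBlocks (a.map Complex.ofReal) 0 0 (d.map Complex.ofReal) := by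
    unfold cρ
    rw [e, Matrix.fromBlocks_map]
    congr 1
  have h1 := D.cρ_mul_poisson_mul h
  rw [e1, poissonYZ, Matrix.fromBlocks_transpose, Matrix.fromBlocks_multiply,
    Matrix.fromBlocks_multiply, Matrix.fromBlocks_inj] at h1
  have hc : D.cρ h * D.cρ D.g = D.cρ D.g * D.cρ h := by
    rw [← cρ_mul, ← cρ_mul, Subgroup.mem_centralizer_singleton_iff.1 hh]
  rw [e1, D.cρ_g, Matrix.fromBlocks_multiply, Matrix.fromBlocks_multiply,
    Matrix.fromBlocks_inj] at hc
  refine ⟨_, _, e1, by simpa using h1.1, by simpa using h1.2.2.2, ?_⟩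
  simpa using! hc.2.2.2

/-- With `N = (1 - g)⁻¹` the loop is `1/2 ω - ω Nᵀ` on the `z` block, so symmetry means `N ω + ω Nᵀ
= ω`. Multiplying by `1 - g` on the left and `1 - gᵀ` on the right reduces this to `g ω gᵀ = ω`. -/
theorem propLoop_transpose : D.propLoop.transpose = D.propLoop := by
  unfold propLoop twistPi
  rw [Matrix.fromBlocks_transpose]
  simp only [Matrix.transpose_zero, Matrix.transpose_sub, Matrix.transpose_neg,
    Matrix.transpose_mul, Matrix.transpose_smul, Matrix.transpose_transpose, poisson_transpose]
  congr 1
  set ω := poisson ℂ l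
  set g := D.gPerp
  set N := (1 - g)⁻¹
  have hu : IsUnit (1 - g).det := D.isUnit_one_sub_gPerp
  have hgN : g * N = N - 1 := eq_sub_of_add_eq D.gPerp_mul_inv_add_one
  have hgN' : N.transpose * g.transpose = N.transpose - 1 := by
    rw [← Matrix.transpose_mul, hgN, Matrix.transpose_sub, Matrix.transpose_one]
  have hs : g * ω * g.transpose = ω := D.gPerp_mul_poisson_mul
  have e1 : N * (1 - g) = 1 := Matrix.nonsing_inv_mul _ hu
  have e2 : (1 - g.transpose) * N.transpose = 1 := by
    have := congrArg Matrix.transpose e1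
    simpa [Matrix.transpose_mul] using this
  have key : N * ω + ω * N.transpose = ω := by
    have h1 : (1 - g) * ω * (1 - g.transpose) = ω * (1 - g.transpose) + (1 - g) * ω := by
      simp only [sub_mul, mul_sub, one_mul, mul_one, hs]
      abel
    calc N * ω + ω * N.transpose
        = N * (ω * (1 - g.transpose) + (1 - g) * ω) * N.transpose := by
          rw [mul_add, add_mul, ← mul_assoc N (1 - g), e1, one_mul, mul_assoc N, mul_assoc ω, e2,
            mul_one]
      _ = ω := by
          rw [← h1, ← mul_assoc, ← mul_assoc, e1, one_mul, mul_assoc, e2, mul_one]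
  rw [hgN, hgN', sub_mul, mul_sub, one_mul, mul_one, mul_neg]
  rw [eq_sub_of_add_eq key]
  module

theorem conj_propLoop {h : G} (hh : h ∈ Subgroup.centralizer {D.g}) :
    D.cρ h * D.propLoop * (D.cρ h).transpose = D.propLoop := by
  obtain ⟨a, d, e, -, h2, h3⟩ := D.cρ_of_mem_centralizer hh
  rw [e]
  unfold propLoop twistPi
  rw [Matrix.fromBlocks_transpose, Matrix.fromBlocks_multiply, Matrix.fromBlocks_multiply]
  simp only [Matrix.zero_mul, Matrix.mul_zero, add_zero, Matrix.transpose_zero, zero_add]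
  congr 1
  have h4 : Commute d (D.gPerp * (1 - D.gPerp)⁻¹) := h3.mul_right (D.commute_gPerp_inv h3)
  have h5 := congrArg Matrix.transpose h4.eq
  rw [Matrix.transpose_mul, Matrix.transpose_mul _ d] at h5
  rw [mul_sub, sub_mul, mul_neg, neg_mul, ← mul_assoc, mul_assoc _ _ d.transpose, h5.symm.symm,
    Matrix.mul_smul, Matrix.smul_mul, h2, ← mul_assoc, h2]

theorem conj_poissonY {h : G} (hh : h ∈ Subgroup.centralizer {D.g}) :
    D.cρ h * poissonY k l * (D.cρ h).transpose = poissonY k l := by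
  obtain ⟨a, d, e, h1, -, -⟩ := D.cρ_of_mem_centralizer hh
  rw [e]
  unfold poissonY
  rw [Matrix.fromBlocks_transpose, Matrix.fromBlocks_multiply, Matrix.fromBlocks_multiply]
  simp [h1]

theorem g_mem_centralizer : D.g ∈ Subgroup.centralizer {D.g} :=
  Subgroup.mem_centralizer_singleton_iff.2 rfl

/-- The algebra behind the twist: the line from a later point, after applying `g⁻¹` at that end, is
the line from an earlier point at distance `s - 1`. In `y` both sides are `s - 1 / 2`; in `z` the
identity is `g ω (N - 1)ᵀ = ω Nᵀ` with `N = (1 - g)⁻¹`, which holds since `N - 1 = g N` and `g ω gᵀ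
= ω`. -/
theorem cρ_g_inv_mul_link (s : ℂ) :
    D.cρ D.g⁻¹ * (s • poissonY k l + (-(1 / 2 : ℂ)) • poissonYZ ℂ k l + D.propLoop)
      = (s - 1) • poissonY k l + (1 / 2 : ℂ) • poissonYZ ℂ k l + D.propLoop := by
  have h1 : D.cρ D.g⁻¹ * D.cρ D.g = 1 := by rw [← cρ_mul, inv_mul_cancel, cρ_one]
  suffices h : s • poissonY k l + (-(1 / 2 : ℂ)) • poissonYZ ℂ k l + D.propLoop
      = D.cρ D.g * ((s - 1) • poissonY k l + (1 / 2 : ℂ) • poissonYZ ℂ k l + D.propLoop) by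
    rw [h, ← mul_assoc, h1, one_mul]
  rw [D.cρ_g]
  unfold poissonY poissonYZ propLoop twistPi
  simp only [Matrix.fromBlocks_smul, Matrix.fromBlocks_add, Matrix.fromBlocks_multiply, smul_zero,
    add_zero, Matrix.zero_mul, Matrix.mul_zero, zero_add, Matrix.one_mul]
  congr 1
  · module
  · set ω := poisson ℂ l
    set g := D.gPerp
    set N := (1 - g)⁻¹
    have hgN : g * N = N - 1 := eq_sub_of_add_eq D.gPerp_mul_inv_add_one
    have hs : g * ω * g.transpose = ω := D.gPerp_mul_poisson_mul
    have h2 : g * (ω * N.transpose) - g * ω = ω * N.transpose := by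
      calc g * (ω * N.transpose) - g * ω = g * (ω * (N - 1).transpose) := by
            rw [Matrix.transpose_sub, Matrix.transpose_one, mul_sub, mul_one, mul_sub]
        _ = g * (ω * (g.transpose * N.transpose)) := by
            have hc : g * N = N * g := (D.commute_gPerp_inv (Commute.refl _)).eq
            rw [← Matrix.transpose_mul, ← hc, hgN]
        _ = ω * N.transpose := by rw [← mul_assoc, ← mul_assoc, hs]
    rw [hgN]
    rw [Matrix.transpose_sub, Matrix.transpose_one, mul_sub, mul_one, mul_add, mul_sub, mul_neg,
      mul_sub, Matrix.mul_smul]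
    rw [sub_eq_iff_eq_add] at h2
    rw [h2]
    module

end Sector
end TwistedTQM
end

/-! ### The correlation function at fixed positions: collision, twist, symmetry -/

noncomputable section
namespace TwistedTQM

set_option linter.unusedSectionVars false

/-- The sign `± 1` of the order of `a` and `b`. -/
def ordSign (a b : ℤ) : ℂ := if a < b then 1 else if b < a then -1 else 0

theorem ordSign_congr {a b c d : ℤ} (h1 : a < b ↔ c < d) (h2 : b < a ↔ d < c) :
    ordSign a b = ordSign c d := by
  unfold ordSign
  simp only [h1, h2]

namespace Sector

variable {G : Type*} [Group G] {k l r : ℕ} (D : Sector G k l r) {I J : Type} [Fintype I] [Fintype J]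

/-- The matrix of all the propagators between points at the positions `θ`, ordered by the keys
`o`. -/
def propMat (θ : I → ℝ) (o : I → ℤ) : Matrix (I × Var k l) (I × Var k l) ℂ :=
  Matrix.of fun x y => (((θ x.1 - θ y.1 : ℝ) : ℂ) • poissonY k l
    + (1 / 2 * ordSign (o x.1) (o y.1)) • poissonYZ ℂ k l + D.propLoop) x.2 y.2

/-- The correlation function of functions `f α` at fixed positions. -/
def corr (θ : I → ℝ) (o : I → ℤ) (f : I → W k l) : Lau (PS (YVar k)) :=
  wick (D.propMat θ o) f

/-- Positions enter through differences and keys through their order. Keeping the order apart from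
the positions gives a meaning to coinciding points and continuity up to the boundary of the simplex.
-/
theorem propMat_congr {θ θ' : I → ℝ} {o o' : I → ℤ} (hθ : ∀ α β, θ α - θ β = θ' α - θ' β)
    (ho : ∀ α β, o α < o β ↔ o' α < o' β) : D.propMat θ o = D.propMat θ' o' := by
  unfold propMat
  ext x y
  simp only [Matrix.of_apply, hθ, ordSign_congr (ho x.1 y.1) (ho y.1 x.1)]

theorem corr_congr {θ θ' : I → ℝ} {o o' : I → ℤ} (hθ : ∀ α β, θ α - θ β = θ' α - θ' β)
    (ho : ∀ α β, o α < o β ↔ o' α < o' β) (f : I → W k l) : D.corr θ o f = D.corr θ' o' f := by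
  unfold corr
  rw [D.propMat_congr hθ ho]

/-- Points with the function `1` can be omitted. -/
theorem corr_comp {c : J → I} (hc : Function.Injective c) (θ : I → ℝ) (o : I → ℤ) (f : I → W k l)
    (hf : ∀ α, α ∉ Set.range c → f α = const 1) :
    D.corr θ o f = D.corr (θ ∘ c) (o ∘ c) (f ∘ c) :=
  wick_comp hc _ f hf

/-- The split points share a position and their lines to the rest agree. Between them the order
contributes `1/2 ω` in one direction and `-1/2 ω` in the other, which after symmetrization is the
single link `ω` of the star product. -/
theorem corr_merge [DecidableEq I] {c : I → J} {a b : I} (hab : a ≠ b) (hc : c a = c b)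
    (hbij : ∀ j, j ≠ c a → ∃! x, c x = j) (hinj : ∀ x, c x = c a → x = a ∨ x = b)
    (θ : J → ℝ) (o : J → ℤ) (o' : I → ℤ) (hlt : o' a < o' b)
    (ho : ∀ x y, c x ≠ c y → (o' x < o' y ↔ o (c x) < o (c y)))
    (f : I → W k l) (f' : J → W k l) (h0 : f' (c a) = star (f a) (f b))
    (h1 : ∀ x, x ≠ a → x ≠ b → f' (c x) = f x) :
    D.corr θ o f' = D.corr (θ ∘ c) o' f := by
  unfold corr
  rw [wick_merge hab hc hbij hinj _ f f' h0 h1]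
  refine wick_congr (fun x y => ?_) f
  obtain ⟨x, i⟩ := x
  obtain ⟨y, j⟩ := y
  have hT : poissonYZ ℂ k l j i = -poissonYZ ℂ k l i j := congrFun (congrFun (poissonYZ_transpose k l) i) j
  simp only [propMat, linkMat, Matrix.add_apply, Matrix.of_apply, Matrix.smul_apply, smul_eq_mul, Function.comp, hT]
  by_cases hxy : c x = c y
  · have hz : ∀ a : ℤ, ordSign a a = 0 := fun a => by simp [ordSign]
    rw [hxy, hz]
    by_cases hxy' : x = y
    · subst hxy'
      have h2 : ¬ (x = a ∧ x = b) := fun h => hab (h.1.symm.trans h.2)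
      simp [h2, hz]
    · have h3 : (x = a ∧ y = b) ∨ (x = b ∧ y = a) := by
        by_cases hx : c x = c a
        · have hy := hxy ▸ hx
          rcases hinj x hx with h | h <;> rcases hinj y hy with h' | h'
          · exact absurd (h.trans h'.symm) hxy'
          · exact Or.inl ⟨h, h'⟩
          · exact Or.inr ⟨h, h'⟩
          · exact absurd (h.trans h'.symm) hxy'
        · exact absurd ((hbij _ hx).unique rfl hxy.symm) hxy'
      rcases h3 with ⟨rfl, rfl⟩ | ⟨rfl, rfl⟩
      · simp [ordSign, hlt, hlt.not_gt, hab.symm]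
        ring
      · simp [ordSign, hlt, hlt.not_gt, hab, hab.symm]
        ring
  · have h3 : ¬ (x = a ∧ y = b) := by
      rintro ⟨rfl, rfl⟩
      exact hxy hc
    have h4 : ¬ (y = a ∧ x = b) := by
      rintro ⟨rfl, rfl⟩
      exact hxy hc.symm
    rw [if_neg h3, if_neg h4, ordSign_congr (ho x y hxy) (ho y x (Ne.symm hxy)),
      ordSign_congr (ho y x (Ne.symm hxy)) (ho x y hxy)]
    ring

theorem propMat_block (θ : I → ℝ) (o : I → ℤ) (α β : I) :
    (Matrix.of fun i j => D.propMat θ o (α, i) (β, j)) = ((θ α - θ β : ℝ) : ℂ) • poissonY k l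
      + (1 / 2 * ordSign (o α) (o β)) • poissonYZ ℂ k l + D.propLoop := rfl

theorem cρ_g_inv_blocks : (∀ i j, D.ρ D.g⁻¹ (Sum.inl i) (Sum.inl j) = (1 : Matrix _ _ ℝ) i j) ∧
    (∀ i j, D.ρ D.g⁻¹ (Sum.inr i) (Sum.inl j) = 0) ∧
    ∀ i j, D.ρ D.g⁻¹ (Sum.inl i) (Sum.inr j) = 0 := by
  have h : D.g⁻¹ ∈ Subgroup.centralizer {D.g} := inv_mem D.g_mem_centralizer
  obtain ⟨a, d, e⟩ := D.toBlocks_of_mem_centralizer h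
  have h1 : D.ρ D.g⁻¹ * D.ρ D.g = 1 := by rw [← map_mul, inv_mul_cancel, map_one]
  rw [e, D.rho_g, Matrix.fromBlocks_multiply] at h1
  rw [show (1 : Matrix (Var k l) (Var k l) ℝ) = Matrix.fromBlocks 1 0 0 1 from
    Matrix.fromBlocks_one.symm, Matrix.fromBlocks_inj] at h1
  have ha : a = 1 := by simpa using h1.1
  rw [e]
  simp [ha]

theorem pull_one {σ : Type} [Fintype σ] [DecidableEq σ] : pull (1 : Matrix σ σ ℝ) = AlgHom.id ℂ _ := by
  refine LinSub.unique (linSub_pull 1) ?_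
  convert linSub_id (ι := σ)
  ext i j
  simp [Matrix.one_apply, apply_ite Complex.ofReal]

/-- The twist `g` moves the last points to the front. -/
theorem corr_wrap (S : I → Prop) [DecidablePred S] (θ : I → ℝ) (o o' : I → ℤ)
    (hlast : ∀ α β, S α → ¬ S β → o β < o α ∧ o' α < o' β)
    (hS : ∀ α β, S α → S β → (o α < o β ↔ o' α < o' β))
    (hS' : ∀ α β, ¬ S α → ¬ S β → (o α < o β ↔ o' α < o' β)) (f : I → W k l) :
    D.corr θ o (fun α => if S α then D.actW D.g (f α) else f α)
      = D.corr (fun α => if S α then θ α - 1 else θ α) o' f := by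
  classical
  -- The twist is a substitution by `g⁻¹` at the points of `S` and by the identity elsewhere; it is
  -- the identity in `y`, hence disappears from the result.
  have hf : (fun α => if S α then D.actW D.g (f α) else f α) = fun α =>
      mapC (pull (if S α then D.ρ D.g⁻¹ else 1)).toLinearMap (f α) := by
    funext α
    split_ifs with h
    · rfl
    · rw [pull_one]
      rfl
  rw [hf]
  unfold corr
  obtain ⟨b1, b2, -⟩ := D.cρ_g_inv_blocks
  have hgc : D.g⁻¹ ∈ Subgroup.centralizer {D.g} := inv_mem D.g_mem_centralizer
  refine (wick_pull (N := 1) (fun α i j => ?_) (fun α i j => ?_) _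
    (D.propMat (fun α => if S α then θ α - 1 else θ α) o') (fun α β => ?_) f).trans ?_
  · split_ifs
    · exact b1 i j
    · simp [Matrix.one_apply]
  · split_ifs
    · exact b2 i j
    · simp
  · rw [propMat_block, propMat_block]
    have hm1 : (1 : Matrix (Var k l) (Var k l) ℝ).map Complex.ofReal = 1 :=
      Matrix.map_one _ (by simp) (by simp)
    by_cases hα : S α <;> by_cases hβ : S β
    -- Both points are moved: the block is invariant under conjugation and the positions are shifted
    -- together.
    · simp only [hα, hβ, if_true]
      change D.cρ D.g⁻¹ * _ * (D.cρ D.g⁻¹).transpose = _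
      rw [mul_add, mul_add, add_mul, add_mul, D.conj_propLoop hgc, Matrix.mul_smul, Matrix.smul_mul,
        D.conj_poissonY hgc, Matrix.mul_smul, Matrix.smul_mul, D.cρ_mul_poisson_mul,
        ordSign_congr (hS α β hα hβ) (hS β α hβ hα), sub_sub_sub_cancel_right]
    -- Only `α` is moved: its sign changes from `-1` to `1` and its position drops by one, as in
    -- `cρ_g_inv_mul_link`.
    · obtain ⟨h1, h2⟩ := hlast α β hα hβ
      simp only [hα, hβ, if_true, if_false, hm1, Matrix.transpose_one, mul_one]
      change D.cρ D.g⁻¹ * _ = _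
      have e1 : 1 / 2 * ordSign (o α) (o β) = -(1 / 2 : ℂ) := by simp [ordSign, h1, h1.not_gt]
      have e2 : 1 / 2 * ordSign (o' α) (o' β) = (1 / 2 : ℂ) := by simp [ordSign, h2]
      rw [e1, e2, D.cρ_g_inv_mul_link]
      congr 3
      push_cast
      ring
    · obtain ⟨h1, h2⟩ := hlast β α hβ hα
      simp only [hα, hβ, if_true, if_false, hm1, one_mul]
      change _ * (D.cρ D.g⁻¹).transpose = _
      have e1 : 1 / 2 * ordSign (o α) (o β) = (1 / 2 : ℂ) := by simp [ordSign, h1]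
      have e2 : 1 / 2 * ordSign (o' α) (o' β) = -(1 / 2 : ℂ) := by
        simp [ordSign, h2, h2.not_gt]
      -- The mirrored case is the transpose, since `ω` and `ω_Y` are antisymmetric and the loop is
      -- symmetric.
      have h3 := congrArg Matrix.transpose (D.cρ_g_inv_mul_link ((θ β - θ α : ℝ) : ℂ))
      rw [Matrix.transpose_mul] at h3
      simp only [Matrix.transpose_add, Matrix.transpose_smul, poissonY_transpose,
        poissonYZ_transpose, propLoop_transpose] at h3
      rw [e1, e2]
      convert h3 using 1
      · congr 1
        push_cast
        module
      · push_cast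
        module
    · simp only [hα, hβ, if_false, hm1, one_mul, Matrix.transpose_one, mul_one]
      rw [ordSign_congr (hS' α β hα hβ) (hS' β α hβ hα)]
  · rw [pull_one]
    rfl

/-- The correlation function is equivariant under the centralizer of `g`. -/
theorem corr_actW {h : G} (hh : h ∈ Subgroup.centralizer {D.g}) (θ : I → ℝ) (o : I → ℤ)
    (f : I → W k l) : D.corr θ o (fun α => D.actW h (f α))
      = mapC (pull (D.ρ h⁻¹).toBlocks₁₁).toLinearMap (D.corr θ o f) := by
  classical
  have hi : h⁻¹ ∈ Subgroup.centralizer {D.g} := inv_mem hh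
  obtain ⟨a, d, e⟩ := D.toBlocks_of_mem_centralizer hi
  refine wick_pull (m := fun _ => D.ρ h⁻¹) (fun α i j => rfl) (fun α i j => ?_) _ _
    (fun α β => ?_) f
  · rw [e]
    rfl
  · change D.cρ h⁻¹ * _ * (D.cρ h⁻¹).transpose = _
    rw [propMat_block, mul_add, mul_add, add_mul, add_mul, D.conj_propLoop hi, Matrix.mul_smul,
      Matrix.smul_mul, D.conj_poissonY hi, Matrix.mul_smul, Matrix.smul_mul, D.cρ_mul_poisson_mul]

/-- The order of the points on the circle: the point `0` is the last one. -/
def ordKey (m : ℕ) : Fin (m + 1) → ℤ := Fin.cons (m : ℤ) fun q => (q.val : ℤ)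

/-- On the simplex the keys have the same order as the positions. Splitting the self loop off each
line, by `(1 - g)⁻¹ = g (1 - g)⁻¹ + 1`, leaves a multiple of `ω_Y` and half of `ω`; on the diagonal
only the loop remains. -/
theorem lines_add_loops {m : ℕ} (u : Fin m → ℝ) (hu : u ∈ simplex m) :
    D.lines u + D.loops m = bi (D.propMat (pos u) (ordKey m)) := by
  have h1 : ∀ B : Fin (m + 1) → Fin (m + 1) → Matrix (Var k l) (Var k l) ℂ,
      (1 / 2 : ℂ) • ∑ α, ∑ β, lineOp (B α β) α β
        = bi (Matrix.of fun x y => B x.1 y.1 x.2 y.2) := by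
    intro B
    unfold bi lineOp
    congr 1
    simp only [Fintype.sum_prod_type, Matrix.of_apply]
    refine Finset.sum_congr rfl fun α _ => ?_
    rw [Finset.sum_comm]
  have h2 : D.lines u = bi (Matrix.of fun x y : Fin (m + 1) × Var k l =>
      (if x.1 = y.1 then 0 else D.propBetween u x.1 y.1 : Matrix (Var k l) (Var k l) ℂ)
        x.2 y.2) := by
    rw [← h1 fun α β => if α = β then 0 else D.propBetween u α β]
    unfold lines
    congr 1
    refine Finset.sum_congr rfl fun α _ => Finset.sum_congr rfl fun β _ => ?_
    split_ifs
    · simp [lineOp]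
    · rfl
  have h3 : D.loops m = bi (Matrix.of fun x y : Fin (m + 1) × Var k l =>
      (if x.1 = y.1 then D.propLoop else 0 : Matrix (Var k l) (Var k l) ℂ) x.2 y.2) := by
    rw [← h1 fun α β => if α = β then D.propLoop else 0]
    unfold loops
    congr 1
    refine Finset.sum_congr rfl fun α _ => ?_
    rw [Finset.sum_eq_single α]
    · simp
    · intro β _ hβ
      simp [hβ.symm, lineOp]
    · simp
  have hpos : ∀ α β : Fin (m + 1), pos u β < pos u α ↔ ordKey m β < ordKey m α := by
    intro α β
    unfold pos ordKey
    refine Fin.cases ?_ (fun a => ?_) α <;> refine Fin.cases ?_ (fun b => ?_) β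
    · simp
    · simp only [Fin.cons_zero, Fin.cons_succ]
      exact iff_of_true (hu.2 b).2 (by have := b.isLt; omega)
    · simp only [Fin.cons_zero, Fin.cons_succ]
      exact iff_of_false (hu.2 a).2.not_gt (by have := a.isLt; omega)
    · simp only [Fin.cons_succ, hu.1.lt_iff_lt, Fin.lt_def, Nat.cast_lt]
  have hinj : ∀ α β : Fin (m + 1), ordKey m α = ordKey m β → α = β := by
    intro α β
    unfold ordKey
    refine Fin.cases ?_ (fun a => ?_) α <;> refine Fin.cases ?_ (fun b => ?_) β
    · simp
    · simp only [Fin.cons_zero, Fin.cons_succ]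
      intro h
      have := b.isLt
      omega
    · simp only [Fin.cons_zero, Fin.cons_succ]
      intro h
      have := a.isLt
      omega
    · simp only [Fin.cons_succ, Nat.cast_inj]
      intro h
      rw [Fin.ext h]
  have hline : ∀ s : ℝ, D.propLine s
      = (s : ℂ) • poissonY k l - (1 / 2 : ℂ) • poissonYZ ℂ k l + D.propLoop := by
    intro s
    unfold propLine poissonY poissonYZ propLoop twistPi
    have e := D.gPerp_mul_inv_add_one
    generalize D.gPerp * (1 - D.gPerp)⁻¹ = X at e ⊢
    rw [← e]
    simp only [Matrix.fromBlocks_smul, Matrix.fromBlocks_add, sub_eq_add_neg, Matrix.fromBlocks_neg,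
      smul_zero, add_zero, neg_zero, Matrix.transpose_add, Matrix.transpose_one, mul_add, mul_one]
    congr 1
    · module
    · module
  rw [h2, h3, ← bi_add]
  congr 1
  ext ⟨α, i⟩ ⟨β, j⟩
  simp only [Matrix.add_apply, Matrix.of_apply, propMat]
  by_cases hαβ : α = β
  · subst hαβ
    simp [ordSign]
  · simp only [if_neg hαβ, Matrix.zero_apply, add_zero]
    refine congrFun (congrFun (?_ : D.propBetween u α β =
      ((pos u α - pos u β : ℝ) : ℂ) • poissonY k l
        + (1 / 2 * ordSign (ordKey m α) (ordKey m β)) • poissonYZ ℂ k l + D.propLoop) i) j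
    unfold propBetween
    split_ifs with h
    · have h' := (hpos α β).1 h
      rw [hline]
      simp only [ordSign, h', h'.not_gt, if_true, if_false]
      module
    · have h' : ordKey m α < ordKey m β := by
        rcases lt_trichotomy (ordKey m α) (ordKey m β) with h1 | h1 | h1
        · exact h1
        · exact absurd (hinj _ _ h1) hαβ
        · exact absurd ((hpos α β).2 h1) h
      rw [hline]
      simp only [ordSign, h', if_true, Matrix.transpose_add, Matrix.transpose_sub,
        Matrix.transpose_smul, poissonY_transpose, poissonYZ_transpose, propLoop_transpose]
      push_cast
      module

end Sector
end TwistedTQM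
end

/-! ### Integration over the simplex: slices and the Stokes formula -/

noncomputable section
namespace TwistedTQM
namespace Sector

open MeasureTheory

section Simplex

/-- The end points `0 < v_1 < … < v_m < 1`. -/
def endpt {m : ℕ} (v : Fin m → ℝ) : Fin (m + 2) → ℝ := Fin.cons 0 (Fin.snoc v 1)

theorem endpt_zero {m : ℕ} (v : Fin m → ℝ) : endpt v 0 = 0 := rfl

theorem endpt_last {m : ℕ} (v : Fin m → ℝ) : endpt v (Fin.last (m + 1)) = 1 := by
  unfold endpt
  rw [← Fin.succ_last, Fin.cons_succ, Fin.snoc_last]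

theorem endpt_mid {m : ℕ} (v : Fin m → ℝ) (j : Fin m) : endpt v j.castSucc.succ = v j := by
  unfold endpt
  rw [Fin.cons_succ, Fin.snoc_castSucc]

/-- Since `v` is increasing, the two neighbours of the slot `q`, with `0` and `1` as outer ones,
impose all the other inequalities. -/
theorem mem_Ioo_endpt_iff {m : ℕ} {v : Fin m → ℝ} (hv : v ∈ simplex m) (q : Fin (m + 1)) (t : ℝ) :
    t ∈ Set.Ioo (endpt v q.castSucc) (endpt v q.succ) ↔
      (0 < t ∧ t < 1) ∧ ∀ j : Fin m, (j.val < q.val → v j < t) ∧ (q.val ≤ j.val → t < v j) := by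
  constructor
  · rintro ⟨h1, h2⟩
    have hlo : ∀ j : Fin m, j.val < q.val → v j < t := by
      intro j hj
      have hq : q.castSucc = (⟨q.val - 1, by omega⟩ : Fin m).castSucc.succ := by
        ext; simp; omega
      rw [hq, endpt_mid] at h1
      refine lt_of_le_of_lt (hv.1.monotone ?_) h1
      rw [Fin.le_def]
      simp only
      omega
    have hhi : ∀ j : Fin m, q.val ≤ j.val → t < v j := by
      intro j hj
      have hq : q.succ = (⟨q.val, by omega⟩ : Fin m).castSucc.succ := by
        ext; simp
      rw [hq, endpt_mid] at h2
      exact lt_of_lt_of_le h2 (hv.1.monotone hj)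
    refine ⟨⟨?_, ?_⟩, fun j => ⟨hlo j, hhi j⟩⟩
    · by_cases hq : q.val = 0
      · have : q.castSucc = 0 := by ext; simpa using hq
        rwa [this, endpt_zero] at h1
      · exact lt_trans (hv.2 ⟨q.val - 1, by omega⟩).1 (hlo _ (by simp only; omega))
    · by_cases hq : q.val = m
      · have : q.succ = Fin.last (m + 1) := by ext; simpa using hq
        rwa [this, endpt_last] at h2
      · exact lt_trans (hhi ⟨q.val, by omega⟩ le_rfl) (hv.2 _).2
  · rintro ⟨⟨h0, h1⟩, h⟩
    constructor
    · by_cases hq : q.val = 0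
      · have : q.castSucc = 0 := by ext; simpa using hq
        rwa [this, endpt_zero]
      · have hq' : q.castSucc = (⟨q.val - 1, by omega⟩ : Fin m).castSucc.succ := by
          ext; simp; omega
        rw [hq', endpt_mid]
        exact (h _).1 (by simp only; omega)
    · by_cases hq : q.val = m
      · have : q.succ = Fin.last (m + 1) := by ext; simpa using hq
        rwa [this, endpt_last]
      · have hq' : q.succ = (⟨q.val, by omega⟩ : Fin m).castSucc.succ := by
          ext; simp
        rw [hq', endpt_mid]
        exact (h _).2 le_rfl

/-- The slices of the simplex in the direction `q` are intervals over a simplex of one dimension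
less, the form required by Fubini. -/
theorem insertNth_mem_simplex_iff {m : ℕ} (q : Fin (m + 1)) (t : ℝ) (v : Fin m → ℝ) :
    (q.insertNth t v : Fin (m + 1) → ℝ) ∈ simplex (m + 1) ↔
      v ∈ simplex m ∧ t ∈ Set.Ioo (endpt v q.castSucc) (endpt v q.succ) := by
  set u : Fin (m + 1) → ℝ := q.insertNth t v with hu
  have huq : u q = t := by simp [hu]
  have huv : ∀ j, u (q.succAbove j) = v j := fun j => by simp [hu]
  constructor
  · intro h
    have hv : v ∈ simplex m := by
      refine ⟨fun a b hab => ?_, fun j => huv j ▸ h.2 _⟩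
      rw [← huv, ← huv]
      exact h.1 (Fin.strictMono_succAbove q hab)
    refine ⟨hv, (mem_Ioo_endpt_iff hv q t).2 ⟨huq ▸ h.2 q, fun j => ⟨fun hj => ?_, fun hj => ?_⟩⟩⟩
    · rw [← huq, ← huv]
      refine h.1 ?_
      rw [Fin.succAbove_of_castSucc_lt _ _ (by simpa [Fin.lt_def] using hj)]
      simpa [Fin.lt_def] using hj
    · rw [← huq, ← huv]
      refine h.1 ?_
      rw [Fin.succAbove_of_le_castSucc _ _ (by simpa [Fin.le_def] using hj)]
      simp only [Fin.lt_def, Fin.val_succ]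
      omega
  · rintro ⟨hv, ht⟩
    obtain ⟨h01, h⟩ := (mem_Ioo_endpt_iff hv q t).1 ht
    constructor
    · intro a b hab
      rcases Fin.eq_self_or_eq_succAbove q a with ha | ⟨i, rfl⟩ <;>
        rcases Fin.eq_self_or_eq_succAbove q b with hb | ⟨j, hb⟩
      · exact absurd hab (by rw [hb, ha]; exact lt_irrefl _)
      · rw [ha, hb, huv, huq]
        rw [ha, hb] at hab
        refine (h j).2 ?_
        by_contra hlt
        rw [Fin.succAbove_of_castSucc_lt _ _ (by simpa [Fin.lt_def] using hlt)] at hab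
        simp only [Fin.lt_def, Fin.val_castSucc] at hab
        omega
      · rw [hb, huv, huq]
        rw [hb] at hab
        refine (h i).1 ?_
        by_contra hlt
        rw [Fin.succAbove_of_le_castSucc _ _ (by simpa [Fin.le_def] using hlt)] at hab
        simp only [Fin.lt_def, Fin.val_succ] at hab
        omega
      · rw [hb, huv, huv]
        rw [hb] at hab
        exact hv.1 ((Fin.strictMono_succAbove q).lt_iff_lt.1 hab)
    · intro a
      rcases Fin.eq_self_or_eq_succAbove q a with ha | ⟨i, rfl⟩
      · rw [ha, huq]; exact h01
      · rw [huv]; exact hv.2 i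

theorem measurableSet_simplex (m : ℕ) : MeasurableSet (simplex m) := by
  have h : simplex m = (⋂ (a : Fin m) (b : Fin m) (_ : a < b), {u : Fin m → ℝ | u a < u b}) ∩
      ⋂ i : Fin m, {u : Fin m → ℝ | u i ∈ Set.Ioo (0 : ℝ) 1} := by
    ext u
    simp only [simplex, Set.mem_ofPred_eq, Set.mem_inter_iff, Set.mem_iInter, StrictMono]
  rw [h]
  refine MeasurableSet.inter ?_ ?_
  · refine MeasurableSet.iInter fun a => MeasurableSet.iInter fun b => MeasurableSet.iInter fun _ =>
      measurableSet_lt (measurable_pi_apply a) (measurable_pi_apply b)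
  · exact MeasurableSet.iInter fun i => measurableSet_Ioo.preimage (measurable_pi_apply i)

theorem simplex_subset_Icc (m : ℕ) : simplex m ⊆ Set.Icc 0 1 := fun _ hu =>
  ⟨fun i => (hu.2 i).1.le, fun i => (hu.2 i).2.le⟩

theorem integrableOn_simplex {m : ℕ} {w : (Fin m → ℝ) → ℂ} (hw : Continuous w) :
    IntegrableOn w (simplex m) :=
  (hw.continuousOn.integrableOn_compact isCompact_Icc).mono_set (simplex_subset_Icc m)

theorem continuous_endpt {m : ℕ} (a : Fin (m + 2)) : Continuous fun v : Fin m → ℝ => endpt v a := by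
  refine Fin.cases ?_ (fun b => ?_) a
  · exact continuous_const
  · refine Fin.lastCases ?_ (fun j => ?_) b
    · simp only [Fin.succ_last, endpt_last]
      exact continuous_const
    · simp only [endpt_mid]
      exact continuous_apply j

theorem endpt_le {m : ℕ} {v : Fin m → ℝ} (hv : v ∈ simplex m) (q : Fin (m + 1)) :
    endpt v q.castSucc ≤ endpt v q.succ := by
  refine Fin.cases ?_ (fun i => ?_) q
  · rw [Fin.castSucc_zero, endpt_zero]
    rcases Nat.eq_zero_or_pos m with rfl | hm
    · have : (Fin.succ 0 : Fin 2) = Fin.last 1 := rfl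
      rw [this, endpt_last]
      exact zero_le_one
    · obtain ⟨m, rfl⟩ := Nat.exists_eq_succ_of_ne_zero hm.ne'
      have : (Fin.succ 0 : Fin (m + 3)) = (0 : Fin (m + 1)).castSucc.succ := rfl
      rw [this, endpt_mid]
      exact (hv.2 0).1.le
  · rw [← Fin.succ_castSucc, endpt_mid]
    by_cases hi : i.val + 1 = m
    · have : i.succ.succ = Fin.last (m + 1) := by ext; simpa using hi
      rw [this, endpt_last]
      exact (hv.2 i).2.le
    · have : i.succ.succ = (⟨i.val + 1, by omega⟩ : Fin m).castSucc.succ := by ext; simp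
      rw [this, endpt_mid]
      exact hv.1.monotone (by simp [Fin.le_def])

theorem continuous_insertNth {m : ℕ} (q : Fin (m + 1)) :
    Continuous fun p : ℝ × (Fin m → ℝ) => (q.insertNth p.1 p.2 : Fin (m + 1) → ℝ) := by
  refine continuous_pi fun a => ?_
  rcases Fin.eq_self_or_eq_succAbove q a with rfl | ⟨i, rfl⟩
  · simpa using continuous_fst
  · simp only [Fin.insertNth_apply_succAbove]
    exact (continuous_apply i).comp continuous_snd

/-- The Stokes formula on the simplex for one of the coordinates. -/
theorem integral_simplex_deriv {m : ℕ} (q : Fin (m + 1)) {w w' : (Fin (m + 1) → ℝ) → ℂ}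
    (hw' : Continuous w')
    (hd : ∀ (v : Fin m → ℝ) (t : ℝ), HasDerivAt (fun t => w (q.insertNth t v))
      (w' (q.insertNth t v)) t) :
    ∫ u in simplex (m + 1), w' u = ∫ v in simplex m,
      (w (q.insertNth (endpt v q.succ) v) - w (q.insertNth (endpt v q.castSucc) v)) := by
  have hmp := (volume_preserving_piFinSuccAbove (fun _ : Fin (m + 1) => ℝ) q).symm
  have hint := integrableOn_simplex hw'
  rw [← hmp.setIntegral_preimage_emb (MeasurableEquiv.measurableEmbedding _)]
  rw [← hmp.integrableOn_comp_preimage (MeasurableEquiv.measurableEmbedding _)] at hint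
  have hS := (measurableSet_simplex (m + 1)).preimage
    (MeasurableEquiv.piFinSuccAbove (fun _ : Fin (m + 1) => ℝ) q).symm.measurable
  rw [← integral_indicator hS]
  rw [← integrable_indicator_iff hS] at hint
  rw [Measure.volume_eq_prod] at hint ⊢
  have hint' : Integrable (((MeasurableEquiv.piFinSuccAbove (fun _ : Fin (m + 1) => ℝ) q).symm ⁻¹'
      simplex (m + 1)).indicator fun x => w'
        ((MeasurableEquiv.piFinSuccAbove (fun _ : Fin (m + 1) => ℝ) q).symm x))
      ((volume : Measure ℝ).prod (volume : Measure (Fin m → ℝ))) := hint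
  -- Fubini with the coordinate `q` innermost; the fundamental theorem of calculus is then applied
  -- on each slice.
  rw [integral_prod_symm _ hint', ← integral_indicator (measurableSet_simplex m)]
  refine integral_congr_ae (Filter.Eventually.of_forall fun v => ?_)
  have hmem : ∀ t : ℝ, (t, v) ∈ (MeasurableEquiv.piFinSuccAbove (fun _ : Fin (m + 1) => ℝ) q).symm ⁻¹'
      simplex (m + 1) ↔ v ∈ simplex m ∧ t ∈ Set.Ioo (endpt v q.castSucc) (endpt v q.succ) :=
    fun t => insertNth_mem_simplex_iff q t v
  by_cases hv : v ∈ simplex m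
  · rw [Set.indicator_of_mem hv]
    have h1 : ∀ t : ℝ, ((MeasurableEquiv.piFinSuccAbove (fun _ : Fin (m + 1) => ℝ) q).symm ⁻¹'
        simplex (m + 1)).indicator (fun x => w'
          ((MeasurableEquiv.piFinSuccAbove (fun _ : Fin (m + 1) => ℝ) q).symm x)) (t, v)
        = (Set.Ioo (endpt v q.castSucc) (endpt v q.succ)).indicator
          (fun t => w' (q.insertNth t v)) t := by
      intro t
      by_cases ht : t ∈ Set.Ioo (endpt v q.castSucc) (endpt v q.succ)
      · rw [Set.indicator_of_mem ((hmem t).2 ⟨hv, ht⟩), Set.indicator_of_mem ht]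
        rfl
      · rw [Set.indicator_of_notMem (fun h => ht ((hmem t).1 h).2), Set.indicator_of_notMem ht]
    simp only [h1]
    rw [integral_indicator measurableSet_Ioo, ← integral_Ioc_eq_integral_Ioo,
      ← intervalIntegral.integral_of_le (endpt_le hv q)]
    refine intervalIntegral.integral_eq_sub_of_hasDerivAt (fun t _ => hd v t) ?_
    refine Continuous.intervalIntegrable (hw'.comp ?_) _ _
    exact (continuous_insertNth q).comp (continuous_id.prodMk continuous_const)
  · rw [Set.indicator_of_notMem hv]
    refine integral_eq_zero_of_ae (Filter.Eventually.of_forall fun t => ?_)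
    exact Set.indicator_of_notMem (fun h => hv ((hmem t).1 h).1) _

/-- The Stokes formula for `u q * w`: a variable on which nothing depends integrates to the length
of its interval. -/
theorem integral_simplex_removeNth {m : ℕ} (q : Fin (m + 1)) {w : (Fin m → ℝ) → ℂ}
    (hw : Continuous w) :
    ∫ u in simplex (m + 1), w (fun j => u (q.succAbove j)) = ∫ v in simplex m,
      ((endpt v q.succ : ℂ) * w v - (endpt v q.castSucc : ℂ) * w v) := by
  have h := integral_simplex_deriv q (w := fun u => (u q : ℂ) * w (fun j => u (q.succAbove j)))
    (w' := fun u => w (fun j => u (q.succAbove j)))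
    (hw.comp (continuous_pi fun j => continuous_apply _)) (fun v t => by
      simp only [Fin.insertNth_apply_same, Fin.insertNth_apply_succAbove]
      simpa using (Complex.ofRealCLM.hasDerivAt (x := t)).mul_const (w v))
  simpa only [Fin.insertNth_apply_same, Fin.insertNth_apply_succAbove] using h

/-- The lengths of the consecutive intervals cut out by the remaining points telescope to `1`. -/
theorem sum_integral_simplex_removeNth {m : ℕ} {w : (Fin m → ℝ) → ℂ} (hw : Continuous w) :
    ∑ q : Fin (m + 1), ∫ u in simplex (m + 1), w (fun j => u (q.succAbove j))
      = ∫ v in simplex m, w v := by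
  simp only [integral_simplex_removeNth _ hw]
  have hc : ∀ a : Fin (m + 2), Continuous fun v : Fin m → ℝ => (endpt v a : ℂ) * w v := fun a =>
    (Complex.continuous_ofReal.comp (continuous_endpt a)).mul hw
  rw [← integral_finsetSum (f := fun (q : Fin (m + 1)) (v : Fin m → ℝ) =>
    (endpt v q.succ : ℂ) * w v - (endpt v q.castSucc : ℂ) * w v) _
    fun q _ => integrableOn_simplex ((hc _).sub (hc _))]
  refine setIntegral_congr_fun (measurableSet_simplex m) fun v _ => ?_
  simp only [Finset.sum_sub_distrib]
  have h1 := Fin.sum_univ_succ (fun a : Fin (m + 2) => (endpt v a : ℂ) * w v)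
  have h2 := Fin.sum_univ_castSucc (fun a : Fin (m + 2) => (endpt v a : ℂ) * w v)
  rw [endpt_zero] at h1
  rw [endpt_last] at h2
  have h3 := h1.symm.trans h2
  simp only [Complex.ofReal_zero, zero_mul, zero_add, Complex.ofReal_one, one_mul] at h3
  rw [h3]
  ring

end Simplex

/-! ### Rotations of the circle -/

section Rotation

/-- The rotation of the circle which moves the point `u i` to the base point, and the base point
to `1 - u i`. -/
def rotate {m : ℕ} (i : Fin (m + 1)) (u : Fin (m + 1) → ℝ) : Fin (m + 1) → ℝ := fun a =>
  if h : a.val + i.val < m then u ⟨a.val + i.val + 1, by omega⟩ - u i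
  else if a.val + i.val = m then 1 - u i
  else u ⟨a.val + i.val - m - 1, by omega⟩ - u i + 1

/-- A rotation keeps the cyclic order. The new coordinates come in three runs: the points after `u
i` (`r1`), the old base point at index `m - i` (`r2`), and the points before `u i`, one turn later
(`r3`). -/
theorem rotate_mem_simplex_iff {m : ℕ} (i : Fin (m + 1)) (u : Fin (m + 1) → ℝ) :
    rotate i u ∈ simplex (m + 1) ↔ u ∈ simplex (m + 1) := by
  have hi := i.isLt
  have r1 : ∀ a : ℕ, ∀ h : a + i.val < m, rotate i u ⟨a, by omega⟩ = u ⟨a + i.val + 1, by omega⟩ - u i :=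
    fun a h => by simp [rotate, h]
  have r2 : rotate i u ⟨m - i.val, by omega⟩ = 1 - u i := by
    have h1 : m - i.val + i.val = m := by omega
    simp [rotate, h1]
  have r3 : ∀ a : ℕ, ∀ h : a < i.val,
      rotate i u ⟨a + (m - i.val + 1), by omega⟩ = u ⟨a, by omega⟩ - u i + 1 := fun a h => by
    have h1 : ¬ (a + (m - i.val + 1) + i.val < m) := by omega
    have h2 : ¬ (a + (m - i.val + 1) + i.val = m) := by omega
    have h3 : a + (m - i.val + 1) + i.val - m - 1 = a := by omega
    simp [rotate, h1, h2, h3]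
  set q : Fin (m + 1) := ⟨m - i.val, by omega⟩ with hq
  have cases : ∀ a : Fin (m + 1), (∃ h : a.val + i.val < m, a = ⟨a.val, by omega⟩) ∨ a = q ∨
      ∃ b : ℕ, ∃ h : b < i.val, a = ⟨b + (m - i.val + 1), by omega⟩ := by
    intro a
    have := a.isLt
    rcases lt_trichotomy (a.val + i.val) m with h | h | h
    · exact Or.inl ⟨h, rfl⟩
    · exact Or.inr (Or.inl (Fin.ext (by simp [hq]; omega)))
    · exact Or.inr (Or.inr ⟨a.val - (m - i.val + 1), by omega, Fin.ext (by simp; omega)⟩)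
  have cases' : ∀ a : Fin (m + 1), (∃ b : ℕ, ∃ h : b + i.val < m, a = ⟨b + i.val + 1, by omega⟩) ∨
      a = i ∨ ∃ h : a.val < i.val, a = ⟨a.val, by omega⟩ := by
    intro a
    have := a.isLt
    rcases lt_trichotomy i.val a.val with h | h | h
    · exact Or.inl ⟨a.val - i.val - 1, by omega, Fin.ext (by simp; omega)⟩
    · exact Or.inr (Or.inl (Fin.ext h.symm))
    · exact Or.inr (Or.inr ⟨h, rfl⟩)
  constructor
  · rintro ⟨hm, h01⟩
    have a0 := h01 q
    rw [r2] at a0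
    have b1 : ∀ b : ℕ, ∀ h : b + i.val < m, u i < u ⟨b + i.val + 1, by omega⟩ ∧
        u ⟨b + i.val + 1, by omega⟩ < 1 := fun b h => by
      have h1 := (h01 ⟨b, by omega⟩).1
      have h2 : rotate i u ⟨b, by omega⟩ < rotate i u q := hm (Fin.lt_def.2 (by simp only [hq]; omega))
      rw [r1 b h] at h1 h2
      rw [r2] at h2
      constructor <;> linarith
    have b3 : ∀ b : ℕ, ∀ h : b < i.val, 0 < u ⟨b, by omega⟩ ∧ u ⟨b, by omega⟩ < u i := fun b h => by
      have h1 := (h01 ⟨b + (m - i.val + 1), by omega⟩).2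
      have h2 : rotate i u q < rotate i u ⟨b + (m - i.val + 1), by omega⟩ :=
        hm (Fin.lt_def.2 (by simp only [hq]; omega))
      rw [r3 b h] at h1 h2
      rw [r2] at h2
      constructor <;> linarith
    have a1 := a0.1
    have a2 := a0.2
    constructor
    · intro a b hab
      rcases cases' a with ⟨a', ha, rfl⟩ | rfl | ⟨ha, -⟩ <;>
        rcases cases' b with ⟨b', hb, rfl⟩ | rfl | ⟨hb, -⟩
      · have h2 : rotate i u ⟨a', by omega⟩ < rotate i u ⟨b', by omega⟩ :=
          hm (Fin.lt_def.2 (by have := Fin.lt_def.1 hab; (try simp only at this ⊢); omega))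
        rw [r1 a' ha, r1 b' hb] at h2
        linarith
      · have := Fin.lt_def.1 hab; simp only at this; omega
      · have := Fin.lt_def.1 hab; simp only at this; omega
      · exact (b1 b' hb).1
      · exact absurd hab (lt_irrefl _)
      · have := Fin.lt_def.1 hab; omega
      · exact lt_trans (b3 a.val ha).2 (b1 b' hb).1
      · exact (b3 a.val ha).2
      · have h2 : rotate i u ⟨a.val + (m - i.val + 1), by omega⟩
            < rotate i u ⟨b.val + (m - i.val + 1), by omega⟩ :=
          hm (Fin.lt_def.2 (by have := Fin.lt_def.1 hab; (try simp only at this ⊢); omega))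
        rw [r3 _ ha, r3 _ hb] at h2
        have : u a < u b := by simpa using h2
        exact this
    · intro a
      rcases cases' a with ⟨a', ha, rfl⟩ | rfl | ⟨ha, -⟩
      · have := b1 a' ha
        constructor <;> linarith
      · constructor <;> linarith
      · have := b3 a.val ha
        exact ⟨this.1, lt_trans this.2 (by linarith)⟩
  · rintro ⟨hm, h01⟩
    have b1 : ∀ b : ℕ, ∀ h : b + i.val < m, u i < u ⟨b + i.val + 1, by omega⟩ := fun b h =>
      hm (Fin.lt_def.2 (by simp only; omega))
    have b3 : ∀ b : ℕ, ∀ h : b < i.val, u ⟨b, by omega⟩ < u i := fun b h =>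
      hm (by simpa [Fin.lt_def] using h)
    have h0 := h01 i
    have a1 := h0.1
    have a2 := h0.2
    constructor
    · intro a b hab
      rcases cases a with ⟨ha, ha'⟩ | rfl | ⟨a', ha, rfl⟩ <;>
        rcases cases b with ⟨hb, hb'⟩ | hb' | ⟨b', hb, rfl⟩
      · rw [ha', hb', r1 _ ha, r1 _ hb]
        have : u ⟨a.val + i.val + 1, by omega⟩ < u ⟨b.val + i.val + 1, by omega⟩ :=
          hm (Fin.lt_def.2 (by have := Fin.lt_def.1 hab; (try simp only at this ⊢); omega))
        linarith
      · rw [ha', hb', r1 _ ha, r2]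
        have := (h01 ⟨a.val + i.val + 1, by omega⟩).2
        linarith
      · rw [ha', r1 _ ha, r3 _ hb]
        have h2 := (h01 ⟨a.val + i.val + 1, by omega⟩).2
        have h3 := (h01 ⟨b', by omega⟩).1
        linarith
      · have := Fin.lt_def.1 hab; simp only [hq] at this; omega
      · rw [hb'] at hab; exact absurd hab (lt_irrefl _)
      · rw [r2, r3 _ hb]
        have h3 := (h01 ⟨b', by omega⟩).1
        linarith
      · have := Fin.lt_def.1 hab; simp only at this; omega
      · rw [hb'] at hab
        have := Fin.lt_def.1 hab
        simp only [hq] at this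
        omega
      · rw [r3 _ ha, r3 _ hb]
        have : u ⟨a', by omega⟩ < u ⟨b', by omega⟩ :=
          hm (Fin.lt_def.2 (by have := Fin.lt_def.1 hab; (try simp only at this ⊢); omega))
        linarith
    · intro a
      rcases cases a with ⟨ha, ha'⟩ | rfl | ⟨a', ha, rfl⟩
      · rw [ha', r1 _ ha]
        have h2 := (h01 ⟨a.val + i.val + 1, by omega⟩).2
        have h3 := b1 _ ha
        constructor <;> linarith
      · rw [r2]
        constructor <;> linarith
      · rw [r3 _ ha]
        have h2 := (h01 ⟨a', by omega⟩).1
        have h3 := b3 _ ha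
        constructor <;> linarith

/-- The linear involution `u_i ↦ - u_i`, `u_j ↦ u_j - u_i`. -/
def shear {n : ℕ} (i : Fin n) : (Fin n → ℝ) →ₗ[ℝ] (Fin n → ℝ) where
  toFun u a := if a = i then -u i else u a - u i
  map_add' u v := by ext a; simp only [Pi.add_apply]; split_ifs <;> ring
  map_smul' c u := by ext a; simp only [Pi.smul_apply, smul_eq_mul, RingHom.id_apply]; split_ifs <;> ring

theorem shear_shear {n : ℕ} (i : Fin n) (u : Fin n → ℝ) : shear i (shear i u) = u := by
  ext a
  by_cases h : a = i
  · simp [shear, h]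
  · simp [shear, h]

/-- The determinant of an involution is `1` or `-1`. -/
theorem measurePreserving_shear {n : ℕ} (i : Fin n) :
    MeasurePreserving (shear i) (volume : Measure (Fin n → ℝ)) volume := by
  have h1 : LinearMap.det (shear i) * LinearMap.det (shear i) = 1 := by
    rw [← LinearMap.det_comp]
    have : shear i ∘ₗ shear i = LinearMap.id := LinearMap.ext (shear_shear i)
    rw [this, LinearMap.det_id]
  have h0 : LinearMap.det (shear i) ≠ 0 := fun h => by simp [h] at h1
  refine ⟨(LinearMap.continuous_of_finiteDimensional _).measurable, ?_⟩
  rw [Measure.map_linearMap_addHaar_eq_smul_addHaar _ h0]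
  have h2 : |(LinearMap.det (shear i))⁻¹| = 1 := by
    rcases mul_self_eq_one_iff.1 h1 with h | h <;> simp [h]
  rw [h2]
  simp

/-- The permutation underlying the rotation. -/
def rotPerm {m : ℕ} (i : Fin (m + 1)) : Fin (m + 1) ≃ Fin (m + 1) :=
  Equiv.ofBijective (fun a => if h : a.val + i.val < m then ⟨a.val + i.val + 1, by omega⟩
    else if a.val + i.val = m then i else ⟨a.val + i.val - m - 1, by omega⟩)
    (Finite.injective_iff_bijective.1 fun a b h => by
      have ha := a.isLt
      have hb := b.isLt
      have hi := i.isLt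
      ext
      simp only [Fin.ext_iff] at h
      split_ifs at h <;> simp at h <;> omega)

/-- A linear involution, a permutation of the coordinates and a translation, each of which preserves
the volume. -/
theorem rotate_eq {m : ℕ} (i : Fin (m + 1)) (u : Fin (m + 1) → ℝ) :
    rotate i u = (fun a => shear i u (rotPerm i a)) +
      fun a => if a.val + i.val < m then (0 : ℝ) else 1 := by
  ext a
  have ha := a.isLt
  have hi := i.isLt
  simp only [rotate, rotPerm, Equiv.ofBijective_apply, shear, LinearMap.coe_mk, AddHom.coe_mk,
    Pi.add_apply]
  by_cases h1 : a.val + i.val < m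
  · have : (⟨a.val + i.val + 1, by omega⟩ : Fin (m + 1)) ≠ i := fun h => by
      rw [Fin.ext_iff] at h
      simp at h
      omega
    simp [h1, this]
  · by_cases h2 : a.val + i.val = m
    · simp [h2]
      ring
    · have : (⟨a.val + i.val - m - 1, by omega⟩ : Fin (m + 1)) ≠ i := fun h => by
        rw [Fin.ext_iff] at h
        simp at h
        omega
      simp [h1, h2, this]

theorem measurePreserving_rotate {m : ℕ} (i : Fin (m + 1)) :
    MeasurePreserving (rotate i) (volume : Measure (Fin (m + 1) → ℝ)) volume := by
  have h1 := volume_measurePreserving_piCongrLeft (fun _ : Fin (m + 1) => ℝ) (rotPerm i).symm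
  have h2 := measurePreserving_add_right (volume : Measure (Fin (m + 1) → ℝ))
    (fun a => if a.val + i.val < m then (0 : ℝ) else 1)
  have h3 := h2.comp (h1.comp (measurePreserving_shear i))
  convert h3 using 1
  funext u
  rw [rotate_eq]
  simp only [Function.comp]
  congr 1
  funext a
  have := MeasurableEquiv.piCongrLeft_apply_apply (β := fun _ : Fin (m + 1) => ℝ) (rotPerm i).symm
    (shear i u) (rotPerm i a)
  rw [Equiv.symm_apply_apply] at this
  exact this.symm

theorem rotate_injective {m : ℕ} (i : Fin (m + 1)) :
    Function.Injective (rotate i : (Fin (m + 1) → ℝ) → _) := by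
  intro u v h
  rw [rotate_eq, rotate_eq, add_left_inj] at h
  have h1 : shear i u = shear i v := by
    funext a
    simpa using congrFun h ((rotPerm i).symm a)
  rw [← shear_shear i u, h1, shear_shear]

theorem continuous_rotate {m : ℕ} (i : Fin (m + 1)) :
    Continuous (rotate i : (Fin (m + 1) → ℝ) → Fin (m + 1) → ℝ) := by
  refine continuous_pi fun a => ?_
  unfold rotate
  split_ifs
  all_goals fun_prop

/-- The positions of the other points after the rotation. -/
def rotPos {m : ℕ} (i : Fin (m + 1)) (u : Fin (m + 1) → ℝ) : Fin m → ℝ := fun j =>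
  rotate i u ((Fin.rev i).succAbove j)

/-- After the rotation as a change of variables, the `i`-th integrand ignores the old base point,
which sits at the index `Fin.rev i`; summing over `i` integrates it over the whole circle, of length
one. -/
theorem sum_integral_rotPos {m : ℕ} {w : (Fin m → ℝ) → ℂ} (hw : Continuous w) :
    ∑ i : Fin (m + 1), ∫ u in simplex (m + 1), w (rotPos i u) = ∫ v in simplex m, w v := by
  rw [← sum_integral_simplex_removeNth hw]
  refine Fintype.sum_equiv Fin.revPerm _ _ fun i => ?_
  have h := (measurePreserving_rotate i).setIntegral_preimage_emb
    (Continuous.measurableEmbedding (γ := Fin (m + 1) → ℝ) (continuous_rotate i)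
      (rotate_injective i))
    (fun u : Fin (m + 1) → ℝ => w fun j => u ((Fin.rev i).succAbove j)) (simplex (m + 1))
  have h2 : rotate i ⁻¹' simplex (m + 1) = simplex (m + 1) :=
    Set.ext fun u => rotate_mem_simplex_iff i u
  rw [h2] at h
  exact h

end Rotation

end Sector
end TwistedTQM
end

/-! ### Coefficientwise integrals, and the derivative in a position -/

noncomputable section
namespace TwistedTQM

set_option linter.unusedSectionVars false

section Coefficients

open MvPowerSeries (coeff)

variable {ι κ : Type}

/-- The coefficient of `ħ ^ n x ^ d`. -/
def cf (n : ℤ) (d : ι →₀ ℕ) : Lau (PS ι) →ₗ[ℂ] ℂ := (coeff d).comp (lcoeff n)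

theorem cf_apply (n : ℤ) (d : ι →₀ ℕ) (x : Lau (PS ι)) : cf n d x = coeff d (lcoeff n x) := rfl

theorem cf_ext {x y : Lau (PS ι)} (h : ∀ n d, cf n d x = cf n d y) : x = y :=
  Lau.ext fun n => MvPowerSeries.ext fun d => h n d

theorem cf_hbar_smul (n : ℤ) (d : ι →₀ ℕ) (x : Lau (PS ι)) : cf n d (hbar • x) = cf (n - 1) d x := by
  rw [cf_apply, lcoeff_hbar_smul, cf_apply]

theorem FinDep.cf_mapC {φ : PS ι →ₗ[ℂ] PS κ} (hφ : FinDep φ) (d : κ →₀ ℕ) :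
    ∃ (s : Finset (ι →₀ ℕ)) (c : (ι →₀ ℕ) → ℂ), ∀ n x,
      cf n d (mapC φ x) = ∑ e ∈ s, c e * cf n e x := by
  obtain ⟨s, hs⟩ := hφ.coeff_eq d
  refine ⟨s, fun e => coeff d (φ (MvPowerSeries.monomial e 1)), fun n x => ?_⟩
  rw [cf_apply, lcoeff_mapC, hs]
  exact Finset.sum_congr rfl fun e _ => mul_comm _ _

theorem FinDep.continuous_coeff {X : Type*} [TopologicalSpace X] {φ : PS ι →ₗ[ℂ] PS κ}
    (hφ : FinDep φ) {s : X → PS ι} (hs : ∀ e, Continuous fun u => coeff e (s u)) (d : κ →₀ ℕ) :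
    Continuous fun u => coeff d (φ (s u)) := by
  obtain ⟨t, ht⟩ := hφ.coeff_eq d
  rw [funext fun u => ht (s u)]
  exact continuous_finsetSum _ fun e _ => (hs e).mul continuous_const

theorem FinDep.hasDerivAt_coeff {φ : PS ι →ₗ[ℂ] PS κ} (hφ : FinDep φ) {s : ℝ → PS ι} {s' : PS ι}
    {t : ℝ} (hs : ∀ e, HasDerivAt (fun u => coeff e (s u)) (coeff e s') t) (d : κ →₀ ℕ) :
    HasDerivAt (fun u => coeff d (φ (s u))) (coeff d (φ s')) t := by
  obtain ⟨t, ht⟩ := hφ.coeff_eq d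
  rw [funext fun u => ht (s u), ht s']
  exact HasDerivAt.fun_sum fun e _ => (hs e).mul_const _

theorem coeff_bi [Fintype ι] (Q : Matrix ι ι ℂ) (s : PS ι) (d : ι →₀ ℕ) :
    coeff d (bi Q s) = 1 / 2 * ∑ x, ∑ y, Q x y * coeff d ((pd x ∘ₗ pd y) s) := by
  simp only [bi, LinearMap.smul_apply, LinearMap.sum_apply, map_smul, map_sum, smul_eq_mul]
  rfl

theorem continuous_coeff_bi_pow [Fintype ι] {X : Type*} [TopologicalSpace X]
    {Q : X → Matrix ι ι ℂ} (hQ : ∀ x y, Continuous fun u => Q u x y) (p : ℕ) :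
    ∀ {s : X → PS ι} (_ : ∀ e, Continuous fun u => coeff e (s u)) (d : ι →₀ ℕ),
      Continuous fun u => coeff d ((bi (Q u) ^ p) (s u)) := by
  induction p with
  | zero => exact fun hs d => hs d
  | succ p ih =>
    intro s hs d
    simp only [pow_succ, Module.End.mul_apply]
    refine ih (fun e => ?_) d
    simp only [coeff_bi]
    exact continuous_const.mul (continuous_finsetSum _ fun x _ => continuous_finsetSum _ fun y _ =>
      (hQ x y).mul (((finDep_pd x).comp (finDep_pd y)).continuous_coeff hs e))

/-- Operators with constant coefficients commute, so the power rule holds as for numbers. For `p =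
0` the truncated exponent is harmless because of the factor `p`. -/
theorem hasDerivAt_coeff_bi_pow [Fintype ι] {Q : ℝ → Matrix ι ι ℂ} {R : Matrix ι ι ℂ} {t : ℝ}
    (hQ : ∀ x y, HasDerivAt (fun u => Q u x y) (R x y) t) (s : PS ι) (p : ℕ) : ∀ d : ι →₀ ℕ,
    HasDerivAt (fun u => coeff d ((bi (Q u) ^ p) s))
      (coeff d ((p : ℂ) • (bi (Q t) ^ (p - 1)) (bi R s))) t := by
  induction p with
  | zero =>
    intro d
    simpa using hasDerivAt_const t (coeff d s)
  | succ p ih =>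
    intro d
    have h1 : ∀ u, (bi (Q u) ^ (p + 1)) s = bi (Q u) ((bi (Q u) ^ p) s) := fun u => by
      rw [pow_succ', Module.End.mul_apply]
    simp only [h1, coeff_bi]
    refine (HasDerivAt.const_mul _ (HasDerivAt.fun_sum fun x _ => HasDerivAt.fun_sum fun y _ =>
      (hQ x y).fun_mul (((finDep_pd x).comp (finDep_pd y)).hasDerivAt_coeff ih d))).congr_deriv ?_
    simp only [Finset.sum_add_distrib, mul_add, ← coeff_bi]
    rw [← map_add]
    congr 1
    have hc : Commute (bi R) (bi (Q t) ^ p) := (bi_comm R (Q t)).pow_right p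
    have hc' := LinearMap.congr_fun hc.eq s
    simp only [Module.End.mul_apply] at hc'
    rw [hc', map_smul, ← Module.End.mul_apply (bi (Q t)), ← pow_succ']
    rcases Nat.eq_zero_or_pos p with rfl | hp
    · simp
    · rw [Nat.sub_add_cancel hp, Nat.add_sub_cancel]
      push_cast
      module

/-- Uniformly bounded below families of Laurent series with continuous coefficients. -/
structure ContFam {X : Type*} [TopologicalSpace X] (H : X → Lau (PS ι)) : Prop where
  bounded : ∃ N : ℤ, ∀ u, ∀ n < N, lcoeff n (H u) = 0
  continuous : ∀ n d, Continuous fun u => cf n d (H u)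

theorem ContFam.mapC {X : Type*} [TopologicalSpace X] {φ : PS ι →ₗ[ℂ] PS κ} (hφ : FinDep φ)
    {H : X → Lau (PS ι)} (h : ContFam H) : ContFam fun u => mapC φ (H u) where
  bounded := by
    obtain ⟨N, hN⟩ := h.bounded
    exact ⟨N, fun u n hn => by rw [lcoeff_mapC, hN u n hn, map_zero]⟩
  continuous n d := hφ.continuous_coeff (h.continuous n) d

theorem contFam_hexp_bi [Fintype ι] {X : Type*} [TopologicalSpace X] {Q : X → Matrix ι ι ℂ}
    (hQ : ∀ x y, Continuous fun u => Q u x y) (F : Lau (PS ι)) :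
    ContFam fun u => hexp (bi (Q u)) F where
  bounded := by
    obtain ⟨N, hN⟩ := exists_lcoeff_eq_zero F
    exact ⟨N, fun u n hn => of_symm_hexp_coeff_eq_zero _ F N hN n hn⟩
  continuous n d := by
    obtain ⟨N, hN⟩ := exists_lcoeff_eq_zero F
    have hn : n < N + (n - N + 1).toNat := by omega
    simp only [cf_apply, fun u => lcoeff_hexp (bi (Q u)) F hN hn, map_sum, map_smul]
    exact continuous_finsetSum _ fun p _ => continuous_const.mul (continuous_coeff_bi_pow hQ p
      (s := fun _ => lcoeff (n - p) F) (fun _ => continuous_const) d)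

theorem hasDerivAt_cf_hexp_bi [Fintype ι] {Q : ℝ → Matrix ι ι ℂ} {R : Matrix ι ι ℂ} {t : ℝ}
    (hQ : ∀ x y, HasDerivAt (fun u => Q u x y) (R x y) t) (F : Lau (PS ι)) (n : ℤ) (d : ι →₀ ℕ) :
    HasDerivAt (fun u => cf n d (hexp (bi (Q u)) F))
      (cf n d (hbar • hexp (bi (Q t)) (mapC (bi R) F))) t := by
  obtain ⟨N, hN⟩ := exists_lcoeff_eq_zero F
  have hn : n < N + ((n - N + 1).toNat + 1 : ℕ) := by omega
  have hN' : ∀ n < N, lcoeff n (mapC (bi R) F) = 0 := fun n hn => by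
    rw [lcoeff_mapC, hN n hn, map_zero]
  have hn' : n - 1 < N + ((n - N + 1).toNat : ℕ) := by omega
  have h := HasDerivAt.fun_sum (u := Finset.range ((n - N + 1).toNat + 1)) fun p _ =>
    (hasDerivAt_coeff_bi_pow hQ (lcoeff (n - p) F) p d).const_mul ((p.factorial : ℂ)⁻¹)
  have e : (fun u => cf n d (hexp (bi (Q u)) F)) = fun u =>
      ∑ p ∈ Finset.range ((n - N + 1).toNat + 1),
        (p.factorial : ℂ)⁻¹ * coeff d ((bi (Q u) ^ p) (lcoeff (n - p) F)) := funext fun u => by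
    rw [cf_apply, lcoeff_hexp _ F hN hn, map_sum]
    rfl
  rw [e]
  refine h.congr_deriv ?_
  · symm
    -- The term `p = 0` has derivative zero, and `(p + 1) / (p + 1)! = 1 / p!` shifts the rest by
    -- one power of `ħ`.
    rw [cf_hbar_smul, cf_apply, lcoeff_hexp _ _ hN' hn', map_sum, Finset.sum_range_succ']
    simp only [Nat.cast_zero, zero_smul, map_zero, lcoeff_mapC, mul_zero, add_zero]
    refine Finset.sum_congr rfl fun p _ => ?_
    rw [Nat.add_sub_cancel, map_smul, map_smul, smul_eq_mul, smul_eq_mul, ← mul_assoc,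
      Nat.factorial_succ]
    have : n - 1 - (p : ℤ) = n - ((p + 1 : ℕ) : ℤ) := by push_cast; ring
    rw [this]
    congr 1
    have h1 : ((p : ℂ) + 1) ≠ 0 := by exact_mod_cast Nat.succ_ne_zero p
    have h2 : (p.factorial : ℂ) ≠ 0 := by exact_mod_cast p.factorial_ne_zero
    push_cast
    field_simp

end Coefficients

namespace Sector

open MeasureTheory

section Integrals

variable {ι κ : Type} {m : ℕ}

/-- The Laurent series `x` is the integral of the family `H` over the simplex, coefficient by
coefficient. -/
def IsInt (m : ℕ) (H : (Fin m → ℝ) → Lau (PS ι)) (x : Lau (PS ι)) : Prop :=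
  ∀ n d, IntegrableOn (fun u => cf n d (H u)) (simplex m) ∧
    cf n d x = ∫ u in simplex m, cf n d (H u)

variable {H H' : (Fin m → ℝ) → Lau (PS ι)} {x x' : Lau (PS ι)}

theorem IsInt.unique (h : IsInt m H x) (h' : IsInt m H x') : x = x' :=
  cf_ext fun n d => (h n d).2.trans (h' n d).2.symm

theorem IsInt.congr (h : IsInt m H x) (e : ∀ u ∈ simplex m, H u = H' u) : IsInt m H' x := by
  intro n d
  have e' : Set.EqOn (fun u => cf n d (H u)) (fun u => cf n d (H' u)) (simplex m) := fun u hu => by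
    simp only [e u hu]
  exact ⟨(h n d).1.congr_fun e' (measurableSet_simplex m),
    (h n d).2.trans (setIntegral_congr_fun (measurableSet_simplex m) e')⟩

theorem IsInt.add (h : IsInt m H x) (h' : IsInt m H' x') :
    IsInt m (fun u => H u + H' u) (x + x') := fun n d => by
  simp only [map_add]
  exact ⟨(h n d).1.add (h' n d).1, by rw [(h n d).2, (h' n d).2, integral_add (h n d).1 (h' n d).1]⟩

theorem IsInt.zero : IsInt m (fun _ => 0) (0 : Lau (PS ι)) := fun n d => by
  simp only [map_zero]
  exact ⟨integrableOn_zero, by simp⟩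

theorem IsInt.smul (c : ℂ) (h : IsInt m H x) : IsInt m (fun u => c • H u) (c • x) := fun n d => by
  simp only [map_smul]
  exact ⟨(h n d).1.smul c, by rw [(h n d).2, integral_smul]⟩

theorem IsInt.hbar (h : IsInt m H x) : IsInt m (fun u => hbar • H u) (hbar • x) := fun n d => by
  simp only [cf_hbar_smul]
  exact h _ _

theorem IsInt.sum {β : Type*} (t : Finset β) {H : β → (Fin m → ℝ) → Lau (PS ι)}
    {x : β → Lau (PS ι)} (h : ∀ b ∈ t, IsInt m (H b) (x b)) :
    IsInt m (fun u => ∑ b ∈ t, H b u) (∑ b ∈ t, x b) := by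
  classical
  induction t using Finset.induction_on with
  | empty => simpa using IsInt.zero
  | insert b t hb ih =>
    simp only [Finset.sum_insert hb]
    exact (h b (Finset.mem_insert_self _ _)).add
      (ih fun c hc => h c (Finset.mem_insert_of_mem hc))

theorem IsInt.mapC {φ : PS ι →ₗ[ℂ] PS κ} (hφ : FinDep φ) (h : IsInt m H x) :
    IsInt m (fun u => mapC φ (H u)) (mapC φ x) := fun n d => by
  obtain ⟨s, c, hc⟩ := hφ.cf_mapC d
  simp only [hc]
  have hi : ∀ e ∈ s, IntegrableOn (fun u => c e * cf n e (H u)) (simplex m) := fun e _ =>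
    (h n e).1.const_mul (c e)
  refine ⟨integrable_finsetSum s hi, ?_⟩
  rw [integral_finsetSum s hi]
  refine Finset.sum_congr rfl fun e _ => ?_
  rw [integral_const_mul, (h n e).2]

/-- Each coefficient is integrable because the simplex lies in a compact cube, and the uniform lower
bound makes the integrals a Laurent series. -/
theorem _root_.TwistedTQM.ContFam.exists_isInt (h : ContFam H) : ∃ x, IsInt m H x := by
  obtain ⟨N, hN⟩ := h.bounded
  refine ⟨ofS (HahnSeries.ofSuppBddBelow (fun n d => ∫ u in simplex m, cf n d (H u))
    ⟨N, fun n hn => ?_⟩), fun n d => ⟨integrableOn_simplex (h.continuous n d), rfl⟩⟩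
  by_contra hlt
  apply hn
  funext d
  simp only [cf_apply, hN _ n (not_le.1 hlt), map_zero, integral_zero]
  rfl

theorem cf_K_smul (c : K) {A N : ℤ} (hA : ∀ n < A, c.coeff n = 0) (n : ℤ) (d : ι →₀ ℕ)
    (y : Lau (PS ι)) (hN : ∀ n < N, lcoeff n y = 0) :
    cf n d (c • y) = ∑ p ∈ Finset.range (n - A - N + 1).toNat,
      c.coeff (A + p) * cf (n - A - p) d y := by
  have h := coeff_smul_eq_sum_range c (toS y) A N n (n - A - N + 1).toNat hA hN (by omega)
  rw [cf_apply]
  change MvPowerSeries.coeff d (((HahnModule.of ℂ).symm (c • HahnModule.of ℂ (toS y))).coeff n) = _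
  rw [h, map_sum]
  rfl

/-- The common lower bound turns multiplication by the infinite series `c` into one finite sum for
all `u`, which commutes with the integral. -/
theorem IsInt.K_smul (c : K) (hb : ∃ N : ℤ, ∀ u, ∀ n < N, lcoeff n (H u) = 0) (h : IsInt m H x) :
    IsInt m (fun u => c • H u) (c • x) := fun n d => by
  obtain ⟨N, hN⟩ := hb
  have hx : ∀ n < N, lcoeff n x = 0 := fun n hn => MvPowerSeries.ext fun d => by
    have := (h n d).2
    simp only [cf_apply, hN _ n hn, map_zero, integral_zero] at this
    simpa using this
  have hA : ∀ n < c.order, c.coeff n = 0 := fun n hn => HahnSeries.coeff_eq_zero_of_lt_order hn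
  simp only [cf_K_smul c hA n d _ (hN _), cf_K_smul c hA n d _ hx]
  have hi : ∀ p ∈ Finset.range (n - c.order - N + 1).toNat, IntegrableOn
      (fun u => c.coeff (c.order + p) * cf (n - c.order - p) d (H u)) (simplex m) := fun p _ =>
    (h _ d).1.const_mul _
  refine ⟨integrable_finsetSum _ hi, ?_⟩
  rw [integral_finsetSum _ hi]
  refine Finset.sum_congr rfl fun p _ => ?_
  rw [integral_const_mul, (h _ d).2]

end Integrals

variable {G : Type*} [Group G] {k l r : ℕ} (D : Sector G k l r) {I : Type} [Fintype I]

theorem continuous_propMat {X : Type*} [TopologicalSpace X] {θ : X → I → ℝ} (hθ : Continuous θ)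
    (o : I → ℤ) (x y : I × Var k l) : Continuous fun u => D.propMat (θ u) o x y := by
  simp only [propMat, Matrix.of_apply, Matrix.add_apply, Matrix.smul_apply, smul_eq_mul]
  have h : ∀ α, Continuous fun u => θ u α := fun α => (continuous_apply α).comp hθ
  refine ((Continuous.mul (Complex.continuous_ofReal.comp ((h _).sub (h _))) continuous_const).add
    continuous_const).add continuous_const

theorem contFam_corr {X : Type*} [TopologicalSpace X] {θ : X → I → ℝ} (hθ : Continuous θ)
    (o : I → ℤ) (f : I → W k l) : ContFam fun u => D.corr (θ u) o f := by
  classical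
  exact (contFam_hexp_bi (D.continuous_propMat hθ o) _).mapC linSub_proj.finDep

/-- The derivative of the propagators with respect to the position of the point `p`. -/
theorem hasDerivAt_propMat [DecidableEq I] (θ : I → ℝ) (p : I) (t : ℝ) (o : I → ℤ)
    (x y : I × Var k l) : HasDerivAt (fun t => D.propMat (Function.update θ p t) o x y)
      ((Matrix.of fun x y : I × Var k l => (((if x.1 = p then 1 else 0) - (if y.1 = p then 1 else 0) : ℂ)
        * poissonY k l x.2 y.2)) x y) t := by
  simp only [propMat, Matrix.of_apply, Matrix.add_apply, Matrix.smul_apply, smul_eq_mul]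
  have h : ∀ α, HasDerivAt (fun t => Function.update θ p t α) (if α = p then 1 else 0 : ℝ) t := by
    intro α
    by_cases hα : α = p
    · subst hα
      simpa using hasDerivAt_id' t
    · simpa [hα] using hasDerivAt_const t (θ α)
  have h1 := (((h x.1).sub (h y.1)).ofReal_comp.mul_const (poissonY k l x.2 y.2))
  have h2 := (h1.add_const (1 / 2 * ordSign (o x.1) (o y.1) * poissonYZ ℂ k l x.2 y.2)).add_const
    (D.propLoop x.2 y.2)
  refine h2.congr_deriv ?_
  split_ifs <;> simp

theorem sum_poissonY_smul {M : Type*} [AddCommGroup M] [Module ℂ M] (T : Var k l → Var k l → M) :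
    ∑ x, ∑ y, poissonY k l x y • T x y
      = ∑ a, ∑ b, poisson ℂ k a b • T (Sum.inl a) (Sum.inl b) := by
  rw [Fintype.sum_sum_type]
  simp only [Fintype.sum_sum_type (α₁ := YVar k) (α₂ := YVar l), poissonY, Matrix.fromBlocks_apply₁₁,
    Matrix.fromBlocks_apply₁₂, Matrix.fromBlocks_apply₂₁, Matrix.fromBlocks_apply₂₂,
    Matrix.zero_apply, zero_smul, Finset.sum_const_zero, add_zero]

/-- Only lines from `p` to other points depend on the position of `p`. By antisymmetry of `ω_Y`
their derivative is symmetrically equivalent to `-2 ω_Y` from every point to `p`, the terms from `p`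
to itself vanishing; the sum over all points is a total derivative once the points are identified.
-/
theorem proj_comp_bi [DecidableEq I] (p : I) :
    (proj I k l).toLinearMap ∘ₗ bi (Matrix.of fun x y : I × Var k l =>
        (((if x.1 = p then 1 else 0) - (if y.1 = p then 1 else 0) : ℂ) * poissonY k l x.2 y.2))
      = -∑ a, ∑ b, poisson ℂ k a b • (pd a ∘ₗ (proj I k l).toLinearMap ∘ₗ pd (p, Sum.inl b)) := by
  have hT : ∀ i j, poissonY k l j i = -poissonY k l i j := fun i j =>
    congrFun (congrFun (poissonY_transpose k l) i) j
  have e1 : bi (Matrix.of fun x y : I × Var k l =>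
        (((if x.1 = p then 1 else 0) - (if y.1 = p then 1 else 0) : ℂ) * poissonY k l x.2 y.2))
      = bi (Matrix.of fun x y : I × Var k l => -2 * ((if y.1 = p then 1 else 0) * poissonY k l x.2 y.2)) :=
    bi_congr fun x y => by
      simp only [Matrix.of_apply, hT x.2 y.2]
      ring
  have hpd : ∀ a, pd a ∘ₗ (proj I k l).toLinearMap
      = (proj I k l).toLinearMap ∘ₗ ∑ α, pd (α, Sum.inl a) := by
    intro a
    rw [(linSub_proj (I := I) (k := k) (l := l)).pd_comp a]
    congr 1
    rw [Fintype.sum_prod_type]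
    refine Finset.sum_congr rfl fun α _ => ?_
    simp [ite_smul, Finset.sum_ite_eq']
  rw [e1]
  simp only [← LinearMap.comp_assoc, hpd]
  refine LinearMap.ext fun s => ?_
  have e2 : bi (Matrix.of fun x y : I × Var k l => -2 * ((if y.1 = p then 1 else 0) * poissonY k l x.2 y.2)) s
      = -∑ α, ∑ a, ∑ b, poisson ℂ k a b • pd (α, Sum.inl a) (pd (p, Sum.inl b) s) := by
    have e3 : ∀ α x, ∑ β, ∑ y, (-2 * ((if β = p then (1 : ℂ) else 0) * poissonY k l x y)) •
          pd (α, x) (pd (β, y) s) = (-2 : ℂ) • ∑ y, poissonY k l x y • pd (α, x) (pd (p, y) s) := by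
      intro α x
      rw [Finset.sum_eq_single p (fun β _ h => by simp [h]) (by simp), Finset.smul_sum]
      simp only [if_true, one_mul, mul_smul]
    simp only [bi, Matrix.of_apply, LinearMap.smul_apply, LinearMap.sum_apply,
      Module.End.mul_apply, Fintype.sum_prod_type]
    simp only [e3, ← Finset.smul_sum, smul_smul, sum_poissonY_smul]
    norm_num
  rw [LinearMap.comp_apply, e2]
  simp only [LinearMap.sum_apply, LinearMap.neg_apply, LinearMap.comp_apply, LinearMap.smul_apply,
    map_neg, map_sum, map_smul]
  rw [Finset.sum_comm]
  congr 1
  refine Finset.sum_congr rfl fun a _ => ?_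
  rw [Finset.sum_comm]
  refine Finset.sum_congr rfl fun b _ => ?_
  rw [Finset.smul_sum]

/-- The dependence of the correlation function on the position of the point `p`. -/
theorem hasDerivAt_corr [DecidableEq I] (θ : I → ℝ) (p : I) (t : ℝ) (o : I → ℤ) (f : I → W k l)
    (n : ℤ) (d : YVar k →₀ ℕ) :
    HasDerivAt (fun t => cf n d (D.corr (Function.update θ p t) o f))
      (cf n d (-(hbar • ∑ a, ∑ b, poisson ℂ k a b • mapC (pd a) (D.corr (Function.update θ p t) o
        (Function.update f p (mapC (pd (Sum.inl b)) (f p))))))) t := by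
  set R : Matrix (I × Var k l) (I × Var k l) ℂ := Matrix.of fun x y : I × Var k l =>
    (((if x.1 = p then 1 else 0) - (if y.1 = p then 1 else 0) : ℂ) * poissonY k l x.2 y.2) with hR
  have h1 : HasDerivAt (fun t => cf n d (D.corr (Function.update θ p t) o f))
      (MvPowerSeries.coeff d (proj I k l (lcoeff n
        (hbar • hexp (bi (D.propMat (Function.update θ p t) o)) (mapC (bi R) (ofS (emb f))))))) t :=
    FinDep.hasDerivAt_coeff (linSub_proj (I := I) (k := k) (l := l)).finDep
      (fun e => hasDerivAt_cf_hexp_bi (fun x y => D.hasDerivAt_propMat θ p t o x y) _ n e) d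
  refine h1.congr_deriv ?_
  rw [commute_hexp_mapC (bi_comm _ _)]
  change cf n d (mapC (proj I k l).toLinearMap (hbar • mapC (bi R) _)) = _
  rw [map_smul, mapC_comp, hR, proj_comp_bi, ← smul_neg]
  congr 2
  have e : ∀ (φ : PS (I × Var k l) →ₗ[ℂ] PS (YVar k)) x, mapC (-φ) x = -mapC φ x := fun φ x => rfl
  rw [e]
  congr 1
  simp only [mapC_sum, mapC_smul]
  refine Finset.sum_congr rfl fun a _ => Finset.sum_congr rfl fun b _ => ?_
  rw [← mapC_comp, ← mapC_comp, ← commute_hexp_mapC (bi_comm_pd _ _), mapC_pd_emb]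
  rfl

section Integral

variable {m : ℕ}

theorem pos_continuous : Continuous (pos : (Fin m → ℝ) → Fin (m + 1) → ℝ) := by
  refine continuous_pi fun α => ?_
  refine Fin.cases continuous_const (fun q => ?_) α
  exact continuous_apply q

/-- Lines and loops commute, so their exponentials merge. The right side keeps the order keys fixed
and is therefore continuous in `u` everywhere, unlike a formula that compares positions. -/
theorem integrand_eq (F : Lau (PS (Fin (m + 1) × Var k l))) {u : Fin m → ℝ} (hu : u ∈ simplex m) :
    D.integrand F u
      = mapC (proj (Fin (m + 1)) k l).toLinearMap (hexp (bi (D.propMat (pos u) (ordKey m))) F) := by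
  rw [← D.lines_add_loops u hu, ← hexp_add]
  · rfl
  · have h1 : ∀ (P : Matrix (Var k l) (Var k l) ℂ) (α β : Fin (m + 1)) (P' : Matrix (Var k l) (Var k l) ℂ)
        (α' β' : Fin (m + 1)), Commute (lineOp P α β) (lineOp P' α' β') := by
      intro P α β P' α' β'
      unfold lineOp
      refine Commute.sum_left _ _ _ fun i _ => Commute.sum_left _ _ _ fun j _ =>
        Commute.sum_right _ _ _ fun i' _ => Commute.sum_right _ _ _ fun j' _ =>
        Commute.smul_left (Commute.smul_right ?_ _) _
      exact Commute.mul_left (Commute.mul_right (pd_comm _ _) (pd_comm _ _))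
        (Commute.mul_right (pd_comm _ _) (pd_comm _ _))
    unfold lines loops
    refine Commute.smul_left (Commute.smul_right (Commute.sum_left _ _ _ fun α _ =>
      Commute.sum_left _ _ _ fun β _ => Commute.sum_right _ _ _ fun γ _ => ?_) _) _
    split_ifs
    · exact Commute.zero_left _
    · exact h1 _ _ _ _ _ _

theorem isInt_integral (F : Lau (PS (Fin (m + 1) × Var k l))) :
    IsInt m (fun u => mapC (proj (Fin (m + 1)) k l).toLinearMap
      (hexp (bi (D.propMat (pos u) (ordKey m))) F)) (D.integral F) := by
  have hc : ContFam (fun u => mapC (proj (Fin (m + 1)) k l).toLinearMap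
      (hexp (bi (D.propMat (pos u) (ordKey m))) F)) :=
    (contFam_hexp_bi (D.continuous_propMat pos_continuous _) F).mapC linSub_proj.finDep
  obtain ⟨x, hx⟩ := hc.exists_isInt
  have h : IsInt m (fun u => D.integrand F u) x := hx.congr fun u hu => (D.integrand_eq F hu).symm
  have : D.integral F = x := cf_ext fun n d => (h n d).2.symm
  rw [this]
  exact hx

/-- The integral over the simplex as a linear map. -/
def integralL (m : ℕ) : Lau (PS (Fin (m + 1) × Var k l)) →ₗ[K] Lau (PS (YVar k)) where
  toFun := D.integral
  map_add' F F' := (D.isInt_integral (F + F')).unique (by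
    simp only [map_add]
    exact (D.isInt_integral F).add (D.isInt_integral F'))
  map_smul' c F := (D.isInt_integral (c • F)).unique (by
    simp only [map_smul]
    exact (D.isInt_integral F).K_smul c
      ((contFam_hexp_bi (D.continuous_propMat pos_continuous _) F).mapC linSub_proj.finDep).bounded)

/-- The correlation function integrated over the simplex. -/
def corrInt (m : ℕ) : MultilinearMap ℂ (fun _ : Fin (m + 1) => W k l) (Lau (PS (YVar k))) where
  toFun f := D.integral (ofS (emb f))
  map_update_add' {d} f α x y := by
    rw [Subsingleton.elim d (Classical.decEq _)]
    refine (D.isInt_integral _).unique (((D.isInt_integral _).add (D.isInt_integral _)).congr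
      fun u _ => ?_)
    exact (@wick_update_add _ _ _ _ (Classical.decEq _) _ f α x y).symm
  map_update_smul' {d} f α c x := by
    rw [Subsingleton.elim d (Classical.decEq _)]
    refine (D.isInt_integral _).unique (((D.isInt_integral _).smul c).congr fun u _ => ?_)
    exact (@wick_update_smul _ _ _ _ (Classical.decEq _) _ f α c x).symm

theorem isInt_corrInt (f : Fin (m + 1) → W k l) :
    IsInt m (fun u => D.corr (pos u) (ordKey m) f) (D.corrInt m f) := D.isInt_integral _

theorem exists_isInt_corr {θ : (Fin m → ℝ) → I → ℝ} (hθ : Continuous θ) (o : I → ℤ) (f : I → W k l) :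
    ∃ x, IsInt m (fun u => D.corr (θ u) o f) x := (D.contFam_corr hθ o f).exists_isInt

end Integral

end Sector
end TwistedTQM
end

/-! ### Boundary terms: the Hochschild operator and `ħ Δ` -/

noncomputable section
namespace TwistedTQM

set_option linter.unusedSectionVars false

section Leibniz

variable {k l : ℕ}

theorem pd_star (y : Var k l) (p q : W k l) :
    mapC (pd y) (star p q) = star (mapC (pd y) p) q + star p (mapC (pd y) q) := by
  have h : pd y ∘ₗ (diag : PS (Fin 2 × Var k l) →ₐ[ℂ] _).toLinearMap
      = (diag : PS (Fin 2 × Var k l) →ₐ[ℂ] _).toLinearMap ∘ₗ (pd (0, y) + pd (1, y)) := by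
    rw [linSub_diag.pd_comp y]
    congr 1
    rw [Fintype.sum_prod_type, Fin.sum_univ_two]
    simp [ite_smul]
  have e0 : Function.update ![p, q] 0 (mapC (pd y) (![p, q] 0)) = ![mapC (pd y) p, q] := by
    ext a; fin_cases a <;> rfl
  have e1 : Function.update ![p, q] 1 (mapC (pd y) (![p, q] 1)) = ![p, mapC (pd y) q] := by
    ext a; fin_cases a <;> rfl
  rw [star_eq, mapC_comp, h, ← mapC_comp, mapC_add, map_add,
    ← commute_hexp_mapC (bi_comm_pd _ _), ← commute_hexp_mapC (bi_comm_pd _ _), mapC_pd_emb,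
    mapC_pd_emb, e0, e1, ← star_eq, ← star_eq]

end Leibniz

section FinLemmas

theorem val_predAbove {m : ℕ} (p : Fin (m + 1)) (x : Fin (m + 2)) :
    (p.val < x.val ∧ (p.predAbove x).val = x.val - 1) ∨
      (x.val ≤ p.val ∧ (p.predAbove x).val = x.val) := by
  unfold Fin.predAbove
  split_ifs with h
  · exact Or.inl ⟨h, rfl⟩
  · exact Or.inr ⟨not_lt.1 h, rfl⟩

theorem contractNth_predAbove {α : Type*} {m : ℕ} (op : α → α → α) (p : Fin (m + 1))
    (f : Fin (m + 2) → α) (x : Fin (m + 2)) (h : x ≠ p.castSucc) (h' : x ≠ p.succ) :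
    Fin.contractNth p.castSucc op f (p.predAbove x) = f x := by
  have hx : x.val ≠ p.val := fun e => h (Fin.ext e)
  have hx' : x.val ≠ p.val + 1 := fun e => h' (Fin.ext e)
  rcases val_predAbove p x with ⟨h1, h2⟩ | ⟨h1, h2⟩
  · rw [Fin.contractNth_apply_of_gt _ _ _ _ (by rw [Fin.val_castSucc]; omega)]
    congr 1
    ext
    rw [Fin.val_succ]
    omega
  · rw [Fin.contractNth_apply_of_lt _ _ _ _ (by rw [Fin.val_castSucc]; omega)]
    congr 1
    ext
    rw [Fin.val_castSucc, h2]

theorem contractNth_self {α : Type*} {m : ℕ} (op : α → α → α) (p : Fin (m + 1))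
    (f : Fin (m + 2) → α) : Fin.contractNth p.castSucc op f p = op (f p.castSucc) (f p.succ) :=
  Fin.contractNth_apply_of_eq _ _ _ _ rfl

theorem predAbove_eq_self_iff {m : ℕ} (p : Fin (m + 1)) (x : Fin (m + 2)) :
    p.predAbove x = p ↔ x = p.castSucc ∨ x = p.succ := by
  constructor
  · intro h
    by_contra hx
    push Not at hx
    have h1 := Fin.succAbove_predAbove hx.1
    have h2 := Fin.succ_succAbove_predAbove hx.2
    rw [h] at h1 h2
    rw [Fin.succAbove_castSucc_self] at h1
    exact hx.2 h1.symm
  · rintro (rfl | rfl)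
    · simp
    · simp

end FinLemmas

namespace Sector

open MeasureTheory

variable {G : Type*} [Group G] {k l r : ℕ} (D : Sector G k l r)

theorem IsInt.neg {ι : Type} {m : ℕ} {H : (Fin m → ℝ) → Lau (PS ι)} {x : Lau (PS ι)}
    (h : IsInt m H x) : IsInt m (fun u => -H u) (-x) := fun n d => by
  simp only [map_neg]
  exact ⟨(h n d).1.neg, by rw [(h n d).2, integral_neg]⟩

theorem pos_insertNth {m : ℕ} (q : Fin (m + 1)) (t s : ℝ) (v : Fin m → ℝ) :
    pos (q.insertNth t v) = Function.update (pos (q.insertNth s v)) q.succ t := by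
  unfold pos
  rw [← Fin.cons_update, Fin.update_insertNth]

/-- The Stokes formula for the correlation function and the position of the point `q + 1`. -/
theorem corr_stokes {m : ℕ} (q : Fin (m + 1)) (f : Fin (m + 2) → W k l) {x y : Lau (PS (YVar k))}
    (hx : IsInt m (fun v => D.corr (pos (q.insertNth (endpt v q.succ) v)) (ordKey (m + 1)) f) x)
    (hy : IsInt m (fun v => D.corr (pos (q.insertNth (endpt v q.castSucc) v)) (ordKey (m + 1)) f) y) :
    x - y = -(hbar • ∑ a, ∑ b, poisson ℂ k a b • mapC (pd a)
      (D.corrInt (m + 1) (Function.update f q.succ (mapC (pd (Sum.inl b)) (f q.succ))))) := by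
  refine cf_ext fun n d => ?_
  have h := IsInt.neg (IsInt.hbar (IsInt.sum (Finset.univ : Finset (YVar k)) fun a _ =>
    IsInt.sum (Finset.univ : Finset (YVar k)) fun b _ => ((D.isInt_corrInt (m := m + 1)
      (Function.update f q.succ (mapC (pd (Sum.inl b)) (f q.succ)))).mapC
        (finDep_pd a)).smul (poisson ℂ k a b)))
  rw [(h n d).2, map_sub, (hx n d).2, (hy n d).2, ← integral_sub (hx n d).1 (hy n d).1]
  -- The integrand of the right side is the derivative of the correlation function in the coordinate
  -- `q`.
  refine (integral_simplex_deriv q (w := fun u => cf n d (D.corr (pos u) (ordKey (m + 1)) f))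
    ?_ fun v t => ?_).symm
  · simp only [map_neg, cf_hbar_smul, map_sum, map_smul]
    exact Continuous.neg (continuous_finsetSum _ fun a _ => continuous_finsetSum _ fun b _ =>
      Continuous.mul continuous_const (((D.contFam_corr pos_continuous _ _).mapC (finDep_pd a)).continuous _ _))
  · have h1 := D.hasDerivAt_corr (pos (q.insertNth 0 v)) q.succ t (ordKey (m + 1)) f n d
    simp only [← pos_insertNth] at h1
    exact h1

theorem ordKey_cases (m : ℕ) (s : Fin (m + 1)) :
    (s.val = 0 ∧ ordKey m s = m) ∨ (0 < s.val ∧ ordKey m s = (s.val : ℤ) - 1) := by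
  unfold ordKey
  refine Fin.cases ?_ (fun q => ?_) s
  · simp
  · simp

/-- `Fin.predAbove p` is the map of points that identifies the neighbours `p` and `p + 1` and
nothing else. -/
theorem corr_merge_predAbove {m : ℕ} (p : Fin (m + 1)) (θ : Fin (m + 1) → ℝ) (o : Fin (m + 1) → ℤ)
    (o' : Fin (m + 2) → ℤ) (hlt : o' p.castSucc < o' p.succ)
    (ho : ∀ x y, p.predAbove x ≠ p.predAbove y →
      (o' x < o' y ↔ o (p.predAbove x) < o (p.predAbove y)))
    (f : Fin (m + 2) → W k l) (f' : Fin (m + 1) → W k l)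
    (h0 : f' p = star (f p.castSucc) (f p.succ))
    (h1 : ∀ x, x ≠ p.castSucc → x ≠ p.succ → f' (p.predAbove x) = f x) :
    D.corr θ o f' = D.corr (θ ∘ p.predAbove) o' f := by
  have e1 : p.predAbove p.castSucc = p := by simp
  have e2 : p.predAbove p.succ = p := by simp
  refine D.corr_merge (a := p.castSucc) (b := p.succ) (Fin.castSucc_lt_succ).ne (e1.trans e2.symm)
    (fun j hj => ?_) (fun x hx => ?_) θ o o' hlt ho f f' (by rw [e1, h0]) h1
  · rw [e1] at hj
    refine ⟨p.castSucc.succAbove j, ?_, fun y hy => ?_⟩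
    · rcases lt_or_ge j p with h | h
      · rw [Fin.succAbove_of_castSucc_lt _ _ (by simpa using h)]
        exact Fin.predAbove_castSucc_of_le _ _ h.le
      · rw [Fin.succAbove_of_le_castSucc _ _ (by simpa using h)]
        exact Fin.predAbove_succ_of_le _ _ h
    · have h2 : y ≠ p.castSucc := by
        rintro rfl
        exact hj (hy.symm.trans e1)
      have := Fin.succAbove_predAbove h2
      rw [← this]
      exact congrArg _ hy
  · exact (predAbove_eq_self_iff p x).1 (hx.trans e1)

/-- The functions `f`, all but the ones at the points `0` and `q + 1` differentiated. -/
def partialFam {m : ℕ} (f : Fin (m + 2) → W k l) (q : Fin (m + 1)) (i : Fin m → YVar k) :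
    Fin (m + 2) → W k l :=
  Fin.cons (f 0) (q.insertNth (f q.succ) fun s => mapC (pd (Sum.inl (i s))) (f (q.succAbove s).succ))

theorem partialFam_zero {m : ℕ} (f : Fin (m + 2) → W k l) (q : Fin (m + 1)) (i : Fin m → YVar k) :
    partialFam f q i 0 = f 0 := rfl

theorem partialFam_same {m : ℕ} (f : Fin (m + 2) → W k l) (q : Fin (m + 1)) (i : Fin m → YVar k) :
    partialFam f q i q.succ = f q.succ := by
  simp [partialFam]

theorem partialFam_succAbove {m : ℕ} (f : Fin (m + 2) → W k l) (q : Fin (m + 1)) (i : Fin m → YVar k)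
    (s : Fin m) : partialFam f q i (q.succAbove s).succ
      = mapC (pd (Sum.inl (i s))) (f (q.succAbove s).succ) := by
  simp [partialFam]

/-- The functions `f`, all but the one at the point `0` differentiated. -/
def dFam {m : ℕ} (f : Fin (m + 1) → W k l) (i : Fin m → YVar k) : Fin (m + 1) → W k l :=
  Fin.cons (f 0) fun q => mapC (pd (Sum.inl (i q))) (f q.succ)

theorem corr_update_add {m : ℕ} (θ : Fin (m + 1) → ℝ) (o : Fin (m + 1) → ℤ) (f : Fin (m + 1) → W k l)
    (s : Fin (m + 1)) {x y : W k l} (h : f s = x + y) : D.corr θ o f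
      = D.corr θ o (Function.update f s x) + D.corr θ o (Function.update f s y) := by
  have := wick_update_add (D.propMat θ o) f s x y
  rw [← h, Function.update_eq_self] at this
  exact this

theorem pos_predAbove {m : ℕ} (i : Fin m) (q : Fin (m + 1)) (hq : i.predAbove q = i)
    (hq' : ∀ s, i.predAbove (q.succAbove s) = s) (v : Fin m → ℝ) :
    pos v ∘ i.succ.predAbove = pos (q.insertNth (v i) v) := by
  funext x
  refine Fin.cases ?_ (fun y => ?_) x
  · simp [pos]
  · simp only [Function.comp, Fin.succ_predAbove_succ, pos, Fin.cons_succ]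
    rcases Fin.eq_self_or_eq_succAbove q y with rfl | ⟨s, rfl⟩
    · simp [hq]
    · simp [hq']

theorem ordKey_predAbove {m : ℕ} (i : Fin m) (x y : Fin (m + 2))
    (h : i.succ.predAbove x ≠ i.succ.predAbove y) : ordKey (m + 1) x < ordKey (m + 1) y ↔
      ordKey m (i.succ.predAbove x) < ordKey m (i.succ.predAbove y) := by
  have h' : (i.succ.predAbove x).val ≠ (i.succ.predAbove y).val := fun e => h (Fin.ext e)
  have h1 := val_predAbove i.succ x
  have h2 := val_predAbove i.succ y
  have h3 := ordKey_cases (m + 1) x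
  have h4 := ordKey_cases (m + 1) y
  have h5 := ordKey_cases m (i.succ.predAbove x)
  have h6 := ordKey_cases m (i.succ.predAbove y)
  rw [Fin.val_succ] at h1 h2
  have := x.isLt
  have := y.isLt
  have := i.isLt
  push_cast at *
  omega

-- By the Leibniz rule the derivative of a product falls on one factor. If the left factor stays
-- undifferentiated, its point has reached the upper end of its interval; if the right one does, its
-- point has reached the lower end. So an interior collision yields two boundary terms.
set_option maxHeartbeats 800000 in
theorem corr_contract_interior {m : ℕ} (f : Fin (m + 2) → W k l) (i : Fin m) (j : Fin m → YVar k)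
    (v : Fin m → ℝ) :
    D.corr (pos v) (ordKey m) (dFam (Fin.contractNth i.succ.castSucc (fun a b => star a b) f) j)
      = D.corr (pos (i.castSucc.insertNth (endpt v i.castSucc.succ) v)) (ordKey (m + 1))
          (partialFam f i.castSucc j)
        + D.corr (pos (i.succ.insertNth (endpt v i.succ.castSucc) v)) (ordKey (m + 1))
          (partialFam f i.succ j) := by
  have hlt : ordKey (m + 1) i.succ.castSucc < ordKey (m + 1) i.succ.succ := by
    simp [ordKey]
  have hs : dFam (Fin.contractNth i.succ.castSucc (fun a b => star a b) f) j i.succ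
      = star (f i.castSucc.succ) (mapC (pd (Sum.inl (j i))) (f i.succ.succ)) +
        star (mapC (pd (Sum.inl (j i))) (f i.castSucc.succ)) (f i.succ.succ) := by
    unfold dFam
    rw [Fin.cons_succ, contractNth_self, pd_star, add_comm]
    rfl
  have hc : ∀ x, x ≠ i.succ.castSucc → x ≠ i.succ.succ → ∀ z, Function.update
      (dFam (Fin.contractNth i.succ.castSucc (fun a b => star a b) f) j) i.succ z
        (i.succ.predAbove x) = Fin.cases (motive := fun _ => W k l) (f 0)
          (fun y => mapC (pd (Sum.inl (j (i.predAbove y)))) (f y.succ)) x := by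
    intro x hx hx' z
    rw [Function.update_of_ne (fun h => ((predAbove_eq_self_iff _ _).1 h).elim hx hx')]
    revert hx hx'
    refine Fin.cases (fun _ _ => ?_) (fun y hx hx' => ?_) x
    · have h0 : i.succ.predAbove (0 : Fin (m + 2)) = 0 := by simp
      have h1 := contractNth_predAbove (fun a b => star a b) i.succ f 0 (by
        simp [Fin.ext_iff]) (by simp [Fin.ext_iff])
      rw [h0] at h1 ⊢
      exact h1
    · have h1 := contractNth_predAbove (fun a b => star a b) i.succ f y.succ hx hx'
      rw [Fin.succ_predAbove_succ] at h1 ⊢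
      unfold dFam
      rw [Fin.cons_succ, h1]
      rfl
  have q1 : ∀ s, i.predAbove (i.castSucc.succAbove s) = s := fun s =>
    Fin.succAbove_right_injective (p := i.castSucc)
      (Fin.succAbove_predAbove (Fin.succAbove_ne _ _))
  have q2 : ∀ s, i.predAbove (i.succ.succAbove s) = s := fun s =>
    Fin.succAbove_right_injective (p := i.succ)
      (Fin.succ_succAbove_predAbove (Fin.succAbove_ne _ _))
  rw [D.corr_update_add _ _ _ i.succ hs]
  congr 1
  · rw [D.corr_merge_predAbove i.succ (pos v) (ordKey m) (ordKey (m + 1)) hlt (ordKey_predAbove i)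
      (partialFam f i.castSucc j), pos_predAbove i i.castSucc (by simp) q1, endpt_mid]
    · rw [Function.update_self]
      have e1 := partialFam_same f i.castSucc j
      have e2 := partialFam_succAbove f i.castSucc j i
      rw [Fin.succAbove_castSucc_self] at e2
      rw [Fin.succ_castSucc] at e1
      rw [e1, e2, Fin.succ_castSucc]
    · intro x hx hx'
      rw [hc x hx hx']
      revert hx hx'
      refine Fin.cases (fun _ _ => rfl) (fun y hx hx' => ?_) x
      have hy : y ≠ i.castSucc := fun h => hx (by rw [h]; rfl)
      have := partialFam_succAbove f i.castSucc j (i.predAbove y)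
      rw [Fin.succAbove_predAbove hy] at this
      exact this.symm
  · rw [D.corr_merge_predAbove i.succ (pos v) (ordKey m) (ordKey (m + 1)) hlt (ordKey_predAbove i)
      (partialFam f i.succ j), pos_predAbove i i.succ (by simp) q2]
    · rw [← Fin.succ_castSucc, endpt_mid]
    · rw [Function.update_self]
      have e1 := partialFam_succAbove f i.succ j i
      rw [Fin.succAbove_succ_self, Fin.succ_castSucc] at e1
      rw [e1, partialFam_same f i.succ j, Fin.succ_castSucc]
    · intro x hx hx'
      rw [hc x hx hx']
      revert hx hx'
      refine Fin.cases (fun _ _ => rfl) (fun y hx hx' => ?_) x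
      have hy : y ≠ i.succ := fun h => hx' (by rw [h])
      have := partialFam_succAbove f i.succ j (i.predAbove y)
      rw [Fin.succ_succAbove_predAbove hy] at this
      exact this.symm

/-- The product `a_0 ⋆ g a_1` splits into points at the position `1`, the twisted one being last.
`corr_wrap` removes `g` and puts that point at `0` in front, which is the facet where the first
position is zero. The intermediate keys give the point `1` the value `m + 1` and lower all others by
one. -/
theorem corr_contract_first {m : ℕ} (f : Fin (m + 2) → W k l) (j : Fin m → YVar k) (v : Fin m → ℝ) :
    D.corr (pos v) (ordKey m) (dFam (Fin.contractNth 0 (fun a b => star a b)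
        fun s => if s = 1 then D.actW D.g (f s) else f s) j)
      = D.corr (pos ((0 : Fin (m + 1)).insertNth (endpt v (0 : Fin (m + 1)).castSucc) v))
          (ordKey (m + 1)) (partialFam f 0 j) := by
  have hw := D.corr_wrap (fun s : Fin (m + 2) => s = 1) (pos v ∘ (0 : Fin (m + 1)).predAbove)
    (fun s => if s.val = 1 then (m : ℤ) + 1 else ordKey (m + 1) s - 1) (ordKey (m + 1))
    (fun α β hα hβ => ?_) (fun α β hα hβ => by simp [hα, hβ]) (fun α β hα hβ => ?_)
    (partialFam f 0 j)
  · have hθ : (fun s : Fin (m + 2) => if s = 1 then (pos v ∘ (0 : Fin (m + 1)).predAbove) s - 1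
        else (pos v ∘ (0 : Fin (m + 1)).predAbove) s)
        = pos ((0 : Fin (m + 1)).insertNth (endpt v (0 : Fin (m + 1)).castSucc) v) := by
      funext s
      refine Fin.cases ?_ (fun t => Fin.cases ?_ (fun s => ?_) t) s
      · simp [pos]
      · have : (Fin.succ 0 : Fin (m + 2)) = 1 := rfl
        simp [pos, this, endpt_zero]
      · have h1 : s.succ.succ ≠ (1 : Fin (m + 2)) := by simp [Fin.ext_iff]
        simp only [h1, if_false, Function.comp]
        have h2 : (0 : Fin (m + 1)).predAbove s.succ.succ = s.succ := by simp
        rw [h2]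
        simp [pos]
    rw [hθ] at hw
    rw [← hw]
    refine D.corr_merge_predAbove 0 (pos v) (ordKey m) _ ?_ (fun x y hxy => ?_) _ _ ?_ fun x hx hx' => ?_
    · have h1 := ordKey_cases (m + 1) (0 : Fin (m + 1)).castSucc
      simp at h1
      simp [h1]
    · have h' : ((0 : Fin (m + 1)).predAbove x).val ≠ ((0 : Fin (m + 1)).predAbove y).val :=
        fun e => hxy (Fin.ext e)
      have h1 := val_predAbove 0 x
      have h2 := val_predAbove 0 y
      have h3 := ordKey_cases (m + 1) x
      have h4 := ordKey_cases (m + 1) y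
      have h5 := ordKey_cases m ((0 : Fin (m + 1)).predAbove x)
      have h6 := ordKey_cases m ((0 : Fin (m + 1)).predAbove y)
      rw [Fin.val_zero] at h1 h2
      have := x.isLt
      have := y.isLt
      push_cast at *
      split_ifs <;> omega
    · have e0 : (0 : Fin (m + 1)).castSucc ≠ (1 : Fin (m + 2)) := by simp
      have e1 : (0 : Fin (m + 1)).succ = (1 : Fin (m + 2)) := rfl
      have e2 := partialFam_same f 0 j
      rw [e1] at e2
      rw [if_neg e0, if_pos e1, e1, e2, ← e1]
      unfold dFam
      rw [Fin.cons_zero]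
      have h := contractNth_self (fun a b => star a b) (0 : Fin (m + 1))
        (fun s => if s = 1 then D.actW D.g (f s) else f s)
      rw [if_neg e0, ← e1, if_pos rfl] at h
      exact h
    · revert hx hx'
      refine Fin.cases (fun hx => absurd rfl hx) (fun t => Fin.cases (fun _ hx' => absurd rfl hx')
        (fun t _ _ => ?_) t) x
      have h1 : t.succ.succ ≠ (1 : Fin (m + 2)) := by simp [Fin.ext_iff]
      have h2 : (0 : Fin (m + 1)).predAbove t.succ.succ = t.succ := by simp
      have h3 := contractNth_predAbove (fun a b => star a b) 0
        (fun s => if s = 1 then D.actW D.g (f s) else f s) t.succ.succ (by simp [Fin.ext_iff])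
        (by simp [Fin.ext_iff])
      have h4 := partialFam_succAbove f 0 j t
      rw [Fin.succAbove_zero] at h4
      rw [h2, if_neg h1] at h3
      rw [if_neg h1, h2, h4]
      unfold dFam
      rw [Fin.cons_succ]
      exact congrArg _ h3
  · have h1 : β.val ≠ 1 := fun e => hβ (Fin.ext e)
    have := β.isLt
    have h2 := ordKey_cases (m + 1) β
    have h3 := ordKey_cases (m + 1) 1
    simp only [hα, h1, if_false]
    simp at h3 ⊢
    push_cast at h2
    omega
  · have h1 : β.val ≠ 1 := fun e => hβ (Fin.ext e)
    have h2 : α.val ≠ 1 := fun e => hα (Fin.ext e)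
    simp [h1, h2]

/-- The last point meets the base point, which also sits at `1` and comes after it; no twist lies
between them. -/
theorem corr_contract_last {m : ℕ} (f : Fin (m + 2) → W k l) (j : Fin m → YVar k) (v : Fin m → ℝ) :
    D.corr (pos v) (ordKey m) (dFam (Fin.contractNth 0 (fun a b => star a b) fun s => f (s - 1)) j)
      = D.corr (pos ((Fin.last m).insertNth (endpt v (Fin.last m).succ) v))
          (ordKey (m + 1)) (partialFam f (Fin.last m) j) := by
  -- The two points to be identified, last and zero, are not neighbours as indices, so this map
  -- replaces `Fin.predAbove`.
  let c : Fin (m + 2) → Fin (m + 1) := fun x => Fin.lastCases 0 id x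
  have c1 : c (Fin.last (m + 1)) = 0 := by simp [c]
  have c2 : ∀ y, c (Fin.castSucc y) = y := fun y => by simp [c]
  have c0 : c 0 = 0 := c2 0
  have hc : ∀ x, (x.val = m + 1 ∧ (c x).val = 0) ∨ (x.val ≤ m ∧ (c x).val = x.val) := by
    intro x
    refine Fin.lastCases ?_ (fun y => ?_) x
    · exact Or.inl ⟨rfl, by rw [c1]; rfl⟩
    · refine Or.inr ⟨?_, by rw [c2]; rfl⟩
      have := y.isLt
      simp only [Fin.val_castSucc]
      omega
  have hθ : pos v ∘ c = pos ((Fin.last m).insertNth (endpt v (Fin.last m).succ) v) := by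
    funext x
    refine Fin.cases (by simp [pos, c0]) (fun y => Fin.lastCases ?_ (fun z => ?_) y) x
    · have : endpt v (Fin.last m).succ = 1 := endpt_last v
      simp only [Function.comp, Fin.succ_last, c1, pos, Fin.cons_zero]
      rw [← Fin.succ_last, Fin.cons_succ, Fin.insertNth_apply_same, this]
    · simp only [Function.comp, Fin.succ_castSucc, c2, pos, Fin.cons_succ]
      rw [← Fin.succ_castSucc, Fin.cons_succ, ← Fin.succAbove_last, Fin.insertNth_apply_succAbove]
  rw [← hθ]
  have h10 : ∀ z : Fin (m + 1), (z.succ - 1 : Fin (m + 2)) = z.castSucc := fun z => by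
    rw [sub_eq_iff_eq_add, Fin.coeSucc_eq_succ]
  refine D.corr_merge (a := Fin.last (m + 1)) (b := 0) (by simp [Fin.ext_iff]) (c1.trans c0.symm)
    (fun y hy => ⟨y.castSucc, c2 y, fun x hx => ?_⟩) (fun x hx => ?_) _ _ _ ?_ (fun x y hxy => ?_)
    _ _ ?_ (fun x hx hx' => ?_)
  · rw [c1] at hy
    ext
    have hy' : y.val ≠ 0 := fun e => hy (Fin.ext e)
    have := hc x
    rw [hx] at this
    simp only [Fin.val_castSucc]
    omega
  · have := hc x
    rw [hx, c1] at this
    simp only [Fin.ext_iff, Fin.val_last, Fin.val_zero] at *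
    omega
  · rw [← Fin.succ_last]
    simp [ordKey]
  · have hxy' : (c x).val ≠ (c y).val := fun e => hxy (Fin.ext e)
    have h1 := hc x
    have h2 := hc y
    have h3 := ordKey_cases (m + 1) x
    have h4 := ordKey_cases (m + 1) y
    have h5 := ordKey_cases m (c x)
    have h6 := ordKey_cases m (c y)
    push_cast at *
    omega
  · rw [c1]
    have e := partialFam_same f (Fin.last m) j
    rw [Fin.succ_last] at e
    rw [e, partialFam_zero]
    unfold dFam
    rw [Fin.cons_zero]
    have h := contractNth_self (fun a b => star a b) (0 : Fin (m + 1))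
      (fun s : Fin (m + 2) => f (s - 1))
    have e1 : ((0 : Fin (m + 1)).succ - 1 : Fin (m + 2)) = 0 := h10 0
    have e2 : ((0 : Fin (m + 1)).castSucc - 1 : Fin (m + 2)) = Fin.last (m + 1) := by
      rw [sub_eq_iff_eq_add, Fin.last_add_one]
      rfl
    rw [e1, e2] at h
    exact h
  · revert hx hx'
    refine Fin.lastCases (fun hx => absurd rfl hx) (fun y => ?_) x
    refine Fin.cases (fun _ hx' => absurd rfl hx') (fun z _ _ => ?_) y
    rw [c2]
    have e := partialFam_succAbove f (Fin.last m) j z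
    rw [Fin.succAbove_last, Fin.succ_castSucc] at e
    rw [e]
    unfold dFam
    rw [Fin.cons_succ]
    have h3 := contractNth_predAbove (fun a b => star a b) 0
        (fun s : Fin (m + 2) => f (s - 1)) z.succ.succ (by simp [Fin.ext_iff])
        (by simp [Fin.ext_iff])
    have h2 : (0 : Fin (m + 1)).predAbove z.succ.succ = z.succ := by simp
    rw [h2, h10] at h3
    exact congrArg _ h3

/-- The form `dy ^ {i_1} ∧ … ∧ dy ^ {i_m}`. -/
def dyProd {m : ℕ} (i : Fin m → YVar k) : ExteriorAlgebra ℂ (YVar k → ℂ) :=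
  (List.ofFn fun q => dy (i q)).prod

theorem dyProd_succ {m : ℕ} (i : Fin (m + 1) → YVar k) :
    dyProd i = dy (i 0) * dyProd (fun q => i q.succ) := by
  simp [dyProd, List.ofFn_succ]

theorem dyProd_eq {m : ℕ} (i : Fin m → YVar k) :
    dyProd i = ExteriorAlgebra.ιMulti ℂ m (fun q => (Pi.single (i q) 1 : YVar k → ℂ)) := by
  rw [ExteriorAlgebra.ιMulti_apply]
  rfl

theorem contractLeft_dyProd (b : YVar k) : ∀ {m : ℕ} (i : Fin (m + 1) → YVar k),
    CliffordAlgebra.contractLeft (LinearMap.proj b) (dyProd i)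
      = ∑ q : Fin (m + 1), (-1 : ℂ) ^ q.val • (if i q = b then (1 : ℂ) else 0) •
          dyProd (fun s => i (q.succAbove s)) := by
  have hdy : ∀ (a : YVar k) (ω : ExteriorAlgebra ℂ (YVar k → ℂ)),
      CliffordAlgebra.contractLeft (LinearMap.proj b) (dy a * ω)
        = (if a = b then (1 : ℂ) else 0) • ω
          - dy a * CliffordAlgebra.contractLeft (LinearMap.proj b) ω := by
    intro a ω
    have h := CliffordAlgebra.contractLeft_ι_mul (Q := (0 : QuadraticForm ℂ (YVar k → ℂ)))
      (LinearMap.proj b) (Pi.single a 1) ω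
    refine h.trans ?_
    congr 2
    simp [Pi.single_apply, eq_comm]
  intro m
  induction m with
  | zero =>
    intro i
    rw [dyProd_succ, hdy, Fin.sum_univ_one]
    simp [dyProd, CliffordAlgebra.contractLeft_one]
  | succ m ih =>
    intro i
    rw [dyProd_succ, hdy, ih, Fin.sum_univ_succ (n := m + 1), sub_eq_add_neg]
    refine congrArg₂ _ ?_ ?_
    · simp
    · rw [Finset.mul_sum, ← Finset.sum_neg_distrib]
      refine Finset.sum_congr rfl fun q _ => ?_
      rw [dyProd_succ (fun s => i (q.succ.succAbove s))]
      simp only [Fin.succ_succAbove_zero, Fin.succ_succAbove_succ, Fin.val_succ, pow_succ,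
        mul_smul_comm]
      module

/-- The form with the function `s` as a coefficient and the constant form `ω`. -/
def tens (ω : ExteriorAlgebra ℂ (YVar k → ℂ)) : PS (YVar k) →ₗ[ℂ] Form k :=
  (TensorProduct.mk ℂ (PS (YVar k)) (ExteriorAlgebra ℂ (YVar k → ℂ))).flip ω

/-- The integrated correlation function with values in forms. -/
def formInt (m : ℕ) (f : Fin (m + 1) → W k l) : Ω k :=
  ∑ i : Fin m → YVar k, mapC (tens (dyProd i)) (D.corrInt m (dFam f i))

theorem BV_tens (ω : ExteriorAlgebra ℂ (YVar k → ℂ)) (x : Lau (PS (YVar k))) :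
    BV k (mapC (tens ω) x) = ∑ a, ∑ b, poisson ℂ k a b •
      mapC (tens (CliffordAlgebra.contractLeft (LinearMap.proj b) ω)) (mapC (pd a) x) := by
  unfold BV
  simp only [mapC_sum, mapC_smul]
  rfl

theorem mapC_tens_smul (c : ℂ) (ω : ExteriorAlgebra ℂ (YVar k → ℂ)) (x : Lau (PS (YVar k))) :
    mapC (tens (c • ω)) x = c • mapC (tens ω) x := by
  unfold tens
  rw [map_smul]
  rfl

theorem mapC_tens_sum {β : Type*} (t : Finset β) (ω : β → ExteriorAlgebra ℂ (YVar k → ℂ))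
    (x : Lau (PS (YVar k))) : mapC (tens (∑ b ∈ t, ω b)) x = ∑ b ∈ t, mapC (tens (ω b)) x := by
  unfold tens
  rw [map_sum, mapC_sum]

theorem dFam_insertNth {m : ℕ} (f : Fin (m + 2) → W k l) (q : Fin (m + 1)) (b : YVar k)
    (j : Fin m → YVar k) : dFam f (q.insertNth b j) = Function.update (partialFam f q j) q.succ
      (mapC (pd (Sum.inl b)) (partialFam f q j q.succ)) := by
  funext x
  refine Fin.cases ?_ (fun y => ?_) x
  · rw [Function.update_of_ne (Fin.succ_ne_zero q).symm]
    rfl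
  · rcases Fin.eq_self_or_eq_succAbove q y with rfl | ⟨s, rfl⟩
    · rw [Function.update_self, partialFam_same]
      simp [dFam]
    · rw [Function.update_of_ne (by simp [Fin.succAbove_ne]), partialFam_succAbove]
      simp [dFam]

/-- Contraction with the `q`-th `dy` frees the index of the derivative at the point `q + 1`. With
the outer derivative and `ω` this is the divergence of `corr_stokes`, that is the difference of two
boundary integrals, with the sign `(-1) ^ q` of the contraction. -/
theorem BV_formInt {m : ℕ} (f : Fin (m + 2) → W k l)
    (X Y : Fin (m + 1) → (Fin m → YVar k) → Lau (PS (YVar k)))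
    (hX : ∀ q j, IsInt m (fun v => D.corr (pos (q.insertNth (endpt v q.succ) v)) (ordKey (m + 1))
      (partialFam f q j)) (X q j))
    (hY : ∀ q j, IsInt m (fun v => D.corr (pos (q.insertNth (endpt v q.castSucc) v)) (ordKey (m + 1))
      (partialFam f q j)) (Y q j)) :
    hbar • BV k (D.formInt (m + 1) f)
      = ∑ q : Fin (m + 1), (-1 : ℂ) ^ q.val • ∑ j, mapC (tens (dyProd j)) (Y q j - X q j) := by
  have h1 : ∀ q j, Y q j - X q j = hbar • ∑ a, ∑ b, poisson ℂ k a b • mapC (pd a)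
      (D.corrInt (m + 1) (dFam f (q.insertNth b j))) := by
    intro q j
    rw [← neg_sub, D.corr_stokes q _ (hX q j) (hY q j), neg_neg]
    simp only [dFam_insertNth]
  have h2 : ∀ (q : Fin (m + 1)) (T : (Fin (m + 1) → YVar k) → Ω k),
      ∑ i, T i = ∑ b, ∑ j, T (q.insertNth b j) := by
    intro q T
    rw [← (Fin.insertNthEquiv (fun _ : Fin (m + 1) => YVar k) q).sum_comp, Fintype.sum_prod_type]
    rfl
  have h3 : BV k (D.formInt (m + 1) f) = ∑ q : Fin (m + 1), (-1 : ℂ) ^ q.val •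
      ∑ i : Fin (m + 1) → YVar k, ∑ a, poisson ℂ k a (i q) •
        mapC (tens (dyProd fun s => i (q.succAbove s))) (mapC (pd a) (D.corrInt (m + 1) (dFam f i))) := by
    unfold formInt
    rw [map_sum]
    simp only [BV_tens, contractLeft_dyProd, mapC_tens_sum, mapC_tens_smul, Finset.smul_sum]
    refine Eq.symm (Finset.sum_comm.trans ?_)
    refine Finset.sum_congr rfl fun i _ => Finset.sum_comm.trans ?_
    refine Finset.sum_congr rfl fun a _ => Eq.symm (Finset.sum_comm.trans ?_)
    refine Finset.sum_congr rfl fun q _ => ?_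
    rw [Finset.sum_eq_single (i q)]
    · rw [if_pos rfl, one_smul, smul_comm]
    · intro b _ hb
      rw [if_neg hb.symm, zero_smul, smul_zero, smul_zero]
    · simp
  rw [h3, Finset.smul_sum]
  refine Finset.sum_congr rfl fun q _ => ?_
  rw [smul_comm]
  congr 1
  rw [h2 q, Finset.sum_comm, Finset.smul_sum]
  refine Finset.sum_congr rfl fun j _ => ?_
  rw [h1, map_smul]
  congr 1
  rw [map_sum, Finset.sum_comm]
  refine Finset.sum_congr rfl fun a _ => ?_
  rw [map_sum]
  refine Finset.sum_congr rfl fun b _ => ?_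
  rw [LinearMap.map_smul_of_tower, Fin.insertNth_apply_same]
  simp only [Fin.insertNth_apply_succAbove]

theorem isInt_corrInt_contract {m : ℕ} (f : Fin (m + 2) → W k l)
    (X Y : Fin (m + 1) → (Fin m → YVar k) → Lau (PS (YVar k)))
    (hX : ∀ q j, IsInt m (fun v => D.corr (pos (q.insertNth (endpt v q.succ) v)) (ordKey (m + 1))
      (partialFam f q j)) (X q j))
    (hY : ∀ q j, IsInt m (fun v => D.corr (pos (q.insertNth (endpt v q.castSucc) v)) (ordKey (m + 1))
      (partialFam f q j)) (Y q j)) (j : Fin m → YVar k) :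
    D.corrInt m (dFam (Fin.contractNth 0 (fun a b => star a b) fun s => f (s - 1)) j)
        = X (Fin.last m) j ∧
      D.corrInt m (dFam (Fin.contractNth 0 (fun a b => star a b)
        fun s => if s = 1 then D.actW D.g (f s) else f s) j) = Y 0 j ∧
      ∀ i : Fin m, D.corrInt m (dFam (Fin.contractNth i.succ.castSucc (fun a b => star a b) f) j)
        = X i.castSucc j + Y i.succ j := by
  refine ⟨?_, ?_, fun i => ?_⟩
  · exact (D.isInt_corrInt _).unique ((hX _ j).congr fun v _ => (D.corr_contract_last f j v).symm)
  · exact (D.isInt_corrInt _).unique ((hY 0 j).congr fun v _ => (D.corr_contract_first f j v).symm)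
  · exact (D.isInt_corrInt _).unique (((hX i.castSucc j).add (hY i.succ j)).congr
      fun v _ => (D.corr_contract_interior f i j v).symm)

/-- The correlation map intertwines the Hochschild operator and the operator `ħ Δ`. -/
theorem formInt_hoch {m : ℕ} (f : Fin (m + 2) → W k l) :
    (-1 : ℂ) ^ (m + 1) •
        D.formInt m (Fin.contractNth 0 (fun a b => star a b) fun s => f (s - 1)) +
      D.formInt m (Fin.contractNth 0 (fun a b => star a b)
        fun s => if s = 1 then D.actW D.g (f s) else f s) +
      ∑ i : Fin m, (-1 : ℂ) ^ (i.val + 1) •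
        D.formInt m (Fin.contractNth i.succ.castSucc (fun a b => star a b) f)
      = hbar • BV k (D.formInt (m + 1) f) := by
  have hθ : ∀ (q : Fin (m + 1)) (a : Fin (m + 2)), Continuous fun v : Fin m → ℝ =>
      pos (q.insertNth (endpt v a) v) := fun q a =>
    pos_continuous.comp ((continuous_insertNth q).comp ((continuous_endpt a).prodMk continuous_id))
  -- `X` collects the integrals over the upper ends and `Y`, below, those over the lower ends of the
  -- `q`-th interval.
  choose X hX using fun (q : Fin (m + 1)) (j : Fin m → YVar k) =>
    D.exists_isInt_corr (hθ q q.succ) (ordKey (m + 1)) (partialFam f q j)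
  choose Y hY using fun (q : Fin (m + 1)) (j : Fin m → YVar k) =>
    D.exists_isInt_corr (hθ q q.castSucc) (ordKey (m + 1)) (partialFam f q j)
  have h := D.isInt_corrInt_contract f X Y hX hY
  rw [D.BV_formInt f X Y hX hY]
  unfold formInt
  simp only [fun j => (h j).1, fun j => (h j).2.1, fun j i => (h j).2.2 i, map_add, map_sub,
    Finset.sum_add_distrib, Finset.sum_sub_distrib, smul_add, smul_sub]
  -- `Y 0` is the twisted term and `X` at the last index the wrapped one; the others pair as `X i +
  -- Y (i + 1)` into interior collisions.
  rw [Fin.sum_univ_succ (fun q : Fin (m + 1) => (-1 : ℂ) ^ q.val • ∑ j, mapC (tens (dyProd j)) (Y q j)),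
    Fin.sum_univ_castSucc (fun q : Fin (m + 1) => (-1 : ℂ) ^ q.val • ∑ j, mapC (tens (dyProd j)) (X q j))]
  simp only [Fin.val_zero, pow_zero, one_smul, Fin.val_succ, Fin.val_castSucc, Fin.val_last, pow_succ,
    mul_neg, mul_one, neg_smul, Finset.sum_neg_distrib]
  abel

end Sector
end TwistedTQM
end

/-! ### Cyclic rotations: the Connes operator and `d`; equivariance of the function part -/

noncomputable section
namespace TwistedTQM

set_option linter.unusedSectionVars false

namespace Sector

open MeasureTheory

variable {G : Type*} [Group G] {k l r : ℕ} (D : Sector G k l r)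

/-- The functions `f`, all differentiated. -/
def allD {m : ℕ} (f : Fin (m + 1) → W k l) (i : Fin (m + 1) → YVar k) : Fin (m + 1) → W k l :=
  fun s => mapC (pd (Sum.inl (i s))) (f s)

theorem pd_corrInt {m : ℕ} (y : YVar k) (f : Fin (m + 1) → W k l) :
    mapC (pd y) (D.corrInt m f)
      = ∑ α, D.corrInt m (Function.update f α (mapC (pd (Sum.inl y)) (f α))) := by
  refine ((D.isInt_corrInt f).mapC (finDep_pd y)).unique ((IsInt.sum Finset.univ fun α _ =>
    D.isInt_corrInt (Function.update f α (mapC (pd (Sum.inl y)) (f α)))).congr fun u _ => ?_)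
  exact (pd_wick y _ f).symm

theorem deRham_tens (ω : ExteriorAlgebra ℂ (YVar k → ℂ)) (x : Lau (PS (YVar k))) :
    deRham k (mapC (tens ω) x) = ∑ a, mapC (tens (dy a * ω)) (mapC (pd a) x) := by
  unfold deRham
  simp only [mapC_sum]
  rfl

theorem dyProd_perm {m : ℕ} (i : Fin m → YVar k) (σ : Equiv.Perm (Fin m)) :
    dyProd (i ∘ σ) = Equiv.Perm.sign σ • dyProd i := by
  rw [dyProd_eq, dyProd_eq]
  exact AlternatingMap.map_perm (ExteriorAlgebra.ιMulti ℂ m)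
    (fun q => (Pi.single (i q) 1 : YVar k → ℂ)) σ

theorem mapC_tens_neg (ω : ExteriorAlgebra ℂ (YVar k → ℂ)) (x : Lau (PS (YVar k))) :
    mapC (tens (-ω)) x = -mapC (tens ω) x := by
  unfold tens
  rw [map_neg]
  rfl

theorem mapC_pd_comm {σ : Type} (i j : σ) (x : Lau (PS σ)) :
    mapC (pd i) (mapC (pd j) x) = mapC (pd j) (mapC (pd i) x) := by
  rw [mapC_comp, mapC_comp]
  congr 2
  exact (pd_comm i j).eq

/-- Two derivatives at one point are symmetric in their indices, whereas the exchange of the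
corresponding `dy` changes the sign of the form. -/
theorem sum_second_derivatives_eq_zero {m : ℕ} (f : Fin (m + 1) → W k l) (s : Fin m) :
    ∑ i : Fin (m + 1) → YVar k, mapC (tens (dyProd i)) (D.corrInt m
      (Function.update (dFam f (Fin.tail i)) s.succ
        (mapC (pd (Sum.inl (i 0))) (dFam f (Fin.tail i) s.succ)))) = 0 := by
  let U : (Fin (m + 1) → YVar k) → Fin (m + 1) → W k l := fun i =>
    Function.update (dFam f (Fin.tail i)) s.succ
      (mapC (pd (Sum.inl (i 0))) (dFam f (Fin.tail i) s.succ))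
  let T : (Fin (m + 1) → YVar k) → Ω k := fun i => mapC (tens (dyProd i)) (D.corrInt m (U i))
  have h0 : ∀ i, U (i ∘ Equiv.swap 0 s.succ) = U i := by
    intro i
    funext x
    by_cases hx : x = s.succ
    · subst hx
      simp only [U, Function.update_self, dFam, Fin.cons_succ, Fin.tail, Function.comp,
        Equiv.swap_apply_left, Equiv.swap_apply_right]
      exact mapC_pd_comm _ _ _
    · simp only [U]
      rw [Function.update_of_ne hx, Function.update_of_ne hx]
      revert hx
      refine Fin.cases (fun _ => ?_) (fun y hy => ?_) x
      · simp only [dFam, Fin.cons_zero]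
      · simp only [dFam, Fin.cons_succ, Fin.tail, Function.comp,
          Equiv.swap_apply_of_ne_of_ne (Fin.succ_ne_zero y) hy]
  have h1 : ∀ i, T (i ∘ Equiv.swap 0 s.succ) = -T i := by
    intro i
    simp only [T, h0]
    rw [dyProd_perm, Equiv.Perm.sign_swap (Fin.succ_ne_zero s).symm, Units.neg_smul, one_smul,
      mapC_tens_neg]
  have h2 : ∑ i, T i = -∑ i, T i := by
    rw [← Finset.sum_neg_distrib]
    simp only [← h1]
    exact (Equiv.sum_comp (Equiv.arrowCongr (Equiv.swap 0 s.succ) (Equiv.refl (YVar k))) T).symm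
  have h3 : (2 : ℂ) • ∑ i, T i = 0 := by
    rw [two_smul]
    nth_rewrite 1 [h2]
    exact neg_add_cancel _
  exact (smul_eq_zero.1 h3).resolve_left two_ne_zero

/-- Of the total derivative only the term on the so far undifferentiated function at the point `0`
survives. -/
theorem deRham_formInt {m : ℕ} (f : Fin (m + 1) → W k l) :
    deRham k (D.formInt m f)
      = ∑ i : Fin (m + 1) → YVar k, mapC (tens (dyProd i)) (D.corrInt m (allD f i)) := by
  have h1 : deRham k (D.formInt m f) = ∑ i : Fin (m + 1) → YVar k, ∑ α, mapC (tens (dyProd i))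
      (D.corrInt m (Function.update (dFam f (Fin.tail i)) α
        (mapC (pd (Sum.inl (i 0))) (dFam f (Fin.tail i) α)))) := by
    have h2 : ∀ (T : (Fin (m + 1) → YVar k) → Ω k), ∑ i, T i = ∑ a, ∑ j, T (Fin.cons a j) := by
      intro T
      rw [← (Fin.consEquiv (fun _ : Fin (m + 1) => YVar k)).sum_comp, Fintype.sum_prod_type]
      rfl
    unfold formInt
    rw [map_sum, h2, Finset.sum_comm]
    refine Finset.sum_congr rfl fun j _ => ?_
    rw [deRham_tens]
    refine Finset.sum_congr rfl fun a _ => ?_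
    rw [pd_corrInt, map_sum]
    refine Finset.sum_congr rfl fun α _ => ?_
    rw [dyProd_succ, Fin.tail_cons, Fin.cons_zero]
    simp only [Fin.cons_succ]
  rw [h1, Finset.sum_comm, Fin.sum_univ_succ]
  simp only [D.sum_second_derivatives_eq_zero, Finset.sum_const_zero, add_zero]
  refine Finset.sum_congr rfl fun i _ => ?_
  have e : Function.update (dFam f (Fin.tail i)) 0
      (mapC (pd (Sum.inl (i 0))) (dFam f (Fin.tail i) 0)) = allD f i := by
    funext x
    refine Fin.cases ?_ (fun y => ?_) x
    · simp only [Function.update_self, dFam, Fin.cons_zero, allD]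
    · rw [Function.update_of_ne (Fin.succ_ne_zero y)]
      simp only [dFam, Fin.cons_succ, allD, Fin.tail]
  rw [e]

theorem pd_actW_g (y : YVar k) (x : W k l) :
    mapC (pd (Sum.inl y)) (D.actW D.g x) = D.actW D.g (mapC (pd (Sum.inl y)) x) := by
  unfold actW
  obtain ⟨b1, b2, -⟩ := D.cρ_g_inv_blocks
  rw [mapC_comp, mapC_comp, (linSub_pull (D.ρ D.g⁻¹)).pd_comp]
  congr 3
  rw [Fintype.sum_sum_type]
  simp only [Matrix.map_apply, b1, b2]
  simp [Matrix.one_apply, apply_ite Complex.ofReal, ite_smul]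

/-- A translation is the inverse of the `i`-th power of a cycle of length `m + 1`, whose sign is
`(-1) ^ m`. -/
theorem sign_subRight {m : ℕ} (i : Fin (m + 1)) :
    Equiv.Perm.sign (Equiv.subRight i) = (-1) ^ (m * i.val) := by
  have h : Equiv.subRight i = ((finRotate (m + 1)) ^ i.val)⁻¹ := by
    rw [eq_inv_iff_mul_eq_one]
    have h1 : ∀ (n : ℕ) (x : Fin (m + 1)), (finRotate (m + 1) ^ n) x = x + Fin.ofNat (m + 1) n := by
      intro n
      induction n with
      | zero =>
        intro x
        ext
        simp
      | succ n ih =>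
        intro x
        rw [pow_succ', Equiv.Perm.mul_apply, ih, finRotate_apply]
        ext
        simp [Fin.val_add, add_assoc]
    ext x
    rw [Equiv.Perm.mul_apply, h1]
    have : Fin.ofNat (m + 1) i.val = i := by
      ext
      simp
    rw [this]
    simp
  rw [h, Equiv.Perm.sign_inv, map_pow, sign_finRotate, pow_mul, Nat.add_sub_cancel]

/-- Unwinding the twist and rotating the circle give the same positions up to a common translation,
which propagators do not notice. -/
theorem rotPos_zero_shift {m : ℕ} (i : Fin (m + 1)) (u : Fin (m + 1) → ℝ) (α : Fin (m + 1)) :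
    pos (rotPos i u) α = (if i < α + i then u (α + i) - 1 else u (α + i)) + (1 - u i) := by
  refine Fin.cases ?_ (fun j => ?_) α
  · simp [pos]
  · simp only [pos, Fin.cons_succ, rotPos, rotate]
    have hi := i.isLt
    have hj := j.isLt
    have hr : (Fin.rev i).val = m - i.val := by rw [Fin.val_rev]; omega
    have ha : (j.val < m - i.val ∧ ((Fin.rev i).succAbove j).val = j.val) ∨
        (m - i.val ≤ j.val ∧ ((Fin.rev i).succAbove j).val = j.val + 1) := by
      rcases lt_or_ge j.val (m - i.val) with h | h
      · refine Or.inl ⟨h, ?_⟩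
        rw [Fin.succAbove_of_castSucc_lt _ _ (Fin.lt_def.2 (by rw [Fin.val_castSucc, hr]; exact h))]
        rfl
      · refine Or.inr ⟨h, ?_⟩
        rw [Fin.succAbove_of_le_castSucc _ _ (Fin.le_def.2 (by rw [Fin.val_castSucc, hr]; exact h))]
        rfl
    have hv : (j.succ + i).val = if m + 1 ≤ j.val + 1 + i.val then j.val + 1 + i.val - (m + 1)
        else j.val + 1 + i.val := by
      rw [Fin.val_add_eq_ite, Fin.val_succ]
    rcases ha with ⟨h1, h2⟩ | ⟨h1, h2⟩
    · have e1 : ((Fin.rev i).succAbove j).val + i.val < m := by omega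
      have e2 : (⟨((Fin.rev i).succAbove j).val + i.val + 1, by omega⟩ : Fin (m + 1)) = j.succ + i := by
        ext
        rw [hv, if_neg (by omega)]
        simp only
        omega
      have e3 : i < j.succ + i := Fin.lt_def.2 (by rw [hv, if_neg (by omega)]; omega)
      rw [dif_pos e1, e2, if_pos e3]
      ring
    · have e1 : ¬ ((Fin.rev i).succAbove j).val + i.val < m := by omega
      have e0 : ¬ ((Fin.rev i).succAbove j).val + i.val = m := by omega
      have e2 : (⟨((Fin.rev i).succAbove j).val + i.val - m - 1, by omega⟩ : Fin (m + 1)) = j.succ + i := by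
        ext
        rw [hv, if_pos (by omega)]
        simp only
        omega
      have e3 : ¬ i < j.succ + i := fun h => by
        rw [Fin.lt_def, hv, if_pos (by omega)] at h
        omega
      rw [dif_neg e1, if_neg e0, e2, if_neg e3]
      ring

/-- The unit at the base point is dropped, the twisted points after `i` are wrapped to the front,
and the points are relabelled by `α ↦ α + i`, so that `F 0`, placed at `u i`, becomes the new base
point. -/
theorem corr_cyclic {m : ℕ} (F : Fin (m + 1) → W k l) (i : Fin (m + 1)) (u : Fin (m + 1) → ℝ) :
    D.corr (pos u) (ordKey (m + 1)) (Fin.cons (const 1) fun s : Fin (m + 1) =>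
        if i < s then D.actW D.g (F (s - i)) else F (s - i))
      = D.corr (pos (rotPos i u)) (ordKey m) F := by
  have h1 := D.corr_comp (Fin.succ_injective (m + 1)) (pos u) (ordKey (m + 1))
    (Fin.cons (const 1) fun s : Fin (m + 1) =>
        if i < s then D.actW D.g (F (s - i)) else F (s - i)) (fun α hα => by
      revert hα
      refine Fin.cases (fun _ => rfl) (fun y hy => absurd ⟨y, rfl⟩ hy) α)
  have hv : ∀ α : Fin (m + 1), (α + i).val = if m + 1 ≤ α.val + i.val then α.val + i.val - (m + 1)
      else α.val + i.val := fun α => Fin.val_add_eq_ite α i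
  have h2 := D.corr_wrap (fun s : Fin (m + 1) => i < s) u (fun s => (s.val : ℤ))
    (fun s => if i < s then (s.val : ℤ) - (m + 1) else s.val)
    (fun α β hα hβ => by
      rw [if_pos hα, if_neg hβ]
      rw [Fin.lt_def] at hα hβ
      have := α.isLt
      omega)
    (fun α β hα hβ => by simp only [if_pos hα, if_pos hβ]; omega)
    (fun α β hα hβ => by simp only [if_neg hα, if_neg hβ])
    (fun s => F (s - i))
  rw [h1]
  refine h2.trans ?_
  rw [D.corr_comp (c := fun α : Fin (m + 1) => α + i) (add_left_injective i) _ _ _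
    (fun α hα => absurd ⟨α - i, sub_add_cancel α i⟩ hα)]
  have h3 : (fun s : Fin (m + 1) => F (s - i)) ∘ (fun α => α + i) = F := by
    funext α
    simp
  rw [h3]
  refine D.corr_congr (fun α β => ?_) (fun α β => ?_) F
  · rw [rotPos_zero_shift, rotPos_zero_shift]
    simp only [Function.comp]
    ring
  · simp only [Function.comp, Fin.lt_def]
    have h4 := ordKey_cases m α
    have h5 := ordKey_cases m β
    have h6 := hv α
    have h7 := hv β
    have := α.isLt
    have := β.isLt
    have := i.isLt
    generalize (α + i).val = x at *
    generalize (β + i).val = y at *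
    split_ifs at h6 h7 ⊢ <;> omega

theorem corrInt_cyclic {m : ℕ} (F : Fin (m + 1) → W k l) :
    ∑ i : Fin (m + 1), D.corrInt (m + 1) (Fin.cons (const 1) fun s : Fin (m + 1) =>
        if i < s then D.actW D.g (F (s - i)) else F (s - i)) = D.corrInt m F := by
  refine cf_ext fun n d => ?_
  rw [map_sum, (D.isInt_corrInt F n d).2]
  refine Eq.trans (Finset.sum_congr rfl fun i _ => ?_) (sum_integral_rotPos
    ((D.contFam_corr pos_continuous (ordKey m) F).continuous n d))
  rw [(D.isInt_corrInt _ n d).2]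
  simp only [D.corr_cyclic F i]

/-- The correlation map intertwines the Connes operator and the de Rham differential. -/
theorem formInt_connes {m : ℕ} (f : Fin (m + 1) → W k l) :
    ∑ i : Fin (m + 1), (-1 : ℂ) ^ (m * i.val) • D.formInt (m + 1) (Fin.cons (const 1)
        fun s : Fin (m + 1) => if i < s then D.actW D.g (f (s - i)) else f (s - i))
      = deRham k (D.formInt m f) := by
  rw [D.deRham_formInt]
  have h1 : ∀ i : Fin (m + 1), (-1 : ℂ) ^ (m * i.val) • D.formInt (m + 1) (Fin.cons (const 1)
        fun s : Fin (m + 1) => if i < s then D.actW D.g (f (s - i)) else f (s - i))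
      = ∑ j : Fin (m + 1) → YVar k, mapC (tens (dyProd j)) (D.corrInt (m + 1)
        (Fin.cons (const 1) fun s : Fin (m + 1) =>
          if i < s then D.actW D.g (allD f j (s - i)) else allD f j (s - i))) := by
    intro i
    unfold formInt
    rw [Finset.smul_sum]
    -- Rotating the indices along with the functions costs the sign of the rotation of the `dy`,
    -- which cancels the sign in the Connes operator.
    rw [← (Equiv.arrowCongr (Equiv.subRight i).symm (Equiv.refl (YVar k))).sum_comp]
    refine Finset.sum_congr rfl fun j _ => ?_
    have e1 : (Equiv.arrowCongr (Equiv.subRight i).symm (Equiv.refl (YVar k))) j = j ∘ Equiv.subRight i := rfl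
    rw [e1, dyProd_perm, sign_subRight]
    have e2 : (((-1) ^ (m * i.val) : ℤˣ) • dyProd j) = (-1 : ℂ) ^ (m * i.val) • dyProd j := by
      rcases Nat.even_or_odd (m * i.val) with h | h
      · simp [h.neg_one_pow]
      · simp [h.neg_one_pow]
    rw [e2, mapC_tens_smul, smul_smul, ← mul_pow, neg_one_mul, neg_neg, one_pow, one_smul]
    have e3 : dFam (Fin.cons (const 1) fun s : Fin (m + 1) =>
          if i < s then D.actW D.g (f (s - i)) else f (s - i)) (j ∘ Equiv.subRight i)
        = Fin.cons (const 1) fun s : Fin (m + 1) =>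
          if i < s then D.actW D.g (allD f j (s - i)) else allD f j (s - i) := by
      funext x
      refine Fin.cases ?_ (fun s => ?_) x
      · simp only [dFam, Fin.cons_zero]
      · simp only [dFam, Fin.cons_succ, allD]
        split_ifs
        · exact D.pd_actW_g _ _
        · rfl
    rw [e3]
  rw [Finset.sum_congr rfl fun i _ => h1 i, Finset.sum_comm]
  refine Finset.sum_congr rfl fun j _ => ?_
  rw [← map_sum, D.corrInt_cyclic]

/-- Every slot after the first is differentiated. This is why the correlation map descends to
normalized chains. -/
theorem formInt_eq_zero {m : ℕ} (f : Fin (m + 1) → W k l) (s : Fin m) (hs : f s.succ = const 1) :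
    D.formInt m f = 0 := by
  refine Finset.sum_eq_zero fun i _ => ?_
  have h : dFam f i s.succ = 0 := by
    refine Lau.ext fun n => ?_
    simp only [dFam, Fin.cons_succ, hs, lcoeff_mapC]
    change pd _ ((HahnSeries.single (0 : ℤ) (1 : PS (Var k l))).coeff n) = _
    rw [HahnSeries.coeff_single]
    split_ifs
    · exact (MvPowerSeries.pderiv ℂ _).map_one_eq_zero
    · exact map_zero _
  rw [(D.corrInt m).map_coord_zero s.succ h, map_zero]

theorem corrInt_actW {m : ℕ} {h : G} (hh : h ∈ Subgroup.centralizer {D.g}) (f : Fin (m + 1) → W k l) :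
    D.corrInt m (fun s => D.actW h (f s))
      = mapC (pull (D.ρ h⁻¹).toBlocks₁₁).toLinearMap (D.corrInt m f) :=
  (D.isInt_corrInt _).unique (((D.isInt_corrInt f).mapC (linSub_pull _).finDep).congr
    fun _ _ => (D.corr_actW hh _ _ f).symm)

theorem pd_actW {h : G} (hh : h ∈ Subgroup.centralizer {D.g}) (y : YVar k) (x : W k l) :
    mapC (pd (Sum.inl y)) (D.actW h x) = ∑ a, ((D.ρ h⁻¹).toBlocks₁₁ a y : ℂ) •
      D.actW h (mapC (pd (Sum.inl a)) x) := by
  obtain ⟨a, d, e⟩ := D.toBlocks_of_mem_centralizer (inv_mem hh)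
  unfold actW
  rw [mapC_comp, (linSub_pull (D.ρ h⁻¹)).pd_comp, Fintype.sum_sum_type, e]
  simp only [Matrix.map_apply, Matrix.fromBlocks_apply₁₁, Matrix.fromBlocks_apply₂₁, Matrix.zero_apply,
    Complex.ofReal_zero, zero_smul, Finset.sum_const_zero, add_zero, Matrix.toBlocks_fromBlocks₁₁]
  rw [← mapC_comp, mapC_sum, map_sum]
  refine Finset.sum_congr rfl fun b _ => ?_
  rw [mapC_smul, LinearMap.map_smul_of_tower]

/-- The correlation map is equivariant under the centralizer of `g`. -/
theorem formInt_actW {m : ℕ} {h : G} (hh : h ∈ Subgroup.centralizer {D.g}) (f : Fin (m + 1) → W k l) :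
    D.formInt m (fun s => D.actW h (f s)) = D.actΩ h (D.formInt m f) := by
  set M := (D.ρ h⁻¹).toBlocks₁₁ with hM
  have h1 : ∀ i : Fin m → YVar k, D.corrInt m (dFam (fun s => D.actW h (f s)) i)
      = ∑ j : Fin m → YVar k, (∏ q, (M (j q) (i q) : ℂ)) •
        mapC (pull M).toLinearMap (D.corrInt m (dFam f j)) := by
    intro i
    have e1 : dFam (fun s => D.actW h (f s)) i = Fin.cons (D.actW h (f 0))
        fun q => ∑ a, (M a (i q) : ℂ) • D.actW h (mapC (pd (Sum.inl a)) (f q.succ)) := by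
      funext x
      refine Fin.cases ?_ (fun q => ?_) x
      · simp only [dFam, Fin.cons_zero]
      · simp only [dFam, Fin.cons_succ]
        exact D.pd_actW hh _ _
    rw [e1, ← MultilinearMap.curryLeft_apply, MultilinearMap.map_sum]
    refine Finset.sum_congr rfl fun j _ => ?_
    have e2 : (Fin.cons (D.actW h (f 0)) fun q => D.actW h (mapC (pd (Sum.inl (j q))) (f q.succ)) :
        Fin (m + 1) → W k l) = fun s => D.actW h (dFam f j s) := by
      funext x
      refine Fin.cases ?_ (fun q => ?_) x
      · simp only [dFam, Fin.cons_zero]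
      · simp only [dFam, Fin.cons_succ]
    rw [MultilinearMap.map_smul_univ, ← D.corrInt_actW hh, MultilinearMap.curryLeft_apply, e2]
  -- Derivatives and the `dy` transform with the same products of matrix entries, so the two double
  -- sums agree after an exchange.
  have h2 : ∀ j : Fin m → YVar k, ExteriorAlgebra.map (Matrix.mulVecLin (M.map Complex.ofReal).transpose)
      (dyProd j) = ∑ i : Fin m → YVar k, (∏ q, (M (j q) (i q) : ℂ)) • dyProd i := by
    intro j
    have e1 : (Matrix.mulVecLin (M.map Complex.ofReal).transpose) ∘
        (fun q => (Pi.single (j q) 1 : YVar k → ℂ))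
        = fun q => ∑ a, (M (j q) a : ℂ) • (Pi.single a 1 : YVar k → ℂ) := by
      funext q
      ext b
      simp [Pi.single_apply]
    rw [dyProd_eq, ExteriorAlgebra.map_apply_ιMulti, e1]
    refine (MultilinearMap.map_sum (ExteriorAlgebra.ιMulti ℂ m).toMultilinearMap _).trans ?_
    refine Finset.sum_congr rfl fun i _ => ?_
    rw [MultilinearMap.map_smul_univ, dyProd_eq]
    rfl
  unfold formInt
  rw [map_sum]
  simp only [h1, map_sum]
  rw [Finset.sum_comm]
  refine Finset.sum_congr rfl fun j _ => ?_
  have h3 : D.actΩ h (mapC (tens (dyProd j)) (D.corrInt m (dFam f j)))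
      = mapC (tens (ExteriorAlgebra.map (Matrix.mulVecLin (M.map Complex.ofReal).transpose) (dyProd j)))
        (mapC (pull M).toLinearMap (D.corrInt m (dFam f j))) := rfl
  rw [h3, h2, mapC_tens_sum]
  refine Finset.sum_congr rfl fun i _ => ?_
  rw [mapC_tens_smul, LinearMap.map_smul_of_tower]

end Sector
end TwistedTQM
end

/-! ### Elementary matrices and the twisted trace -/

noncomputable section
namespace TwistedTQM

set_option linter.unusedSectionVars false

section Elementary

variable {k l r : ℕ}

/-- The matrix `f E` for a function `f` and a matrix `E` of numbers. -/
def elem (f : W k l) (E : Matrix (Fin r) (Fin r) ℂ) : A k l r := E.map fun c => c • f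

theorem elem_apply (f : W k l) (E : Matrix (Fin r) (Fin r) ℂ) (i j : Fin r) :
    elem f E i j = E i j • f := rfl

theorem eq_sum_elem (a : A k l r) :
    a = ∑ p : Fin r × Fin r, elem (a p.1 p.2) (Matrix.single p.1 p.2 1) := by
  ext1 i j
  rw [Matrix.sum_apply, Finset.sum_eq_single (i, j)]
  · simp [elem_apply]
  · rintro ⟨c, d⟩ - h
    have h' : ¬ (c = i ∧ d = j) := fun e => h (by rw [e.1, e.2])
    simp [elem_apply, h']
  · simp

/-- The matrices `f E` span the algebra. On them a statement about chains separates into one about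
functions and one about numerical matrices. -/
theorem multilinearMap_ext_elem {m : ℕ} {M : Type*} [AddCommMonoid M] [Module K M]
    {φ ψ : MultilinearMap K (fun _ : Fin m => A k l r) M}
    (h : ∀ (f : Fin m → W k l) (E : Fin m → Matrix (Fin r) (Fin r) ℂ), φ (fun s => elem (f s) (E s)) = ψ fun s => elem (f s) (E s)) : φ = ψ := by
  refine MultilinearMap.ext fun t => ?_
  have ht : t = fun s => ∑ p : Fin r × Fin r, elem (t s p.1 p.2) (Matrix.single p.1 p.2 1) :=
    funext fun s => eq_sum_elem (t s)
  rw [ht, MultilinearMap.map_sum, MultilinearMap.map_sum]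
  exact Finset.sum_congr rfl fun p _ => h _ _

theorem mmul_elem (f f' : W k l) (E E' : Matrix (Fin r) (Fin r) ℂ) :
    mmul (elem f E) (elem f' E') = elem (star f f') (E * E') := by
  ext1 i j
  change ∑ c, star (elem f E i c) (elem f' E' c j) = _
  simp only [elem_apply, Matrix.mul_apply, Finset.sum_smul, LinearMap.map_smul_of_tower,
    LinearMap.smul_apply, smul_smul]

theorem oneA_eq_elem : oneA k l r = elem (const 1) 1 := by
  ext1 i j
  by_cases h : i = j
  · simp [oneA, scalarMat, elem_apply, h]
  · simp [oneA, scalarMat, elem_apply, h]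

end Elementary

section Products

variable {M : Type*} [Monoid M]

theorem prod_ofFn_eq {n : ℕ} {X : Fin n → M} {x : ℕ → M} (h : ∀ s, X s = x s.val) :
    (List.ofFn X).prod = ((List.range n).map x).prod := by
  congr 1
  refine List.ext_getElem (by simp) fun i h1 h2 => ?_
  simp [h]

theorem prod_ofFn_contractNth {n : ℕ} (p : Fin n) (X : Fin (n + 1) → M) :
    (List.ofFn (Fin.contractNth p.castSucc (fun a b => a * b) X)).prod = (List.ofFn X).prod := by
  have h : ∀ {n : ℕ} (X : Fin n → M), (List.ofFn X).prod = Fin.partialProd X (Fin.last n) := by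
    intro n X
    unfold Fin.partialProd
    rw [List.take_of_length_le (by simp)]
  have h1 := congrFun (Fin.partialProd_contractNth X p.castSucc) (Fin.last n)
  rw [h, h]
  refine h1.trans ?_
  simp only [Function.comp]
  congr 1
  ext
  have := p.isLt
  rw [Fin.succAbove_of_le_castSucc _ _ (Fin.le_def.2 (by simp))]
  rfl

theorem prod_conj {u v : M} (huv : v * u = 1) (huv' : u * v = 1) (x : ℕ → M) (n : ℕ) :
    ((List.range n).map fun s => u * x s * v).prod = u * ((List.range n).map x).prod * v := by
  induction n with
  | zero => simp [huv']
  | succ n ih =>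
    rw [List.prod_range_succ, List.prod_range_succ, ih]
    calc u * ((List.range n).map x).prod * v * (u * x n * v)
        = u * ((List.range n).map x).prod * (v * u) * x n * v := by simp only [mul_assoc]
      _ = _ := by rw [huv, mul_one]; simp only [mul_assoc]

end Products

namespace Sector

variable {G : Type*} [Group G] {k l r : ℕ} (D : Sector G k l r)

theorem actA_elem (h : G) (f : W k l) (E : Matrix (Fin r) (Fin r) ℂ) :
    D.actA h (elem f E) = elem (D.actW h f) (D.κ h * E * D.κ h⁻¹) := by
  ext1 i j
  change ∑ c, ∑ d, (HahnSeries.C (D.κ h i c * D.κ h⁻¹ d j) : K) • D.actW h (elem f E c d) = _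
  simp only [elem_apply, C_smul, LinearMap.map_smul_of_tower, smul_smul, Matrix.mul_apply,
    Finset.sum_mul, Finset.sum_smul]
  rw [Finset.sum_comm]
  refine Finset.sum_congr rfl fun d _ => Finset.sum_congr rfl fun c _ => ?_
  congr 1
  ring

theorem kappa_inv_mul (h : G) : D.κ h⁻¹ * D.κ h = 1 := by rw [← map_mul, inv_mul_cancel, map_one]

theorem kappa_mul_inv (h : G) : D.κ h * D.κ h⁻¹ = 1 := by rw [← map_mul, mul_inv_cancel, map_one]

/-- The twisted trace of matrices of numbers. -/
def trE {m : ℕ} (E : Fin (m + 1) → Matrix (Fin r) (Fin r) ℂ) : ℂ :=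
  Matrix.trace (E 0 * D.κ D.g * (List.ofFn fun q : Fin m => E q.succ).prod)

theorem trE_contract_interior {m : ℕ} (E : Fin (m + 2) → Matrix (Fin r) (Fin r) ℂ) (i : Fin m) :
    D.trE (Fin.contractNth i.succ.castSucc (fun a b => a * b) E) = D.trE E := by
  unfold trE
  have h0 : Fin.contractNth i.succ.castSucc (fun a b => a * b) E 0 = E 0 := by
    rw [Fin.contractNth_apply_of_lt _ _ _ _ (by simp)]
    rfl
  have h1 : (fun q : Fin m => Fin.contractNth i.succ.castSucc (fun a b => a * b) E q.succ)
      = Fin.contractNth i.castSucc (fun a b => a * b) fun q => E q.succ := by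
    funext q
    simp only [Fin.contractNth, Fin.val_succ, Fin.val_castSucc, add_lt_add_iff_right,
      add_left_inj]
    rfl
  rw [h0, h1, prod_ofFn_contractNth]

/-- The trace has `κ g` behind the slot `0`; it cancels the `κ g⁻¹` of the conjugated factor and
leaves `κ g` in its old place. -/
theorem trE_contract_first {m : ℕ} (E : Fin (m + 2) → Matrix (Fin r) (Fin r) ℂ) :
    D.trE (Fin.contractNth 0 (fun a b => a * b)
      fun s => if s = 1 then D.κ D.g * E s * D.κ D.g⁻¹ else E s) = D.trE E := by
  unfold trE
  have h0 : Fin.contractNth 0 (fun a b => a * b)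
      (fun s => if s = 1 then D.κ D.g * E s * D.κ D.g⁻¹ else E s) (0 : Fin (m + 1))
      = E 0 * (D.κ D.g * E 1 * D.κ D.g⁻¹) := by
    rw [Fin.contractNth_apply_of_eq _ _ _ _ (by simp)]
    simp
  have h1 : (fun q : Fin m => Fin.contractNth 0 (fun a b => a * b)
      (fun s => if s = 1 then D.κ D.g * E s * D.κ D.g⁻¹ else E s) q.succ)
      = fun q => E q.succ.succ := by
    funext q
    rw [Fin.contractNth_apply_of_gt _ _ _ _ (by simp)]
    simp [Fin.ext_iff]
  rw [h0, h1, List.ofFn_succ, List.prod_cons]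
  congr 1
  have e : (Fin.succ 0 : Fin (m + 2)) = 1 := rfl
  rw [e]
  simp only [mul_assoc]
  rw [← mul_assoc (D.κ D.g⁻¹), kappa_inv_mul, one_mul]

theorem sub_one_succ {m : ℕ} (z : Fin (m + 1)) : (z.succ - 1 : Fin (m + 2)) = z.castSucc := by
  rw [sub_eq_iff_eq_add, Fin.coeSucc_eq_succ]

theorem zero_sub_one {m : ℕ} : (0 - 1 : Fin (m + 2)) = Fin.last (m + 1) := by
  rw [sub_eq_iff_eq_add, Fin.last_add_one]

theorem trE_contract_last {m : ℕ} (E : Fin (m + 2) → Matrix (Fin r) (Fin r) ℂ) :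
    D.trE (Fin.contractNth 0 (fun a b => a * b) fun s => E (s - 1)) = D.trE E := by
  unfold trE
  have h0 : Fin.contractNth 0 (fun a b => a * b) (fun s : Fin (m + 2) => E (s - 1)) (0 : Fin (m + 1))
      = E (Fin.last (m + 1)) * E 0 := by
    rw [Fin.contractNth_apply_of_eq _ _ _ _ (by simp), Fin.castSucc_zero, zero_sub_one, sub_one_succ]
    rfl
  have h1 : (fun q : Fin m => Fin.contractNth 0 (fun a b => a * b)
      (fun s : Fin (m + 2) => E (s - 1)) q.succ) = fun q => E q.castSucc.succ := by
    funext q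
    rw [Fin.contractNth_apply_of_gt _ _ _ _ (by simp), sub_one_succ, Fin.succ_castSucc]
  rw [h0, h1, List.ofFn_succ', List.concat_eq_append, List.prod_append, List.prod_singleton,
    mul_assoc (E (Fin.last (m + 1))), mul_assoc (E (Fin.last (m + 1))), Matrix.trace_mul_comm,
    mul_assoc, Fin.succ_last]

/-- The conjugations telescope along the run of factors behind `E 0`, and cyclicity of the trace
brings `E 0` to the front. -/
theorem trE_cyclic {m : ℕ} (E : Fin (m + 1) → Matrix (Fin r) (Fin r) ℂ) (i : Fin (m + 1)) :
    D.trE (Fin.cons 1 fun s : Fin (m + 1) =>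
      if i < s then D.κ D.g * E (s - i) * D.κ D.g⁻¹ else E (s - i)) = D.trE E := by
  have hi := i.isLt
  -- The periodic extension of `E`; the product can then be cut at `i` into ranges of natural
  -- numbers.
  let b : ℕ → Matrix (Fin r) (Fin r) ℂ := fun n => E (Fin.ofNat (m + 1) n)
  have hb : ∀ s : Fin (m + 1), E s = b s.val := fun s => by simp [b]
  let x : ℕ → Matrix (Fin r) (Fin r) ℂ := fun n =>
    if i.val < n then D.κ D.g * b (n - i.val) * D.κ D.g⁻¹ else b (n + (m + 1) - i.val)
  unfold trE
  simp only [Fin.cons_zero, Fin.cons_succ, one_mul]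
  rw [prod_ofFn_eq (x := x), prod_ofFn_eq (x := fun n => b (n + 1))]
  · have e1 : List.range (m + 1)
        = List.range (i.val + 1) ++ (List.range (m - i.val)).map (i.val + 1 + ·) := by
      rw [← List.range_add]
      congr 1
      omega
    have e2 : m = (m - i.val) + i.val := by omega
    rw [e1, List.map_append, List.prod_append, List.map_map]
    have e3 : (List.range (m - i.val)).map (x ∘ fun n => i.val + 1 + n)
        = (List.range (m - i.val)).map fun n => D.κ D.g * b (n + 1) * D.κ D.g⁻¹ := by
      refine List.map_congr_left fun n _ => ?_
      simp only [Function.comp, x]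
      rw [if_pos (by omega)]
      congr 3
      omega
    have e4 : (List.range (i.val + 1)).map x = (List.range i.val).map
        (fun n => b (m - i.val + n + 1)) ++ [b (m + 1)] := by
      rw [List.range_succ, List.map_append]
      congr 1
      · refine List.map_congr_left fun n hn => ?_
        rw [List.mem_range] at hn
        simp only [x]
        rw [if_neg (by omega)]
        congr 1
        omega
      · simp [x]
    have e5 : b (m + 1) = E 0 := by
      simp only [b]
      congr 1
      ext
      simp
    have e6 : ((List.range m).map fun n => b (n + 1)).prod
        = ((List.range (m - i.val)).map fun n => b (n + 1)).prod *
          ((List.range i.val).map fun n => b (m - i.val + n + 1)).prod := by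
      conv_lhs => rw [e2]
      rw [List.range_add, List.map_append, List.prod_append, List.map_map]
      rfl
    rw [e3, prod_conj (D.kappa_inv_mul _) (D.kappa_mul_inv _), e4, List.prod_append,
      List.prod_singleton, e5, e6]
    generalize ((List.range (m - i.val)).map fun n => b (n + 1)).prod = P
    generalize ((List.range i.val).map fun n => b (m - i.val + n + 1)).prod = Q
    calc Matrix.trace (D.κ D.g * (Q * E 0 * (D.κ D.g * P * D.κ D.g⁻¹)))
        = Matrix.trace ((D.κ D.g * (Q * E 0 * (D.κ D.g * P))) * D.κ D.g⁻¹) := by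
          simp only [mul_assoc]
      _ = Matrix.trace (Q * (E 0 * (D.κ D.g * P))) := by
          rw [Matrix.trace_mul_comm, ← mul_assoc, kappa_inv_mul, one_mul, mul_assoc]
      _ = Matrix.trace (E 0 * D.κ D.g * (P * Q)) := by
          rw [Matrix.trace_mul_comm]
          simp only [mul_assoc]
  · intro q
    rw [hb]
    simp
  · intro s
    rw [hb (s - i)]
    simp only [x, Fin.lt_def]
    have hs := s.isLt
    split_ifs with h
    · rw [Fin.sub_val_of_le (Fin.le_def.2 h.le)]
    · simp only [b]
      congr 1
      ext
      simp [Fin.sub_def]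
      congr 1
      omega

/-- All inner conjugations cancel, because `κ h` commutes with `κ g`, and the outer one cancels in
the trace. -/
theorem trE_conj {m : ℕ} {h : G} (hh : h ∈ Subgroup.centralizer {D.g})
    (E : Fin (m + 1) → Matrix (Fin r) (Fin r) ℂ) :
    D.trE (fun s => D.κ h * E s * D.κ h⁻¹) = D.trE E := by
  have hc : D.κ h⁻¹ * D.κ D.g = D.κ D.g * D.κ h⁻¹ := by
    rw [← map_mul, ← map_mul]
    congr 1
    exact ((Subgroup.mem_centralizer_singleton_iff.1 (inv_mem hh)))
  unfold trE
  let b : ℕ → Matrix (Fin r) (Fin r) ℂ := fun n => E (Fin.ofNat (m + 1) n)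
  have hb : ∀ s : Fin (m + 1), E s = b s.val := fun s => by simp [b]
  rw [prod_ofFn_eq (x := fun n => D.κ h * b (n + 1) * D.κ h⁻¹) (fun q => by simp only [hb]; rfl),
    prod_ofFn_eq (x := fun n => b (n + 1)) (fun q => by simp only [hb]; rfl),
    prod_conj (D.kappa_inv_mul _) (D.kappa_mul_inv _)]
  generalize ((List.range m).map fun n => b (n + 1)).prod = P
  calc Matrix.trace (D.κ h * E 0 * D.κ h⁻¹ * D.κ D.g * (D.κ h * P * D.κ h⁻¹))
      = Matrix.trace ((D.κ h * (E 0 * (D.κ h⁻¹ * D.κ D.g) * (D.κ h * P))) * D.κ h⁻¹) := by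
        simp only [mul_assoc]
    _ = Matrix.trace (E 0 * D.κ D.g * P) := by
        rw [Matrix.trace_mul_comm, ← mul_assoc, kappa_inv_mul, one_mul, hc]
        simp only [mul_assoc]
        rw [← mul_assoc (D.κ h⁻¹), kappa_inv_mul, one_mul]

end Sector
end TwistedTQM
end

/-! ### The free correlation map on chains of matrices -/

noncomputable section
namespace TwistedTQM

set_option linter.unusedSectionVars false

theorem neg_one_pow_smul_eq {S : Type*} [AddCommGroup S] [Module ℂ S] (n : ℕ) (x : Lau S) :
    (-1 : K) ^ n • x = (-1 : ℂ) ^ n • x := by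
  induction n with
  | zero => simp
  | succ n ih =>
    rw [pow_succ', pow_succ', mul_smul, mul_smul, ih, neg_smul, neg_smul, one_smul, one_smul]

theorem toAlg_C {R : Type*} [Ring R] [Algebra ℂ R] (c : ℂ) :
    toAlg R (HahnSeries.C c) = HahnSeries.C (algebraMap ℂ R c) := by
  ext n
  simp only [toAlg, HahnSeries.C_apply, HahnSeries.map_coeff, HahnSeries.coeff_single]
  split_ifs
  · rfl
  · exact map_zero _

section Insertion

variable {k l r : ℕ}

/-- A matrix of numbers as a matrix of series. -/
def hatMat (σ : Type) : Matrix (Fin r) (Fin r) ℂ →+* Matrix (Fin r) (Fin r) (HahnSeries ℤ (PS σ)) :=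
  ((HahnSeries.C : PS σ →+* HahnSeries ℤ (PS σ)).comp MvPowerSeries.C).mapMatrix

/-- The operator applied in the slot `s`: nothing in the slot `0`, a derivative in all others. -/
def slotOp {m : ℕ} (i : Fin m → YVar k) (s : Fin (m + 1)) : W k l →ₗ[K] W k l :=
  Fin.cons (α := fun _ => W k l →ₗ[K] W k l) LinearMap.id (fun q => mapC (pd (Sum.inl (i q)))) s

theorem slotOp_dFam {m : ℕ} (i : Fin m → YVar k) (f : Fin (m + 1) → W k l) :
    (fun s => slotOp i s (f s)) = Sector.dFam f i := by
  funext s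
  refine Fin.cases ?_ (fun q => ?_) s <;> rfl

/-- The matrix in the slot `s`, at its point. -/
def insertOp {m : ℕ} (i : Fin m → YVar k) (s : Fin (m + 1)) (a : A k l r) :
    Matrix (Fin r) (Fin r) (HahnSeries ℤ (PS (Fin (m + 1) × Var k l))) :=
  a.map fun f => toS (mapC (atP s).toLinearMap (slotOp i s f))

theorem insertOp_add {m : ℕ} (i : Fin m → YVar k) (s : Fin (m + 1)) (a b : A k l r) :
    insertOp i s (a + b) = insertOp i s a + insertOp i s b := by
  ext1 x y
  simp [insertOp]

theorem insertOp_smul {m : ℕ} (i : Fin m → YVar k) (s : Fin (m + 1)) (c : K) (a : A k l r) :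
    insertOp i s (c • a) = toAlg (PS (Fin (m + 1) × Var k l)) c • insertOp i s a := by
  ext1 x y
  simp [insertOp, toS_K_smul]

theorem insertOp_elem {m : ℕ} (i : Fin m → YVar k) (s : Fin (m + 1)) (f : W k l)
    (E : Matrix (Fin r) (Fin r) ℂ) :
    insertOp i s (elem f E) = toS (mapC (atP s).toLinearMap (slotOp i s f)) • hatMat _ E := by
  ext1 x y
  change toS (mapC (atP s).toLinearMap (slotOp i s (E x y • f)))
    = toS (mapC (atP s).toLinearMap (slotOp i s f)) * HahnSeries.C (MvPowerSeries.C (E x y))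
  rw [← C_smul, map_smul, map_smul, toS_K_smul, mul_comm, toAlg_C]
  rfl

end Insertion

namespace Sector

variable {G : Type*} [Group G] {k l r : ℕ} (D : Sector G k l r)

/-- The twisted trace of a product of matrices of series. -/
def traceMulti (m : ℕ) (σ : Type) :
    MultilinearMap (HahnSeries ℤ (PS σ))
      (fun _ : Fin (m + 1) => Matrix (Fin r) (Fin r) (HahnSeries ℤ (PS σ))) (HahnSeries ℤ (PS σ)) :=
  (Matrix.traceLinearMap (Fin r) (HahnSeries ℤ (PS σ)) (HahnSeries ℤ (PS σ))).compMultilinearMap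
    ((MultilinearMap.mkPiAlgebraFin (HahnSeries ℤ (PS σ)) (m + 1) _).compLinearMap fun s =>
      if s = 0 then LinearMap.mulRight _ (hatMat σ (D.κ D.g)) else LinearMap.id)

theorem traceMulti_apply (m : ℕ) (σ : Type)
    (X : Fin (m + 1) → Matrix (Fin r) (Fin r) (HahnSeries ℤ (PS σ))) :
    D.traceMulti m σ X
      = Matrix.trace (X 0 * hatMat σ (D.κ D.g) * (List.ofFn fun q : Fin m => X q.succ).prod) := by
  simp [traceMulti, List.ofFn_succ, Fin.succ_ne_zero]

theorem traceMulti_hatMat (m : ℕ) (σ : Type) (E : Fin (m + 1) → Matrix (Fin r) (Fin r) ℂ) :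
    D.traceMulti m σ (fun s => hatMat σ (E s)) = HahnSeries.C (MvPowerSeries.C (D.trE E)) := by
  have h : (List.ofFn fun q : Fin m => hatMat σ (E q.succ)).prod
      = hatMat σ (List.ofFn fun q : Fin m => E q.succ).prod := by
    rw [map_list_prod, List.map_ofFn]
    rfl
  rw [traceMulti_apply, h, ← map_mul, ← map_mul, trE]
  exact (AddMonoidHom.map_trace
    ((HahnSeries.C : PS σ →+* HahnSeries ℤ (PS σ)).comp MvPowerSeries.C) _).symm

theorem traceAt_eq {m : ℕ} (t : Fin (m + 1) → A k l r) (i : Fin m → YVar k) :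
    D.traceAt t i = ofS (D.traceMulti m _ fun s => insertOp i s (t s)) := by
  rw [traceMulti_apply]
  rfl

theorem insertOp_update {m : ℕ} (i : Fin m → YVar k) (t : Fin (m + 1) → A k l r)
    (p : Fin (m + 1)) (x : A k l r) :
    (fun s => insertOp i s (Function.update t p x s))
      = Function.update (fun s => insertOp i s (t s)) p (insertOp i p x) :=
  funext fun s => Function.apply_update (fun s a => insertOp i s a) t p x s

/-- The twisted trace as a multilinear map. -/
def traceAtMulti {m : ℕ} (i : Fin m → YVar k) :
    MultilinearMap K (fun _ : Fin (m + 1) => A k l r) (Lau (PS (Fin (m + 1) × Var k l))) :=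
  MultilinearMap.mk' (fun t => D.traceAt t i)
    (fun t p x y => by
      simp only [traceAt_eq, insertOp_update, insertOp_add, MultilinearMap.map_update_add, ofS_add])
    (fun t p c x => by
      simp only [traceAt_eq, insertOp_update, insertOp_smul, MultilinearMap.map_update_smul]
      apply toS_injective
      rw [toS_K_smul]
      rfl)

/-- The functions are scalars of a commutative ring of series and come out of the trace, which is
multilinear over that ring. -/
theorem traceAt_elem {m : ℕ} (f : Fin (m + 1) → W k l) (E : Fin (m + 1) → Matrix (Fin r) (Fin r) ℂ)
    (i : Fin m → YVar k) :
    D.traceAt (fun s => elem (f s) (E s)) i = D.trE E • ofS (emb (dFam f i)) := by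
  have h : (fun s => insertOp i s (elem (f s) (E s)))
      = fun s => toS (mapC (atP s).toLinearMap (slotOp i s (f s))) • hatMat _ (E s) :=
    funext fun s => insertOp_elem i s _ _
  rw [traceAt_eq, h, MultilinearMap.map_smul_univ, traceMulti_hatMat, ← C_smul]
  apply toS_injective
  rw [toS_K_smul, mul_comm, toS_ofS, smul_eq_mul, ← slotOp_dFam]
  rw [toAlg_C]
  rfl

/-- The free correlation map as a multilinear map. -/
def freeMulti (m : ℕ) : MultilinearMap K (fun _ : Fin (m + 1) => A k l r) (Ω k) :=
  (HahnSeries.C ((1 - D.gPerp⁻¹).det⁻¹) : K) • ∑ i : Fin m → YVar k,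
    (mapC (tens (dyProd i)) ∘ₗ D.integralL m).compMultilinearMap (D.traceAtMulti i)

theorem freeMulti_apply (m : ℕ) (t : Fin (m + 1) → A k l r) : D.freeMulti m t = D.freeCorr t := by
  simp only [freeMulti, smul_apply, sum_apply]
  rfl

theorem freeMulti_elem (m : ℕ) (f : Fin (m + 1) → W k l)
    (E : Fin (m + 1) → Matrix (Fin r) (Fin r) ℂ) :
    D.freeMulti m (fun s => elem (f s) (E s))
      = ((1 - D.gPerp⁻¹).det⁻¹ * D.trE E) • D.formInt m f := by
  have h : ∀ i : Fin m → YVar k, D.traceAtMulti i (fun s => elem (f s) (E s))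
      = D.trE E • ofS (emb (dFam f i)) := D.traceAt_elem f E
  simp only [freeMulti, smul_apply, sum_apply,
    LinearMap.compMultilinearMap_apply, h, LinearMap.map_smul_of_tower]
  rw [C_smul, mul_smul, ← Finset.smul_sum]
  rfl

/-- The free correlation map on chains. -/
def freeChain : Chain k l r →ₗ[K] Ω k :=
  DirectSum.toModule K ℕ _ fun m => PiTensorProduct.lift (D.freeMulti m)

theorem freeChain_lof (m : ℕ) (x : Tens k l r m) :
    D.freeChain (DirectSum.lof K ℕ (fun m => Tens k l r m) m x)
      = PiTensorProduct.lift (D.freeMulti m) x := by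
  rw [freeChain, DirectSum.toModule_lof]

theorem freeChain_tprod (m : ℕ) (t : Fin (m + 1) → A k l r) :
    D.freeChain (DirectSum.lof K ℕ (fun m => Tens k l r m) m (PiTensorProduct.tprod K t))
      = D.freeMulti m t := by
  rw [freeChain_lof, PiTensorProduct.lift.tprod]

end Sector

section ChainMaps

variable {k l r : ℕ}

theorem contractNth_elem {m : ℕ} (p : Fin (m + 1)) (f : Fin (m + 1) → W k l)
    (E : Fin (m + 1) → Matrix (Fin r) (Fin r) ℂ) :
    Fin.contractNth p (fun a b => mmul a b) (fun s => elem (f s) (E s))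
      = fun s => elem (Fin.contractNth p (fun a b => star a b) f s)
          (Fin.contractNth p (fun a b => a * b) E s) := by
  funext s
  simp only [Fin.contractNth]
  split_ifs
  · rfl
  · exact mmul_elem _ _ _ _
  · rfl

theorem chain_hom_ext_elem {M : Type*} [AddCommGroup M] [Module K M] {φ ψ : Chain k l r →ₗ[K] M}
    (h : ∀ (m : ℕ) (f : Fin (m + 1) → W k l) (E : Fin (m + 1) → Matrix (Fin r) (Fin r) ℂ),
      φ (DirectSum.lof K ℕ (fun m => Tens k l r m) m
          (PiTensorProduct.tprod K fun s => elem (f s) (E s)))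
        = ψ (DirectSum.lof K ℕ (fun m => Tens k l r m) m
          (PiTensorProduct.tprod K fun s => elem (f s) (E s)))) : φ = ψ := by
  refine DirectSum.linearMap_ext K fun m => PiTensorProduct.ext ?_
  exact multilinearMap_ext_elem fun f E => h m f E

end ChainMaps

namespace Sector

variable {G : Type*} [Group G] {k l r : ℕ} (D : Sector G k l r)

theorem lift_face {M : Type*} [AddCommGroup M] [Module K M] {m : ℕ}
    (φ : MultilinearMap K (fun _ : Fin (m + 1) => A k l r) M) (i : Fin (m + 1))
    (a : Fin (m + 2) → A k l r) :
    PiTensorProduct.lift φ (face m i a)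
      = φ (Fin.contractNth i.castSucc (fun x y => mmul x y) a) :=
  PiTensorProduct.lift.tprod _

theorem hoch_lof_succ (m : ℕ) (t : Fin (m + 2) → A k l r) :
    D.hoch (DirectSum.lof K ℕ (fun m => Tens k l r m) (m + 1) (PiTensorProduct.tprod K t))
      = DirectSum.lof K ℕ (fun m => Tens k l r m) m (D.hochMulti m t) := by
  rw [hoch, DirectSum.toModule_lof]
  simp

theorem hoch_lof_zero (x : Tens k l r 0) :
    D.hoch (DirectSum.lof K ℕ (fun m => Tens k l r m) 0 x) = 0 := by
  rw [hoch, DirectSum.toModule_lof]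
  rfl

theorem connes_lof (m : ℕ) (t : Fin (m + 1) → A k l r) :
    D.connes (DirectSum.lof K ℕ (fun m => Tens k l r m) m (PiTensorProduct.tprod K t))
      = DirectSum.lof K ℕ (fun m => Tens k l r m) (m + 1) (D.connesMulti m t) := by
  rw [connes, DirectSum.toModule_lof]
  simp

theorem actChain_lof (h : G) (m : ℕ) (t : Fin (m + 1) → A k l r) :
    D.actChain h (DirectSum.lof K ℕ (fun m => Tens k l r m) m (PiTensorProduct.tprod K t))
      = DirectSum.lof K ℕ (fun m => Tens k l r m) m
          (PiTensorProduct.tprod K fun s => D.actA h (t s)) := by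
  rw [actChain, DirectSum.lmap_lof, PiTensorProduct.map_tprod]

theorem formInt_zero_BV (f : Fin 1 → W k l) : BV k (D.formInt 0 f) = 0 := by
  simp only [formInt, map_sum, BV_tens, dyProd, List.ofFn_zero, List.prod_nil,
    CliffordAlgebra.contractLeft_one]
  refine Finset.sum_eq_zero fun i _ => Finset.sum_eq_zero fun a _ =>
    Finset.sum_eq_zero fun b _ => ?_
  rw [tens, map_zero]
  exact smul_zero _

/-- On elementary tensors all terms carry the same trace, so this is `formInt_hoch`. On a single
factor `b_g` is zero by definition and `Δ` kills functions. -/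
theorem freeChain_hoch : D.freeChain ∘ₗ D.hoch = hbar • (BV k ∘ₗ D.freeChain) := by
  refine chain_hom_ext_elem fun m f E => ?_
  simp only [LinearMap.comp_apply, LinearMap.smul_apply]
  cases m with
  | zero =>
    rw [hoch_lof_zero, map_zero, freeChain_tprod, freeMulti_elem, LinearMap.map_smul_of_tower,
      formInt_zero_BV, smul_zero, smul_zero]
  | succ m =>
    have h1 : (fun s => elem (f ((Equiv.subRight 1) s)) (E ((Equiv.subRight (1 : Fin (m + 2))) s)))
      = fun s => elem (f (s - 1)) (E (s - 1)) := rfl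
    have h2 : (fun s : Fin (m + 2) =>
        (if s = 1 then D.actA D.g else LinearMap.id) (elem (f s) (E s)))
        = fun s => elem (if s = 1 then D.actW D.g (f s) else f s)
            (if s = 1 then D.κ D.g * E s * D.κ D.g⁻¹ else E s) := by
      funext s
      split_ifs
      · exact D.actA_elem _ _ _
      · rfl
    rw [hoch_lof_succ, freeChain_lof, freeChain_tprod, freeMulti_elem, LinearMap.map_smul_of_tower,
      smul_comm hbar, ← formInt_hoch, hochMulti]
    simp only [add_apply, smul_apply, sum_apply,
      map_add, map_sum, map_smul, MultilinearMap.domDomCongr_apply,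
      MultilinearMap.compLinearMap_apply, lift_face, h1, h2, Fin.castSucc_zero]
    rw [contractNth_elem, contractNth_elem, freeMulti_elem, freeMulti_elem, trE_contract_last,
      trE_contract_first, smul_add, smul_add, Finset.smul_sum, neg_one_pow_smul_eq,
      smul_comm ((-1 : ℂ) ^ (m + 1))]
    congr 1
    refine Finset.sum_congr rfl fun i _ => ?_
    rw [contractNth_elem, freeMulti_elem, trE_contract_interior, neg_one_pow_smul_eq, smul_comm]

theorem consOne_elem {m : ℕ} (f : Fin (m + 1) → W k l) (E : Fin (m + 1) → Matrix (Fin r) (Fin r) ℂ) :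
    consOne m (fun s => elem (f s) (E s)) = PiTensorProduct.tprod K fun s : Fin (m + 2) =>
      elem ((Fin.cons (const 1) f : Fin (m + 2) → W k l) s)
        ((Fin.cons 1 E : Fin (m + 2) → Matrix (Fin r) (Fin r) ℂ) s) := by
  change PiTensorProduct.tprod K (Fin.cons (oneA k l r) fun s => elem (f s) (E s) :
    Fin (m + 2) → A k l r) = _
  congr 1
  funext s
  refine Fin.cases ?_ (fun q => ?_) s
  · exact oneA_eq_elem
  · rfl

/-- The rotated traces all coincide by `trE_cyclic`, which leaves `formInt_connes`. -/
theorem freeChain_connes : D.freeChain ∘ₗ D.connes = deRham k ∘ₗ D.freeChain := by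
  refine chain_hom_ext_elem fun m f E => ?_
  simp only [LinearMap.comp_apply]
  have h2 : ∀ i : Fin (m + 1), (fun s : Fin (m + 1) =>
      (if i < s then D.actA D.g else LinearMap.id)
        (elem (f ((Equiv.subRight i) s)) (E ((Equiv.subRight i) s))))
      = fun s => elem (if i < s then D.actW D.g (f (s - i)) else f (s - i))
          (if i < s then D.κ D.g * E (s - i) * D.κ D.g⁻¹ else E (s - i)) := by
    intro i
    funext s
    split_ifs
    · exact D.actA_elem _ _ _
    · rfl
  rw [connes_lof, freeChain_lof, freeChain_tprod, freeMulti_elem, LinearMap.map_smul_of_tower,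
    ← formInt_connes, connesMulti, Finset.smul_sum]
  simp only [smul_apply, sum_apply,
    map_sum, map_smul, MultilinearMap.domDomCongr_apply, MultilinearMap.compLinearMap_apply, h2,
    consOne_elem, PiTensorProduct.lift.tprod]
  refine Finset.sum_congr rfl fun i _ => ?_
  rw [freeMulti_elem, trE_cyclic, neg_one_pow_smul_eq, smul_comm]

theorem freeChain_actChain {h : G} (hh : h ∈ Subgroup.centralizer {D.g}) :
    D.freeChain ∘ₗ D.actChain h = D.actΩ h ∘ₗ D.freeChain := by
  refine chain_hom_ext_elem fun m f E => ?_
  simp only [LinearMap.comp_apply]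
  have h2 : (fun s => D.actA h (elem (f s) (E s)))
      = fun s => elem (D.actW h (f s)) (D.κ h * E s * D.κ h⁻¹) := funext fun s => D.actA_elem _ _ _
  rw [actChain_lof, h2, freeChain_tprod, freeChain_tprod, freeMulti_elem, freeMulti_elem,
    D.trE_conj hh, D.formInt_actW hh, LinearMap.map_smul_of_tower]

theorem freeMulti_eq_zero {m : ℕ} (t : Fin (m + 1) → A k l r) (s : Fin m)
    (hs : t s.succ = oneA k l r) : D.freeMulti m t = 0 := by
  have ht : t = fun p => ∑ c : Fin r × Fin r, elem (t p c.1 c.2) (Matrix.single c.1 c.2 1) :=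
    funext fun p => eq_sum_elem (t p)
  rw [ht, MultilinearMap.map_sum]
  refine Finset.sum_eq_zero fun c _ => ?_
  rw [freeMulti_elem]
  have hc : t s.succ (c s.succ).1 (c s.succ).2
      = if (c s.succ).1 = (c s.succ).2 then const 1 else 0 := by
    rw [hs]
    rfl
  by_cases h : (c s.succ).1 = (c s.succ).2
  · rw [if_pos h] at hc
    rw [D.formInt_eq_zero _ s hc, smul_zero]
  · rw [if_neg h] at hc
    have h0 := (D.freeMulti m).map_coord_zero (m := fun p =>
      elem (t p (c p).1 (c p).2) (Matrix.single (c p).1 (c p).2 1)) s.succ (by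
        ext1 a b
        simp [elem_apply, hc])
    rwa [freeMulti_elem] at h0

end Sector
end TwistedTQM
end

/-! ### Chains as tuples over the natural numbers; insertion operators -/

noncomputable section
namespace TwistedTQM

set_option linter.unusedSectionVars false

instance chainAddCommGroup {k l r : ℕ} : AddCommGroup (Chain k l r) :=
  Module.addCommMonoidToAddCommGroup K

theorem neg_one_pow_smul_eq_int {M : Type*} [AddCommGroup M] [Module K M] (n : ℕ) (x : M) :
    (-1 : K) ^ n • x = (-1 : ℤ) ^ n • x := by
  induction n with
  | zero => simp
  | succ n ih =>
    rw [pow_succ', pow_succ', mul_smul, mul_smul, ih, neg_smul, neg_smul, one_smul, one_smul]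

section Tensors

variable {k l r : ℕ}

/-- The chain `a_0 ⊗ … ⊗ a_m`. -/
def tensor (m : ℕ) (a : ℕ → A k l r) : Chain k l r :=
  DirectSum.lof K ℕ (fun m => Tens k l r m) m (PiTensorProduct.tprod K fun s : Fin (m + 1) => a s)

/-- Tuples indexed by `ℕ`, of which only the first entries count, turn simplicial identities into
arithmetic of indices. -/
theorem tensor_congr {m : ℕ} {a a' : ℕ → A k l r} (h : ∀ s ≤ m, a s = a' s) :
    tensor m a = tensor m a' := by
  unfold tensor
  congr 2
  exact funext fun s => h s (by omega)

/-- The extension of a tuple to all natural numbers. -/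
def extend {m : ℕ} (t : Fin (m + 1) → A k l r) (n : ℕ) : A k l r := t (Fin.ofNat (m + 1) n)

@[simp] theorem extend_val {m : ℕ} (t : Fin (m + 1) → A k l r) (s : Fin (m + 1)) :
    extend t s.val = t s := by simp [extend]

theorem lof_tprod_eq_tensor {m : ℕ} (t : Fin (m + 1) → A k l r) :
    DirectSum.lof K ℕ (fun m => Tens k l r m) m (PiTensorProduct.tprod K t)
      = tensor m (extend t) := by
  simp [tensor]

theorem chain_hom_ext {M : Type*} [AddCommGroup M] [Module K M] {φ ψ : Chain k l r →ₗ[K] M}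
    (h : ∀ (m : ℕ) (a : ℕ → A k l r), φ (tensor m a) = ψ (tensor m a)) : φ = ψ := by
  refine DirectSum.linearMap_ext K fun m => PiTensorProduct.ext (MultilinearMap.ext fun t => ?_)
  change φ (DirectSum.lof K ℕ _ m _) = ψ (DirectSum.lof K ℕ _ m _)
  rw [lof_tprod_eq_tensor]
  exact h m _

/-- The tuple with `x` inserted in the slot `p`. -/
def ins {α : Type*} (p : ℕ) (x : α) (a : ℕ → α) (s : ℕ) : α :=
  if s < p then a s else if s = p then x else a (s - 1)

theorem insertNth_eq_ins {m : ℕ} (p : Fin (m + 2)) (x : A k l r) (a : ℕ → A k l r) :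
    (Fin.insertNth p x fun s : Fin (m + 1) => a s : Fin (m + 2) → A k l r)
      = fun s : Fin (m + 2) => ins p.val x a s.val := by
  funext s
  refine Fin.succAboveCases p ?_ (fun q => ?_) s
  · simp [ins]
  · rw [Fin.insertNth_apply_succAbove]
    by_cases h : q.castSucc < p
    · rw [Fin.succAbove_of_castSucc_lt _ _ h]
      have h' : q.val < p.val := Fin.lt_def.1 h
      simp only [ins, Fin.val_castSucc]
      rw [if_pos h']
    · rw [Fin.succAbove_of_le_castSucc _ _ (not_lt.1 h)]
      have h' : p.val ≤ q.val := Fin.le_def.1 (not_lt.1 h)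
      simp only [ins, Fin.val_succ]
      rw [if_neg (by omega), if_neg (by omega)]
      simp

/-- The insertion of `x / ħ` in all the slots after the first one, with signs. -/
def insOp (x : A k l r) : Chain k l r →ₗ[K] Chain k l r :=
  DirectSum.toModule K ℕ _ fun m =>
    (DirectSum.lof K ℕ (fun m => Tens k l r m) (m + 1)) ∘ₗ PiTensorProduct.lift
      (∑ p : Fin (m + 1), (-1 : K) ^ (p.val + 1) •
        (PiTensorProduct.tprod K (s := fun _ : Fin (m + 2) => A k l r)).curryMid p.succ
          (hbarInv • x))

theorem insOp_lof_curryMid (x : A k l r) (m : ℕ) (t : Fin (m + 1) → A k l r) :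
    insOp x (DirectSum.lof K ℕ (fun m => Tens k l r m) m (PiTensorProduct.tprod K t))
      = ∑ p : Fin (m + 1), (-1 : ℤ) ^ (p.val + 1) •
        DirectSum.lof K ℕ (fun m => Tens k l r m) (m + 1)
          ((PiTensorProduct.tprod K (s := fun _ : Fin (m + 2) => A k l r)).curryMid p.succ
            (hbarInv • x) t) := by
  rw [insOp, DirectSum.toModule_lof, LinearMap.comp_apply, PiTensorProduct.lift.tprod, sum_apply,
    map_sum]
  refine Finset.sum_congr rfl fun p _ => ?_
  rw [smul_apply, LinearMap.map_smul, neg_one_pow_smul_eq_int]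

theorem insOp_lof (x : A k l r) (m : ℕ) (t : Fin (m + 1) → A k l r) :
    insOp x (DirectSum.lof K ℕ (fun m => Tens k l r m) m (PiTensorProduct.tprod K t))
      = ∑ p : Fin (m + 1), (-1 : ℤ) ^ (p.val + 1) •
        DirectSum.lof K ℕ (fun m => Tens k l r m) (m + 1)
          (PiTensorProduct.tprod K (Fin.insertNth p.succ (hbarInv • x) t)) :=
  insOp_lof_curryMid x m t

/-- The insertion operators, linearly in the inserted element. -/
def insChain : A k l r →ₗ[K] Module.End K (Chain k l r) where
  toFun := insOp
  map_add' x y := by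
    refine chain_hom_ext fun m a => ?_
    simp only [tensor, LinearMap.add_apply, insOp_lof_curryMid, ← Finset.sum_add_distrib,
      smul_add, map_add, add_apply]
  map_smul' c x := by
    refine chain_hom_ext fun m a => ?_
    simp only [tensor, LinearMap.smul_apply, insOp_lof_curryMid, Finset.smul_sum,
      smul_comm hbarInv c, map_smul, RingHom.id_apply, smul_apply]
    refine Finset.sum_congr rfl fun p _ => ?_
    rw [smul_comm _ c]

theorem insChain_lof (x : A k l r) (m : ℕ) (t : Fin (m + 1) → A k l r) :
    insChain x (DirectSum.lof K ℕ (fun m => Tens k l r m) m (PiTensorProduct.tprod K t))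
      = ∑ p : Fin (m + 1), (-1 : ℤ) ^ (p.val + 1) •
        DirectSum.lof K ℕ (fun m => Tens k l r m) (m + 1)
          (PiTensorProduct.tprod K (Fin.insertNth p.succ (hbarInv • x) t)) :=
  insOp_lof x m t

theorem insChain_tensor (x : A k l r) (m : ℕ) (a : ℕ → A k l r) :
    insChain x (tensor m a) = ∑ p ∈ Finset.range (m + 1), (-1 : ℤ) ^ (p + 1) •
      tensor (m + 1) (ins (p + 1) (hbarInv • x) a) := by
  rw [tensor, insChain_lof, ← Fin.sum_univ_eq_sum_range (fun p => (-1 : ℤ) ^ (p + 1) •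
      tensor (m + 1) (ins (p + 1) (hbarInv • x) a))]
  refine Finset.sum_congr rfl fun p _ => ?_
  rw [insertNth_eq_ins]
  rfl

theorem adChain_tensor (x : A k l r) (m : ℕ) (a : ℕ → A k l r) :
    adChain x (tensor m a) = ∑ p ∈ Finset.range (m + 1),
      tensor m (Function.update a p (ad x (a p))) := by
  rw [tensor, adChain, DirectSum.lmap_lof,
    ← Fin.sum_univ_eq_sum_range (fun p => tensor m (Function.update a p (ad x (a p)))),
    LinearMap.sum_apply, map_sum]
  refine Finset.sum_congr rfl fun p _ => ?_
  rw [PiTensorProduct.map_tprod, tensor]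
  congr 2
  funext s
  by_cases h : s = p
  · subst h
    simp
  · have h' : s.val ≠ p.val := fun e => h (Fin.ext e)
    simp [h, h']

end Tensors

namespace Sector

variable {G : Type*} [Group G] {k l r : ℕ} (D : Sector G k l r)

/-- The twisted product of the slots `i` and `i + 1`, cyclically, in a tuple of length `m + 2`. -/
def faceTuple (m i : ℕ) (a : ℕ → A k l r) (s : ℕ) : A k l r :=
  if i = m + 1 then (if s = 0 then mmul (a (m + 1)) (a 0) else a s)
  else if s < i then a s
  else if s = i then mmul (a i) (if i = 0 then D.actA D.g (a (i + 1)) else a (i + 1))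
  else a (s + 1)

/-- The tuple `1, a_{m - i + 1}, …, a_m, a_0, g a_1, …, g a_{m - i}`. -/
def rotTuple (m i : ℕ) (a : ℕ → A k l r) (s : ℕ) : A k l r :=
  if s = 0 then oneA k l r
  else if s ≤ i then a (m + s - i)
  else if s = i + 1 then a 0
  else D.actA D.g (a (s - 1 - i))

theorem lof_face {m : ℕ} (i : Fin (m + 1)) (t : Fin (m + 2) → A k l r) (a : ℕ → A k l r)
    (h : ∀ s : Fin (m + 1), Fin.contractNth i.castSucc (fun x y => mmul x y) t s = a s) :
    DirectSum.lof K ℕ (fun m => Tens k l r m) m (face m i t) = tensor m a := by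
  change DirectSum.lof K ℕ (fun m => Tens k l r m) m (PiTensorProduct.tprod K _) = _
  rw [funext h]
  rfl

theorem contractNth_last {m : ℕ} (a : ℕ → A k l r) (s : Fin (m + 1)) :
    Fin.contractNth (Fin.castSucc 0) (fun x y => mmul x y) (fun s : Fin (m + 2) => a (s - 1).val) s
      = D.faceTuple m (m + 1) a s := by
  refine Fin.cases ?_ (fun q => ?_) s
  · rw [Fin.contractNth_apply_of_eq _ _ _ _ (by simp), Fin.castSucc_zero, zero_sub_one,
      sub_one_succ]
    simp [faceTuple]
  · rw [Fin.contractNth_apply_of_gt _ _ _ _ (by simp), sub_one_succ]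
    simp [faceTuple]

theorem contractNth_first {m : ℕ} (a : ℕ → A k l r) (s : Fin (m + 1)) :
    Fin.contractNth (Fin.castSucc 0) (fun x y => mmul x y)
      (fun s : Fin (m + 2) => (if s = 1 then D.actA D.g else LinearMap.id) (a s)) s
      = D.faceTuple m 0 a s := by
  refine Fin.cases ?_ (fun q => ?_) s
  · rw [Fin.contractNth_apply_of_eq _ _ _ _ (by simp)]
    simp [faceTuple]
  · rw [Fin.contractNth_apply_of_gt _ _ _ _ (by simp)]
    simp [faceTuple, Fin.ext_iff]

theorem contractNth_interior {m : ℕ} (a : ℕ → A k l r) (i : Fin m) (s : Fin (m + 1)) :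
    Fin.contractNth i.succ.castSucc (fun x y => mmul x y) (fun s : Fin (m + 2) => a s) s
      = D.faceTuple m (i.val + 1) a s := by
  have hi := i.isLt
  rcases lt_trichotomy s.val (i.val + 1) with h | h | h
  · rw [Fin.contractNth_apply_of_lt _ _ _ _ (by simpa using h), faceTuple,
      if_neg (show ¬ i.val + 1 = m + 1 by omega), if_pos h]
    rfl
  · rw [Fin.contractNth_apply_of_eq _ _ _ _ (by simpa using h), faceTuple,
      if_neg (show ¬ i.val + 1 = m + 1 by omega), if_neg (by omega), if_pos h,
      if_neg (Nat.succ_ne_zero _), Fin.val_castSucc, Fin.val_succ, h]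
  · rw [Fin.contractNth_apply_of_gt _ _ _ _ (by simpa using h), faceTuple,
      if_neg (show ¬ i.val + 1 = m + 1 by omega), if_neg (by omega), if_neg (by omega),
      Fin.val_succ]

theorem hoch_tensor_zero (a : ℕ → A k l r) : D.hoch (tensor 0 a) = 0 := D.hoch_lof_zero _

/-- With faces taken cyclically all terms have the uniform sign `(-1) ^ i`: `i = 0` is the twisted
face and `i = m + 1` the wrapped one. -/
theorem hoch_tensor_succ (m : ℕ) (a : ℕ → A k l r) :
    D.hoch (tensor (m + 1) a) = ∑ i ∈ Finset.range (m + 2), (-1 : ℤ) ^ i •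
      tensor m (D.faceTuple m i a) := by
  rw [tensor, hoch_lof_succ, Finset.sum_range_succ, Finset.sum_range_succ',
    ← Fin.sum_univ_eq_sum_range (fun i => (-1 : ℤ) ^ (i + 1) • tensor m (D.faceTuple m (i + 1) a)),
    hochMulti]
  simp only [add_apply, smul_apply, sum_apply, map_add, map_sum, map_smul,
    neg_one_pow_smul_eq_int]
  have e1 : DirectSum.lof K ℕ (fun m => Tens k l r m) m
      ((face m 0).domDomCongr (Equiv.subRight 1) fun s : Fin (m + 2) => a s)
        = tensor m (D.faceTuple m (m + 1) a) := by
    rw [MultilinearMap.domDomCongr_apply]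
    simp only [Equiv.subRight_apply]
    exact lof_face 0 _ _ (D.contractNth_last a)
  have e2 : DirectSum.lof K ℕ (fun m => Tens k l r m) m
      ((face m 0).compLinearMap (fun s => if s = 1 then D.actA D.g else LinearMap.id)
        fun s : Fin (m + 2) => a s) = tensor m (D.faceTuple m 0 a) := by
    rw [MultilinearMap.compLinearMap_apply]
    exact lof_face 0 _ _ (D.contractNth_first a)
  have e3 : ∀ i : Fin m, DirectSum.lof K ℕ (fun m => Tens k l r m) m
      (face m i.succ fun s : Fin (m + 2) => a s) = tensor m (D.faceTuple m (i.val + 1) a) :=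
    fun i => lof_face i.succ _ _ (D.contractNth_interior a i)
  rw [e1, e2, pow_zero, one_smul]
  simp only [e3]
  abel

theorem connes_tensor (m : ℕ) (a : ℕ → A k l r) :
    D.connes (tensor m a) = ∑ i ∈ Finset.range (m + 1), (-1 : ℤ) ^ (m * i) •
      tensor (m + 1) (D.rotTuple m i a) := by
  rw [tensor, connes_lof, ← Fin.sum_univ_eq_sum_range (fun i => (-1 : ℤ) ^ (m * i) •
    tensor (m + 1) (D.rotTuple m i a)), connesMulti]
  simp only [smul_apply, sum_apply, map_sum, map_smul, neg_one_pow_smul_eq_int]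
  refine Finset.sum_congr rfl fun i _ => ?_
  congr 1
  rw [MultilinearMap.domDomCongr_apply, MultilinearMap.compLinearMap_apply]
  change DirectSum.lof K ℕ (fun m => Tens k l r m) (m + 1) (PiTensorProduct.tprod K _) = _
  rw [tensor]
  congr 2
  funext s
  refine Fin.cases rfl (fun q => ?_) s
  have hi := i.isLt
  have hq := q.isLt
  change (if i < q then D.actA D.g else LinearMap.id) (a (q - i : Fin (m + 1)).val) = _
  have e0 : D.rotTuple m i a q.succ = if q.val + 1 ≤ i.val then a (m + (q.val + 1) - i.val)
      else if q.val + 1 = i.val + 1 then a 0 else D.actA D.g (a (q.val + 1 - 1 - i.val)) := rfl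
  rw [e0]
  rcases lt_trichotomy i q with h | h | h
  · have h' : i.val < q.val := h
    rw [if_pos h, if_neg (by omega), if_neg (by omega), Fin.sub_val_of_le (Fin.le_def.2 h'.le)]
    rfl
  · subst h
    rw [if_neg (lt_irrefl _), if_neg (by omega), if_pos rfl, sub_self]
    rfl
  · have h' : q.val < i.val := h
    rw [if_neg (not_lt.2 h.le), if_pos (by omega)]
    have e : (q - i : Fin (m + 1)).val = m + (q.val + 1) - i.val := by
      rw [Fin.sub_def]
      simp only
      rw [Nat.mod_eq_of_lt (by omega)]
      omega
    rw [e]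
    rfl

theorem actChain_tensor (h : G) (m : ℕ) (a : ℕ → A k l r) :
    D.actChain h (tensor m a) = tensor m fun s => D.actA h (a s) := D.actChain_lof h m _

end Sector
end TwistedTQM
end

/-! ### Cartan calculus of the insertion operators -/

noncomputable section
namespace TwistedTQM

set_option linter.unusedSectionVars false

section Sums

variable {M : Type*} [AddCommGroup M]

theorem neg_one_pow_smul_congr {p q : ℕ} (h : (p : ℤ) % 2 = q % 2) (x : M) :
    (-1 : ℤ) ^ p • x = (-1 : ℤ) ^ q • x := by
  rw [neg_one_pow_eq_pow_mod_two, neg_one_pow_eq_pow_mod_two (n := q), show p % 2 = q % 2 by omega]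

theorem neg_one_pow_smul_eq_neg {p q : ℕ} (h : ((p : ℤ) + 1) % 2 = q % 2) {x y : M} (hxy : x = y) :
    (-1 : ℤ) ^ p • x = -((-1 : ℤ) ^ q • y) := by
  rw [← hxy, neg_one_pow_smul_congr (p := q) (q := p + 1) (by push_cast; omega), pow_succ,
    mul_neg_one, neg_smul, neg_neg]

theorem sum_range_skip {n p : ℕ} (hp : p ≤ n) (f : ℕ → M) :
    ∑ s ∈ Finset.range (n + 1), f s
      = f p + ∑ s ∈ Finset.range n, f (if s < p then s else s + 1) := by
  obtain ⟨q, rfl⟩ := Nat.exists_eq_add_of_le hp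
  rw [add_assoc, Finset.sum_range_add, Finset.sum_range_succ', Finset.sum_range_add,
    add_zero, ← add_assoc, add_comm _ (f p)]
  congr 1
  congr 1
  · refine Finset.sum_congr rfl fun s hs => ?_
    rw [if_pos (Finset.mem_range.1 hs)]
  · refine Finset.sum_congr rfl fun s _ => ?_
    rw [if_neg (by omega)]
    rfl

/-- The cancellation of the simplicial identities in a sum over faces of degeneracies. -/
theorem sum_faces_insertions (N : ℕ) (V U : ℕ → ℕ → M)
    (h1 : ∀ p i, p < N → i ≤ p → V (p + 1) i = U p i)
    (h2 : ∀ p i, p < N → p < i → i ≤ N → V p (i + 1) = U p i) :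
    ∑ p ∈ Finset.range (N + 1), ∑ i ∈ Finset.range (N + 2), (-1 : ℤ) ^ (i + p) • V p i
      = ∑ p ∈ Finset.range (N + 1), (V p p - V p (p + 1))
        - ∑ p ∈ Finset.range N, ∑ i ∈ Finset.range (N + 1), (-1 : ℤ) ^ (i + p) • U p i := by
  -- The two faces `p` and `p + 1` that touch the inserted entry are separated from the faces before
  -- and after it.
  have hrow : ∀ p ∈ Finset.range (N + 1), ∑ i ∈ Finset.range (N + 2), (-1 : ℤ) ^ (i + p) • V p i
      = (∑ i ∈ Finset.range p, (-1 : ℤ) ^ (i + p) • V p i + (V p p - V p (p + 1)))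
        + ∑ j ∈ Finset.range (N - p), (-1 : ℤ) ^ j • V p (p + 2 + j) := by
    intro p hp
    have hp' : p ≤ N := by simpa [Nat.lt_succ_iff] using hp
    obtain ⟨q, rfl⟩ := Nat.exists_eq_add_of_le hp'
    rw [show p + q + 2 = p + 2 + q by omega, Finset.sum_range_add, Finset.sum_range_succ,
      Finset.sum_range_succ, Nat.add_sub_cancel_left]
    congr 1
    · rw [add_assoc]
      congr 1
      rw [neg_one_pow_smul_congr (q := 0) (by omega), neg_one_pow_smul_congr (p := p + 1 + p) (q := 1)
        (by omega)]
      simp [sub_eq_add_neg]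
    · exact Finset.sum_congr rfl fun j _ => neg_one_pow_smul_congr (by push_cast; omega) _
  rw [Finset.sum_congr rfl hrow, Finset.sum_add_distrib, Finset.sum_add_distrib,
    Finset.sum_range_succ' (fun p => ∑ i ∈ Finset.range p, (-1 : ℤ) ^ (i + p) • V p i),
    Finset.sum_range_succ (fun p => ∑ j ∈ Finset.range (N - p), (-1 : ℤ) ^ j • V p (p + 2 + j)),
    Nat.sub_self, Finset.sum_range_zero, Finset.sum_range_zero, add_zero, add_zero]
  have hU : ∑ p ∈ Finset.range N, ∑ i ∈ Finset.range (N + 1), (-1 : ℤ) ^ (i + p) • U p i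
      = - (∑ p ∈ Finset.range N, ∑ i ∈ Finset.range (p + 1), (-1 : ℤ) ^ (i + (p + 1)) • V (p + 1) i)
        - ∑ p ∈ Finset.range N, ∑ j ∈ Finset.range (N - p), (-1 : ℤ) ^ j • V p (p + 2 + j) := by
    rw [← Finset.sum_neg_distrib, ← Finset.sum_sub_distrib]
    refine Finset.sum_congr rfl fun p hp => ?_
    have hp' : p < N := Finset.mem_range.1 hp
    rw [show N + 1 = p + 1 + (N - p) by omega, Finset.sum_range_add, sub_eq_add_neg,
      ← Finset.sum_neg_distrib, ← Finset.sum_neg_distrib]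
    congr 1
    · refine Finset.sum_congr rfl fun i hi => ?_
      rw [h1 p i hp' (Nat.lt_succ_iff.1 (Finset.mem_range.1 hi)), ← add_assoc, pow_succ, mul_neg_one,
        neg_smul, neg_neg]
    · refine Finset.sum_congr rfl fun j hj => ?_
      have hj' := Finset.mem_range.1 hj
      rw [show p + 2 + j = p + 1 + j + 1 by omega, h2 p (p + 1 + j) hp' (by omega) (by omega),
        neg_one_pow_smul_congr (q := j + 1) (by push_cast; omega), pow_succ, mul_neg_one, neg_smul]
  rw [hU]
  abel

end Sums

section Insertions

variable {k l r : ℕ}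

theorem tensor_update_sub (m p : ℕ) (hp : p ≤ m) (a : ℕ → A k l r) (x y : A k l r) :
    tensor m (Function.update a p (x - y))
      = tensor m (Function.update a p x) - tensor m (Function.update a p y) := by
  have h : ∀ z : A k l r, (fun s : Fin (m + 1) => Function.update a p z s)
      = Function.update (fun s : Fin (m + 1) => a s) ⟨p, by omega⟩ z := by
    intro z
    funext s
    by_cases hs : s.val = p
    · subst hs
      simp
    · rw [Function.update_of_ne hs, Function.update_of_ne (fun e => hs (by rw [e]))]
  rw [eq_sub_iff_add_eq]
  simp only [tensor, h]
  rw [← map_add, ← MultilinearMap.map_update_add, sub_add_cancel]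

theorem ad_apply (x a : A k l r) :
    ad x a = mmul (hbarInv • x) a - mmul a (hbarInv • x) := by
  simp only [ad, LinearMap.smul_apply, LinearMap.sub_apply, LinearMap.flip_apply, smul_sub,
    map_smul]

theorem ad_antisymm (x y : A k l r) : ad x y = -ad y x := by
  simp only [ad, LinearMap.smul_apply, LinearMap.sub_apply, LinearMap.flip_apply, smul_sub, neg_sub]

/-- The derivation acts on the old entries as before the insertion and on the inserted `y / ħ` by
`ad x`; only the latter survives. -/
theorem adChain_insChain (x y : A k l r) :
    adChain x ∘ₗ insChain y - insChain y ∘ₗ adChain x = insChain (ad x y) := by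
  refine chain_hom_ext fun m a => ?_
  simp only [LinearMap.sub_apply, LinearMap.comp_apply, insChain_tensor, adChain_tensor, map_sum,
    map_zsmul]
  rw [sub_eq_iff_eq_add, Finset.sum_comm, ← Finset.sum_add_distrib]
  refine Finset.sum_congr rfl fun p hp => ?_
  have hp' : p ≤ m := Nat.lt_succ_iff.1 (Finset.mem_range.1 hp)
  rw [← Finset.smul_sum, ← smul_add]
  congr 1
  rw [sum_range_skip (show p + 1 ≤ m + 1 by omega)]
  congr 1
  · refine tensor_congr fun s _ => ?_
    by_cases hs : s = p + 1
    · subst hs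
      simp [ins]
    · simp [ins, hs]
  · refine Finset.sum_congr rfl fun q _ => tensor_congr fun s _ => ?_
    simp only [ins, Function.update_apply]
    grind

theorem insChain_anticomm (x y : A k l r) :
    insChain x ∘ₗ insChain y = -(insChain y ∘ₗ insChain x) := by
  refine chain_hom_ext fun m a => ?_
  simp only [LinearMap.neg_apply, LinearMap.comp_apply, insChain_tensor, map_sum, map_zsmul,
    Finset.smul_sum, smul_smul, ← pow_add]
  rw [← Finset.sum_product', ← Finset.sum_product', ← Finset.sum_neg_distrib]
  -- Inserting in the other order moves the left entry first and shifts one slot number by one,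
  -- hence the sign.
  refine Finset.sum_nbij' (fun z => if z.2 ≤ z.1 then (z.2, z.1 + 1) else (z.2 - 1, z.1))
    (fun z => if z.2 ≤ z.1 then (z.2, z.1 + 1) else (z.2 - 1, z.1)) ?_ ?_ ?_ ?_ ?_
  · rintro ⟨q, p⟩ h
    simp only [Finset.mem_product, Finset.mem_range] at h ⊢
    split_ifs <;> simp only <;> omega
  · rintro ⟨q, p⟩ h
    simp only [Finset.mem_product, Finset.mem_range] at h ⊢
    split_ifs <;> simp only <;> omega
  · rintro ⟨q, p⟩ h
    grind
  · rintro ⟨q, p⟩ h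
    grind
  · rintro ⟨q, p⟩ h
    simp only [Finset.mem_product, Finset.mem_range] at h
    by_cases hqp : p ≤ q
    · simp only [hqp, if_true]
      refine neg_one_pow_smul_eq_neg (by push_cast; omega) (tensor_congr fun s _ => ?_)
      simp only [ins]
      grind
    · simp only [hqp, if_false]
      refine neg_one_pow_smul_eq_neg (by push_cast; omega) (tensor_congr fun s _ => ?_)
      simp only [ins]
      grind

theorem insChain_sq (x : A k l r) : insChain x * insChain x = 0 := by
  have h : insChain x * insChain x = -(insChain x * insChain x) := insChain_anticomm x x
  have h2 : insChain x * insChain x + insChain x * insChain x = 0 := by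
    nth_rewrite 1 [h]
    exact neg_add_cancel _
  have h3 : (HahnSeries.C (2⁻¹ : ℂ) + HahnSeries.C (2⁻¹ : ℂ) : K) = 1 := by
    rw [← map_add, ← map_one HahnSeries.C]
    norm_num
  rw [← one_smul K (insChain x * insChain x), ← h3, add_smul, ← smul_add, h2, smul_zero]

end Insertions

namespace Sector

variable {G : Type*} [Group G] {k l r : ℕ} (D : Sector G k l r)

theorem actChain_insChain (h : G) (x : A k l r) :
    D.actChain h ∘ₗ insChain x = insChain (D.actA h x) ∘ₗ D.actChain h := by
  refine chain_hom_ext fun m a => ?_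
  simp only [LinearMap.comp_apply, insChain_tensor, map_sum, map_zsmul, actChain_tensor]
  refine Finset.sum_congr rfl fun p _ => ?_
  congr 1
  refine tensor_congr fun s _ => ?_
  simp only [ins]
  split_ifs
  · rfl
  · rw [map_smul]
  · rfl

/-- Faces away from `x` commute with the insertion up to sign and cancel. The two faces that touch
it multiply a neighbour by `x / ħ` from the right or the left and add up to commutators in all
slots. Invariance under `g` enters where `x` stands in the slot `1` and is twisted by the first
face. -/
theorem hoch_insChain {x : A k l r} (hx : D.actA D.g x = x) :
    D.hoch ∘ₗ insChain x + insChain x ∘ₗ D.hoch = adChain x := by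
  refine chain_hom_ext fun m a => ?_
  have hx' : D.actA D.g (hbarInv • x) = hbarInv • x := by rw [map_smul, hx]
  simp only [LinearMap.add_apply, LinearMap.comp_apply]
  rw [insChain_tensor, adChain_tensor]
  simp only [ad_apply]
  have hins : ∀ (n : ℕ) (b : ℕ → A k l r), insChain x (tensor n b) = _ := insChain_tensor x
  generalize hbarInv • x = x' at hx' hins
  have key := sum_faces_insertions m
    (fun p i => tensor m (D.faceTuple m i (ins (p + 1) x' a)))
    (fun p i => tensor m (ins (p + 1) x' (D.faceTuple (m - 1) i a)))
    (fun p i hp hi => tensor_congr fun s hs => by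
      simp only [ins, faceTuple]
      grind)
    (fun p i hp hi him => tensor_congr fun s hs => by
      simp only [ins, faceTuple]
      grind)
  have h1 : D.hoch (∑ p ∈ Finset.range (m + 1), (-1 : ℤ) ^ (p + 1) •
      tensor (m + 1) (ins (p + 1) x' a))
      = -∑ p ∈ Finset.range (m + 1), ∑ i ∈ Finset.range (m + 2), (-1 : ℤ) ^ (i + p) •
        tensor m (D.faceTuple m i (ins (p + 1) x' a)) := by
    rw [← Finset.sum_neg_distrib, map_sum]
    refine Finset.sum_congr rfl fun p _ => ?_
    rw [map_zsmul, hoch_tensor_succ, Finset.smul_sum, ← Finset.sum_neg_distrib]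
    refine Finset.sum_congr rfl fun i _ => ?_
    rw [smul_smul, ← pow_add]
    exact neg_one_pow_smul_eq_neg (by push_cast; omega) rfl
  have h2 : insChain x (D.hoch (tensor m a)) = -∑ p ∈ Finset.range m, ∑ i ∈ Finset.range (m + 1),
      (-1 : ℤ) ^ (i + p) • tensor m (ins (p + 1) x' (D.faceTuple (m - 1) i a)) := by
    cases m with
    | zero => rw [hoch_tensor_zero, map_zero, Finset.sum_range_zero, neg_zero]
    | succ m =>
      rw [hoch_tensor_succ, map_sum, Finset.sum_comm, ← Finset.sum_neg_distrib]
      refine Finset.sum_congr rfl fun i _ => ?_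
      rw [map_zsmul, hins, Finset.smul_sum, ← Finset.sum_neg_distrib]
      refine Finset.sum_congr rfl fun p _ => ?_
      rw [smul_smul, ← pow_add]
      exact neg_one_pow_smul_eq_neg (by push_cast; omega) rfl
  have h3 : ∑ p ∈ Finset.range (m + 1), tensor m (D.faceTuple m p (ins (p + 1) x' a))
      = ∑ p ∈ Finset.range (m + 1), tensor m (Function.update a p (mmul (a p) x')) := by
    refine Finset.sum_congr rfl fun p hp => tensor_congr fun s hs => ?_
    rw [Finset.mem_range] at hp
    simp only [ins, faceTuple, Function.update_apply]
    grind
  -- The left products are shifted by one slot; the last one wraps around to `a_0`.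
  have h4 : ∑ p ∈ Finset.range (m + 1), tensor m (D.faceTuple m (p + 1) (ins (p + 1) x' a))
      = ∑ p ∈ Finset.range (m + 1), tensor m (Function.update a p (mmul x' (a p))) := by
    rw [Finset.sum_range_succ, Finset.sum_range_succ']
    congr 1
    · refine Finset.sum_congr rfl fun p hp => tensor_congr fun s hs => ?_
      rw [Finset.mem_range] at hp
      simp only [ins, faceTuple, Function.update_apply]
      grind
    · refine tensor_congr fun s hs => ?_
      simp only [ins, faceTuple, Function.update_apply]
      grind
  rw [h1, h2, key, Finset.sum_sub_distrib, h3, h4,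
    Finset.sum_congr rfl fun p hp => tensor_update_sub m p
      (Nat.lt_succ_iff.1 (Finset.mem_range.1 hp)) a _ _, Finset.sum_sub_distrib]
  abel

/-- Both composites run over all words with `1` in front, a cyclic rotation of the `a` behind it and
`x / ħ` in any later slot; the signs are opposite. By invariance the twist of `x` is invisible. -/
theorem connes_insChain {x : A k l r} (hx : D.actA D.g x = x) :
    D.connes ∘ₗ insChain x + insChain x ∘ₗ D.connes = 0 := by
  refine chain_hom_ext fun m a => ?_
  have hx' : D.actA D.g (hbarInv • x) = hbarInv • x := by rw [map_smul, hx]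
  simp only [LinearMap.add_apply, LinearMap.comp_apply, LinearMap.zero_apply, insChain_tensor,
    connes_tensor, map_sum, map_zsmul]
  generalize hbarInv • x = x' at hx'
  simp only [Finset.smul_sum, smul_smul, ← pow_add]
  rw [add_eq_zero_iff_eq_neg, ← Finset.sum_product', ← Finset.sum_product', ← Finset.sum_neg_distrib]
  -- For `m + 1 ≤ p + i` the inserted entry is among those rotated in front of `a_0`, so one entry
  -- less of `a` is rotated; otherwise it lands behind `a_0`.
  refine Finset.sum_nbij'
    (fun z => if m + 1 ≤ z.1 + z.2 then (z.2 - 1, z.1 + z.2 - (m + 1)) else (z.2, z.2 + z.1 + 1))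
    (fun z => if z.2 ≤ z.1 then (z.2 + m - z.1, z.1 + 1) else (z.2 - z.1 - 1, z.1)) ?_ ?_ ?_ ?_ ?_
  · rintro ⟨p, i⟩ h
    simp only [Finset.mem_product, Finset.mem_range] at h ⊢
    split_ifs <;> simp only <;> omega
  · rintro ⟨i, q⟩ h
    simp only [Finset.mem_product, Finset.mem_range] at h ⊢
    split_ifs <;> simp only <;> omega
  · rintro ⟨p, i⟩ h
    simp only [Finset.mem_product, Finset.mem_range] at h
    grind
  · rintro ⟨i, q⟩ h
    simp only [Finset.mem_product, Finset.mem_range] at h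
    grind
  · rintro ⟨p, i⟩ h
    simp only [Finset.mem_product, Finset.mem_range] at h
    by_cases hpi : m + 1 ≤ p + i
    · simp only [hpi, if_true]
      obtain ⟨i, rfl⟩ : ∃ i', i = i' + 1 := ⟨i - 1, by omega⟩
      rw [Nat.add_sub_cancel]
      refine neg_one_pow_smul_eq_neg ?_ (tensor_congr fun s _ => ?_)
      · have e : (m + 1) * (i + 1) = m * i + m + i + 1 := by ring
        rw [e]
        omega
      · simp only [ins, rotTuple]
        grind
    · simp only [hpi, if_false]
      refine neg_one_pow_smul_eq_neg ?_ (tensor_congr fun s _ => ?_)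
      · have e : (m + 1) * i = m * i + i := by ring
        rw [e]
        omega
      · simp only [ins, rotTuple]
        grind

end Sector
end TwistedTQM
end

/-! ### The exterior algebra of insertions and the Chevalley–Eilenberg differential -/

noncomputable section
namespace TwistedTQM

set_option linter.unusedSectionVars false

section Ring

variable {R : Type*} [Ring R]

theorem neg_one_pow_succ_smul_mul (n : ℕ) (a b : R) :
    (-1 : ℤ) ^ (n + 1) • (a * b) = (-1 : ℤ) ^ n • (a * -b) := by
  rw [pow_succ, mul_neg_one, neg_smul, mul_neg, smul_neg]

theorem mul_mul_of_anticomm {a b c : R} (h : b * c = -(c * b)) : a * b * c = -(a * c * b) := by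
  rw [mul_assoc, h, mul_neg, mul_assoc]

theorem neg_one_pow_succ_smul_commutator (n : ℕ) (a b c : R) :
    (-1 : ℤ) ^ (n + 1) • -(a * c * b)
      = -((-1 : ℤ) ^ n • -(a * b) * c) - (-1 : ℤ) ^ n • (a * (b * c - c * b)) := by
  simp only [pow_succ, mul_neg_one, neg_smul, mul_sub, smul_sub, smul_neg, neg_neg, neg_mul,
    smul_mul_assoc, mul_assoc]
  abel

end Ring

section Exterior

variable {k l r : ℕ}

/-- The insertion operators as an action of the exterior algebra, from the right. -/
def insAlg : ExteriorAlgebra K (A k l r) →ₐ[K] (Module.End K (Chain k l r))ᵐᵒᵖ :=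
  ExteriorAlgebra.lift K ⟨(MulOpposite.opLinearEquiv K).toLinearMap ∘ₗ insChain, fun x => by
    change MulOpposite.op (insChain x) * MulOpposite.op (insChain x) = 0
    rw [← MulOpposite.op_mul, insChain_sq, MulOpposite.op_zero]⟩

theorem insAlg_ι (x : A k l r) : insAlg (ExteriorAlgebra.ι K x) = MulOpposite.op (insChain x) := by
  rw [insAlg, ExteriorAlgebra.lift_ι_apply]
  rfl

/-- The insertion of `v_0`, then of `v_1`, and so on. -/
def insAlt (j : ℕ) : AlternatingMap K (A k l r) (Module.End K (Chain k l r)) (Fin j) :=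
  ((MulOpposite.opLinearEquiv K).symm.toLinearMap ∘ₗ insAlg.toLinearMap).compAlternatingMap
    (ExteriorAlgebra.ιMulti K j)

theorem insAlt_apply (j : ℕ) (v : Fin j → A k l r) :
    insAlt j v = (insAlg (ExteriorAlgebra.ιMulti K j v)).unop := rfl

theorem insAlt_zero (v : Fin 0 → A k l r) : insAlt 0 v = 1 := by
  rw [insAlt_apply, ExteriorAlgebra.ιMulti_apply, List.ofFn_zero, List.prod_nil, map_one]
  rfl

theorem insAlt_cons (j : ℕ) (x : A k l r) (v : Fin j → A k l r) :
    insAlt (j + 1) (Fin.cons x v) = insAlt j v * insChain x := by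
  rw [insAlt_apply, insAlt_apply, ExteriorAlgebra.ιMulti_apply, ExteriorAlgebra.ιMulti_apply,
    List.ofFn_succ, List.prod_cons, map_mul, insAlg_ι]
  rfl

theorem insAlt_succ (j : ℕ) (v : Fin (j + 1) → A k l r) :
    insAlt (j + 1) v = insAlt j (fun a => v a.succ) * insChain (v 0) := by
  conv_lhs => rw [← Fin.cons_self_tail v]
  exact insAlt_cons _ _ _

/-- Splitting off the last insertion serves the comparison with shuffles; splitting off the first
one serves the closedness. -/
theorem insAlt_last (j : ℕ) (v : Fin (j + 1) → A k l r) :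
    insAlt (j + 1) v = insChain (v (Fin.last j)) * insAlt j (fun a => v a.castSucc) := by
  rw [insAlt_apply, insAlt_apply, ExteriorAlgebra.ιMulti_apply, ExteriorAlgebra.ιMulti_apply,
    List.ofFn_succ', List.concat_eq_append, List.prod_append, List.prod_singleton, map_mul,
    insAlg_ι]
  rfl

/-- The terms of the Chevalley–Eilenberg differential which contain a bracket. -/
def bracketOp : ∀ j, (Fin (j + 1) → A k l r) → Module.End K (Chain k l r)
  | 0, _ => 0
  | j + 1, x => ∑ p : Fin (j + 2), ∑ i : Fin (j + 1), if i.castSucc < p then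
      (-1 : ℤ) ^ (i.val + p.val) •
        insAlt (j + 1) (Fin.cons (ad (x i.castSucc) (x p)) fun q => x (p.succAbove (i.succAbove q)))
      else 0

/-- The Chevalley–Eilenberg differential of the insertion operators. -/
def lieOp (j : ℕ) (x : Fin (j + 1) → A k l r) : Module.End K (Chain k l r) :=
  (∑ i, (-1 : ℤ) ^ i.val • -(insAlt j (fun q => x (i.succAbove q)) * adChain (x i))) + bracketOp j x

theorem insAlt_swap (j : ℕ) (x y : A k l r) (v : Fin j → A k l r) :
    insAlt (j + 2) (Fin.cons x (Fin.cons y v : Fin (j + 1) → A k l r))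
      = -(insAlt (j + 1) (Fin.cons x v) * insChain y) := by
  rw [insAlt_cons, insAlt_cons, insAlt_cons]
  exact mul_mul_of_anticomm (insChain_anticomm y x)

theorem bracketOp_cons_interior (j : ℕ) (x : A k l r) (v : Fin (j + 1) → A k l r) :
    ∑ p : Fin (j + 1), ∑ i : Fin j, (if i.succ.castSucc < p.succ then
      (-1 : ℤ) ^ (i.succ.val + p.succ.val) •
      insAlt (j + 1) (Fin.cons (ad ((Fin.cons x v : Fin (j + 2) → A k l r) i.succ.castSucc)
        ((Fin.cons x v : Fin (j + 2) → A k l r) p.succ)) fun q =>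
          (Fin.cons x v : Fin (j + 2) → A k l r) (p.succ.succAbove (i.succ.succAbove q))) else 0)
      = -(bracketOp j v * insChain x) := by
  cases j with
  | zero => simp [bracketOp]
  | succ j =>
    rw [bracketOp, Finset.sum_mul, ← Finset.sum_neg_distrib]
    refine Finset.sum_congr rfl fun p _ => ?_
    rw [Finset.sum_mul, ← Finset.sum_neg_distrib]
    refine Finset.sum_congr rfl fun i _ => ?_
    have hlt : i.succ.castSucc < p.succ ↔ i.castSucc < p := by
      simp [Fin.lt_def]
    rw [ite_mul, zero_mul]
    by_cases h : i.castSucc < p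
    · rw [if_pos (hlt.2 h), if_pos h]
      have hw : (fun q => (Fin.cons x v : Fin (j + 3) → A k l r)
          (p.succ.succAbove (i.succ.succAbove q)))
          = Fin.cons x fun q => v (p.succAbove (i.succAbove q)) := by
        funext q
        refine Fin.cases ?_ (fun q => ?_) q
        · simp
        · simp
      rw [hw, insAlt_swap, ← Fin.succ_castSucc, Fin.cons_succ, Fin.cons_succ, smul_mul_assoc,
        Fin.val_succ, Fin.val_succ, neg_one_pow_smul_congr (q := i.val + p.val)
        (by push_cast; omega)]
      exact smul_neg _ _
    · rw [if_neg (fun e => h (hlt.1 e)), if_neg h, neg_zero]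

/-- The pairs containing the first argument `x` give the first sum; in the others `x` is moved past
the bracket, at the price of a sign. -/
theorem bracketOp_cons (j : ℕ) (x : A k l r) (v : Fin (j + 1) → A k l r) :
    bracketOp (j + 1) (Fin.cons x v : Fin (j + 2) → A k l r)
      = ∑ i, (-1 : ℤ) ^ i.val • (insAlt j (fun q => v (i.succAbove q)) * insChain (ad (v i) x))
        + -(bracketOp j v * insChain x) := by
  rw [bracketOp, Fin.sum_univ_succ, Finset.sum_eq_zero fun i _ => if_neg (Fin.not_lt_zero _),
    zero_add, ← bracketOp_cons_interior, ← Finset.sum_add_distrib]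
  refine Finset.sum_congr rfl fun p _ => ?_
  rw [Fin.sum_univ_succ]
  congr 1
  rw [if_pos (Fin.lt_def.2 (by simp))]
  have hw : (fun q => (Fin.cons x v : Fin (j + 2) → A k l r)
      (p.succ.succAbove ((0 : Fin (j + 1)).succAbove q))) = fun q => v (p.succAbove q) := by
    funext q
    simp
  have h1 : (Fin.cons x v : Fin (j + 2) → A k l r) (Fin.castSucc 0) = x := rfl
  rw [hw, h1, Fin.cons_succ, insAlt_cons, ad_antisymm (v p) x, map_neg, Fin.val_zero, Fin.val_succ,
    zero_add]
  exact neg_one_pow_succ_smul_mul _ _ _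

/-- Moving `L_(v i)` past `i_x` produces `i_[v i, x]`, and these cancel the brackets with the first
argument. The recursion then has the shape needed for the induction in `hoch_insAlt`. -/
theorem lieOp_cons (j : ℕ) (x : A k l r) (v : Fin (j + 1) → A k l r) :
    lieOp (j + 1) (Fin.cons x v : Fin (j + 2) → A k l r)
      = -(insAlt (j + 1) v * adChain x) - lieOp j v * insChain x := by
  rw [lieOp, bracketOp_cons, Fin.sum_univ_succ, lieOp, add_mul, Finset.sum_mul]
  have h : ∀ i : Fin (j + 1), (-1 : ℤ) ^ i.succ.val •
      -(insAlt (j + 1) (fun q => (Fin.cons x v : Fin (j + 2) → A k l r) (i.succ.succAbove q))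
        * adChain ((Fin.cons x v : Fin (j + 2) → A k l r) i.succ))
      = -((-1 : ℤ) ^ i.val • -(insAlt j (fun q => v (i.succAbove q)) * adChain (v i)) * insChain x)
        - (-1 : ℤ) ^ i.val • (insAlt j (fun q => v (i.succAbove q)) * insChain (ad (v i) x)) := by
    intro i
    have hw : (fun q => (Fin.cons x v : Fin (j + 2) → A k l r) (i.succ.succAbove q))
        = Fin.cons x fun q => v (i.succAbove q) := by
      funext q
      refine Fin.cases ?_ (fun q => ?_) q
      · simp
      · simp
    have hc : insChain (ad (v i) x) = adChain (v i) * insChain x - insChain x * adChain (v i) :=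
      (adChain_insChain (v i) x).symm
    rw [hw, insAlt_cons, Fin.cons_succ, hc, Fin.val_succ]
    exact neg_one_pow_succ_smul_commutator _ _ _ _
  rw [Finset.sum_congr rfl fun i _ => h i, Finset.sum_sub_distrib, Finset.sum_neg_distrib]
  simp only [Fin.val_zero, pow_zero, one_smul, Fin.zero_succAbove, Fin.cons_succ, Fin.cons_zero]
  abel

end Exterior

/-! ### Descent to normalized chains -/

section Normalized

variable {k l r : ℕ} {M : Type*} [AddCommGroup M] [Module K M]

/-- Linear maps on chains which vanish on tensors with a unit in a slot after the first one. -/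
def IsNormalized (φ : Chain k l r →ₗ[K] M) : Prop :=
  ∀ (m : ℕ) (t : Fin (m + 1) → A k l r) (s : Fin m), t s.succ = oneA k l r →
    φ (DirectSum.lof K ℕ (fun m => Tens k l r m) m (PiTensorProduct.tprod K t)) = 0

/-- An insertion never removes a unit and keeps it behind the first slot. -/
theorem IsNormalized.comp_insChain {φ : Chain k l r →ₗ[K] M} (h : IsNormalized φ) (x : A k l r) :
    IsNormalized (φ ∘ₗ insChain x) := by
  intro m t s hs
  rw [LinearMap.comp_apply, insChain_lof, map_sum]
  refine Finset.sum_eq_zero fun p _ => ?_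
  rw [map_zsmul, h (m + 1) _ (p.succAbove s) ?_, smul_zero]
  rw [← Fin.succ_succAbove_succ, Fin.insertNth_apply_succAbove, hs]

theorem IsNormalized.comp_insAlt {φ : Chain k l r →ₗ[K] M} (h : IsNormalized φ) (j : ℕ)
    (v : Fin j → A k l r) : IsNormalized (φ ∘ₗ insAlt j v) := by
  induction j with
  | zero =>
    rw [insAlt_zero]
    exact h
  | succ j ih =>
    rw [insAlt_succ]
    exact (ih fun a => v a.succ).comp_insChain (v 0)

theorem IsNormalized.congr {φ : Chain k l r →ₗ[K] M} (h : IsNormalized φ) (m : ℕ)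
    (t t' : Fin (m + 1) → A k l r) (h0 : t 0 = t' 0)
    (hs : ∀ s : Fin m, t s.succ - t' s.succ ∈ Submodule.span K {oneA k l r}) :
    φ (DirectSum.lof K ℕ (fun m => Tens k l r m) m (PiTensorProduct.tprod K t))
      = φ (DirectSum.lof K ℕ (fun m => Tens k l r m) m (PiTensorProduct.tprod K t')) := by
  classical
  -- The slots are changed one at a time; each change adds a multiple of a tensor with a unit, which
  -- `φ` kills.
  have key : ∀ S : Finset (Fin (m + 1)),
      φ (DirectSum.lof K ℕ (fun m => Tens k l r m) m (PiTensorProduct.tprod K (S.piecewise t t')))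
        = φ (DirectSum.lof K ℕ (fun m => Tens k l r m) m (PiTensorProduct.tprod K t')) := by
    intro S
    induction S using Finset.induction_on with
    | empty => rw [Finset.piecewise_empty]
    | insert a S ha ih =>
      rw [← ih, Finset.piecewise_insert]
      induction a using Fin.cases with
      | zero =>
        rw [h0, ← Finset.piecewise_eq_of_notMem S t t' ha, Function.update_eq_self]
      | succ s =>
        obtain ⟨c, hc⟩ := Submodule.mem_span_singleton.1 (hs s)
        have e : t s.succ = c • oneA k l r + S.piecewise t t' s.succ := by
          rw [hc, Finset.piecewise_eq_of_notMem S t t' ha, sub_add_cancel]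
        rw [e, MultilinearMap.map_update_add, MultilinearMap.map_update_smul,
          Function.update_eq_self, map_add, map_add, map_smul, map_smul,
          h m _ s (Function.update_self _ _ _), smul_zero, zero_add]
  have h1 := key Finset.univ
  rwa [Finset.piecewise_univ] at h1

/-- A complement of the multiples of the unit. -/
theorem exists_section_mkQ (k l r : ℕ) : ∃ σ : ABar k l r →ₗ[K] A k l r,
    (Submodule.span K {oneA k l r}).mkQ ∘ₗ σ = LinearMap.id :=
  LinearMap.exists_rightInverse_of_surjective _ (Submodule.range_mkQ _)

/-- The lift of cyclic chains to chains given by a complement of the multiples of the unit. -/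
def liftCyc (k l r : ℕ) : CycChain k l r →ₗ[K] Chain k l r :=
  DirectSum.lmap fun m => TensorProduct.lift
    (PiTensorProduct.lift.toLinearMap ∘ₗ
      MultilinearMap.compLinearMapₗ (fun _ => (exists_section_mkQ k l r).choose) ∘ₗ
      (PiTensorProduct.tprod K (s := fun _ : Fin (m + 1) => A k l r)).curryLeft)

theorem liftCyc_toCyc_lof (m : ℕ) (t : Fin (m + 1) → A k l r) :
    liftCyc k l r (toCyc k l r (DirectSum.lof K ℕ (fun m => Tens k l r m) m
        (PiTensorProduct.tprod K t)))
      = DirectSum.lof K ℕ (fun m => Tens k l r m) m (PiTensorProduct.tprod K (Fin.cons (t 0)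
          fun q => (exists_section_mkQ k l r).choose
            ((Submodule.span K {oneA k l r}).mkQ (t q.succ)))) := by
  rw [toCyc, DirectSum.lmap_lof, PiTensorProduct.lift.tprod, liftCyc, DirectSum.lmap_lof]
  congr 1
  change TensorProduct.lift _ (t 0 ⊗ₜ[K] PiTensorProduct.tprod K
    fun q : Fin m => (Submodule.span K {oneA k l r}).mkQ (t q.succ)) = _
  rw [TensorProduct.lift.tmul]
  change PiTensorProduct.lift _ _ = _
  rw [PiTensorProduct.lift.tprod]
  rfl

/-- The chosen complement changes later slots only by multiples of the unit, so for normalized maps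
the lift is a genuine descent. -/
theorem IsNormalized.comp_liftCyc_toCyc {φ : Chain k l r →ₗ[K] M} (h : IsNormalized φ) :
    (φ ∘ₗ liftCyc k l r) ∘ₗ toCyc k l r = φ := by
  refine DirectSum.linearMap_ext K fun m => PiTensorProduct.ext (MultilinearMap.ext fun t => ?_)
  change φ (liftCyc k l r (toCyc k l r (DirectSum.lof K ℕ (fun m => Tens k l r m) m
        (PiTensorProduct.tprod K t)))) = φ (DirectSum.lof K ℕ (fun m => Tens k l r m) m
        (PiTensorProduct.tprod K t))
  rw [liftCyc_toCyc_lof]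
  refine h.congr m _ _ rfl fun s => ?_
  refine (Submodule.Quotient.mk_eq_zero _).1 ?_
  change (Submodule.span K {oneA k l r}).mkQ ((exists_section_mkQ k l r).choose
    ((Submodule.span K {oneA k l r}).mkQ (t s.succ)) - t s.succ) = 0
  rw [map_sub]
  have e := (exists_section_mkQ k l r).choose_spec
  rw [show ∀ z, (Submodule.span K {oneA k l r}).mkQ ((exists_section_mkQ k l r).choose z) = z from
    fun z => LinearMap.congr_fun e z, sub_self]

end Normalized

/-! ### Iterated insertions as signed shuffles -/

section Shuffles

variable {m j : ℕ}

/-- A new last one-form placed in the slot `p`. -/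
def shuffleSnocFun (p : Fin (m + j + 1)) (σ : Fin m ⊕ Fin j ≃ Fin (m + j)) :
    Fin m ⊕ Fin (j + 1) → Fin (m + (j + 1)) :=
  Sum.elim (fun q => p.succAbove (σ (Sum.inl q)))
    (Fin.snoc (α := fun _ => Fin (m + j + 1)) (fun a => p.succAbove (σ (Sum.inr a))) p)

theorem shuffleSnocFun_last (p : Fin (m + j + 1)) (σ : Fin m ⊕ Fin j ≃ Fin (m + j)) :
    shuffleSnocFun p σ (Sum.inr (Fin.last j)) = p := by simp [shuffleSnocFun]

theorem shuffleSnocFun_map (p : Fin (m + j + 1)) (σ : Fin m ⊕ Fin j ≃ Fin (m + j))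
    (z : Fin m ⊕ Fin j) : shuffleSnocFun p σ (Sum.map id Fin.castSucc z) = p.succAbove (σ z) := by
  rcases z with q | a <;> simp [shuffleSnocFun]

theorem sum_last_cases {C : Fin m ⊕ Fin (j + 1) → Prop} (h1 : C (Sum.inr (Fin.last j)))
    (h2 : ∀ z : Fin m ⊕ Fin j, C (Sum.map id Fin.castSucc z)) (z : Fin m ⊕ Fin (j + 1)) : C z := by
  rcases z with q | a
  · exact h2 (Sum.inl q)
  · induction a using Fin.lastCases with
    | last => exact h1
    | cast a => exact h2 (Sum.inr a)

theorem shuffleSnocFun_injective (p : Fin (m + j + 1)) (σ : Fin m ⊕ Fin j ≃ Fin (m + j)) :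
    Function.Injective (shuffleSnocFun p σ) := by
  intro z
  induction z using sum_last_cases with
  | h1 =>
    intro z'
    induction z' using sum_last_cases with
    | h1 => exact fun _ => rfl
    | h2 z' =>
      rw [shuffleSnocFun_last, shuffleSnocFun_map]
      exact fun e => absurd e.symm (Fin.succAbove_ne _ _)
  | h2 z =>
    intro z'
    induction z' using sum_last_cases with
    | h1 =>
      rw [shuffleSnocFun_last, shuffleSnocFun_map]
      exact fun e => absurd e (Fin.succAbove_ne _ _)
    | h2 z' =>
      rw [shuffleSnocFun_map, shuffleSnocFun_map]
      intro e
      rw [σ.injective (Fin.succAbove_right_injective e)]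

/-- The shuffle with a new last one-form in the slot `p`. -/
def shuffleSnoc (z : Fin (m + j + 1) × (Fin m ⊕ Fin j ≃ Fin (m + j))) :
    Fin m ⊕ Fin (j + 1) ≃ Fin (m + (j + 1)) :=
  Equiv.ofBijective (shuffleSnocFun z.1 z.2) ((Fintype.bijective_iff_injective_and_card _).2
    ⟨shuffleSnocFun_injective z.1 z.2, by simp⟩)

theorem shuffleSnoc_last (p : Fin (m + j + 1)) (σ : Fin m ⊕ Fin j ≃ Fin (m + j)) :
    shuffleSnoc (p, σ) (Sum.inr (Fin.last j)) = p := shuffleSnocFun_last p σ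

theorem shuffleSnoc_map (p : Fin (m + j + 1)) (σ : Fin m ⊕ Fin j ≃ Fin (m + j))
    (z : Fin m ⊕ Fin j) : shuffleSnoc (p, σ) (Sum.map id Fin.castSucc z) = p.succAbove (σ z) :=
  shuffleSnocFun_map p σ z

theorem shuffleSnoc_inl (p : Fin (m + j + 1)) (σ : Fin m ⊕ Fin j ≃ Fin (m + j)) (q : Fin m) :
    shuffleSnoc (p, σ) (Sum.inl q) = p.succAbove (σ (Sum.inl q)) := shuffleSnocFun_map p σ (Sum.inl q)

theorem shuffleSnoc_inr (p : Fin (m + j + 1)) (σ : Fin m ⊕ Fin j ≃ Fin (m + j)) (a : Fin j) :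
    shuffleSnoc (p, σ) (Sum.inr a.castSucc) = p.succAbove (σ (Sum.inr a)) :=
  shuffleSnocFun_map p σ (Sum.inr a)

/-- The slot of the last one-form and the arrangement of the rest are recovered from the result;
counting does the remainder. -/
theorem shuffleSnoc_bijective : Function.Bijective (shuffleSnoc (m := m) (j := j)) := by
  refine (Fintype.bijective_iff_injective_and_card _).2 ⟨?_, ?_⟩
  · rintro ⟨p, σ⟩ ⟨p', σ'⟩ h
    have hp : p = p' := by
      rw [← shuffleSnoc_last p σ, ← shuffleSnoc_last p' σ', h]
    subst hp
    have hσ : σ = σ' := by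
      ext1 z
      have := shuffleSnoc_map p σ z
      rw [h, shuffleSnoc_map] at this
      exact Fin.succAbove_right_injective this.symm
    rw [hσ]
  · rw [Fintype.card_prod, Fintype.card_equiv finSumFinEquiv, Fintype.card_equiv finSumFinEquiv]
    simp [← add_assoc, Nat.factorial_succ]

theorem strictMono_shuffleSnoc (p : Fin (m + j + 1)) (σ : Fin m ⊕ Fin j ≃ Fin (m + j)) :
    StrictMono (fun q => shuffleSnoc (p, σ) (Sum.inl q)) ↔ StrictMono fun q => σ (Sum.inl q) := by
  simp only [shuffleSnoc_inl, StrictMono]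
  refine forall₃_congr fun q q' _ => ?_
  exact (Fin.strictMono_succAbove p).lt_iff_lt

/-- A slot at or beyond `p` moves by one and changes its sign, but it also acquires an inversion
with the new last one-form; the two changes cancel. -/
theorem shuffleSign_shuffleSnoc (p : Fin (m + j + 1)) (σ : Fin m ⊕ Fin j ≃ Fin (m + j)) :
    Sector.shuffleSign (shuffleSnoc (p, σ)) = (-1) ^ (p.val + 1) * Sector.shuffleSign σ := by
  have hs : ∀ s : Fin (m + j), (-1 : ℤ) ^ ((p.succAbove s).val + 1) *
      (if p < p.succAbove s then -1 else 1) = (-1) ^ (s.val + 1) := by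
    intro s
    by_cases h : s.castSucc < p
    · rw [Fin.succAbove_of_castSucc_lt _ _ h, if_neg (not_lt.2 h.le)]
      simp
    · have h' := not_lt.1 h
      rw [Fin.succAbove_of_le_castSucc _ _ h', if_pos (Fin.le_castSucc_iff.1 h')]
      simp [pow_succ]
  simp only [Sector.shuffleSign, Fin.prod_univ_castSucc, shuffleSnoc_last, shuffleSnoc_inr,
    Fin.castSucc_lt_castSucc_iff, Fin.castSucc_lt_last, true_and, lt_irrefl, false_and, if_false,
    (Fin.strictMono_succAbove p).lt_iff_lt, Finset.prod_mul_distrib, mul_one]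
  have hl : ∀ b : Fin j, ¬ (Fin.last j < b.castSucc) := fun b => not_lt.2 (Fin.le_last _)
  simp only [hl, false_and, if_false, Finset.prod_const_one, mul_one]
  rw [← Finset.prod_congr rfl fun a _ => hs (σ (Sum.inr a)), Finset.prod_mul_distrib]
  ring

variable {k l r : ℕ}

/-- The word in which the `t` and the `ξ / ħ` are shuffled, after the first element. -/
def shuffleWord (σ : Fin m ⊕ Fin j ≃ Fin (m + j)) (ξ : Fin j → A k l r) (t : Fin (m + 1) → A k l r) :
    Fin (m + j + 1) → A k l r :=
  Fin.cons (t 0) fun s => Sum.elim (fun q => t q.succ) (fun a => hbarInv • ξ a) (σ.symm s)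

theorem shuffleWord_shuffleSnoc (p : Fin (m + j + 1)) (σ : Fin m ⊕ Fin j ≃ Fin (m + j))
    (ξ : Fin (j + 1) → A k l r) (t : Fin (m + 1) → A k l r) :
    shuffleWord (shuffleSnoc (p, σ)) ξ t = Fin.insertNth p.succ (hbarInv • ξ (Fin.last j))
      (shuffleWord σ (fun a => ξ a.castSucc) t) := by
  funext s
  refine Fin.succAboveCases p.succ ?_ (fun q => ?_) s
  · rw [Fin.insertNth_apply_same]
    change Sum.elim _ _ ((shuffleSnoc (p, σ)).symm p) = _
    rw [(Equiv.symm_apply_eq _).2 (shuffleSnoc_last p σ).symm]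
    rfl
  · rw [Fin.insertNth_apply_succAbove]
    refine Fin.cases ?_ (fun q => ?_) q
    · rw [Fin.succ_succAbove_zero]
      rfl
    · rw [Fin.succ_succAbove_succ]
      change Sum.elim _ _ ((shuffleSnoc (p, σ)).symm (p.succAbove q)) = Sum.elim _ _ (σ.symm q)
      have e : (shuffleSnoc (p, σ)).symm (p.succAbove q) = Sum.map id Fin.castSucc (σ.symm q) := by
        rw [Equiv.symm_apply_eq, shuffleSnoc_map, Equiv.apply_symm_apply]
      rw [e]
      rcases σ.symm q with z | z <;> rfl

open Classical in
theorem insAlt_lof (m j : ℕ) (ξ : Fin j → A k l r) (t : Fin (m + 1) → A k l r) :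
    insAlt j ξ (DirectSum.lof K ℕ (fun m => Tens k l r m) m (PiTensorProduct.tprod K t))
      = ∑ σ : Fin m ⊕ Fin j ≃ Fin (m + j), if StrictMono (fun q => σ (Sum.inl q)) then
        Sector.shuffleSign σ • DirectSum.lof K ℕ (fun m => Tens k l r m) (m + j)
          (PiTensorProduct.tprod K (shuffleWord σ ξ t)) else 0 := by
  induction j with
  | zero =>
    rw [insAlt_zero]
    -- Without one-forms the only arrangement that preserves the order is the identity.
    refine Eq.symm ((Finset.sum_eq_single (Equiv.sumEmpty (Fin m) (Fin 0)) ?_ ?_).trans ?_)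
    rotate_left 2
    · have h1 : Sector.shuffleSign (m := m) (j := 0) (Equiv.sumEmpty (Fin m) (Fin 0)) = 1 := by
        simp [Sector.shuffleSign]
      have h2 : shuffleWord (m := m) (j := 0) (Equiv.sumEmpty (Fin m) (Fin 0)) ξ t = t := by
        funext s
        refine Fin.cases ?_ (fun q => ?_) s <;> rfl
      have h3 : StrictMono fun q => Equiv.sumEmpty (Fin m) (Fin 0) (Sum.inl q) :=
        fun a b hab => hab
      rw [if_pos h3, h1, one_smul, h2]
      rfl
    · intro σ _ hσ
      refine if_neg fun h => hσ ?_
      have hr : ∀ τ : Fin m ⊕ Fin 0 ≃ Fin (m + 0), Set.range (fun q => τ (Sum.inl q)) = Set.univ := by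
        intro τ
        refine Set.eq_univ_of_forall fun s => ?_
        rcases hz : τ.symm s with q | a
        · exact ⟨q, by simp only [← hz, Equiv.apply_symm_apply]⟩
        · exact a.elim0
      have h3 := (StrictMono.range_inj h
        (g := fun q => Equiv.sumEmpty (Fin m) (Fin 0) (Sum.inl q)) fun a b hab => hab).1 ((hr σ).trans (hr (Equiv.sumEmpty (Fin m) (Fin 0))).symm)
      ext1 z
      rcases z with q | a
      · exact congrFun h3 q
      · exact a.elim0
    · simp
  | succ j ih =>
    rw [insAlt_last, Module.End.mul_apply, ih, map_sum,
      ← shuffleSnoc_bijective.sum_comp, Fintype.sum_prod_type_right]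
    refine Finset.sum_congr rfl fun σ _ => ?_
    simp only [strictMono_shuffleSnoc]
    split_ifs
    · rw [map_zsmul, insChain_lof, Finset.smul_sum]
      refine Finset.sum_congr rfl fun p _ => ?_
      rw [shuffleSign_shuffleSnoc, shuffleWord_shuffleSnoc, smul_smul, mul_comm]
      rfl
    · rw [map_zero, Finset.sum_const_zero]

end Shuffles
end TwistedTQM
end

/-! ### The Lie algebra is closed under the bracket -/

noncomputable section
namespace TwistedTQM

set_option linter.unusedSectionVars false

section Positivity

variable {k l r : ℕ}

theorem coeff_mul_of_nonneg {R : Type*} [Ring R] {x y : HahnSeries ℤ R}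
    (hx : ∀ n < 0, x.coeff n = 0) (hy : ∀ n < 0, y.coeff n = 0) :
    (∀ n < 0, (x * y).coeff n = 0) ∧ (x * y).coeff 0 = x.coeff 0 * y.coeff 0 := by
  constructor
  · intro n hn
    rw [HahnSeries.coeff_mul]
    refine Finset.sum_eq_zero fun p hp => ?_
    simp only [Finset.mem_antidiagonal] at hp
    have h1 : 0 ≤ p.1 := not_lt.1 fun e => hp.1 (hx _ e)
    have h2 : 0 ≤ p.2 := not_lt.1 fun e => hp.2.1 (hy _ e)
    have h3 : p.1 + p.2 = n := hp.2.2
    omega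
  · rw [HahnSeries.coeff_mul]
    refine Finset.sum_eq_single (0, 0) (fun p hp hp0 => ?_) fun h0 => ?_
    · simp only [Finset.mem_antidiagonal] at hp
      have h1 : 0 ≤ p.1 := not_lt.1 fun e => hp.1 (hx _ e)
      have h2 : 0 ≤ p.2 := not_lt.1 fun e => hp.2.1 (hy _ e)
      have h3 : p.1 + p.2 = 0 := hp.2.2
      exact absurd (Prod.ext (show p.1 = 0 by omega) (show p.2 = 0 by omega)) hp0
    · by_contra hne
      refine h0 ?_
      simp only [Finset.mem_antidiagonal]
      refine ⟨fun e => hne ?_, fun e => hne ?_, rfl⟩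
      · rw [e, zero_mul]
      · rw [e, mul_zero]

theorem mapC_nonneg {S S' : Type*} [AddCommGroup S] [Module ℂ S] [AddCommGroup S'] [Module ℂ S']
    (φ : S →ₗ[ℂ] S') {f : Lau S} (hf : ∀ n < 0, lcoeff n f = 0) :
    ∀ n < 0, lcoeff n (mapC φ f) = 0 := fun n hn => by
  rw [lcoeff_mapC, hf n hn, map_zero]

theorem diag_atP {I σ : Type} [Fintype I] [Fintype σ] (α : I) (f : PS σ) :
    diag (atP α f : PS (I × σ)) = f := by
  change MvPowerSeries.rename _ (MvPowerSeries.rename _ f) = f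
  rw [MvPowerSeries.rename_rename]
  exact AlgHom.congr_fun MvPowerSeries.rename_id f

/-- The Moyal exponential has no negative powers of `ħ` and starts with the identity, so the leading
term is the commutative product. -/
theorem star_nonneg {p q : W k l} (hp : IsPlus p) (hq : IsPlus q) :
    IsPlus (star p q) ∧ lcoeff 0 (star p q) = lcoeff 0 p * lcoeff 0 q := by
  have he := coeff_mul_of_nonneg (x := toS (mapC (atP (0 : Fin 2)).toLinearMap p))
    (y := toS (mapC (atP (1 : Fin 2)).toLinearMap q)) (mapC_nonneg (atP (0 : Fin 2)).toLinearMap hp)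
    (mapC_nonneg (atP (1 : Fin 2)).toLinearMap hq)
  have h1 : ofS (emb ![p, q]) = ofS (toS (mapC (atP (0 : Fin 2)).toLinearMap p) *
      toS (mapC (atP (1 : Fin 2)).toLinearMap q)) := by
    unfold emb
    rw [Fin.prod_univ_two]
    rfl
  rw [star_eq, h1]
  constructor
  · refine mapC_nonneg diag.toLinearMap fun n hn => ?_
    exact of_symm_hexp_coeff_eq_zero _ _ 0 he.1 n hn
  · rw [lcoeff_mapC, lcoeff_hexp _ _ (N := 0) (M := 1) he.1 (by simp)]
    simp only [Finset.range_one, Finset.sum_singleton, Nat.factorial_zero, Nat.cast_one, inv_one,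
      one_smul, pow_zero, Nat.cast_zero, sub_zero]
    rw [Module.End.one_apply, lcoeff_ofS, he.2]
    refine (map_mul diag _ _).trans ?_
    exact congrArg₂ _ (diag_atP 0 _) (diag_atP 1 _)

theorem IsPlus.add {f f' : W k l} (h : IsPlus f) (h' : IsPlus f') : IsPlus (f + f') := fun n hn => by
  rw [toS_add, HahnSeries.coeff_add, h n hn, h' n hn, add_zero]

theorem IsPlus.sub {f f' : W k l} (h : IsPlus f) (h' : IsPlus f') : IsPlus (f - f') := fun n hn => by
  change lcoeff n (f - f') = 0
  rw [map_sub]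
  exact (congrArg₂ _ (h n hn) (h' n hn)).trans (sub_zero _)

theorem IsPlus.sum {β : Type*} {t : Finset β} {f : β → W k l} (h : ∀ b ∈ t, IsPlus (f b)) :
    IsPlus (∑ b ∈ t, f b) := fun n hn => by
  change lcoeff n _ = 0
  rw [map_sum]
  exact Finset.sum_eq_zero fun b hb => h b hb n hn

/-- The leading terms commute, so the commutator of functions is divisible by `ħ`. -/
theorem isPlus_commutator {f f' : W k l} (h : IsPlus f) (h' : IsPlus f') :
    IsPlus (hbarInv • (star f f' - star f' f)) := fun n hn => by
  change lcoeff n (hbarInv • (star f f' - star f' f)) = 0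
  rw [lcoeff_hbarInv_smul]
  rcases lt_or_eq_of_le (show n + 1 ≤ 0 by omega) with h1 | h1
  · exact (star_nonneg h h').1.sub (star_nonneg h' h).1 _ h1
  · rw [h1, map_sub, (star_nonneg h h').2, (star_nonneg h' h).2, mul_comm, sub_self]

end Positivity

namespace Sector

variable {G : Type*} [Group G] {k l r : ℕ} (D : Sector G k l r)

/-- The substitution is symplectic, hence preserves the Moyal link, and it is the same at both
points, hence commutes with their identification. -/
theorem actW_star (h : G) (p q : W k l) :
    D.actW h (star p q) = star (D.actW h p) (D.actW h q) := by
  rw [star_eq, star_eq]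
  have h1 : emb ![D.actW h p, D.actW h q]
      = emb fun α : Fin 2 => mapC (pull (D.ρ h⁻¹)).toLinearMap ((![p, q] : Fin 2 → W k l) α) := by
    congr 1
    funext α
    fin_cases α <;> rfl
  have h2 := bi_comp_pullPts (m := fun _ : Fin 2 => D.ρ h⁻¹)
    (linkMat (poissonYZ ℂ k l) (0 : Fin 2) 1) (linkMat (poissonYZ ℂ k l) (0 : Fin 2) 1)
    (fun α β => by
      have e : (Matrix.of fun i j => linkMat (poissonYZ ℂ k l) (0 : Fin 2) 1 (α, i) (β, j))
          = if α = 0 ∧ β = 1 then poissonYZ ℂ k l else 0 := by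
        ext i j
        by_cases hab : α = 0 ∧ β = 1
        · simp [linkMat, hab]
        · rw [if_neg hab]
          exact if_neg hab
      rw [e]
      split_ifs
      · exact D.cρ_mul_poisson_mul h⁻¹
      · rw [mul_zero, zero_mul])
  have h3 : (diag : PS (Fin 2 × Var k l) →ₐ[ℂ] _).comp (pullPts fun _ => D.ρ h⁻¹)
      = (pull (D.ρ h⁻¹)).comp diag := by
    refine LinSub.unique (linSub_diag.comp (linSub_pull _)) ?_
    convert (linSub_pull (D.ρ h⁻¹)).comp (linSub_diag (I := Fin 2)) using 1
    ext ⟨α, x⟩ y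
    simp only [Matrix.mul_apply, Matrix.of_apply, Matrix.map_apply, Fintype.sum_prod_type]
    rw [Finset.sum_eq_single α]
    · simp
    · intro β _ hβ
      refine Finset.sum_eq_zero fun j _ => ?_
      rw [if_neg (fun h => hβ h.symm), Complex.ofReal_zero, zero_mul]
    · simp
  rw [h1, ← mapC_pullPts_emb, ← mapC_hexp h2.symm, mapC_comp, ← AlgHom.comp_toLinearMap, h3]
  rfl

theorem actA_mmul (h : G) (a b : A k l r) :
    D.actA h (mmul a b) = mmul (D.actA h a) (D.actA h b) := by
  rw [eq_sum_elem a, eq_sum_elem b]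
  simp only [map_sum, LinearMap.sum_apply]
  refine Finset.sum_congr rfl fun p _ => Finset.sum_congr rfl fun q _ => ?_
  rw [mmul_elem, actA_elem, actA_elem, actA_elem, mmul_elem, actW_star]
  congr 1
  simp only [mul_assoc]
  rw [← mul_assoc (D.κ h⁻¹) (D.κ h), kappa_inv_mul, one_mul]

theorem actA_ad (h : G) (a b : A k l r) : D.actA h (ad a b) = ad (D.actA h a) (D.actA h b) := by
  simp only [ad, LinearMap.smul_apply, LinearMap.sub_apply, LinearMap.flip_apply, map_smul, map_sub,
    actA_mmul]

theorem scalarMat_eq_elem (f : W k l) : scalarMat r f = elem f 1 := by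
  ext1 i j
  by_cases h : i = j
  · simp [scalarMat, elem_apply, h]
  · simp [scalarMat, elem_apply, h]

theorem actA_scalarMat (h : G) (f : W k l) :
    D.actA h (scalarMat r f) = scalarMat r (D.actW h f) := by
  rw [scalarMat_eq_elem, actA_elem, mul_one, kappa_mul_inv, scalarMat_eq_elem]

theorem scalarMat_mmul (f : W k l) (a : A k l r) (i j : Fin r) :
    mmul (scalarMat r f) a i j = star f (a i j) := by
  change ∑ c, star (scalarMat r f i c) (a c j) = _
  rw [Finset.sum_eq_single i]
  · simp [scalarMat]
  · intro c _ hc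
    simp [scalarMat, hc.symm]
  · simp

theorem mmul_scalarMat (f : W k l) (a : A k l r) (i j : Fin r) :
    mmul a (scalarMat r f) i j = star (a i j) f := by
  change ∑ c, star (a i c) (scalarMat r f c j) = _
  rw [Finset.sum_eq_single j]
  · simp [scalarMat]
  · intro c _ hc
    simp [scalarMat, hc]
  · simp

theorem ad_scalarMat_apply (f : W k l) (a : A k l r) (i j : Fin r) :
    ad (scalarMat r f) a i j = hbarInv • (star f (a i j) - star (a i j) f) := by
  rw [← scalarMat_mmul, ← mmul_scalarMat]
  rfl

theorem ad_apply_scalarMat (f : W k l) (a : A k l r) (i j : Fin r) :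
    ad a (scalarMat r f) i j = hbarInv • (star (a i j) f - star f (a i j)) := by
  rw [← scalarMat_mmul, ← mmul_scalarMat]
  rfl

theorem ad_scalarMat_scalarMat (f f' : W k l) :
    ad (scalarMat r f) (scalarMat r f') = scalarMat r (hbarInv • (star f f' - star f' f)) := by
  ext1 i j
  rw [ad_scalarMat_apply]
  by_cases h : i = j
  · simp [scalarMat, h]
  · simp [scalarMat, h]

theorem hbar_smul_ad_apply (a b : A k l r) (i j : Fin r) :
    (hbar • ad a b) i j = ∑ c, star (a i c) (b c j) - ∑ c, star (b i c) (a c j) := by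
  have h : hbar • ad a b = mmul a b - mmul b a := by
    simp only [ad, LinearMap.smul_apply, LinearMap.sub_apply, LinearMap.flip_apply]
    rw [smul_smul, hbar_mul_hbarInv, one_smul]
  rw [h]
  rfl

theorem ad_mem_lieAlg {x y : A k l r} (hx : x ∈ D.lieAlg) (hy : y ∈ D.lieAlg) :
    ad x y ∈ D.lieAlg := by
  obtain ⟨f, a, hf, hgf, ha, hga, rfl⟩ := hx
  obtain ⟨f', a', hf', hgf', ha', hga', rfl⟩ := hy
  -- Two scalar matrices have a scalar bracket. The mixed brackets reduce entrywise to commutators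
  -- of functions, and in the bracket of the two matrix parts the spare `ħ` cancels the `ħ⁻¹`.
  refine ⟨hbarInv • (star f f' - star f' f),
    ad (scalarMat r f) a' + ad a (scalarMat r f') + hbar • ad a a',
    isPlus_commutator hf hf', ?_, fun i j => ?_, ?_, ?_⟩
  · rw [map_smul, map_sub, actW_star, actW_star, hgf, hgf']
  · refine (IsPlus.add ?_ ?_).add ?_
    · rw [ad_scalarMat_apply]
      exact isPlus_commutator hf (ha' i j)
    · rw [ad_apply_scalarMat]
      exact isPlus_commutator (ha i j) hf'
    · rw [hbar_smul_ad_apply]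
      exact (IsPlus.sum fun c _ => (star_nonneg (ha i c) (ha' c j)).1).sub
        (IsPlus.sum fun c _ => (star_nonneg (ha' i c) (ha c j)).1)
  · simp only [map_add, map_smul, actA_ad, actA_scalarMat, hgf, hgf', hga, hga']
  · have e : ∀ z : A k l r, ad (hbar • a) z = hbar • ad a z := by
      intro z
      simp only [ad, LinearMap.smul_apply, LinearMap.sub_apply, LinearMap.flip_apply, map_smul,
        smul_sub, smul_comm hbar hbarInv]
    have e' : ∀ z : A k l r, ad (scalarMat r f + hbar • a) z = ad (scalarMat r f) z + hbar • ad a z := by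
      intro z
      rw [← e]
      simp only [ad, LinearMap.smul_apply, LinearMap.sub_apply, LinearMap.flip_apply, map_add,
        LinearMap.add_apply, smul_sub, smul_add]
      abel
    rw [e', map_add, map_add, map_smul, map_smul, ad_scalarMat_scalarMat]
    simp only [smul_add]
    abel

theorem actA_of_mem_lieAlg {x : A k l r} (hx : x ∈ D.lieAlg) : D.actA D.g x = x := by
  obtain ⟨f, a, -, hgf, -, hga, rfl⟩ := hx
  rw [map_add, map_smul, actA_scalarMat, hgf, hga]

end Sector
end TwistedTQM
end

/-! ### Assembly: the interactive correlation map and its closedness -/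

noncomputable section
namespace TwistedTQM

set_option linter.unusedSectionVars false

section Ring

variable {R : Type*} [Ring R]

/-- The induction step of closedness in any ring: the previous identity is multiplied by `i` on the
right, and `b` is moved past `i` at the cost of `a`. -/
theorem closed_step {n : ℕ} {L X b i a : R} (h1 : L + X * b - (-1 : ℤ) ^ n • (b * X) = 0)
    (h2 : b * i + i * b = a) :
    -(X * a) - L * i + X * i * b - (-1 : ℤ) ^ (n + 1) • (b * (X * i)) = 0 := by
  have h3 := congrArg (fun z => -(z * i)) h1
  simp only [zero_mul, neg_zero, sub_mul, add_mul, smul_mul_assoc] at h3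
  rw [← h3, ← h2, pow_succ, mul_neg_one, neg_smul]
  simp only [mul_add, mul_assoc]
  abel

theorem anticomm_step {n : ℕ} {X b i : R} (h1 : X * b = (-1 : ℤ) ^ n • (b * X))
    (h2 : b * i + i * b = 0) : X * i * b = (-1 : ℤ) ^ (n + 1) • (b * (X * i)) := by
  rw [mul_assoc, eq_neg_of_add_eq_zero_right h2, mul_neg, ← mul_assoc, h1, pow_succ, mul_neg_one,
    neg_smul, smul_mul_assoc, mul_assoc]

end Ring

section Periodic

variable {M M' M'' N : Type*} [AddCommMonoid M] [Module K M] [AddCommMonoid M'] [Module K M']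
  [AddCommMonoid M''] [Module K M''] [AddCommGroup N] [Module K N]

theorem ext_apply (φ : M →ₗ[K] M') (O : Per M) (p : ℤ) : ext φ O p = φ (O p) := by
  simp [ext]

theorem comp_sum {β : Type*} (t : Finset β) (ψ : M' →ₗ[K] M'') (φ : β → M →ₗ[K] M') :
    ψ ∘ₗ ∑ b ∈ t, φ b = ∑ b ∈ t, ψ ∘ₗ φ b := by
  refine LinearMap.ext fun x => ?_
  simp only [LinearMap.comp_apply, LinearMap.sum_apply, map_sum]

theorem comp_zsmul {N' : Type*} [AddCommGroup N'] [Module K N'] (n : ℤ) (ψ : N →ₗ[K] N')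
    (φ : M →ₗ[K] N) : ψ ∘ₗ (n • φ) = n • (ψ ∘ₗ φ) :=
  LinearMap.ext fun _ => map_zsmul ψ _ _

theorem ext_single (φ : M →ₗ[K] M') (p : ℤ) (x : M) :
    ext φ (Finsupp.single p x) = Finsupp.single p (φ x) := by
  simp [ext]

theorem ext_ext (ψ : M' →ₗ[K] M'') (φ : M →ₗ[K] M') (O : Per M) :
    ext ψ (ext φ O) = ext (ψ ∘ₗ φ) O := by
  refine Finsupp.ext fun p => ?_
  simp [ext_apply]

theorem ext_mulU (φ : M →ₗ[K] M') (O : Per M) : ext φ (mulU O) = mulU (ext φ O) := by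
  induction O using Finsupp.induction_linear with
  | zero => simp
  | add O O' h h' => rw [map_add, map_add, h, h', map_add, map_add]
  | single p x => simp [mulU, ext, Finsupp.lmapDomain]

/-- The `u`-linear extension, linearly in the map. -/
def extHom : (M →ₗ[K] M') →ₗ[K] Per M →ₗ[K] Per M' where
  toFun := ext
  map_add' φ ψ := by
    refine LinearMap.ext fun O => Finsupp.ext fun p => ?_
    simp [ext_apply]
  map_smul' c φ := by
    refine LinearMap.ext fun O => Finsupp.ext fun p => ?_
    simp [ext_apply]

theorem ext_add (φ ψ : M →ₗ[K] M') (O : Per M) : ext (φ + ψ) O = ext φ O + ext ψ O :=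
  LinearMap.congr_fun (extHom.map_add φ ψ) O

theorem ext_zero (O : Per M) : ext (0 : M →ₗ[K] M') O = 0 :=
  LinearMap.congr_fun (extHom (M := M) (M' := M')).map_zero O

theorem ext_neg (φ : M →ₗ[K] N) (O : Per M) : ext (-φ) O = -ext φ O := by
  refine Finsupp.ext fun p => ?_
  simp [ext_apply]

theorem ext_sub (φ ψ : M →ₗ[K] N) (O : Per M) : ext (φ - ψ) O = ext φ O - ext ψ O := by
  refine Finsupp.ext fun p => ?_
  simp [ext_apply]

theorem ext_zsmul (n : ℤ) (φ : M →ₗ[K] N) (O : Per M) : ext (n • φ) O = n • ext φ O := by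
  refine Finsupp.ext fun p => ?_
  simp [ext_apply]

theorem ext_sum {β : Type*} (t : Finset β) (φ : β → M →ₗ[K] M') (O : Per M) :
    ext (∑ b ∈ t, φ b) O = ∑ b ∈ t, ext (φ b) O := by
  have h := LinearMap.congr_fun (map_sum (extHom (M := M) (M' := M')) φ t) O
  rwa [LinearMap.sum_apply] at h

end Periodic

namespace Sector

variable {G : Type*} [Group G] {k l r : ℕ} (D : Sector G k l r)

theorem isNormalized_freeChain : IsNormalized D.freeChain := by
  intro m t s hs
  rw [freeChain_tprod, D.freeMulti_eq_zero t s hs]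

/-- The interactive correlation map on cyclic chains, as a multiple of operators on chains. -/
def corrHom : Module.End K (Chain k l r) →ₗ[K] Per (CycChain k l r) →ₗ[K] Per (Ω k) :=
  extHom ∘ₗ (LinearMap.lcomp K (Ω k) (liftCyc k l r)) ∘ₗ
    (LinearMap.llcomp K (Chain k l r) (Chain k l r) (Ω k) D.freeChain)

theorem corrHom_apply (X : Module.End K (Chain k l r)) :
    D.corrHom X = ext ((D.freeChain ∘ₗ X) ∘ₗ liftCyc k l r) := rfl

theorem C_smul_hom (c : ℂ) (ψ : Per (CycChain k l r) →ₗ[K] Per (Ω k)) :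
    (HahnSeries.C c : K) • ψ = c • ψ :=
  LinearMap.ext fun O => Finsupp.ext fun p => C_smul c (ψ O p)

theorem C_smul_matrix (c : ℂ) (x : A k l r) : (HahnSeries.C c : K) • x = c • x := by
  ext1 i j
  exact C_smul c (x i j)

/-- The interactive correlation map. -/
def corrCochain (j : ℕ) : D.Cochain j where
  toFun ξ := D.corrHom (insAlt j fun a => (ξ a : A k l r))
  map_update_add' ξ i x y := by
    have h : ∀ z : D.lieAlg, (fun a => (Function.update ξ i z a : A k l r))
        = Function.update (fun a => (ξ a : A k l r)) i z :=
      fun z => funext fun a => Function.apply_update (fun _ (w : D.lieAlg) => (w : A k l r)) ξ i z a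
    rw [h, h, h, Submodule.coe_add, AlternatingMap.map_update_add, map_add]
  map_update_smul' ξ i c x := by
    have h : ∀ z : D.lieAlg, (fun a => (Function.update ξ i z a : A k l r))
        = Function.update (fun a => (ξ a : A k l r)) i z :=
      fun z => funext fun a => Function.apply_update (fun _ (w : D.lieAlg) => (w : A k l r)) ξ i z a
    rw [h, h, Submodule.coe_smul, ← C_smul_matrix, AlternatingMap.map_update_smul, map_smul,
      C_smul_hom]
  map_eq_zero_of_eq' ξ a b hab hne := by
    rw [AlternatingMap.map_eq_zero_of_eq _ (fun a => (ξ a : A k l r)) (congrArg Subtype.val hab) hne, map_zero]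

theorem corrCochain_toCyc (j : ℕ) (ξ : Fin j → D.lieAlg) (O : Per (Chain k l r)) :
    D.corrCochain j ξ (ext (toCyc k l r) O)
      = ext (D.freeChain ∘ₗ insAlt j fun a => (ξ a : A k l r)) O := by
  change D.corrHom _ _ = _
  -- The composite with the insertions is still normalized, so the auxiliary lift disappears.
  rw [corrHom_apply, ext_ext, (D.isNormalized_freeChain.comp_insAlt j _).comp_liftCyc_toCyc]

theorem corrCochain_tprod (j m : ℕ) (ξ : Fin j → D.lieAlg) (t : Fin (m + 1) → A k l r) (p : ℤ) :
    D.corrCochain j ξ (Finsupp.single p (toCyc k l r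
        (DirectSum.of (fun m => Tens k l r m) m (PiTensorProduct.tprod K t))))
      = Finsupp.single p (D.intCorr (fun a => (ξ a : A k l r)) t) := by
  rw [← ext_single (toCyc k l r), corrCochain_toCyc, ext_single, LinearMap.comp_apply]
  congr 1
  change D.freeChain (insAlt j _ (DirectSum.lof K ℕ (fun m => Tens k l r m) m _)) = _
  rw [insAlt_lof, map_sum]
  refine Finset.sum_congr rfl fun σ _ => ?_
  split_ifs
  · rw [map_zsmul, freeChain_tprod, freeMulti_apply]
    rfl
  · rw [map_zero]

theorem actChain_insAlt (h : G) (j : ℕ) (v : Fin j → A k l r) :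
    D.actChain h ∘ₗ insAlt j v = insAlt j (fun a => D.actA h (v a)) ∘ₗ D.actChain h := by
  induction j with
  | zero =>
    rw [insAlt_zero, insAlt_zero]
    rfl
  | succ j ih =>
    rw [insAlt_succ, insAlt_succ, Module.End.mul_eq_comp, ← LinearMap.comp_assoc, ih,
      LinearMap.comp_assoc, actChain_insChain, Module.End.mul_eq_comp, LinearMap.comp_assoc]

/-- Closedness at the level of operators on chains, before any correlation is taken: induction with
the Cartan formula `hoch_insChain` for the first argument and the recursion `lieOp_cons` for the
differential. -/
theorem hoch_insAlt (j : ℕ) (v : Fin (j + 1) → A k l r) (hv : ∀ a, D.actA D.g (v a) = v a) :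
    lieOp j v + insAlt (j + 1) v * D.hoch - (-1 : ℤ) ^ (j + 1) • (D.hoch * insAlt (j + 1) v) = 0 := by
  induction j with
  | zero =>
    have h : D.hoch * insChain (v 0) + insChain (v 0) * D.hoch = adChain (v 0) :=
      D.hoch_insChain (hv 0)
    have h1 : lieOp 0 v = -adChain (v 0) := by
      simp [lieOp, bracketOp, insAlt_zero]
    rw [h1, ← h, insAlt_succ, insAlt_zero]
    simp
  | succ j ih =>
    have h : D.hoch * insChain (v 0) + insChain (v 0) * D.hoch = adChain (v 0) :=
      D.hoch_insChain (hv 0)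
    have h2 := ih (fun a => v a.succ) fun a => hv a.succ
    have h1 : lieOp (j + 1) v = -(insAlt (j + 1) (fun a => v a.succ) * adChain (v 0))
        - lieOp j (fun a => v a.succ) * insChain (v 0) := by
      conv_lhs => rw [← Fin.cons_self_tail v]
      exact lieOp_cons j _ _
    rw [h1, insAlt_succ (j + 1) v]
    exact closed_step h2 h

theorem connes_insAlt (j : ℕ) (v : Fin j → A k l r) (hv : ∀ a, D.actA D.g (v a) = v a) :
    insAlt j v * D.connes = (-1 : ℤ) ^ j • (D.connes * insAlt j v) := by
  induction j with
  | zero => simp [insAlt_zero]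
  | succ j ih =>
    have h : D.connes * insChain (v 0) + insChain (v 0) * D.connes = 0 := D.connes_insChain (hv 0)
    rw [insAlt_succ]
    exact anticomm_step (ih (fun a => v a.succ) fun a => hv a.succ) h

theorem freeChain_insAlt_connes (j : ℕ) (v : Fin j → A k l r) (hv : ∀ a, D.actA D.g (v a) = v a) :
    (D.freeChain ∘ₗ insAlt j v) ∘ₗ D.connes
      = (-1 : ℤ) ^ j • (deRham k ∘ₗ (D.freeChain ∘ₗ insAlt j v)) := by
  rw [← LinearMap.comp_assoc, ← freeChain_connes, LinearMap.comp_assoc, LinearMap.comp_assoc]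
  have h := D.connes_insAlt j v hv
  rw [Module.End.mul_eq_comp, Module.End.mul_eq_comp] at h
  rw [h]
  exact LinearMap.ext fun x => map_zsmul D.freeChain _ _

/-- The operator on chains which gives the Chevalley–Eilenberg differential. -/
def lieOp' : ∀ j, (Fin j → A k l r) → Module.End K (Chain k l r)
  | 0, _ => 0
  | j + 1, v => lieOp j v

theorem freeChain_insAlt_hoch (j : ℕ) (v : Fin j → A k l r) (hv : ∀ a, D.actA D.g (v a) = v a) :
    D.freeChain ∘ₗ lieOp' j v + (D.freeChain ∘ₗ insAlt j v) ∘ₗ D.hoch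
      - (-1 : ℤ) ^ j • ((hbar • BV k) ∘ₗ (D.freeChain ∘ₗ insAlt j v)) = 0 := by
  have hF : (hbar • BV k) ∘ₗ (D.freeChain ∘ₗ insAlt j v)
      = D.freeChain ∘ₗ (D.hoch ∘ₗ insAlt j v) := by
    rw [← LinearMap.comp_assoc, ← LinearMap.comp_assoc, freeChain_hoch]
    rfl
  have h : lieOp' j v + insAlt j v * D.hoch - (-1 : ℤ) ^ j • (D.hoch * insAlt j v) = 0 := by
    cases j with
    | zero => simp [lieOp', insAlt_zero]
    | succ j => exact D.hoch_insAlt j v hv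
  rw [hF]
  refine LinearMap.ext fun x => ?_
  have hx := congrArg D.freeChain (LinearMap.congr_fun h x)
  rw [LinearMap.sub_apply, LinearMap.add_apply, map_sub, map_add, LinearMap.smul_apply,
    map_zsmul] at hx
  exact hx.trans (map_zero _)

theorem dLie_eq (br : D.lieAlg → D.lieAlg → D.lieAlg)
    (hbr : ∀ x y : D.lieAlg, (br x y : A k l r) = ad (x : A k l r) y) (j : ℕ)
    (ξ : Fin j → D.lieAlg) (O : Per (Chain k l r)) :
    D.dLie br D.corrCochain ξ O
      = ext (D.freeChain ∘ₗ lieOp' j fun a => (ξ a : A k l r)) O := by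
  match j with
  | 0 =>
    rw [lieOp', LinearMap.comp_zero, ext_zero]
    rfl
  | 1 =>
    have h1 : lieOp 0 (fun a => (ξ a : A k l r)) = -adChain (ξ 0 : A k l r) := by
      simp [lieOp, bracketOp, insAlt_zero]
    rw [dLie, corrCochain_toCyc, ext_ext, insAlt_zero, lieOp', h1, LinearMap.comp_neg, ext_neg]
    rfl
  | j + 2 =>
    rw [dLie, lieOp', lieOp, bracketOp, LinearMap.comp_add, ext_add]
    simp only [comp_sum, ext_sum, corrCochain_toCyc]
    congr 1
    · refine Finset.sum_congr rfl fun i _ => ?_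
      rw [ext_ext, smul_neg, smul_neg, LinearMap.comp_neg, ext_neg, ← ext_zsmul, comp_zsmul]
      rfl
    · refine Finset.sum_congr rfl fun p _ => Finset.sum_congr rfl fun i _ => ?_
      split_ifs
      · have hw : (fun a => ((Fin.cons (br (ξ i.castSucc) (ξ p))
            (fun q => ξ (p.succAbove (i.succAbove q))) : Fin (j + 1) → D.lieAlg) a : A k l r))
            = Fin.cons (ad (ξ i.castSucc : A k l r) (ξ p))
              fun q => (ξ (p.succAbove (i.succAbove q)) : A k l r) := by
          funext a
          refine Fin.cases ?_ (fun q => ?_) a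
          · exact hbr _ _
          · rfl
        rw [hw, ← ext_zsmul, comp_zsmul]
      · rw [LinearMap.comp_zero, ext_zero]

end Sector

end TwistedTQM
end
theorem mainTheorem5 {G : Type*} [Group G] [Finite G] (k l r : ℕ)
    (D : TwistedTQM.Sector G k l r) :
    ∃ (br : D.lieAlg → D.lieAlg → D.lieAlg) (Φ : ∀ j, D.Cochain j),
      -- the Lie bracket of the algebra of matrices restricts to the Lie algebra
      (∀ x y : D.lieAlg, (br x y : TwistedTQM.A k l r) = TwistedTQM.ad (x : TwistedTQM.A k l r) y) ∧
      -- the cochain is the interactive correlation map, extended linearly in `u`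
      (∀ (j m : ℕ) (ξ : Fin j → D.lieAlg) (t : Fin (m + 1) → TwistedTQM.A k l r) (p : ℤ),
        Φ j ξ (Finsupp.single p (TwistedTQM.toCyc k l r
            (DirectSum.of (fun m => TwistedTQM.Tens k l r m) m (PiTensorProduct.tprod TwistedTQM.K t))))
          = Finsupp.single p (D.intCorr (fun a => (ξ a : TwistedTQM.A k l r)) t)) ∧
      -- it is equivariant under the centralizer of `g`
      (∀ h ∈ Subgroup.centralizer {D.g}, ∀ (j : ℕ) (ξ ξ' : Fin j → D.lieAlg),
        (∀ a, (ξ' a : TwistedTQM.A k l r) = D.actA h (ξ a)) →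
        ∀ O : TwistedTQM.Per (TwistedTQM.Chain k l r),
          Φ j ξ' (TwistedTQM.ext (TwistedTQM.toCyc k l r) (TwistedTQM.ext (D.actChain h) O))
            = TwistedTQM.ext (D.actΩ h) (Φ j ξ (TwistedTQM.ext (TwistedTQM.toCyc k l r) O))) ∧
      -- it is closed
      (∀ (j : ℕ) (ξ : Fin j → D.lieAlg) (O : TwistedTQM.Per (TwistedTQM.Chain k l r)),
        TwistedTQM.ext (TwistedTQM.toCyc k l r) (TwistedTQM.ext (D.actChain D.g) O)
            = TwistedTQM.ext (TwistedTQM.toCyc k l r) O →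
        D.dLie br Φ ξ O + Φ j ξ (TwistedTQM.ext (TwistedTQM.toCyc k l r) (D.chainDiff O))
          - (-1 : ℤ) ^ j • TwistedTQM.formDiff k (Φ j ξ (TwistedTQM.ext (TwistedTQM.toCyc k l r) O)) = 0) := by
  refine ⟨fun x y => ⟨TwistedTQM.ad (x : TwistedTQM.A k l r) y, D.ad_mem_lieAlg x.2 y.2⟩,
    D.corrCochain, fun x y => rfl, fun j m ξ t p => D.corrCochain_tprod j m ξ t p, ?_, ?_⟩
  · intro h hh j ξ ξ' hξ O
    rw [D.corrCochain_toCyc, D.corrCochain_toCyc, TwistedTQM.ext_ext, TwistedTQM.ext_ext,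
      funext hξ, LinearMap.comp_assoc, ← D.actChain_insAlt, ← LinearMap.comp_assoc,
      D.freeChain_actChain hh, LinearMap.comp_assoc]
  · intro j ξ O _
    -- Elements of the Lie algebra are `g`-invariant, as the Cartan formulas require.
    have hv : ∀ a, D.actA D.g (ξ a : TwistedTQM.A k l r) = ξ a :=
      fun a => D.actA_of_mem_lieAlg (ξ a).2
    rw [D.dLie_eq _ (fun x y => rfl), D.corrCochain_toCyc, D.corrCochain_toCyc]
    have h1 := D.freeChain_insAlt_hoch j _ hv
    have h2 := D.freeChain_insAlt_connes j _ hv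
    have h3 := congrArg (fun φ => TwistedTQM.ext φ O) h1
    simp only [TwistedTQM.ext_sub, TwistedTQM.ext_add, TwistedTQM.ext_zero,
      TwistedTQM.ext_zsmul] at h3
    -- The identity splits by its explicit powers of `u`: the `B_g` part is `d` up to the sign `(-1)
    -- ^ j`, and the rest is the Hochschild identity `h3`.
    rw [TwistedTQM.Sector.chainDiff, TwistedTQM.formDiff, LinearMap.add_apply, map_add,
      LinearMap.add_apply, LinearMap.comp_apply, LinearMap.comp_apply, TwistedTQM.ext_mulU,
      TwistedTQM.ext_ext, TwistedTQM.ext_ext, TwistedTQM.ext_ext, TwistedTQM.ext_ext, h2,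
      TwistedTQM.ext_zsmul, map_zsmul, smul_add, ← h3]
    abel
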